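/- **Notation.** Let $q>1$ be real, $\lambda=q-q^{-1}$, $[a]=\frac{q^a-q^{-a}}{q-q^{-1}}$, $\{a\}=q^a+q^{-a}$. Capital indices run over $+,-,3$, small indices over $+,-,3,0$, repeated indices are summed. Put $g_{+-}=g^{+-}=-q$, $g_{-+}=g^{-+}=-q^{-1}$, $g_{33}=g^{33}=1$, $\eta^{AB}=g^{AB}$, $\eta^{00}=-1$ (all other entries $0$), $X\circ Y=g_{AB}X^AY^B$, and $\varepsilon_{+-}{}^3=q$, $\varepsilon_{-+}{}^3=-q$, $\varepsilon_{33}{}^3=1-q^2$, $\varepsilon_{+3}{}^+=1$, $\varepsilon_{3+}{}^+=-q^2$, $\varepsilon_{-3}{}^-=-q^2$, $\varepsilon_{3-}{}^-=1$ (others $0$), with $\varepsilon_{ABC}=g_{CD}\varepsilon_{AB}{}^D$, $\varepsilon_A{}^{BC}=g^{BD}\varepsilon_{AD}{}^C$, $\varepsilon^{ABC}=g^{AD}\varepsilon_D{}^{BC}$. Let $\hat R^{AB}{}_{CD}=\delta^A_C\delta^B_D-q^{-4}\varepsilon^{FAB}\varepsilon_{FDC}-q^{-4}(q^2-1)g^{AB}g_{CD}$.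 Put $\epsilon^{AB}{}_C:=g^{EB}g^{FA}\varepsilon_{FEC}$ and $\kappa=(1+q^2)^{-2}$. The projectors $P_\pm,P_T$ on $\mathbb C^4\otimes\mathbb C^4$ have the entries (rows $ab$, columns $cd$; all entries not listed are $0$) $P_+$: $(A0,C0)=\kappa q^2\delta^A_C$, $(A0,0D)=-\kappa\delta^A_D$, $(A0,CD)=\kappa\varepsilon_{DC}{}^A$, $(0B,C0)=-\kappa q^4\delta^B_C$, $(0B,0D)=\kappa q^2\delta^B_D$, $(0B,CD)=-\kappa q^2\varepsilon_{DC}{}^B$, $(AB,C0)=\kappa q^2\epsilon^{AB}{}_C$, $(AB,0D)=-\kappa\epsilon^{AB}{}_D$, $(AB,CD)=\kappa\varepsilon_{DC}{}^E\epsilon^{AB}{}_E$; $P_-$: $(A0,C0)=\kappa q^2\delta^A_C$, $(A0,0D)=-\kappa q^4\delta^A_D$, $(A0,CD)=-\kappa q^2\varepsilon_{DC}{}^A$, $(0B,C0)=-\kappa\delta^B_C$, $(0B,0D)=\kappa q^2\delta^B_D$, $(0B,CD)=\kappa\varepsilon_{DC}{}^B$, $(AB,C0)=-\kappa\epsilon^{AB}{}_C$,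 $(AB,0D)=\kappa q^2\epsilon^{AB}{}_D$, $(AB,CD)=\kappa\varepsilon_{DC}{}^E\epsilon^{AB}{}_E$; $P_T$: $(00,00)=\kappa q^2$, $(00,CD)=-\kappa q^2g_{CD}$, $(AB,00)=-\kappa q^2g^{AB}$, $(AB,CD)=\kappa q^2g^{AB}g_{CD}$; $P_S=1-P_T-P_+-P_-$ and $\hat R_{II}^{-1}=q^2P_S+q^{-2}P_T-P_+-P_-$. **The algebra.** Let $\mathcal A_q$ be the unital complex algebra generated by $X^a,P^a,R^A,S^A,U,\Lambda^{1/2}$ and the inverse $\Lambda^{-1/2}$ of $\Lambda^{1/2}$, with the relations $$\varepsilon_{CB}{}^AX^BX^C=(1-q^2)X^0X^A,\quad X^0X^A=X^AX^0,$$ $$U^2=1+\tfrac12(q^4-1)^2(R\circ R+S\circ S),\quad UR^A=R^AU,\quad US^A=S^AU,$$ $$\varepsilon_{CB}{}^AR^BR^C=\tfrac1{1+q^2}UR^A,\quad \varepsilon_{CB}{}^AS^BS^C=-\tfrac1{1+q^2}US^A,\quad R^AS^B=q^2\hat R^{AB}{}_{CD}S^CR^D,$$ $$R^AX^0=\tfrac{q^4+1}{q(q^2+1)}X^0R^A+\tfrac{q^2-1}{q(q^2+1)}\varepsilon_{LM}{}^AX^MR^L-\tfrac{q}{(1+q^2)^2}X^AU,$$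 $$R^AX^B=\tfrac1{1+q^2}\Big[q(1+q^2)X^AR^B-\tfrac{q^2-1}q\varepsilon_C{}^{AB}X^0R^C-\tfrac{q^2-1}qg^{AB}X\circ R-\tfrac2q\varepsilon^{ABG}\varepsilon_{STG}X^TR^S-\tfrac{1}{q(1+q^2)}g^{AB}X^0U+\tfrac1{q(1+q^2)}\varepsilon_M{}^{AB}X^MU\Big],$$ $$S^AX^0=\tfrac{q^4+1}{q(q^2+1)}X^0S^A+\tfrac{q^2-1}{q(q^2+1)}\varepsilon_{LM}{}^AX^MS^L-\tfrac{1}{q(1+q^2)^2}X^AU,$$ $$S^AX^B=\tfrac1{1+q^2}\Big[\tfrac{1+q^2}qX^AS^B-\tfrac{q^2-1}q\varepsilon_C{}^{AB}X^0S^C+q(q^2-1)g^{AB}X\circ S-\tfrac2q\varepsilon^{ABG}\varepsilon_{KTG}X^TS^K-\tfrac{q}{1+q^2}g^{AB}X^0U-\tfrac1{q(1+q^2)}\varepsilon_M{}^{AB}X^MU\Big],$$ $$UX^0=\tfrac{q^4+1}{q(q^2+1)}X^0U-\tfrac{(q^2-1)^2}qX\circ R,\quad UX^A=\tfrac{q^4+1}{q(q^2+1)}X^AU-q(q^2-1)^2X^0R^A-\tfrac{(q^2-1)^2}q\varepsilon_{CB}{}^AX^BR^C,$$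 the relations obtained from all these by replacing $X$ by $P$ throughout, and $$\Lambda^{1/2}X^a=q^{-1}X^a\Lambda^{1/2},\quad\Lambda^{1/2}P^a=qP^a\Lambda^{1/2},\quad\Lambda^{1/2}\text{ commutes with }R^A,S^A,U,$$ $$P^aX^b-q^{-2}(\hat R_{II}^{-1})^{ab}{}_{cd}X^cP^d=-\tfrac i2\Lambda^{-1/2}\{(1+q^4)\eta^{ab}U+q^2(1-q^4)V^{ab}\},$$ where $V^{A0}=R^A+q^2S^A$, $V^{0A}=-q^2R^A-S^A$, $V^{AB}=\varepsilon_C{}^{AB}(R^C-S^C)$, $V^{00}=0$. The $*$-structure is $\overline{X^0}=X^0$, $\overline{X^A}=g_{AB}X^B$, $\overline{P^0}=P^0$, $\overline{P^A}=g_{AB}P^B$, $\overline{R^A}=-g_{AB}S^B$, $\overline{S^A}=-g_{AB}R^B$, $\overline U=U$, $\overline{\Lambda^{1/2}}=q^4\Lambda^{-1/2}$. A $*$-representation on a subspace $D$ of a Hilbert space is a unital homomorphism $\rho:\mathcal A_q\to\mathrm{End}(D)$ with $\langle\rho(\bar x)\varphi,\psi\rangle=\langle\varphi,\rho(x)\psi\rangle$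 for all generators $x$ and $\varphi,\psi\in D$. **The families.** Labels are: *space-like*, $l_0\in[1,q)$; *time-like*, $t_0\in\mathbb R$ with $|t_0|\in[1,q)$ (forward if $t_0>0$, backward if $t_0<0$). For each label let $H$ be the Hilbert space with orthonormal basis $|j,m,n,M\rangle$, with $j,m,n,M$ integers, $-j\le m\le j$, and, in the time-like case only, also $j\le n$; let $D$ be the span of the basis. Define matrix elements as follows; all matrix elements and reduced matrix elements not listed are $0$. *$X^0,\Lambda^{\pm1/2},U$.* $X^0$ is diagonal with eigenvalue $\frac{l_0q^M}{[2]}\lambda[n]$ (space-like), $\frac{t_0q^M}{[2]}\{n+1\}$ (time-like). $\Lambda^{\pm1/2}|j,m,n,M\rangle=q^{\pm2}|j,m,n,M\pm1\rangle$. $\langle j,m,n,M|U|j,m,n+1,M\rangle=\langle j,m,n+1,M|U|j,m,n,M\rangle$ equals $\frac1{[2]}\sqrt{\frac{\{n-j\}\{n+j+1\}}{\{n\}\{n+1\}}}$ (space-like), $\frac1{[2]}\sqrt{\frac{[n-j+1][n+j+2]}{[n+1][n+2]}}$ (time-like). *Vector operators.* For $Y=X,R,S,P$, suppressing $n,M$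 and writing $y_{j'j}=\langle j'\|Y^-\|j\rangle$: $\langle j,m+1|Y^+|j,m\rangle=-q^{m+2}\sqrt{[j+m+1][j-m]}\,y_{jj}$, $\langle j+1,m+1|Y^+|j,m\rangle=q^{m-2j}\sqrt{[j+m+1][j+m+2]}\,y_{j+1,j}$, $\langle j-1,m+1|Y^+|j,m\rangle=q^{m+2j+2}\sqrt{[j-m][j-m-1]}\,y_{j-1,j}$; $\langle j,m-1|Y^-|j,m\rangle=q^m\sqrt{[j+m][j-m+1]}\,y_{jj}$, $\langle j+1,m-1|Y^-|j,m\rangle=q^m\sqrt{[j-m+1][j-m+2]}\,y_{j+1,j}$, $\langle j-1,m-1|Y^-|j,m\rangle=q^m\sqrt{[j+m][j+m-1]}\,y_{j-1,j}$; $\langle j,m|Y^3|j,m\rangle=q^{3/2}\frac{\sqrt{1+q^2}}{q^2-1}\Big(q^{2m}-\frac{q^{2j+1}+q^{-2j-1}}{q+q^{-1}}\Big)y_{jj}$, $\langle j+1,m|Y^3|j,m\rangle=q^{m-j-1/2}\sqrt{1+q^2}\sqrt{[j-m+1][j+m+1]}\,y_{j+1,j}$, $\langle j-1,m|Y^3|j,m\rangle=-q^{m+j+1/2}\sqrt{1+q^2}\sqrt{[j-m][j+m]}\,y_{j-1,j}$.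 Below, $j\ge1$ in the elements $j\to j$ and $j\ge0$ in all others; put $N_j=\sqrt{[2j+1][2j+3]}$. *Space-like.* $\langle j+1,n,M\|X^-\|j,n,M\rangle=l_0q^{M+j}\frac{\sqrt{\{n+j+1\}\{n-j-1\}}}{\{j+1\}\sqrt{[2]}N_j}$, $\langle j,n,M\|X^-\|j,n,M\rangle=-q^{-1}\frac{l_0q^M[n]\lambda^2}{\sqrt{[2]}\{j\}\{j+1\}}$, $\langle j,n,M\|X^-\|j+1,n,M\rangle=-l_0q^{M-j-2}\frac{\sqrt{\{n+j+1\}\{n-j-1\}}}{\{j+1\}\sqrt{[2]}N_j}$. For $n'=n\pm1$, with $e=n'-n$: $\langle j+1,n',M\|R^-\|j,n,M\rangle=\frac{e\,q^{2j-1}}{\{j+1\}[2]^{3/2}\lambda N_j}\sqrt{\frac{\{e(j+1)+n'\}\{ej+n'\}}{\{n\}\{n'\}}}$, $\langle j,n',M\|R^-\|j,n,M\rangle=\frac{q^{-3}}{\{j\}\{j+1\}[2]^{3/2}}\sqrt{\frac{\{ej+n'\}\{n-ej\}}{\{n\}\{n'\}}}$, $\langle j,n',M\|R^-\|j+1,n,M\rangle=-\frac{e\,q^{-2j-5}}{\{j+1\}[2]^{3/2}\lambda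 N_j}\sqrt{\frac{\{n'-e(j+1)\}\{n-e(j+1)\}}{\{n\}\{n'\}}}$; $S^-$ has the same elements with $q^{2j-1}$ and $q^{-2j-5}$ both replaced by $q^{-3}$ and with the opposite sign in the elements $j\to j$. $\langle j+1,n+1,M'\|P^-\|j,n,M\rangle=\frac i2(\delta_{M',M+1}q^{2+2j-n}-\delta_{M',M-1}q^{2+n})\frac{1}{\{j+1\}\lambda l_0q^M}\frac{\sqrt{[2]}}{N_j}\sqrt{\frac{\{n+j+2\}\{n+j+1\}}{\{n\}\{n+1\}}}$, $\langle j+1,n-1,M'\|P^-\|j,n,M\rangle=\frac i2(\delta_{M',M+1}q^{2+2j+n}-\delta_{M',M-1}q^{2-n})\frac{1}{\{j+1\}\lambda l_0q^M}\frac{\sqrt{[2]}}{N_j}\sqrt{\frac{\{n-j-2\}\{n-j-1\}}{\{n\}\{n-1\}}}$, $\langle j,n+1,M'\|P^-\|j,n,M\rangle=\frac{i\sqrt{[2]}}{2\{j\}\{j+1\}l_0q^M}(\delta_{M',M+1}q^{-n}+\delta_{M',M-1}q^{2+n})\sqrt{\frac{\{n+j+1\}\{n-j\}}{\{n\}\{n+1\}}}$,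 $\langle j,n-1,M'\|P^-\|j,n,M\rangle=-\frac{i\sqrt{[2]}}{2\{j\}\{j+1\}l_0q^M}(\delta_{M',M+1}q^{n}+\delta_{M',M-1}q^{2-n})\sqrt{\frac{\{n-j-1\}\{n+j\}}{\{n\}\{n-1\}}}$, $\langle j,n+1,M'\|P^-\|j+1,n,M\rangle=-\frac i2(\delta_{M',M+1}q^{-2-2j-n}-\delta_{M',M-1}q^{2+n})\frac{1}{\{j+1\}\lambda l_0q^M}\frac{\sqrt{[2]}}{N_j}\sqrt{\frac{\{n-j\}\{n-j-1\}}{\{n\}\{n+1\}}}$, $\langle j,n-1,M'\|P^-\|j+1,n,M\rangle=-\frac i2(\delta_{M',M+1}q^{-2-2j+n}-\delta_{M',M-1}q^{2-n})\frac{1}{\{j+1\}\lambda l_0q^M}\frac{\sqrt{[2]}}{N_j}\sqrt{\frac{\{n+j+1\}\{n+j\}}{\{n\}\{n-1\}}}$, $\langle j,m,n+1,M'|P^0|j,m,n,M\rangle=-\frac{i}{2\lambda l_0q^M}(\delta_{M',M+1}q^{1-n}+\delta_{M',M-1}q^{3+n})\sqrt{\frac{\{n-j\}\{n+j+1\}}{\{n\}\{n+1\}}}$,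 $\langle j,m,n-1,M'|P^0|j,m,n,M\rangle=\frac{i}{2\lambda l_0q^M}(\delta_{M',M+1}q^{1+n}+\delta_{M',M-1}q^{3-n})\sqrt{\frac{\{n-j-1\}\{n+j\}}{\{n\}\{n-1\}}}$. *Time-like* (between states that occur). $\langle j+1,n,M\|X^-\|j,n,M\rangle=t_0q^{M+j}\lambda\frac{\sqrt{[n-j][n+j+2]}}{\{j+1\}\sqrt{[2]}N_j}$, $\langle j,n,M\|X^-\|j,n,M\rangle=-q^{-1}\lambda\frac{t_0q^M\{n+1\}}{\sqrt{[2]}\{j\}\{j+1\}}$, $\langle j,n,M\|X^-\|j+1,n,M\rangle=-t_0q^{M-j-2}\lambda\frac{\sqrt{[n-j][n+j+2]}}{\{j+1\}\sqrt{[2]}N_j}$. For $n'=n\pm1$, with $e=n'-n$: $\langle j+1,n',M\|R^-\|j,n,M\rangle=\frac{e\,q^{2j-1}}{\{j+1\}[2]^{3/2}\lambda N_j}\sqrt{\frac{[e(j+1)+n'+1][ej+n'+1]}{[n+1][n'+1]}}$, $\langle j,n',M\|R^-\|j,n,M\rangle=\frac{q^{-3}}{\{j\}\{j+1\}[2]^{3/2}}\sqrt{\frac{[ej+n'+1][n-ej+1]}{[n+1][n'+1]}}$,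 $\langle j,n',M\|R^-\|j+1,n,M\rangle=-\frac{e\,q^{-2j-5}}{\{j+1\}[2]^{3/2}\lambda N_j}\sqrt{\frac{[n'-e(j+1)+1][n-e(j+1)+1]}{[n+1][n'+1]}}$; $S^-$ is obtained from $R^-$ by the same replacements as in the space-like case. $\langle j+1,n+1,M'\|P^-\|j,n,M\rangle=\frac i2(\delta_{M',M+1}q^{1+2j-n}+\delta_{M',M-1}q^{3+n})\frac{1}{\{j+1\}\lambda t_0q^M}\frac{\sqrt{[2]}}{N_j}\sqrt{\frac{[n+j+3][n+j+2]}{[n+2][n+1]}}$, $\langle j+1,n-1,M'\|P^-\|j,n,M\rangle=-\frac i2(\delta_{M',M+1}q^{3+2j+n}+\delta_{M',M-1}q^{1-n})\frac{1}{\{j+1\}\lambda t_0q^M}\frac{\sqrt{[2]}}{N_j}\sqrt{\frac{[n-j-1][n-j]}{[n][n+1]}}$, $\langle j,n+1,M'\|P^-\|j,n,M\rangle=\frac{i\sqrt{[2]}}{2\{j\}\{j+1\}t_0q^M}(\delta_{M',M+1}q^{-1-n}-\delta_{M',M-1}q^{3+n})\sqrt{\frac{[n+j+2][n-j+1]}{[n+2][n+1]}}$,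 $\langle j,n-1,M'\|P^-\|j,n,M\rangle=\frac{i\sqrt{[2]}}{2\{j\}\{j+1\}t_0q^M}(\delta_{M',M+1}q^{1+n}-\delta_{M',M-1}q^{1-n})\sqrt{\frac{[n+j+1][n-j]}{[n][n+1]}}$, $\langle j,n+1,M'\|P^-\|j+1,n,M\rangle=-\frac i2(\delta_{M',M+1}q^{-3-2j-n}+\delta_{M',M-1}q^{3+n})\frac{1}{\{j+1\}\lambda t_0q^M}\frac{\sqrt{[2]}}{N_j}\sqrt{\frac{[n-j+1][n-j]}{[n+2][n+1]}}$, $\langle j,n-1,M'\|P^-\|j+1,n,M\rangle=\frac i2(\delta_{M',M+1}q^{-1-2j+n}+\delta_{M',M-1}q^{1-n})\frac{1}{\{j+1\}\lambda t_0q^M}\frac{\sqrt{[2]}}{N_j}\sqrt{\frac{[n+j+2][n+j+1]}{[n][n+1]}}$, $\langle j,m,n+1,M'|P^0|j,m,n,M\rangle=-\frac{i}{2\lambda t_0q^M}(\delta_{M',M+1}q^{-n}-\delta_{M',M-1}q^{4+n})\sqrt{\frac{[n-j+1][n+j+2]}{[n+1][n+2]}}$, $\langle j,m,n-1,M'|P^0|j,m,n,M\rangle=-\frac{i}{2\lambda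 t_0q^M}(\delta_{M',M+1}q^{2+n}-\delta_{M',M-1}q^{2-n})\sqrt{\frac{[n-j][n+j+1]}{[n][n+1]}}$. **Theorem.** (1) For every label there is a $*$-representation $\rho$ of $\mathcal A_q$ on $D$ with these matrix elements. (2) For every such $\rho$: $X^0$ acts diagonally with the eigenvalues above, and $X\circ X$ acts diagonally with eigenvalue $\frac{l_0^2q^{2M}}{[2]^2}\{n+1\}\{n-1\}$ (space-like), $\frac{t_0^2q^{2M}\lambda^2}{[2]^2}[n+2][n]$ (time-like). With $L^A=\frac{q^2+1}{q^2}(US^A-UR^A+(q^4-1)\varepsilon_{CB}{}^AR^BS^C)$, $W=U^2-q^2(q^4-1)^2R\circ S$, the element $\tau^{-1/2}=W+q^2(1-q^2)L^3$ acts invertibly on $D$; with its inverse $\tau^{1/2}$ and $T^+=q^2\sqrt{1+q^2}\,\tau^{1/2}L^+$, $T^-=-q^3\sqrt{1+q^2}\,\tau^{1/2}L^-$, the operator $\tau=(\tau^{1/2})^2$ has eigenvalue $q^{-4m}$ on $|j,m,n,M\rangle$, and $\vec T^2=q\,\tau^{-1/2}T^-T^++\lambda^{-2}\big(q\,\tau^{-1/2}+q^{-1}(\tau^{1/2}-q^2-1)\big)$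 has eigenvalue $[j][j+1]$. (3) Every such $\rho$ is irreducible: $D\ne0$ has no $\rho$-invariant subspaces except $0$ and $D$, and every bounded operator $T$ on $H$ with $\langle\rho(\bar x)\varphi,T\psi\rangle=\langle\varphi,T\rho(x)\psi\rangle$ for all generators $x$ and $\varphi,\psi\in D$ is a scalar. (4) Representations $\rho$, $\rho'$ (on $D\subset H$, $D'\subset H'$) belonging to different labels are inequivalent: there is no linear bijection $D\to D'$ that intertwines them, and no unitary $V:H\to H'$ with $\langle\rho'(\bar x)\psi,V\varphi\rangle=\langle\psi,V\rho(x)\varphi\rangle$ for all generators $x$, $\varphi\in D$, $\psi\in D'$. -/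

import Mathlib

namespace QMink

noncomputable section

/-! ## Indices, generators and structure constants -/

/-- The three space indices `+`, `-`, `3`. -/
inductive E3
  | plus | minus | three
  deriving DecidableEq

instance : Fintype E3 where
  elems := {.plus, .minus, .three}
  complete := by intro x; cases x <;> decide

/-- The four Minkowski indices: `none` is the index `0`, `some A` is the space index `A`. -/
abbrev M4 := Option E3

/-- `pos` selects the coordinates `X^a`, `mom` the momenta `P^a`. -/
inductive Kind
  | pos | mom

/-- The generators: `vec pos a = X^a`, `vec mom a = P^a`, `R A = R^A`, `S A = S^A`, `U`,
`lamHalf` is the scaling operator `Λ^{1/2}` and `lamInv` its inverse `Λ^{-1/2}`. -/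
inductive Gen
  | vec (k : Kind) (a : M4)
  | R (A : E3)
  | S (A : E3)
  | U
  | lamHalf
  | lamInv

/-- The Euclidean `q`-metric; its entries with upper indices are the same as with lower ones. -/
def g (q : ℂ) : E3 → E3 → ℂ
  | .plus, .minus => -q
  | .minus, .plus => -q⁻¹
  | .three, .three => 1
  | _, _ => 0

/-- The Minkowski metric; its entries with upper indices are the same as with lower ones. -/
def eta (q : ℂ) : M4 → M4 → ℂ
  | none, none => -1
  | some A, some B => g q A B
  | _, _ => 0

/-- `ε_{AB}{}^C`. -/
def eps (q : ℂ) : E3 → E3 → E3 → ℂ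
  | .plus, .minus, .three => q
  | .minus, .plus, .three => -q
  | .three, .three, .three => 1 - q ^ 2
  | .plus, .three, .plus => 1
  | .three, .plus, .plus => -q ^ 2
  | .minus, .three, .minus => -q ^ 2
  | .three, .minus, .minus => 1
  | _, _, _ => 0

/-- `ε_{ABC} = g_{CD} ε_{AB}{}^D`. -/
def epsLow (q : ℂ) (A B C : E3) : ℂ := ∑ D, g q C D * eps q A B D

/-- `ε_A{}^{BC} = g^{BD} ε_{AD}{}^C`. -/
def epsMix (q : ℂ) (A B C : E3) : ℂ := ∑ D, g q B D * eps q A D C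

/-- `ε^{ABC} = g^{AD} ε_D{}^{BC}`. -/
def epsUp (q : ℂ) (A B C : E3) : ℂ := ∑ D, g q A D * epsMix q D B C

/-- Kronecker delta. -/
def delta {ι : Type} [DecidableEq ι] (a b : ι) : ℂ := if a = b then 1 else 0

/-- The matrix `R̂^{AB}{}_{CD}` of `q`-Euclidean space. -/
def RHat (q : ℂ) (A B C D : E3) : ℂ :=
  delta A C * delta B D - (q ^ 4)⁻¹ * ∑ F, epsUp q F A B * epsLow q F D C
    - (q ^ 4)⁻¹ * (q ^ 2 - 1) * (g q A B * g q C D)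

/-- `g^{EB} g^{FA} ε_{FEC}`. -/
def epsRaise (q : ℂ) (A B C : E3) : ℂ := ∑ E, ∑ F, g q E B * g q F A * epsLow q F E C

/-- The selfdual projector `P_+^{ab}{}_{cd}`. -/
def PPlus (q : ℂ) : M4 → M4 → M4 → M4 → ℂ
  | some A, none, some C, none => q ^ 2 / (1 + q ^ 2) ^ 2 * delta A C
  | some A, none, none, some D => -1 / (1 + q ^ 2) ^ 2 * delta A D
  | some A, none, some C, some D => 1 / (1 + q ^ 2) ^ 2 * eps q D C A
  | none, some B, some C, none => -q ^ 4 / (1 + q ^ 2) ^ 2 * delta B C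
  | none, some B, none, some D => q ^ 2 / (1 + q ^ 2) ^ 2 * delta B D
  | none, some B, some C, some D => -q ^ 2 / (1 + q ^ 2) ^ 2 * eps q D C B
  | some A, some B, some C, none => q ^ 2 / (1 + q ^ 2) ^ 2 * epsRaise q A B C
  | some A, some B, none, some D => -1 / (1 + q ^ 2) ^ 2 * epsRaise q A B D
  | some A, some B, some C, some D =>
      1 / (1 + q ^ 2) ^ 2 * ∑ E, eps q D C E * epsRaise q A B E
  | _, _, _, _ => 0

/-- The antiselfdual projector `P_-^{ab}{}_{cd}`. -/
def PMinus (q : ℂ) : M4 → M4 → M4 → M4 → ℂ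
  | some A, none, some C, none => q ^ 2 / (1 + q ^ 2) ^ 2 * delta A C
  | some A, none, none, some D => -q ^ 4 / (1 + q ^ 2) ^ 2 * delta A D
  | some A, none, some C, some D => -q ^ 2 / (1 + q ^ 2) ^ 2 * eps q D C A
  | none, some B, some C, none => -1 / (1 + q ^ 2) ^ 2 * delta B C
  | none, some B, none, some D => q ^ 2 / (1 + q ^ 2) ^ 2 * delta B D
  | none, some B, some C, some D => 1 / (1 + q ^ 2) ^ 2 * eps q D C B
  | some A, some B, some C, none => -1 / (1 + q ^ 2) ^ 2 * epsRaise q A B C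
  | some A, some B, none, some D => q ^ 2 / (1 + q ^ 2) ^ 2 * epsRaise q A B D
  | some A, some B, some C, some D =>
      1 / (1 + q ^ 2) ^ 2 * ∑ E, eps q D C E * epsRaise q A B E
  | _, _, _, _ => 0

/-- The trace projector `P_T^{ab}{}_{cd}`. -/
def PTrace (q : ℂ) : M4 → M4 → M4 → M4 → ℂ
  | none, none, none, none => q ^ 2 / (1 + q ^ 2) ^ 2
  | none, none, some C, some D => -q ^ 2 / (1 + q ^ 2) ^ 2 * g q C D
  | some A, some B, none, none => -q ^ 2 / (1 + q ^ 2) ^ 2 * g q A B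
  | some A, some B, some C, some D => q ^ 2 / (1 + q ^ 2) ^ 2 * (g q A B * g q C D)
  | _, _, _, _ => 0

/-- The symmetric projector `P_S = 1 - P_T - P_+ - P_-`. -/
def PSym (q : ℂ) (a b c d : M4) : ℂ :=
  delta a c * delta b d - PTrace q a b c d - PPlus q a b c d - PMinus q a b c d

/-- The inverse of `R̂_{II} = q^{-2} P_S + q^2 P_T - P_+ - P_-`. -/
def RIIInv (q : ℂ) (a b c d : M4) : ℂ :=
  q ^ 2 * PSym q a b c d + (q ^ 2)⁻¹ * PTrace q a b c d - PPlus q a b c d - PMinus q a b c d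

/-- The invariant scalar product `X ∘ Y = g_{AB} X^A Y^B`. -/
def dot {𝒜 : Type*} [Ring 𝒜] [Algebra ℂ 𝒜] (q : ℂ) (x y : E3 → 𝒜) : 𝒜 :=
  ∑ A, ∑ B, g q A B • (x A * y B)

/-- `ε_{CB}{}^A x^B y^C` (note the order of the indices). -/
def cross {𝒜 : Type*} [Ring 𝒜] [Algebra ℂ 𝒜] (q : ℂ) (x y : E3 → 𝒜) (A : E3) : 𝒜 :=
  ∑ C, ∑ B, eps q C B A • (x B * y C)

/-! ## The algebra -/

/-- The free algebra on the generators. -/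
abbrev Free := FreeAlgebra ℂ Gen

/-- The generators in the free algebra; `fV k a` is `X^a` or `P^a`, and `fX0`, `fX` are its time
and space components. -/
abbrev fX0 (k : Kind) : Free := FreeAlgebra.ι ℂ (.vec k none)
abbrev fX (k : Kind) (A : E3) : Free := FreeAlgebra.ι ℂ (.vec k (some A))
abbrev fV (k : Kind) (a : M4) : Free := FreeAlgebra.ι ℂ (.vec k a)
abbrev fR (A : E3) : Free := FreeAlgebra.ι ℂ (.R A)
abbrev fS (A : E3) : Free := FreeAlgebra.ι ℂ (.S A)
abbrev fU : Free := FreeAlgebra.ι ℂ .U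
abbrev fL : Free := FreeAlgebra.ι ℂ .lamHalf
abbrev fLi : Free := FreeAlgebra.ι ℂ .lamInv

/-- The `q`-Lorentz generators `V^{ab}` in terms of `R^A` and `S^A`. -/
def lorentzV (q : ℂ) : M4 → M4 → Free
  | some A, none => fR A + q ^ 2 • fS A
  | none, some A => -(q ^ 2 • fR A) - fS A
  | some A, some B => ∑ C, epsMix q C A B • (fR C - fS C)
  | none, none => 0

/-- The defining relations of the algebra. The relations with an argument `k` hold for the
coordinates (`k = pos`) and, identically, for the momenta (`k = mom`). -/
inductive Rel (q : ℂ) : Free → Free → Prop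
  | vecVec (k : Kind) (A : E3) :
      Rel q (cross q (fX k) (fX k) A) ((1 - q ^ 2) • (fX0 k * fX k A))
  | vecZero (k : Kind) (A : E3) : Rel q (fX0 k * fX k A) (fX k A * fX0 k)
  | uSq : Rel q (fU * fU) (1 + ((1 / 2) * (q ^ 4 - 1) ^ 2) • (dot q fR fR + dot q fS fS))
  | rr (A : E3) : Rel q (cross q fR fR A) ((1 / (1 + q ^ 2)) • (fU * fR A))
  | ss (A : E3) : Rel q (cross q fS fS A) (-((1 / (1 + q ^ 2)) • (fU * fS A)))
  | rs (A B : E3) :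
      Rel q (fR A * fS B) (q ^ 2 • ∑ C, ∑ D, RHat q A B C D • (fS C * fR D))
  | ur (A : E3) : Rel q (fU * fR A) (fR A * fU)
  | us (A : E3) : Rel q (fU * fS A) (fS A * fU)
  | rVecZero (k : Kind) (A : E3) :
      Rel q (fR A * fX0 k)
        ((q⁻¹ * ((q ^ 4 + 1) / (q ^ 2 + 1))) • (fX0 k * fR A)
          + (q⁻¹ * ((q ^ 2 - 1) / (q ^ 2 + 1))) • cross q (fX k) fR A
          - (q / (1 + q ^ 2) ^ 2) • (fX k A * fU))
  | rVec (k : Kind) (A B : E3) :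
      Rel q (fR A * fX k B)
        ((1 / (1 + q ^ 2)) •
          ((q * (1 + q ^ 2)) • (fX k A * fR B)
            - (q⁻¹ * (q ^ 2 - 1)) • (∑ C, epsMix q C A B • (fX0 k * fR C))
            - (q⁻¹ * (q ^ 2 - 1) * g q A B) • dot q (fX k) fR
            - (2 / q) • (∑ G, ∑ S, ∑ T, (epsUp q A B G * epsLow q S T G) • (fX k T * fR S))
            - (q⁻¹ * (1 / (1 + q ^ 2)) * g q A B) • (fX0 k * fU)
            + (q⁻¹ * (1 / (1 + q ^ 2))) • (∑ M, epsMix q M A B • (fX k M * fU))))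
  | sVecZero (k : Kind) (A : E3) :
      Rel q (fS A * fX0 k)
        ((q⁻¹ * ((q ^ 4 + 1) / (q ^ 2 + 1))) • (fX0 k * fS A)
          + (q⁻¹ * ((q ^ 2 - 1) / (q ^ 2 + 1))) • cross q (fX k) fS A
          - (1 / (q * (1 + q ^ 2) ^ 2)) • (fX k A * fU))
  | sVec (k : Kind) (A B : E3) :
      Rel q (fS A * fX k B)
        ((1 / (1 + q ^ 2)) •
          ((q⁻¹ * (1 + q ^ 2)) • (fX k A * fS B)
            - (q⁻¹ * (q ^ 2 - 1)) • (∑ C, epsMix q C A B • (fX0 k * fS C))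
            + (q * (q ^ 2 - 1) * g q A B) • dot q (fX k) fS
            - (2 / q) • (∑ G, ∑ S, ∑ T, (epsUp q A B G * epsLow q S T G) • (fX k T * fS S))
            - (q / (1 + q ^ 2) * g q A B) • (fX0 k * fU)
            - (q⁻¹ * (1 / (1 + q ^ 2))) • (∑ M, epsMix q M A B • (fX k M * fU))))
  | uVecZero (k : Kind) :
      Rel q (fU * fX0 k)
        ((q⁻¹ * ((q ^ 4 + 1) / (q ^ 2 + 1))) • (fX0 k * fU)
          - (q⁻¹ * (q ^ 2 - 1) ^ 2) • dot q (fX k) fR)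
  | uVec (k : Kind) (A : E3) :
      Rel q (fU * fX k A)
        ((q⁻¹ * ((q ^ 4 + 1) / (q ^ 2 + 1))) • (fX k A * fU)
          - (q * (q ^ 2 - 1) ^ 2) • (fX0 k * fR A)
          - (q⁻¹ * (q ^ 2 - 1) ^ 2) • cross q (fX k) fR A)
  | lamMulInv : Rel q (fL * fLi) 1
  | lamInvMul : Rel q (fLi * fL) 1
  | lamPos (a : M4) : Rel q (fL * fV .pos a) (q⁻¹ • (fV .pos a * fL))
  | lamMom (a : M4) : Rel q (fL * fV .mom a) (q • (fV .mom a * fL))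
  | lamR (A : E3) : Rel q (fL * fR A) (fR A * fL)
  | lamS (A : E3) : Rel q (fL * fS A) (fS A * fL)
  | lamU : Rel q (fL * fU) (fU * fL)
  | heisenberg (a b : M4) :
      Rel q
        (fV .mom a * fV .pos b
          - (q ^ 2)⁻¹ • ∑ c, ∑ d, RIIInv q a b c d • (fV .pos c * fV .mom d))
        (-(Complex.I / 2) •
          (fLi * (((1 + q ^ 4) * eta q a b) • fU + (q ^ 2 * (1 - q ^ 4)) • lorentzV q a b)))

/-- The algebra generated by `X^a`, `P^a`, `R^A`, `S^A`, `U`, `Λ^{1/2}`, `Λ^{-1/2}` subject to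
the defining relations. -/
abbrev QAlg (q : ℝ) := RingQuot (Rel (q : ℂ))

/-- The generators as elements of the algebra. -/
def gen (q : ℝ) (x : Gen) : QAlg q := RingQuot.mkAlgHom ℂ (Rel (q : ℂ)) (FreeAlgebra.ι ℂ x)

/-- The conjugates of the generators. They determine the `*`-structure, which is antilinear and
reverses products. -/
def genStar (q : ℝ) : Gen → QAlg q
  | .vec k none => gen q (.vec k none)
  | .vec k (some A) => ∑ B, g q A B • gen q (.vec k (some B))
  | .R A => -∑ B, g q A B • gen q (.S B)
  | .S A => -∑ B, g q A B • gen q (.R B)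
  | .U => gen q .U
  | .lamHalf => ((q : ℂ) ^ 4) • gen q .lamInv
  | .lamInv => (((q : ℂ) ^ 4)⁻¹) • gen q .lamHalf

/-- The square `X ∘ X` of the three-dimensional radius. -/
def radiusSq (q : ℝ) : QAlg q :=
  dot q (fun A => gen q (.vec .pos (some A))) (fun A => gen q (.vec .pos (some A)))

/-- The rotation generators `L^A`. -/
def rotL (q : ℝ) (A : E3) : QAlg q :=
  (((q : ℂ) ^ 2 + 1) / (q : ℂ) ^ 2) •
    (gen q .U * gen q (.S A) - gen q .U * gen q (.R A)
      + ((q : ℂ) ^ 4 - 1) • cross q (fun B => gen q (.R B)) (fun B => gen q (.S B)) A)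

/-- `W = U^2 - q^2 (q^4 - 1)^2 R ∘ S`. -/
def rotW (q : ℝ) : QAlg q :=
  gen q .U * gen q .U
    - ((q : ℂ) ^ 2 * ((q : ℂ) ^ 4 - 1) ^ 2) • dot q (fun A => gen q (.R A)) (fun A => gen q (.S A))

/-- `τ^{-1/2} = W + q^2 (1 - q^2) L^3`. -/
def tauInvHalf (q : ℝ) : QAlg q :=
  rotW q + ((q : ℂ) ^ 2 * (1 - (q : ℂ) ^ 2)) • rotL q .three

/-! ## `*`-representations -/

section Rep

variable {H : Type*} [NormedAddCommGroup H] [InnerProductSpace ℂ H]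
variable {H' : Type*} [NormedAddCommGroup H'] [InnerProductSpace ℂ H']

/-- A `*`-representation of the algebra by (in general unbounded) operators on the common
invariant domain `D` in the Hilbert space `H`. -/
structure StarRep (q : ℝ) (D : Submodule ℂ H) where
  /-- The underlying representation by endomorphisms of `D`. -/
  toHom : QAlg q →ₐ[ℂ] Module.End ℂ D
  /-- The conjugate of a generator is represented by a formal adjoint on `D`. -/
  adjoint : ∀ (x : Gen) (φ ψ : D),
    inner ℂ (toHom (genStar q x) φ) ψ = inner ℂ φ (toHom (gen q x) ψ)

variable {q : ℝ} {D : Submodule ℂ H} {D' : Submodule ℂ H'}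

/-- Irreducibility: the domain has no invariant subspaces other than `0` and itself, and every
bounded operator on `H` that commutes (in the weak sense) with the representation is a scalar. -/
def StarRep.Irreducible (ρ : StarRep q D) : Prop :=
  Nontrivial D ∧
  (∀ V : Submodule ℂ D, (∀ (a : QAlg q), ∀ φ ∈ V, ρ.toHom a φ ∈ V) → V = ⊥ ∨ V = ⊤) ∧
  (∀ T : H →L[ℂ] H,
    (∀ (x : Gen) (φ ψ : D),
      inner ℂ (ρ.toHom (genStar q x) φ : H) (T ψ) = inner ℂ (φ : H) (T (ρ.toHom (gen q x) ψ : H))) →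
    ∃ c : ℂ, T = c • ContinuousLinearMap.id ℂ H)

/-- Equivalence as modules over the algebra: a linear bijection of the domains that intertwines
the two representations. -/
def StarRep.AlgEquivalent (ρ : StarRep q D) (ρ' : StarRep q D') : Prop :=
  ∃ e : D ≃ₗ[ℂ] D', ∀ (a : QAlg q) (φ : D), e (ρ.toHom a φ) = ρ'.toHom a (e φ)

/-- Unitary equivalence in the weak sense: a unitary map that intertwines the matrix elements,
without any condition on the image of the domain. -/
def StarRep.UnitarilyEquivalent (ρ : StarRep q D) (ρ' : StarRep q D') : Prop :=
  ∃ V : H ≃ₗᵢ[ℂ] H', ∀ (x : Gen) (φ : D) (ψ : D'),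
    inner ℂ (ρ'.toHom (genStar q x) ψ : H') (V φ) = inner ℂ (ψ : H') (V (ρ.toHom (gen q x) φ : H))

/-- The operator `τ^{1/2}`, the inverse of `τ^{-1/2}` (see `tauInvHalf`) on the domain. -/
def StarRep.tauHalf (ρ : StarRep q D) : Module.End ℂ D := Ring.inverse (ρ.toHom (tauInvHalf q))

/-- `T^+ = q^2 (1 + q^2)^{1/2} τ^{1/2} L^+`. -/
def StarRep.tPlus (ρ : StarRep q D) : Module.End ℂ D :=
  ((q ^ 2 * √(1 + q ^ 2) : ℝ) : ℂ) • (ρ.tauHalf * ρ.toHom (rotL q .plus))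

/-- `T^- = -q^3 (1 + q^2)^{1/2} τ^{1/2} L^-`. -/
def StarRep.tMinus (ρ : StarRep q D) : Module.End ℂ D :=
  ((-q ^ 3 * √(1 + q ^ 2) : ℝ) : ℂ) • (ρ.tauHalf * ρ.toHom (rotL q .minus))

/-- The Casimir operator of `SU_q(2)`:
`q τ^{-1/2} T^- T^+ + (q - q^{-1})^{-2} (q τ^{-1/2} + q^{-1} (τ^{1/2} - q^2 - 1))`. -/
def StarRep.tSq (ρ : StarRep q D) : Module.End ℂ D :=
  (q : ℂ) • (ρ.toHom (tauInvHalf q) * ρ.tMinus * ρ.tPlus)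
    + ((q : ℂ) / ((q : ℂ) - (q : ℂ)⁻¹) ^ 2) • ρ.toHom (tauInvHalf q)
    + ((q : ℂ)⁻¹ / ((q : ℂ) - (q : ℂ)⁻¹) ^ 2) •
      (ρ.tauHalf - ((q : ℂ) ^ 2 + 1) • (1 : Module.End ℂ D))

end Rep

/-! ## The matrix elements -/

/-- `[a]`. -/
def brk (q : ℝ) (a : ℤ) : ℝ := (q ^ a - q ^ (-a)) / (q - q⁻¹)

/-- `{a}`. -/
def crl (q : ℝ) (a : ℤ) : ℝ := q ^ a + q ^ (-a)

/-- `λ`. -/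
def lam (q : ℝ) : ℝ := q - q⁻¹

/-- The matrix element `⟨j', m' | X^A | j, m⟩` of a vector operator whose reduced matrix element
`⟨j' ‖ X^- ‖ j⟩` is `r`. -/
def vecElt (q : ℝ) (A : E3) (r : ℝ) (j' m' j m : ℤ) : ℝ :=
  match A with
  | .plus =>
    if m' = m + 1 then
      if j' = j then -q ^ (m + 2) * √(brk q (j + m + 1) * brk q (j - m)) * r
      else if j' = j + 1 then
        q ^ (m - 2 * j) * √(brk q (j + m + 1) * brk q (j + m + 2)) * r
      else if j' = j - 1 then
        q ^ (m + 2 * j + 2) * √(brk q (j - m) * brk q (j - m - 1)) * r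
      else 0
    else 0
  | .minus =>
    if m' = m - 1 then
      if j' = j then q ^ m * √(brk q (j + m) * brk q (j - m + 1)) * r
      else if j' = j + 1 then q ^ m * √(brk q (j - m + 1) * brk q (j - m + 2)) * r
      else if j' = j - 1 then q ^ m * √(brk q (j + m) * brk q (j + m - 1)) * r
      else 0
    else 0
  | .three =>
    if m' = m then
      if j' = j then
        q ^ (3 / 2 : ℝ) * (√(1 + q ^ 2) / (q ^ 2 - 1))
          * (q ^ (2 * m) - (q ^ (2 * j + 1) + q ^ (-2 * j - 1)) / (q + q⁻¹)) * r
      else if j' = j + 1 then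
        q ^ ((m : ℝ) - (j : ℝ) - 1 / 2) * √(1 + q ^ 2)
          * √(brk q (j - m + 1) * brk q (j + m + 1)) * r
      else if j' = j - 1 then
        -q ^ ((m : ℝ) + (j : ℝ) + 1 / 2) * √(1 + q ^ 2)
          * √(brk q (j - m) * brk q (j + m)) * r
      else 0
    else 0

/-! ### Space-like reduced matrix elements

All functions below give the element from `(j, n, M)` to `(j', n', M')`. -/

/-- `⟨j', n', M' ‖ X^- ‖ j, n, M⟩`, space-like. -/
def redXSpace (q l : ℝ) (j' n' M' j n M : ℤ) : ℝ :=
  if n' = n ∧ M' = M then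
    if j' = j + 1 then
      l * q ^ (M + j) * (√(crl q (n + j + 1) * crl q (n - j - 1))
        / (crl q (j + 1) * √(brk q 2 * brk q (2 * j + 1) * brk q (2 * j + 3))))
    else if j' = j ∧ 1 ≤ j then
      -q⁻¹ * ((l * q ^ M * brk q n * lam q ^ 2) / (√(brk q 2) * crl q j * crl q (j + 1)))
    else if j = j' + 1 then
      -l * q ^ (M - j' - 2) * (√(crl q (n + j' + 1) * crl q (n - j' - 1))
        / (crl q (j' + 1) * √(brk q 2 * brk q (2 * j' + 1) * brk q (2 * j' + 3))))
    else 0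
  else 0

/-- `⟨j', n', M' ‖ R^- ‖ j, n, M⟩`, space-like. -/
def redRSpace (q : ℝ) (j' n' M' j n M : ℤ) : ℝ :=
  if (n' = n + 1 ∨ n' = n - 1) ∧ M' = M then
    if j' = j + 1 then
      ((n' - n : ℤ) * q ^ (2 * j - 1))
        / (crl q (j + 1) * brk q 2 ^ (3 / 2 : ℝ) * lam q
            * √(brk q (2 * j + 1) * brk q (2 * j + 3)))
        * √(crl q ((n' - n) * (j + 1) + n') * crl q ((n' - n) * j + n')
            / (crl q n * crl q n'))
    else if j' = j ∧ 1 ≤ j then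
      q ^ (-3 : ℤ) / (crl q (j + 1) * crl q j * brk q 2 ^ (3 / 2 : ℝ))
        * √(crl q ((n' - n) * j + n') * crl q (n - (n' - n) * j) / (crl q n * crl q n'))
    else if j = j' + 1 then
      -(((n' - n : ℤ) * q ^ (-2 * j' - 5))
        / (crl q (j' + 1) * brk q 2 ^ (3 / 2 : ℝ) * lam q
            * √(brk q (2 * j' + 1) * brk q (2 * j' + 3))))
        * √(crl q (n' - (n' - n) * (j' + 1)) * crl q (n - (n' - n) * (j' + 1))
            / (crl q n * crl q n'))
    else 0
  else 0

/-- `⟨j', n', M' ‖ S^- ‖ j, n, M⟩`, space-like. -/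
def redSSpace (q : ℝ) (j' n' M' j n M : ℤ) : ℝ :=
  if (n' = n + 1 ∨ n' = n - 1) ∧ M' = M then
    if j' = j + 1 then
      ((n' - n : ℤ) * q ^ (-3 : ℤ))
        / (crl q (j + 1) * brk q 2 ^ (3 / 2 : ℝ) * lam q
            * √(brk q (2 * j + 1) * brk q (2 * j + 3)))
        * √(crl q ((n' - n) * (j + 1) + n') * crl q ((n' - n) * j + n')
            / (crl q n * crl q n'))
    else if j' = j ∧ 1 ≤ j then
      -(q ^ (-3 : ℤ) / (crl q (j + 1) * crl q j * brk q 2 ^ (3 / 2 : ℝ)))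
        * √(crl q ((n' - n) * j + n') * crl q (n - (n' - n) * j) / (crl q n * crl q n'))
    else if j = j' + 1 then
      -(((n' - n : ℤ) * q ^ (-3 : ℤ))
        / (crl q (j' + 1) * brk q 2 ^ (3 / 2 : ℝ) * lam q
            * √(brk q (2 * j' + 1) * brk q (2 * j' + 3))))
        * √(crl q (n' - (n' - n) * (j' + 1)) * crl q (n - (n' - n) * (j' + 1))
            / (crl q n * crl q n'))
    else 0
  else 0

/-- The combination `δ_{M',M+1} a + δ_{M',M-1} b`. -/
def shiftM (M' M : ℤ) (a b : ℝ) : ℝ :=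
  (if M' = M + 1 then a else 0) + (if M' = M - 1 then b else 0)

/-- `⟨j', n', M' ‖ P^- ‖ j, n, M⟩` divided by the imaginary unit, space-like. -/
def redPSpace (q l : ℝ) (j' n' M' j n M : ℤ) : ℝ :=
  if j' = j + 1 then
    if n' = n + 1 then
      1 / 2 * shiftM M' M (q ^ (2 + 2 * j - n)) (-q ^ (2 + n))
        * (1 / (crl q (j + 1) * lam q * l * q ^ M))
        * √(brk q 2 / (brk q (2 * j + 1) * brk q (2 * j + 3)))
        * √(crl q (n + j + 2) * crl q (n + j + 1) / (crl q n * crl q (n + 1)))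
    else if n' = n - 1 then
      1 / 2 * shiftM M' M (q ^ (2 + 2 * j + n)) (-q ^ (2 - n))
        * (1 / (crl q (j + 1) * lam q * l * q ^ M))
        * √(brk q 2 / (brk q (2 * j + 1) * brk q (2 * j + 3)))
        * √(crl q (n - j - 2) * crl q (n - j - 1) / (crl q n * crl q (n - 1)))
    else 0
  else if j' = j ∧ 1 ≤ j then
    if n' = n + 1 then
      √(brk q 2) / (2 * crl q j * crl q (j + 1) * l * q ^ M)
        * shiftM M' M (q ^ (-n)) (q ^ (2 + n))
        * √(crl q (n + j + 1) * crl q (n - j) / (crl q n * crl q (n + 1)))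
    else if n' = n - 1 then
      -(√(brk q 2) / (2 * crl q j * crl q (j + 1) * l * q ^ M))
        * shiftM M' M (q ^ n) (q ^ (2 - n))
        * √(crl q (n - j - 1) * crl q (n + j) / (crl q n * crl q (n - 1)))
    else 0
  else if j = j' + 1 then
    if n' = n + 1 then
      -(1 / 2) * shiftM M' M (q ^ (-2 - 2 * j' - n)) (-q ^ (2 + n))
        * (1 / (crl q (j' + 1) * lam q * l * q ^ M))
        * √(brk q 2 / (brk q (2 * j' + 1) * brk q (2 * j' + 3)))
        * √(crl q (n - j') * crl q (n - j' - 1) / (crl q n * crl q (n + 1)))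
    else if n' = n - 1 then
      -(1 / 2) * shiftM M' M (q ^ (-2 - 2 * j' + n)) (-q ^ (2 - n))
        * (1 / (crl q (j' + 1) * lam q * l * q ^ M))
        * √(brk q 2 / (brk q (2 * j' + 1) * brk q (2 * j' + 3)))
        * √(crl q (n + j' + 1) * crl q (n + j') / (crl q n * crl q (n - 1)))
    else 0
  else 0

/-- `⟨j, m, n', M' | P^0 | j, m, n, M⟩` divided by the imaginary unit, space-like. -/
def eltP0Space (q l : ℝ) (n' M' j n M : ℤ) : ℝ :=
  if n' = n + 1 then
    -(1 / (2 * lam q * l * q ^ M)) * shiftM M' M (q ^ (1 - n)) (q ^ (3 + n))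
      * √(crl q (n - j) * crl q (n + j + 1) / (crl q n * crl q (n + 1)))
  else if n' = n - 1 then
    1 / (2 * lam q * l * q ^ M) * shiftM M' M (q ^ (1 + n)) (q ^ (3 - n))
      * √(crl q (n - j - 1) * crl q (n + j) / (crl q n * crl q (n - 1)))
  else 0

/-- `⟨j, m, n + 1, M | U | j, m, n, M⟩ = ⟨j, m, n, M | U | j, m, n + 1, M⟩`, space-like. -/
def coeffUSpace (q : ℝ) (j n : ℤ) : ℝ :=
  1 / brk q 2 * √(crl q (n - j) * crl q (n + j + 1) / (crl q n * crl q (n + 1)))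

/-! ### Time-like reduced matrix elements -/

/-- `⟨j', n', M' ‖ X^- ‖ j, n, M⟩`, time-like. -/
def redXTime (q t : ℝ) (j' n' M' j n M : ℤ) : ℝ :=
  if n' = n ∧ M' = M then
    if j' = j + 1 then
      t * q ^ (M + j) * lam q * (√(brk q (n - j) * brk q (n + j + 2))
        / (crl q (j + 1) * √(brk q 2 * brk q (2 * j + 1) * brk q (2 * j + 3))))
    else if j' = j ∧ 1 ≤ j then
      -q⁻¹ * lam q * ((t * q ^ M * crl q (n + 1)) / (√(brk q 2) * crl q j * crl q (j + 1)))
    else if j = j' + 1 then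
      -t * q ^ (M - j' - 2) * lam q * (√(brk q (n - j') * brk q (n + j' + 2))
        / (crl q (j' + 1) * √(brk q 2 * brk q (2 * j' + 1) * brk q (2 * j' + 3))))
    else 0
  else 0

/-- `⟨j', n', M' ‖ R^- ‖ j, n, M⟩`, time-like. -/
def redRTime (q : ℝ) (j' n' M' j n M : ℤ) : ℝ :=
  if (n' = n + 1 ∨ n' = n - 1) ∧ M' = M then
    if j' = j + 1 then
      ((n' - n : ℤ) * q ^ (2 * j - 1))
        / (crl q (j + 1) * brk q 2 ^ (3 / 2 : ℝ) * lam q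
            * √(brk q (2 * j + 1) * brk q (2 * j + 3)))
        * √(brk q ((n' - n) * (j + 1) + n' + 1) * brk q ((n' - n) * j + n' + 1)
            / (brk q (n + 1) * brk q (n' + 1)))
    else if j' = j ∧ 1 ≤ j then
      q ^ (-3 : ℤ) / (crl q (j + 1) * crl q j * brk q 2 ^ (3 / 2 : ℝ))
        * √(brk q ((n' - n) * j + n' + 1) * brk q (n - (n' - n) * j + 1)
            / (brk q (n + 1) * brk q (n' + 1)))
    else if j = j' + 1 then
      -(((n' - n : ℤ) * q ^ (-2 * j' - 5))
        / (crl q (j' + 1) * brk q 2 ^ (3 / 2 : ℝ) * lam q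
            * √(brk q (2 * j' + 1) * brk q (2 * j' + 3))))
        * √(brk q (n' - (n' - n) * (j' + 1) + 1) * brk q (n - (n' - n) * (j' + 1) + 1)
            / (brk q (n + 1) * brk q (n' + 1)))
    else 0
  else 0

/-- `⟨j', n', M' ‖ S^- ‖ j, n, M⟩`, time-like. -/
def redSTime (q : ℝ) (j' n' M' j n M : ℤ) : ℝ :=
  if (n' = n + 1 ∨ n' = n - 1) ∧ M' = M then
    if j' = j + 1 then
      ((n' - n : ℤ) * q ^ (-3 : ℤ))
        / (crl q (j + 1) * brk q 2 ^ (3 / 2 : ℝ) * lam q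
            * √(brk q (2 * j + 1) * brk q (2 * j + 3)))
        * √(brk q ((n' - n) * (j + 1) + n' + 1) * brk q ((n' - n) * j + n' + 1)
            / (brk q (n + 1) * brk q (n' + 1)))
    else if j' = j ∧ 1 ≤ j then
      -(q ^ (-3 : ℤ) / (crl q (j + 1) * crl q j * brk q 2 ^ (3 / 2 : ℝ)))
        * √(brk q ((n' - n) * j + n' + 1) * brk q (n - (n' - n) * j + 1)
            / (brk q (n + 1) * brk q (n' + 1)))
    else if j = j' + 1 then
      -(((n' - n : ℤ) * q ^ (-3 : ℤ))
        / (crl q (j' + 1) * brk q 2 ^ (3 / 2 : ℝ) * lam q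
            * √(brk q (2 * j' + 1) * brk q (2 * j' + 3))))
        * √(brk q (n' - (n' - n) * (j' + 1) + 1) * brk q (n - (n' - n) * (j' + 1) + 1)
            / (brk q (n + 1) * brk q (n' + 1)))
    else 0
  else 0

/-- `⟨j', n', M' ‖ P^- ‖ j, n, M⟩` divided by the imaginary unit, time-like. -/
def redPTime (q t : ℝ) (j' n' M' j n M : ℤ) : ℝ :=
  if j' = j + 1 then
    if n' = n + 1 then
      1 / 2 * shiftM M' M (q ^ (1 + 2 * j - n)) (q ^ (3 + n))
        * (1 / (t * q ^ M * lam q * crl q (j + 1)))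
        * √(brk q 2 / (brk q (2 * j + 1) * brk q (2 * j + 3)))
        * √(brk q (n + j + 3) * brk q (n + j + 2) / (brk q (n + 2) * brk q (n + 1)))
    else if n' = n - 1 then
      -(1 / 2) * shiftM M' M (q ^ (3 + 2 * j + n)) (q ^ (1 - n))
        * (1 / (t * q ^ M * lam q * crl q (j + 1)))
        * √(brk q 2 / (brk q (2 * j + 1) * brk q (2 * j + 3)))
        * √(brk q (n - j - 1) * brk q (n - j) / (brk q n * brk q (n + 1)))
    else 0
  else if j' = j ∧ 1 ≤ j then
    if n' = n + 1 then
      √(brk q 2) / (2 * crl q j * crl q (j + 1) * t * q ^ M)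
        * shiftM M' M (q ^ (-1 - n)) (-q ^ (3 + n))
        * √(brk q (n + j + 2) * brk q (n - j + 1) / (brk q (n + 2) * brk q (n + 1)))
    else if n' = n - 1 then
      √(brk q 2) / (2 * crl q j * crl q (j + 1) * t * q ^ M)
        * shiftM M' M (q ^ (1 + n)) (-q ^ (1 - n))
        * √(brk q (n + j + 1) * brk q (n - j) / (brk q n * brk q (n + 1)))
    else 0
  else if j = j' + 1 then
    if n' = n + 1 then
      -(1 / 2) * shiftM M' M (q ^ (-3 - 2 * j' - n)) (q ^ (3 + n))
        * (1 / (lam q * crl q (j' + 1) * t * q ^ M))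
        * √(brk q 2 / (brk q (2 * j' + 1) * brk q (2 * j' + 3)))
        * √(brk q (n - j' + 1) * brk q (n - j') / (brk q (n + 2) * brk q (n + 1)))
    else if n' = n - 1 then
      1 / 2 * shiftM M' M (q ^ (-1 - 2 * j' + n)) (q ^ (1 - n))
        * (1 / (lam q * crl q (j' + 1) * t * q ^ M))
        * √(brk q 2 / (brk q (2 * j' + 1) * brk q (2 * j' + 3)))
        * √(brk q (n + j' + 2) * brk q (n + j' + 1) / (brk q n * brk q (n + 1)))
    else 0
  else 0

/-- `⟨j, m, n', M' | P^0 | j, m, n, M⟩` divided by the imaginary unit, time-like. -/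
def eltP0Time (q t : ℝ) (n' M' j n M : ℤ) : ℝ :=
  if n' = n + 1 then
    -(1 / (2 * lam q * t * q ^ M)) * shiftM M' M (q ^ (-n)) (-q ^ (4 + n))
      * √(brk q (n - j + 1) * brk q (n + j + 2) / (brk q (n + 1) * brk q (n + 2)))
  else if n' = n - 1 then
    -(1 / (2 * lam q * t * q ^ M)) * shiftM M' M (q ^ (2 + n)) (-q ^ (2 - n))
      * √(brk q (n - j) * brk q (n + j + 1) / (brk q n * brk q (n + 1)))
  else 0

/-- `⟨j, m, n + 1, M | U | j, m, n, M⟩ = ⟨j, m, n, M | U | j, m, n + 1, M⟩`, time-like. -/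
def coeffUTime (q : ℝ) (j n : ℤ) : ℝ :=
  1 / brk q 2 * √(brk q (n - j + 1) * brk q (n + j + 2) / (brk q (n + 1) * brk q (n + 2)))

/-! ### The families -/

/-- The labels of the representations: space-like with `l_0 ∈ [1, q)`, time-like with
`|t_0| ∈ [1, q)` (forward for `t_0 > 0`, backward for `t_0 < 0`). -/
inductive Family (q : ℝ)
  | space (l : ℝ) (hl : l ∈ Set.Ico 1 q)
  | time (t : ℝ) (ht : |t| ∈ Set.Ico 1 q)

/-- Quantum numbers. -/
@[ext] structure QNum where
  /-- angular momentum -/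
  j : ℤ
  /-- third component of the angular momentum -/
  m : ℤ
  /-- label of the hyperboloid points -/
  n : ℤ
  /-- label of the hyperboloids -/
  M : ℤ
  deriving DecidableEq

variable {q : ℝ}

/-- The quantum numbers that occur: `-j ≤ m ≤ j`, hence `0 ≤ j`, and moreover `j ≤ n` in the
time-like case. -/
def Family.Occurs : Family q → QNum → Prop
  | .space _ _, s => |s.m| ≤ s.j
  | .time _ _, s => |s.m| ≤ s.j ∧ s.j ≤ s.n

/-- The index set of the orthonormal basis. -/
abbrev State (f : Family q) := {s : QNum // f.Occurs s}

/-- The Hilbert space `ℓ²` over the index set. -/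
abbrev Hilb (f : Family q) := lp (fun _ : State f => ℂ) 2

/-- The standard orthonormal (Hilbert) basis of vectors `|j, m, n, M⟩`. -/
def basisVec (f : Family q) : HilbertBasis (State f) ℂ (Hilb f) :=
  HilbertBasis.ofRepr (LinearIsometryEquiv.refl ℂ (Hilb f))

/-- The domain: all finite linear combinations of the `|j, m, n, M⟩`. -/
def dom (f : Family q) : Submodule ℂ (Hilb f) := Submodule.span ℂ (Set.range (basisVec f))

/-- `|j, m, n, M⟩` as an element of the domain. -/
def ket (f : Family q) (s : State f) : dom f :=
  ⟨basisVec f s, Submodule.subset_span ⟨s, rfl⟩⟩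

/-- The eigenvalue of `X^0`. -/
def timeVal : Family q → QNum → ℝ
  | .space l _, s => l * q ^ s.M / brk q 2 * lam q * brk q s.n
  | .time t _, s => t * q ^ s.M / brk q 2 * crl q (s.n + 1)

/-- The eigenvalue of `X ∘ X`. -/
def radiusSqVal : Family q → QNum → ℝ
  | .space l _, s => l ^ 2 * q ^ (2 * s.M) / brk q 2 ^ 2 * crl q (s.n + 1) * crl q (s.n - 1)
  | .time t _, s =>
      t ^ 2 * q ^ (2 * s.M) * lam q ^ 2 / brk q 2 ^ 2 * brk q (s.n + 2) * brk q s.n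

/-- `⟨j', n', M' ‖ X^- ‖ j, n, M⟩`. -/
def redX : Family q → QNum → QNum → ℝ
  | .space l _, s', s => redXSpace q l s'.j s'.n s'.M s.j s.n s.M
  | .time t _, s', s => redXTime q t s'.j s'.n s'.M s.j s.n s.M

/-- `⟨j', n', M' ‖ R^- ‖ j, n, M⟩`. -/
def redR : Family q → QNum → QNum → ℝ
  | .space _ _, s', s => redRSpace q s'.j s'.n s'.M s.j s.n s.M
  | .time _ _, s', s => redRTime q s'.j s'.n s'.M s.j s.n s.M

/-- `⟨j', n', M' ‖ S^- ‖ j, n, M⟩`. -/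
def redS : Family q → QNum → QNum → ℝ
  | .space _ _, s', s => redSSpace q s'.j s'.n s'.M s.j s.n s.M
  | .time _ _, s', s => redSTime q s'.j s'.n s'.M s.j s.n s.M

/-- `⟨j', n', M' ‖ P^- ‖ j, n, M⟩` divided by the imaginary unit. -/
def redP : Family q → QNum → QNum → ℝ
  | .space l _, s', s => redPSpace q l s'.j s'.n s'.M s.j s.n s.M
  | .time t _, s', s => redPTime q t s'.j s'.n s'.M s.j s.n s.M

/-- `⟨j, m, n', M' | P^0 | j, m, n, M⟩` divided by the imaginary unit. -/
def eltP0 : Family q → QNum → QNum → ℝ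
  | .space l _, s', s => eltP0Space q l s'.n s'.M s.j s.n s.M
  | .time t _, s', s => eltP0Time q t s'.n s'.M s.j s.n s.M

/-- `⟨j, m, n + 1, M | U | j, m, n, M⟩`. -/
def coeffU : Family q → ℤ → ℤ → ℝ
  | .space _ _, j, n => coeffUSpace q j n
  | .time _ _, j, n => coeffUTime q j n

/-- The matrix element `⟨j', m', n', M' | x | j, m, n, M⟩` of the generator `x`, where
`s' = (j', m', n', M')` and `s = (j, m, n, M)`. -/
def matElt (f : Family q) : Gen → QNum → QNum → ℂ
  | .vec .pos none, s', s => if s' = s then (timeVal f s : ℂ) else 0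
  | .vec .pos (some A), s', s => (vecElt q A (redX f s' s) s'.j s'.m s.j s.m : ℂ)
  | .vec .mom none, s', s =>
      if s'.j = s.j ∧ s'.m = s.m then Complex.I * (eltP0 f s' s : ℂ) else 0
  | .vec .mom (some A), s', s =>
      Complex.I * (vecElt q A (redP f s' s) s'.j s'.m s.j s.m : ℂ)
  | .R A, s', s => (vecElt q A (redR f s' s) s'.j s'.m s.j s.m : ℂ)
  | .S A, s', s => (vecElt q A (redS f s' s) s'.j s'.m s.j s.m : ℂ)
  | .U, s', s =>
      if s'.j = s.j ∧ s'.m = s.m ∧ s'.M = s.M then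
        if s'.n = s.n + 1 then (coeffU f s.j s.n : ℂ)
        else if s.n = s'.n + 1 then (coeffU f s.j s'.n : ℂ)
        else 0
      else 0
  | .lamHalf, s', s => if s' = ⟨s.j, s.m, s.n, s.M + 1⟩ then (q : ℂ) ^ 2 else 0
  | .lamInv, s', s => if s' = ⟨s.j, s.m, s.n, s.M - 1⟩ then ((q : ℂ) ^ 2)⁻¹ else 0

/-- The representation `ρ` has the explicit matrix elements of the family member `f`. -/
def StarRep.HasMatrixElements {f : Family q} (ρ : StarRep q (dom f)) : Prop :=
  ∀ (x : Gen) (s' s : State f),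
    inner ℂ (ket f s') (ρ.toHom (gen q x) (ket f s)) = matElt f x s'.1 s.1

end

end QMink

open QMink

namespace QMink

noncomputable section

/-! ## Vector operators in a rational gauge -/

/-! The relations are checked with a `q`-analogue of the Wigner–Eckart theorem. The operators `X`,
`P`, `R`, `S` are vector operators for the quantum rotation group: their dependence on `m` is
universal, and everything else sits in reduced elements, which act on the labels `n`, `M` and depend
on `j`. A product of two vector operators has a scalar, a vector and a spin-two part, and each part
is computed from the reduced elements alone (`dot_vecOp`, `cross_vecOp`, `quint_vecOp`). Conversely
a tensor is recovered from its three parts (`tensor_ext`). So every relation becomes a finite set of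
identities between reduced elements.

After a rescaling of the basis vectors that removes all square roots, the reduced elements are
rational in `q`, `J = q ^ j` and `N = q ^ (n + κ)`. A sign `σ` distinguishes the two types of
family: `σ = 1`, `κ = 0` is space-like and `σ = -1`, `κ = 1` is time-like. The identities are then
identities of rational functions. Coefficients that would lead to labels outside the index set
vanish. Only at the time-like states with `j = n = 0` does a denominator vanish too, and there it
belongs to a path that already carries the factor zero.

The momenta are treated by stripping off the length. On the unit hyperboloid there are operators
`x`, `u`, `r`, `s` that do not involve `M`. The coordinates are `x μ`, with `μ` the length operator,
and the momenta are `g₊ (x u - q u x) + g₋ (x u - q⁻¹ u x)`, where `g₊` and `g₋` shift `M` by `1`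
and `-1`. The relations with the Lorentz generators are linear in the four-vector and are inherited
by the momenta. The relations among the momenta follow from the `q`-Serre relation `u² x + x u² = (q
+ q⁻¹) u x u - (q - q⁻¹)² x` (`momentum_bilinear_zero`). In the Heisenberg relation the tensor `x u
x` is rewritten through tensors with `u` outside (`HatModel.middle_u`). Then the part with `g₊`
drops out, and `g₋ μ` is a multiple of `Λ^{-1/2}` (`HatModel.heisenberg_aux`, `heisenberg_genOp`).
All relations are collected in `rel_genOp`.

The listed matrix elements differ from those in the rational basis only by ratios of norms of basis
vectors (`matElt_eq_famOp`), and the `*`-property is a symmetry of the listed elements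
(`conj_starElt`).

For the remaining claims, `L`, `W` and `X ∘ X - X⁰ X⁰` are computed from the same identities. The
last one has eigenvalue `σ (len q ^ M)²`. Since the modulus of the label lies in `[1, q)`, this
value determines `σ`, the modulus of the label and `M`; then `X⁰` gives the sign of the label and
`n`, `W` gives `j`, and `τ^{-1/2}` gives `m` (`exists_separating`). So the joint spectrum is simple,
and the joint spectra for different labels are disjoint, which excludes intertwiners between them.
Invariant subspaces are spanned by kets, bounded operators in the weak commutant are diagonal, and
nonzero matrix elements connect all kets (`eq_of_links`). This gives irreducibility. -/

/-- Finite linear combinations of the labels `(n, M)`. -/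
abbrev Radial := ℤ × ℤ →₀ ℂ

/-- Finite linear combinations of all quantum numbers. -/
abbrev Full := QNum →₀ ℂ

/-- The change of the angular momentum made by a component of a vector operator. -/
inductive Step
  | up | stay | down

/-- The vectors with angular momentum labels `j`, `m`. -/
def emb (j m : ℤ) : Radial →ₗ[ℂ] Full :=
  Finsupp.lmapDomain ℂ ℂ (fun p : ℤ × ℤ => (⟨j, m, p.1, p.2⟩ : QNum))

lemma emb_single (j m : ℤ) (p : ℤ × ℤ) (c : ℂ) :
    emb j m (Finsupp.single p c) = Finsupp.single (⟨j, m, p.1, p.2⟩ : QNum) c := by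
  simp [emb, Finsupp.lmapDomain_apply, Finsupp.mapDomain_single]

lemma full_hom_ext {V : Type*} [AddCommGroup V] [Module ℂ V] {S T : Full →ₗ[ℂ] V}
    (h : ∀ j m w, S (emb j m w) = T (emb j m w)) : S = T := by
  refine Finsupp.lhom_ext fun s c => ?_
  have := h s.j s.m (Finsupp.single (s.n, s.M) c)
  simpa only [emb_single] using this

/-- `z - z⁻¹`. -/
def zsub (z : ℂ) : ℂ := z - z⁻¹

/-- `z + z⁻¹`. -/
def zadd (z : ℂ) : ℂ := z + z⁻¹

/-- The dependence of a vector operator on `J = q ^ j` and `μ = q ^ m`. -/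
def angCoef (q : ℂ) : E3 → Step → ℂ → ℂ → ℂ
  | .plus, .up, J, μ => μ / J ^ 2
  | .plus, .stay, J, μ => -q ^ 2 * μ * zsub (J / μ)
  | .plus, .down, J, μ => μ * q ^ 2 * J ^ 2 * zsub (J / μ) * zsub (J / μ / q)
  | .minus, .up, _, μ => μ / (q * (1 + q ^ 2) * (q - q⁻¹) ^ 2)
  | .minus, .stay, J, μ => μ * zsub (J * μ) / (q * (1 + q ^ 2) * (q - q⁻¹) ^ 2)
  | .minus, .down, J, μ =>
      μ * zsub (J * μ) * zsub (J * μ / q) / (q * (1 + q ^ 2) * (q - q⁻¹) ^ 2)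
  | .three, .up, J, μ => μ / (J * q) / (q - q⁻¹)
  | .three, .stay, J, μ => (μ ^ 2 - zadd (q * J ^ 2) / (q + q⁻¹)) / (q - q⁻¹)
  | .three, .down, J, μ => -μ * J * zsub (J / μ) * zsub (J * μ) / (q - q⁻¹)

/-- The change of the third component of the angular momentum. -/
def weight : E3 → ℤ
  | .plus => 1
  | .minus => -1
  | .three => 0

/-- Reduced matrix elements, as operators on `Radial`. -/
abbrev RedVec := Step → ℤ → Module.End ℂ Radial

/-- The vector operator with given reduced matrix elements. -/
def vecOp (q : ℂ) (y : RedVec) (A : E3) : Module.End ℂ Full :=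
  Finsupp.linearCombination ℂ fun s : QNum =>
    angCoef q A .up (q ^ s.j) (q ^ s.m) •
        emb (s.j + 1) (s.m + weight A) (y .up s.j (Finsupp.single (s.n, s.M) 1))
      + angCoef q A .stay (q ^ s.j) (q ^ s.m) •
        emb s.j (s.m + weight A) (y .stay s.j (Finsupp.single (s.n, s.M) 1))
      + angCoef q A .down (q ^ s.j) (q ^ s.m) •
        emb (s.j - 1) (s.m + weight A) (y .down s.j (Finsupp.single (s.n, s.M) 1))

/-- The operator that does not change the angular momentum, with given reduced matrix elements. -/
def scalOp (t : ℤ → Module.End ℂ Radial) : Module.End ℂ Full :=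
  Finsupp.linearCombination ℂ fun s : QNum =>
    emb s.j s.m (t s.j (Finsupp.single (s.n, s.M) 1))

lemma vecOp_emb (q : ℂ) (y : RedVec) (A : E3) (j m : ℤ) (w : Radial) :
    vecOp q y A (emb j m w) =
      angCoef q A .up (q ^ j) (q ^ m) • emb (j + 1) (m + weight A) (y .up j w)
      + angCoef q A .stay (q ^ j) (q ^ m) • emb j (m + weight A) (y .stay j w)
      + angCoef q A .down (q ^ j) (q ^ m) • emb (j - 1) (m + weight A) (y .down j w) := by
  have : vecOp q y A ∘ₗ emb j m =
      angCoef q A .up (q ^ j) (q ^ m) • (emb (j + 1) (m + weight A) ∘ₗ y .up j)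
      + angCoef q A .stay (q ^ j) (q ^ m) • (emb j (m + weight A) ∘ₗ y .stay j)
      + angCoef q A .down (q ^ j) (q ^ m) • (emb (j - 1) (m + weight A) ∘ₗ y .down j) := by
    refine Finsupp.lhom_ext' fun p => LinearMap.ext_ring ?_
    simp [emb_single, vecOp, Finsupp.linearCombination_single]
  simpa using LinearMap.congr_fun this w

lemma scalOp_emb (t : ℤ → Module.End ℂ Radial) (j m : ℤ) (w : Radial) :
    scalOp t (emb j m w) = emb j m (t j w) := by
  have : scalOp t ∘ₗ emb j m = emb j m ∘ₗ t j := by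
    refine Finsupp.lhom_ext' fun p => LinearMap.ext_ring ?_
    simp [emb_single, scalOp, Finsupp.linearCombination_single]
  simpa using LinearMap.congr_fun this w

lemma sum_E3 {V : Type*} [AddCommMonoid V] (f : E3 → V) :
    ∑ A, f A = f .plus + f .minus + f .three := by
  have : (Finset.univ : Finset E3) = {.plus, .minus, .three} := rfl
  rw [this]
  simp [add_assoc]

/-- The reduced form of `Y ∘ Z`. -/
def dotRed (q : ℂ) (y z : RedVec) (j : ℤ) : Module.End ℂ Radial :=
  (q ^ 2 * zsub ((q ^ j) ^ 2) * zsub (q ^ 2 * (q ^ j) ^ 2) / ((q ^ 2 + 1) * (q - q⁻¹)) ^ 2) •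
      (y .stay j * z .stay j)
    - (q ^ 2 * zsub (q ^ 2 * (q ^ j) ^ 2) * zsub (q ^ 3 * (q ^ j) ^ 2)
        / (q * (1 + q ^ 2) * (q - q⁻¹) ^ 2)) • (y .down (j + 1) * z .up j)
    - (q ^ 2 * zsub ((q ^ j) ^ 2) * zsub ((q ^ j) ^ 2 / q)
        / (q * (1 + q ^ 2) * (q - q⁻¹) ^ 2)) • (y .up (j - 1) * z .down j)

/-- The reduced form of the vector product of vector operators. -/
def crossRed (q : ℂ) (y z : RedVec) : RedVec
  | .up, j => (q ^ 2 / ((q ^ 2 + 1) * (q - q⁻¹))) •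
      (zsub (q ^ 4 * (q ^ j) ^ 2) • (y .stay (j + 1) * z .up j)
        - zsub ((q ^ j) ^ 2) • (y .up j * z .stay j))
  | .stay, j => (q ^ 2 / (q ^ 2 + 1) * zadd (q * (q ^ j) ^ 2)) • (y .stay j * z .stay j)
      + (q / (q - q⁻¹)) • (zsub (q ^ 3 * (q ^ j) ^ 2) • (y .down (j + 1) * z .up j)
        - zsub ((q ^ j) ^ 2 / q) • (y .up (j - 1) * z .down j))
  | .down, j => (q ^ 2 / ((q ^ 2 + 1) * (q - q⁻¹))) •
      (zsub (q ^ 2 * (q ^ j) ^ 2) • (y .down j * z .stay j)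
        - zsub ((q ^ j) ^ 2 / q ^ 2) • (y .stay (j - 1) * z .down j))

/-- The components of the spin-two part of a tensor operator. -/
inductive E5
  | mm | m3 | zero | p3 | pp

/-- The spin-two part of the tensor product of two vectors. -/
def quint {𝒜 : Type*} [Ring 𝒜] [Algebra ℂ 𝒜] (q : ℂ) (y z : E3 → 𝒜) : E5 → 𝒜
  | .mm => y .minus * z .minus
  | .m3 => q ^ 2 • (y .minus * z .three) + y .three * z .minus
  | .zero => y .plus * z .minus + q ^ 4 • (y .minus * z .plus)
      + (q + q ^ 3) • (y .three * z .three)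
  | .p3 => y .plus * z .three + q ^ 2 • (y .three * z .plus)
  | .pp => y .plus * z .plus

/-- The reduced form of the spin-two part, for the change of `j` by `2, 1, 0, -1, -2`. -/
def quintRed (y z : RedVec) : Fin 5 → ℤ → Module.End ℂ Radial
  | 0, j => y .up (j + 1) * z .up j
  | 1, j => y .up j * z .stay j + y .stay (j + 1) * z .up j
  | 2, j => y .stay j * z .stay j + y .down (j + 1) * z .up j + y .up (j - 1) * z .down j
  | 3, j => y .down j * z .stay j + y .stay (j - 1) * z .down j
  | 4, j => y .down (j - 1) * z .down j

end

end QMink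

/-! ### Scalar, vector and spin-two parts of a product of two vector operators. -/

namespace QMink
noncomputable section
lemma zpow_j (q : ℂ) (hq : q ≠ 0) (j : ℤ) : q ^ (j + 1) = q * q ^ j ∧ q ^ (j - 1) = q ^ j / q ∧
    q ^ (j + -1) = q ^ j / q := by
  refine ⟨by rw [zpow_add_one₀ hq]; ring, by rw [zpow_sub_one₀ hq]; rfl, ?_⟩
  rw [← sub_eq_add_neg, zpow_sub_one₀ hq]; rfl

/-- Contraction with the invariant metric is the projection to spin zero: the two-step paths that
end at a different `j` cancel, and for the paths that return to `j` the dependence on `m` drops out.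
The coefficients in `dotRed` are what remains. -/
theorem dot_vecOp (q : ℂ) (h0 : q ≠ 0) (h1 : q ^ 2 - 1 ≠ 0) (h2 : q ^ 2 + 1 ≠ 0) (y z : RedVec) :
    dot q (vecOp q y) (vecOp q z) = scalOp (dotRed q y z) := by
  refine full_hom_ext fun j m w => ?_
  have e1 : ∀ k : ℤ, k + 1 + -1 = k := fun k => by ring
  have e2 : ∀ k : ℤ, k + -1 + 1 = k := fun k => by ring
  have e3 : ∀ k : ℤ, k - 1 + 1 = k := fun k => by ring
  have e4 : ∀ k : ℤ, k + 1 - 1 = k := fun k => by ring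
  simp only [dot, dotRed, sum_E3, g, zero_smul, add_zero, zero_add, LinearMap.add_apply,
    LinearMap.smul_apply, Module.End.mul_apply, vecOp_emb, scalOp_emb, LinearMap.sub_apply, map_add,
    map_sub, map_smul, weight, angCoef, e1, e2, e3, e4, (zpow_j q h0 _).1, (zpow_j q h0 _).2.1,
    (zpow_j q h0 _).2.2]
  have hJ : q ^ j ≠ 0 := zpow_ne_zero _ h0
  have hμ : q ^ m ≠ 0 := zpow_ne_zero _ h0
  -- Once the shifts of `j` and `m` are expressed by factors `q`, the powers `q ^ j` and `q ^ m` may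
  -- be treated as independent nonzero variables. Each path then gives an identity of rational
  -- functions.
  generalize q ^ j = J at *
  generalize q ^ m = μ at *
  have h3 : 1 + q ^ 2 ≠ 0 := by rwa [add_comm]
  have hl : q - q⁻¹ = (q ^ 2 - 1) / q := by field_simp
  simp only [hl, zsub, zadd]
  match_scalars <;> field_simp <;> ring
-- The structure constants `eps` project two vectors to a vector, so the two-step paths that change
-- `j` by two cancel and the others acquire the angular coefficients of a single vector operator.
-- The weights in `crossRed` play the role of `6j` symbols.
theorem cross_vecOp (q : ℂ) (h0 : q ≠ 0) (h1 : q ^ 2 - 1 ≠ 0) (h2 : q ^ 2 + 1 ≠ 0) (y z : RedVec)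
    (A : E3) :
    cross q (vecOp q y) (vecOp q z) A = vecOp q (crossRed q y z) A := by
  refine full_hom_ext fun j m w => ?_
  cases A
  all_goals
    have e1 : ∀ k : ℤ, k + 1 + -1 = k := fun k => by ring
    have e2 : ∀ k : ℤ, k + -1 + 1 = k := fun k => by ring
    have e3 : ∀ k : ℤ, k - 1 + 1 = k := fun k => by ring
    have e4 : ∀ k : ℤ, k + 1 - 1 = k := fun k => by ring
    simp only [cross, crossRed, sum_E3, eps, zero_smul, add_zero, zero_add, LinearMap.add_apply,
      LinearMap.smul_apply, Module.End.mul_apply, vecOp_emb, LinearMap.sub_apply, map_add,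
      map_sub, map_smul, weight, angCoef, e1, e2, e3, e4, (zpow_j q h0 _).1, (zpow_j q h0 _).2.1,
      (zpow_j q h0 _).2.2]
    have hJ : q ^ j ≠ 0 := zpow_ne_zero _ h0
    have hμ : q ^ m ≠ 0 := zpow_ne_zero _ h0
    generalize q ^ j = J at *
    generalize q ^ m = μ at *
    have h3 : 1 + q ^ 2 ≠ 0 := by rwa [add_comm]
    have hl : q - q⁻¹ = (q ^ 2 - 1) / q := by field_simp
    simp only [hl, zsub, zadd]
    match_scalars <;> field_simp <;> ring

/-- The scaling of `q ^ j` under a step. -/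
def Step.scale (q : ℂ) : Step → ℂ → ℂ
  | .up, J => q * J
  | .stay, J => J
  | .down, J => J / q

/-- The contribution to `quint` of the path that makes first the step `D₁`, then `D₂`. -/
def quintCoef (q : ℂ) (k : E5) (D₂ D₁ : Step) (J μ : ℂ) : ℂ :=
  match k with
  | .mm => angCoef q .minus D₂ (D₁.scale q J) (μ / q) * angCoef q .minus D₁ J μ
  | .m3 => q ^ 2 * (angCoef q .minus D₂ (D₁.scale q J) μ * angCoef q .three D₁ J μ)
      + angCoef q .three D₂ (D₁.scale q J) (μ / q) * angCoef q .minus D₁ J μ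
  | .zero => angCoef q .plus D₂ (D₁.scale q J) (μ / q) * angCoef q .minus D₁ J μ
      + q ^ 4 * (angCoef q .minus D₂ (D₁.scale q J) (q * μ) * angCoef q .plus D₁ J μ)
      + (q + q ^ 3) * (angCoef q .three D₂ (D₁.scale q J) μ * angCoef q .three D₁ J μ)
  | .p3 => angCoef q .plus D₂ (D₁.scale q J) μ * angCoef q .three D₁ J μ
      + q ^ 2 * (angCoef q .three D₂ (D₁.scale q J) (q * μ) * angCoef q .plus D₁ J μ)
  | .pp => angCoef q .plus D₂ (D₁.scale q J) (q * μ) * angCoef q .plus D₁ J μ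

/-- The weights of the components of a spin-two tensor. -/
def E5.weight : E5 → ℤ
  | .mm => -2
  | .m3 => -1
  | .zero => 0
  | .p3 => 1
  | .pp => 2

/-- In this normalization of `angCoef` all two-step paths from `j` to the same final value have the
same spin-two coefficient. One representative path can therefore be factored out and the reduced
elements simply add up in `quintRed`. The representatives are chosen so that, apart from the one
that goes up twice, their first step is `stay` or `down`. -/
theorem quint_vecOp (q : ℂ) (h0 : q ≠ 0) (h1 : q ^ 2 - 1 ≠ 0) (h2 : q ^ 2 + 1 ≠ 0) (y z : RedVec)
    (k : E5) (j m : ℤ) (w : Radial) :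
    quint q (vecOp q y) (vecOp q z) k (emb j m w) =
      quintCoef q k .up .up (q ^ j) (q ^ m) • emb (j + 2) (m + k.weight) (quintRed y z 0 j w)
      + quintCoef q k .up .stay (q ^ j) (q ^ m) • emb (j + 1) (m + k.weight) (quintRed y z 1 j w)
      + quintCoef q k .stay .stay (q ^ j) (q ^ m) • emb j (m + k.weight) (quintRed y z 2 j w)
      + quintCoef q k .down .stay (q ^ j) (q ^ m) • emb (j - 1) (m + k.weight) (quintRed y z 3 j w)
      + quintCoef q k .down .down (q ^ j) (q ^ m) • emb (j - 2) (m + k.weight)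
        (quintRed y z 4 j w) := by
  cases k
  all_goals
    have e5 : ∀ k : ℤ, k + 1 + 1 = k + 2 := fun k => by ring
    have e6 : ∀ k : ℤ, k - 1 - 1 = k - 2 := fun k => by ring
    have e7 : ∀ k : ℤ, k + -1 + -1 = k + -2 := fun k => by ring
    have e8 : ∀ k : ℤ, k + 1 + 0 = k + 1 := fun k => by ring
    have e9 : ∀ k : ℤ, k + -1 + 0 = k + -1 := fun k => by ring
    have e1 : ∀ k : ℤ, k + 1 + -1 = k := fun k => by ring
    have e2 : ∀ k : ℤ, k + -1 + 1 = k := fun k => by ring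
    have e3 : ∀ k : ℤ, k - 1 + 1 = k := fun k => by ring
    have e4 : ∀ k : ℤ, k + 1 - 1 = k := fun k => by ring
    simp only [quint, quintRed, quintCoef, Step.scale, E5.weight, add_zero, LinearMap.add_apply,
      LinearMap.smul_apply, Module.End.mul_apply, vecOp_emb, map_add, map_smul, weight, angCoef,
        e1, e2, e3, e4, e5, e6, e7, e8, e9, (zpow_j q h0 _).1, (zpow_j q h0 _).2.1,
      (zpow_j q h0 _).2.2]
    have hJ : q ^ j ≠ 0 := zpow_ne_zero _ h0
    have hμ : q ^ m ≠ 0 := zpow_ne_zero _ h0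
    generalize q ^ j = J at *
    generalize q ^ m = μ at *
    have h3 : 1 + q ^ 2 ≠ 0 := by rwa [add_comm]
    have hl : q - q⁻¹ = (q ^ 2 - 1) / q := by field_simp
    simp only [hl, zsub, zadd]
    match_scalars <;> field_simp <;> ring

end
end QMink

namespace QMink

noncomputable section

/-! ## The radial operators -/

/-- The basis of `Radial`. -/
abbrev radVec (n M : ℤ) : Radial := Finsupp.single (n, M) 1

/-- The operator with the matrix elements `a n` from `n` to `n + 1` and `b n` from `n` to
`n - 1`. -/
def ladder (a b : ℤ → ℂ) : Module.End ℂ Radial :=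
  Finsupp.linearCombination ℂ fun p : ℤ × ℤ =>
    a p.1 • radVec (p.1 + 1) p.2 + b p.1 • radVec (p.1 - 1) p.2

/-- The operator that is diagonal with eigenvalues `a n`. -/
def diagN (a : ℤ → ℂ) : Module.End ℂ Radial :=
  Finsupp.linearCombination ℂ fun p : ℤ × ℤ => a p.1 • radVec p.1 p.2

lemma ladder_radVec (a b : ℤ → ℂ) (n M : ℤ) :
    ladder a b (radVec n M) = a n • radVec (n + 1) M + b n • radVec (n - 1) M := by
  simp only [ladder, Finsupp.linearCombination_single, one_smul]

lemma diagN_radVec (a : ℤ → ℂ) (n M : ℤ) : diagN a (radVec n M) = a n • radVec n M := by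
  simp only [diagN, Finsupp.linearCombination_single, one_smul]

/-- `z + σ / z`. -/
def csig (σ z : ℂ) : ℂ := z + σ / z

/-- `z - σ / z`. -/
def dsig (σ z : ℂ) : ℂ := z - σ / z

/-- `q ^ (n + κ)`. -/
def nuPow (q : ℂ) (κ n : ℤ) : ℂ := q ^ (n + κ)

/-- `1 / ({j} {j + 1})` in terms of `J = q ^ j`. -/
def stayFac (q J : ℂ) : ℂ := 1 / (zadd J * zadd (q * J))

/-- `1 / ({j} ^ 2 (q ^ (2 j - 1) - q ^ (1 - 2 j)) (q ^ (2 j + 1) - q ^ (- 2 j - 1)))` in terms of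
`J = q ^ j`. -/
def downFac (q J : ℂ) : ℂ := 1 / (zadd J ^ 2 * zsub (J ^ 2 / q) * zsub (q * J ^ 2))

/-- The reduced form of `[2] U`. -/
def uRed (q σ : ℂ) (κ : ℤ) (j : ℤ) : Module.End ℂ Radial :=
  ladder (fun n => 1 / csig σ (nuPow q κ n))
    (fun n => csig σ (nuPow q κ n / (q * q ^ j)) * csig σ (nuPow q κ n * q ^ j)
      / csig σ (nuPow q κ n))

/-- The reduced form of `[2] R` for `a = q ^ (2 j)`, `b = q ^ (- 2 j - 2)`, `c = q ^ (- 2)`, and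
of `[2] S` for `a = b = q ^ (- 2)`, `c = - q ^ (- 2)`. -/
def rsRed (q σ : ℂ) (κ : ℤ) (a b : ℂ → ℂ) (c : ℂ) : RedVec
  | .up, j => ladder (fun n => a (q ^ j) / csig σ (nuPow q κ n))
      (fun n => -a (q ^ j) * csig σ (nuPow q κ n / (q * q ^ j))
        * csig σ (nuPow q κ n / (q ^ 2 * q ^ j)) / csig σ (nuPow q κ n))
  | .stay, j => (c * stayFac q (q ^ j)) • uRed q σ κ j
  | .down, j => downFac q (q ^ j) • ladder (fun n => -b (q ^ j) / csig σ (nuPow q κ n))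
      (fun n => b (q ^ j) * csig σ (nuPow q κ n * q ^ j) * csig σ (nuPow q κ n * q ^ j / q)
        / csig σ (nuPow q κ n))

/-- The reduced form of `[2] R`. -/
def rRed (q σ : ℂ) (κ : ℤ) : RedVec :=
  rsRed q σ κ (fun J => J ^ 2) (fun J => 1 / (q ^ 2 * J ^ 2)) (1 / q ^ 2)

/-- The reduced form of `[2] S`. -/
def sRed (q σ : ℂ) (κ : ℤ) : RedVec :=
  rsRed q σ κ (fun _ => 1 / q ^ 2) (fun _ => 1 / q ^ 2) (-(1 / q ^ 2))

/-- The reduced form of the space components of the rescaled coordinates. -/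
def xRed (q σ : ℂ) (κ : ℤ) : RedVec
  | .up, j => diagN fun n => (q ^ 2 - (q ^ 2)⁻¹) * q * q ^ j * csig σ (nuPow q κ n / (q * q ^ j))
  | .stay, j => diagN fun n =>
      -(q ^ 2 - (q ^ 2)⁻¹) * stayFac q (q ^ j) * dsig σ (nuPow q κ n)
  | .down, j => diagN fun n =>
      -(q ^ 2 - (q ^ 2)⁻¹) / q ^ j * downFac q (q ^ j) * csig σ (nuPow q κ n * q ^ j)

/-- The reduced form of the rescaled time coordinate. -/
def x0Red (q σ : ℂ) (κ : ℤ) (_ : ℤ) : Module.End ℂ Radial := diagN fun n => dsig σ (nuPow q κ n)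

lemma nuPow_add_one (q : ℂ) (hq : q ≠ 0) (κ n : ℤ) : nuPow q κ (n + 1) = q * nuPow q κ n := by
  rw [nuPow, nuPow, add_right_comm, zpow_add_one₀ hq, mul_comm]

lemma nuPow_sub_one (q : ℂ) (hq : q ≠ 0) (κ n : ℤ) : nuPow q κ (n - 1) = nuPow q κ n / q := by
  rw [nuPow, nuPow, sub_add_eq_add_sub, zpow_sub_one₀ hq]; rfl

/-- The reduced form of a scalar operator after a vector operator. -/
def scalVec (t : ℤ → Module.End ℂ Radial) (y : RedVec) : RedVec
  | .up, j => t (j + 1) * y .up j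
  | .stay, j => t j * y .stay j
  | .down, j => t (j - 1) * y .down j

/-- The reduced form of a vector operator after a scalar operator. -/
def vecScal (y : RedVec) (t : ℤ → Module.End ℂ Radial) : RedVec := fun Δ j => y Δ j * t j

lemma scalOp_mul_vecOp (q : ℂ) (t : ℤ → Module.End ℂ Radial) (y : RedVec) (A : E3) :
    scalOp t * vecOp q y A = vecOp q (scalVec t y) A := by
  refine full_hom_ext fun j m w => ?_
  simp only [Module.End.mul_apply, vecOp_emb, map_add, map_smul, scalOp_emb, scalVec]

lemma vecOp_mul_scalOp (q : ℂ) (t : ℤ → Module.End ℂ Radial) (y : RedVec) (A : E3) :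
    vecOp q y A * scalOp t = vecOp q (vecScal y t) A := by
  refine full_hom_ext fun j m w => ?_
  simp only [Module.End.mul_apply, vecOp_emb, scalOp_emb, vecScal]

lemma scalOp_mul (s t : ℤ → Module.End ℂ Radial) : scalOp s * scalOp t = scalOp (s * t) := by
  refine full_hom_ext fun j m w => ?_
  simp only [Module.End.mul_apply, scalOp_emb, Pi.mul_apply]

/-- The denominators that occur in the reduced matrix elements do not vanish. -/
structure Regular (q σ J N : ℂ) : Prop where
  q0 : q ≠ 0
  q1 : q ^ 2 - 1 ≠ 0
  q2 : q ^ 2 + 1 ≠ 0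
  q3 : 1 + q ^ 2 ≠ 0
  j0 : J ≠ 0
  n0 : N ≠ 0
  n1 : N ^ 2 + σ ≠ 0
  n2 : q ^ 2 * N ^ 2 + σ ≠ 0
  a0 : J ^ 2 + 1 ≠ 0
  a1 : q ^ 2 * J ^ 2 + 1 ≠ 0
  a2 : J ^ 2 + q ^ 2 ≠ 0
  a3 : q ^ 4 * J ^ 2 + 1 ≠ 0
  b0 : J ^ 4 - q ^ 2 ≠ 0
  b1 : q ^ 2 * J ^ 4 - 1 ≠ 0
  b2 : q ^ 6 * J ^ 4 - 1 ≠ 0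
  b3 : J ^ 4 - q ^ 6 ≠ 0
  -- The last five conditions repeat `a1`, `a3`, `b1`, `b2` and `n2` with the factors in the other
  -- order.
  c1 : J ^ 2 * q ^ 2 + 1 ≠ 0
  c2 : J ^ 2 * q ^ 4 + 1 ≠ 0
  c3 : J ^ 4 * q ^ 2 - 1 ≠ 0
  c4 : J ^ 4 * q ^ 6 - 1 ≠ 0
  c5 : N ^ 2 * q ^ 2 + σ ≠ 0

namespace Regular

variable {q σ J N : ℂ} (h : Regular q σ J N)
include h

/-- Each factor of the reduced elements is written as one fraction whose denominator is a product of
quantities listed in `Regular`, apart from harmless powers of `q`, `J`, `N`. Clearing denominators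
then leaves polynomial identities. -/
lemma csig_self : csig σ N = (N ^ 2 + σ) / N := by
  have := h.n0
  simp only [csig]; field_simp

lemma csig_mul : csig σ (q * N) = (q ^ 2 * N ^ 2 + σ) / (q * N) := by
  have := h.n0; have := h.q0
  simp only [csig]; field_simp

lemma csig_div : csig σ (N / q) = (N ^ 2 + q ^ 2 * σ) / (q * N) := by
  have := h.n0; have := h.q0
  simp only [csig]; field_simp

lemma stayFac_self : stayFac q J = q * J ^ 2 / ((J ^ 2 + 1) * (q ^ 2 * J ^ 2 + 1)) := by
  obtain ⟨q0, q1, q2, q3, j0, n0, n1, n2, a0, a1, a2, a3, b0, b1, b2, b3, c1, c2, c3, c4, c5⟩ := h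
  simp only [stayFac, zadd]; field_simp

lemma stayFac_mul :
    stayFac q (q * J) = q ^ 3 * J ^ 2 / ((q ^ 2 * J ^ 2 + 1) * (q ^ 4 * J ^ 2 + 1)) := by
  obtain ⟨q0, q1, q2, q3, j0, n0, n1, n2, a0, a1, a2, a3, b0, b1, b2, b3, c1, c2, c3, c4, c5⟩ := h
  have e : q * (q * J) + (q * (q * J))⁻¹ = (q ^ 4 * J ^ 2 + 1) / (q ^ 2 * J) := by field_simp
  simp only [stayFac, zadd, e]; field_simp

lemma stayFac_div : stayFac q (J / q) = q * J ^ 2 / ((J ^ 2 + q ^ 2) * (J ^ 2 + 1)) := by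
  obtain ⟨q0, q1, q2, q3, j0, n0, n1, n2, a0, a1, a2, a3, b0, b1, b2, b3, c1, c2, c3, c4, c5⟩ := h
  have e : J / q + (J / q)⁻¹ = (J ^ 2 + q ^ 2) / (q * J) := by field_simp
  have e' : q * (J / q) + (q * (J / q))⁻¹ = (J ^ 2 + 1) / J := by field_simp
  simp only [stayFac, zadd, e, e']; field_simp

lemma downFac_self :
    downFac q J = q ^ 2 * J ^ 6 / ((J ^ 2 + 1) ^ 2 * (J ^ 4 - q ^ 2) * (q ^ 2 * J ^ 4 - 1)) := by
  obtain ⟨q0, q1, q2, q3, j0, n0, n1, n2, a0, a1, a2, a3, b0, b1, b2, b3, c1, c2, c3, c4, c5⟩ := h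
  have e : J + J⁻¹ = (J ^ 2 + 1) / J := by field_simp
  have e' : J ^ 2 / q - (J ^ 2 / q)⁻¹ = (J ^ 4 - q ^ 2) / (q * J ^ 2) := by field_simp
  have e'' : q * J ^ 2 - (q * J ^ 2)⁻¹ = (q ^ 2 * J ^ 4 - 1) / (q * J ^ 2) := by field_simp
  simp only [downFac, zadd, zsub, e, e', e'']; field_simp

lemma downFac_mul :
    downFac q (q * J) =
      q ^ 6 * J ^ 6 / ((q ^ 2 * J ^ 2 + 1) ^ 2 * (q ^ 2 * J ^ 4 - 1) * (q ^ 6 * J ^ 4 - 1)) := by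
  obtain ⟨q0, q1, q2, q3, j0, n0, n1, n2, a0, a1, a2, a3, b0, b1, b2, b3, c1, c2, c3, c4, c5⟩ := h
  have e : q * J + (q * J)⁻¹ = (q ^ 2 * J ^ 2 + 1) / (q * J) := by field_simp
  have e' : (q * J) ^ 2 / q - ((q * J) ^ 2 / q)⁻¹ = (q ^ 2 * J ^ 4 - 1) / (q * J ^ 2) := by
    field_simp
  have e'' : q * (q * J) ^ 2 - (q * (q * J) ^ 2)⁻¹ = (q ^ 6 * J ^ 4 - 1) / (q ^ 3 * J ^ 2) := by
    field_simp
  simp only [downFac, zadd, zsub, e, e', e'']; field_simp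

lemma downFac_div :
    downFac q (J / q) =
      q ^ 6 * J ^ 6 / ((J ^ 2 + q ^ 2) ^ 2 * (J ^ 4 - q ^ 6) * (J ^ 4 - q ^ 2)) := by
  obtain ⟨q0, q1, q2, q3, j0, n0, n1, n2, a0, a1, a2, a3, b0, b1, b2, b3, c1, c2, c3, c4, c5⟩ := h
  have e : J / q + (J / q)⁻¹ = (J ^ 2 + q ^ 2) / (q * J) := by field_simp
  have e' : (J / q) ^ 2 / q - ((J / q) ^ 2 / q)⁻¹ = (J ^ 4 - q ^ 6) / (q ^ 3 * J ^ 2) := by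
    field_simp
  have e'' : q * (J / q) ^ 2 - (q * (J / q) ^ 2)⁻¹ = (J ^ 4 - q ^ 2) / (q * J ^ 2) := by
    field_simp
  simp only [downFac, zadd, zsub, e, e', e'']; field_simp

end Regular

end
end QMink

namespace QMink

noncomputable section

set_option maxRecDepth 4000
set_option linter.unusedSimpArgs false
set_option linter.unusedVariables false
set_option linter.unusedTactic false
set_option linter.unreachableTactic false
set_option linter.unnecessarySeqFocus false

/-! ## Identities for the reduced matrix elements -/

/-- The reduced form of a rescaled rotation generator. -/
def rotRed (q : ℂ) : RedVec
  | .up, _ => 0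
  | .stay, _ => (-((q + q⁻¹) / q ^ 2)) • 1
  | .down, _ => 0

section Reduced

variable {q σ : ℂ} {κ j n : ℤ}

set_option maxHeartbeats 4000000 in
/-- The vector parts of the relations that are linear in `R`, `S`, `U`. -/
theorem coordinate_vector_identities {M : ℤ} (h : Regular q σ (q ^ j) (nuPow q κ n)) (Δ : Step) :
    (vecScal (rRed q σ κ) (x0Red q σ κ) Δ j) (radVec n M) = ((q⁻¹ * ((q ^ 4 + 1) / (q ^ 2 + 1))) •
      scalVec (x0Red q σ κ) (rRed q σ κ) Δ j + (q⁻¹ * ((q ^ 2 - 1) / (q ^ 2 + 1))) • crossRed q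
      (xRed q σ κ) (rRed q σ κ) Δ j - (q / (1 + q ^ 2) ^ 2) • vecScal (xRed q σ κ) (uRed q σ κ) Δ
      j) (radVec n M) ∧
    (vecScal (sRed q σ κ) (x0Red q σ κ) Δ j) (radVec n M) = ((q⁻¹ * ((q ^ 4 + 1) / (q ^ 2 + 1))) •
      scalVec (x0Red q σ κ) (sRed q σ κ) Δ j + (q⁻¹ * ((q ^ 2 - 1) / (q ^ 2 + 1))) • crossRed q
      (xRed q σ κ) (sRed q σ κ) Δ j - (1 / (q * (1 + q ^ 2) ^ 2)) • vecScal (xRed q σ κ) (uRed q σ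
      κ) Δ j) (radVec n M) ∧
    (crossRed q (rRed q σ κ) (xRed q σ κ) Δ j) (radVec n M) = ((q - 2 / q * (1 + q ^ 4) / (1 + q ^
      2)) • crossRed q (xRed q σ κ) (rRed q σ κ) Δ j - (q⁻¹ * (q ^ 2 - 1) * (1 + q ^ 4) / (1 + q ^
      2)) • scalVec (x0Red q σ κ) (rRed q σ κ) Δ j + (q⁻¹ * (1 + q ^ 4) / (1 + q ^ 2) ^ 2) •
      vecScal (xRed q σ κ) (uRed q σ κ) Δ j) (radVec n M) ∧
    (crossRed q (sRed q σ κ) (xRed q σ κ) Δ j) (radVec n M) = ((q⁻¹ - 2 / q * (1 + q ^ 4) / (1 + q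
      ^ 2)) • crossRed q (xRed q σ κ) (sRed q σ κ) Δ j - (q⁻¹ * (q ^ 2 - 1) * (1 + q ^ 4) / (1 + q
      ^ 2)) • scalVec (x0Red q σ κ) (sRed q σ κ) Δ j - (q⁻¹ * (1 + q ^ 4) / (1 + q ^ 2) ^ 2) •
      vecScal (xRed q σ κ) (uRed q σ κ) Δ j) (radVec n M) ∧
    (scalVec (uRed q σ κ) (xRed q σ κ) Δ j) (radVec n M) = ((q⁻¹ * ((q ^ 4 + 1) / (q ^ 2 + 1))) •
      vecScal (xRed q σ κ) (uRed q σ κ) Δ j - (q * (q ^ 2 - 1) ^ 2) • scalVec (x0Red q σ κ) (rRed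
      q σ κ) Δ j - (q⁻¹ * (q ^ 2 - 1) ^ 2) • crossRed q (xRed q σ κ) (rRed q σ κ) Δ j) (radVec n
      M) ∧
    (crossRed q (xRed q σ κ) (xRed q σ κ) Δ j) (radVec n M) = ((1 - q ^ 2) • scalVec (x0Red q σ κ)
      (xRed q σ κ) Δ j) (radVec n M) ∧
    (scalVec (x0Red q σ κ) (xRed q σ κ) Δ j) (radVec n M) = (vecScal (xRed q σ κ) (x0Red q σ κ) Δ
      j) (radVec n M) ∧
    (scalVec (x0Red q σ κ) (scalVec (uRed q σ κ) (xRed q σ κ)) Δ j) (radVec n M) = ((1 / (q +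
      q⁻¹)) • (scalVec (uRed q σ κ) (scalVec (x0Red q σ κ) (xRed q σ κ)) Δ j + vecScal (scalVec
      (x0Red q σ κ) (xRed q σ κ)) (uRed q σ κ) Δ j) + (σ * (q - q⁻¹) ^ 2 * q) • (q ^ 2 • rRed q σ
      κ Δ j + sRed q σ κ Δ j)) (radVec n M) ∧
    (vecScal (xRed q σ κ) ((uRed q σ κ) * (x0Red q σ κ)) Δ j) (radVec n M) = ((1 / (q + q⁻¹)) •
      (scalVec (uRed q σ κ) (scalVec (x0Red q σ κ) (xRed q σ κ)) Δ j + vecScal (scalVec (x0Red q σ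
      κ) (xRed q σ κ)) (uRed q σ κ) Δ j) - (σ * (q - q⁻¹) ^ 2 * q) • (rRed q σ κ Δ j + q ^ 2 •
      sRed q σ κ Δ j)) (radVec n M) ∧
    (crossRed q (xRed q σ κ) (scalVec (uRed q σ κ) (xRed q σ κ)) Δ j) (radVec n M) = (((1 - q ^ 2)
      / (q + q⁻¹)) • (scalVec (uRed q σ κ) (scalVec (x0Red q σ κ) (xRed q σ κ)) Δ j + vecScal
      (scalVec (x0Red q σ κ) (xRed q σ κ)) (uRed q σ κ) Δ j) - (σ * (q - q⁻¹) ^ 2 * q * (1 + q ^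
      4)) • (rRed q σ κ Δ j - sRed q σ κ Δ j)) (radVec n M) := by
  have e3 : ∀ k : ℤ, k - 1 + 1 = k := fun k => by ring
  have e4 : ∀ k : ℤ, k + 1 - 1 = k := fun k => by ring
  have q0 := h.q0
  have hl : q - q⁻¹ = (q ^ 2 - 1) / q := by field_simp
  refine ⟨?_, ?_, ?_, ?_, ?_, ?_, ?_, ?_, ?_, ?_⟩
  all_goals cases Δ
  all_goals
    simp only [crossRed, dotRed, quintRed, scalVec, vecScal, rRed, sRed, rsRed, xRed, uRed, x0Red,
      rotRed, ladder_radVec, diagN_radVec, map_add, map_sub, map_smul, LinearMap.add_apply,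
      LinearMap.sub_apply, LinearMap.smul_apply, LinearMap.neg_apply, LinearMap.zero_apply,
      Module.End.mul_apply, Pi.mul_apply, Module.End.one_apply, nuPow_add_one q q0,
      nuPow_sub_one q q0, e3, e4, (zpow_j q q0 _).1, (zpow_j q q0 _).2.1, hl]
    -- From here on `q`, `σ`, `J`, `N` are independent variables, restricted only by the
    -- nonvanishing of denominators; in particular `σ` is free, so that both types of family are
    -- covered. At most one ladder step is made in each product, so the only denominator depending
    -- on `n` is that of the initial state.
    generalize q ^ j = J at *
    generalize nuPow q κ n = N at *
    try simp only [h.csig_self, h.csig_mul, h.csig_div, h.stayFac_self, h.stayFac_mul,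
      h.stayFac_div, h.downFac_self, h.downFac_mul, h.downFac_div, zsub, zadd]
    clear q0
    obtain ⟨q0, q1, q2, q3, j0, n0, n1, n2, a0, a1, a2, a3, b0, b1, b2, b3, c1, c2, c3, c4,
      c5⟩ := h
    match_scalars <;> try simp only [csig, dsig]
    all_goals field_simp
    all_goals ring

set_option maxHeartbeats 4000000 in
/-- The spin-two parts of the relations that are linear in `R`, `S`, `U`. -/
theorem coordinate_quint_identities {M : ℤ} (h : Regular q σ (q ^ j) (nuPow q κ n)) (i : Fin 5) :
    (quintRed (rRed q σ κ) (xRed q σ κ) i j) (radVec n M) = (q • quintRed (xRed q σ κ) (rRed q σ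
      κ) i j) (radVec n M) ∧
    (quintRed (sRed q σ κ) (xRed q σ κ) i j) (radVec n M) = (q⁻¹ • quintRed (xRed q σ κ) (sRed q σ
      κ) i j) (radVec n M) ∧
    (quintRed (xRed q σ κ) (scalVec (uRed q σ κ) (xRed q σ κ)) i j) (radVec n M) = ((1 / (q +
      q⁻¹)) • (quintRed (scalVec (uRed q σ κ) (xRed q σ κ)) (xRed q σ κ) i j + quintRed (xRed q σ
      κ) (vecScal (xRed q σ κ) (uRed q σ κ)) i j)) (radVec n M) := by
  have e3 : ∀ k : ℤ, k - 1 + 1 = k := fun k => by ring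
  have e4 : ∀ k : ℤ, k + 1 - 1 = k := fun k => by ring
  have q0 := h.q0
  have hl : q - q⁻¹ = (q ^ 2 - 1) / q := by field_simp
  refine ⟨?_, ?_, ?_⟩
  all_goals fin_cases i
  all_goals
    simp only [crossRed, dotRed, quintRed, scalVec, vecScal, rRed, sRed, rsRed, xRed, uRed, x0Red,
      rotRed, ladder_radVec, diagN_radVec, map_add, map_sub, map_smul, LinearMap.add_apply,
      LinearMap.sub_apply, LinearMap.smul_apply, LinearMap.neg_apply, LinearMap.zero_apply,
      Module.End.mul_apply, Pi.mul_apply, Module.End.one_apply, nuPow_add_one q q0,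
      nuPow_sub_one q q0, e3, e4, (zpow_j q q0 _).1, (zpow_j q q0 _).2.1, hl]
    generalize q ^ j = J at *
    generalize nuPow q κ n = N at *
    try simp only [h.csig_self, h.csig_mul, h.csig_div, h.stayFac_self, h.stayFac_mul,
      h.stayFac_div, h.downFac_self, h.downFac_mul, h.downFac_div, zsub, zadd]
    clear q0
    obtain ⟨q0, q1, q2, q3, j0, n0, n1, n2, a0, a1, a2, a3, b0, b1, b2, b3, c1, c2, c3, c4,
      c5⟩ := h
    match_scalars <;> try simp only [csig, dsig]
    all_goals field_simp
    all_goals ring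

set_option maxHeartbeats 4000000 in
/-- The scalar parts of the relations that are linear in `R`, `S`, `U`. -/
theorem coordinate_scalar_identities {M : ℤ} (h : Regular q σ (q ^ j) (nuPow q κ n)) :
    (dotRed q (rRed q σ κ) (xRed q σ κ) j) (radVec n M) = ((q - q⁻¹ * (q ^ 2 - 1) * (q ^ 2 + 1 +
      (q ^ 2)⁻¹) / (1 + q ^ 2)) • dotRed q (xRed q σ κ) (rRed q σ κ) j - (q⁻¹ * (q ^ 2 + 1 + (q ^
      2)⁻¹) / (1 + q ^ 2) ^ 2) • ((x0Red q σ κ) * (uRed q σ κ)) j) (radVec n M) ∧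
    (dotRed q (sRed q σ κ) (xRed q σ κ) j) (radVec n M) = ((q⁻¹ + q * (q ^ 2 - 1) * (q ^ 2 + 1 +
      (q ^ 2)⁻¹) / (1 + q ^ 2)) • dotRed q (xRed q σ κ) (sRed q σ κ) j - (q * (q ^ 2 + 1 + (q ^
      2)⁻¹) / (1 + q ^ 2) ^ 2) • ((x0Red q σ κ) * (uRed q σ κ)) j) (radVec n M) ∧
    (((uRed q σ κ) * (x0Red q σ κ)) j) (radVec n M) = ((q⁻¹ * ((q ^ 4 + 1) / (q ^ 2 + 1))) •
      ((x0Red q σ κ) * (uRed q σ κ)) j - (q⁻¹ * (q ^ 2 - 1) ^ 2) • dotRed q (xRed q σ κ) (rRed q σ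
      κ) j) (radVec n M) ∧
    (dotRed q (xRed q σ κ) (xRed q σ κ) j) (radVec n M) = (((x0Red q σ κ) * (x0Red q σ κ)) j + (σ
      * (q + q⁻¹) ^ 2) • 1) (radVec n M) ∧
    (((x0Red q σ κ) * (uRed q σ κ) * (x0Red q σ κ)) j) (radVec n M) = ((1 / (q + q⁻¹)) • (((uRed q
      σ κ) * (x0Red q σ κ) * (x0Red q σ κ)) j + ((x0Red q σ κ) * (x0Red q σ κ) * (uRed q σ κ)) j)
      - (σ * (q - q⁻¹) ^ 2 / (q + q⁻¹)) • (uRed q σ κ) j) (radVec n M) ∧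
    (dotRed q (xRed q σ κ) (scalVec (uRed q σ κ) (xRed q σ κ)) j) (radVec n M) = ((1 / (q + q⁻¹))
      • (((uRed q σ κ) * (x0Red q σ κ) * (x0Red q σ κ)) j + ((x0Red q σ κ) * (x0Red q σ κ) * (uRed
      q σ κ)) j) + (σ * (2 * (q + q⁻¹) + (q - q⁻¹) ^ 2 * (q ^ 2 + 1 + (q ^ 2)⁻¹) / (q + q⁻¹))) •
      (uRed q σ κ) j) (radVec n M) := by
  have e3 : ∀ k : ℤ, k - 1 + 1 = k := fun k => by ring
  have e4 : ∀ k : ℤ, k + 1 - 1 = k := fun k => by ring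
  have q0 := h.q0
  have hl : q - q⁻¹ = (q ^ 2 - 1) / q := by field_simp
  refine ⟨?_, ?_, ?_, ?_, ?_, ?_⟩
  all_goals
    simp only [crossRed, dotRed, quintRed, scalVec, vecScal, rRed, sRed, rsRed, xRed, uRed, x0Red,
      rotRed, ladder_radVec, diagN_radVec, map_add, map_sub, map_smul, LinearMap.add_apply,
      LinearMap.sub_apply, LinearMap.smul_apply, LinearMap.neg_apply, LinearMap.zero_apply,
      Module.End.mul_apply, Pi.mul_apply, Module.End.one_apply, nuPow_add_one q q0,
      nuPow_sub_one q q0, e3, e4, (zpow_j q q0 _).1, (zpow_j q q0 _).2.1, hl]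
    generalize q ^ j = J at *
    generalize nuPow q κ n = N at *
    try simp only [h.csig_self, h.csig_mul, h.csig_div, h.stayFac_self, h.stayFac_mul,
      h.stayFac_div, h.downFac_self, h.downFac_mul, h.downFac_div, zsub, zadd]
    clear q0
    obtain ⟨q0, q1, q2, q3, j0, n0, n1, n2, a0, a1, a2, a3, b0, b1, b2, b3, c1, c2, c3, c4,
      c5⟩ := h
    match_scalars <;> try simp only [csig, dsig]
    all_goals field_simp
    all_goals ring

end Reduced

end

end QMink

/-! ### Identities that are quadratic in the Lorentz generators. -/

namespace QMink

noncomputable section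

set_option maxRecDepth 4000
set_option linter.unusedSimpArgs false
set_option linter.unusedVariables false
set_option linter.unusedTactic false
set_option linter.unreachableTactic false
set_option linter.unnecessarySeqFocus false

section Reduced

variable {q σ : ℂ} {κ j n : ℤ}

set_option maxHeartbeats 4000000 in
/-- The vector parts of the relations that are quadratic in `R`, `S`, `U`. -/
theorem lorentz_vector_identities {M : ℤ} (h : Regular q σ (q ^ j) (nuPow q κ n)) (Δ : Step)
    (hx : nuPow q κ n ^ 2 + q ^ 2 * σ ≠ 0 ∨
      Δ = .up ∧ q ^ j = 1 ∧ nuPow q κ n = q ∧ σ = -1) :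
    (scalVec (uRed q σ κ) (scalVec (uRed q σ κ) (xRed q σ κ)) Δ j + vecScal (vecScal (xRed q σ κ)
      (uRed q σ κ)) (uRed q σ κ) Δ j) (radVec n M) = ((q + q⁻¹) • vecScal (scalVec (uRed q σ κ)
      (xRed q σ κ)) (uRed q σ κ) Δ j - (q - q⁻¹) ^ 2 • xRed q σ κ Δ j) (radVec n M) ∧
    (scalVec (uRed q σ κ) (rRed q σ κ) Δ j) (radVec n M) = (vecScal (rRed q σ κ) (uRed q σ κ) Δ j)
      (radVec n M) ∧
    (scalVec (uRed q σ κ) (sRed q σ κ) Δ j) (radVec n M) = (vecScal (sRed q σ κ) (uRed q σ κ) Δ j)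
      (radVec n M) ∧
    (crossRed q (rRed q σ κ) (rRed q σ κ) Δ j) (radVec n M) = ((1 / (1 + q ^ 2)) • scalVec (uRed q
      σ κ) (rRed q σ κ) Δ j) (radVec n M) ∧
    (crossRed q (sRed q σ κ) (sRed q σ κ) Δ j) (radVec n M) = (-((1 / (1 + q ^ 2)) • scalVec (uRed
      q σ κ) (sRed q σ κ) Δ j)) (radVec n M) ∧
    (crossRed q (rRed q σ κ) (sRed q σ κ) Δ j) (radVec n M) = (-((q ^ 2)⁻¹ • crossRed q (sRed q σ
      κ) (rRed q σ κ) Δ j)) (radVec n M) ∧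
    (scalVec (uRed q σ κ) (sRed q σ κ) Δ j - scalVec (uRed q σ κ) (rRed q σ κ) Δ j + (q ^ 4 - 1) •
      crossRed q (rRed q σ κ) (sRed q σ κ) Δ j) (radVec n M) = (rotRed q Δ j) (radVec n M) := by
  have e3 : ∀ k : ℤ, k - 1 + 1 = k := fun k => by ring
  have e4 : ∀ k : ℤ, k + 1 - 1 = k := fun k => by ring
  have q0 := h.q0
  have hl : q - q⁻¹ = (q ^ 2 - 1) / q := by field_simp
  refine ⟨?_, ?_, ?_, ?_, ?_, ?_, ?_⟩
  all_goals cases Δ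
  all_goals
    simp only [crossRed, dotRed, quintRed, scalVec, vecScal, rRed, sRed, rsRed, xRed, uRed, x0Red,
      rotRed, ladder_radVec, diagN_radVec, map_add, map_sub, map_smul, LinearMap.add_apply,
      LinearMap.sub_apply, LinearMap.smul_apply, LinearMap.neg_apply, LinearMap.zero_apply,
      Module.End.mul_apply, Pi.mul_apply, Module.End.one_apply, nuPow_add_one q q0,
      nuPow_sub_one q q0, e3, e4, (zpow_j q q0 _).1, (zpow_j q q0 _).2.1, hl]
    generalize q ^ j = J at *
    generalize nuPow q κ n = N at *
    try simp only [h.csig_self, h.csig_mul, h.csig_div, h.stayFac_self, h.stayFac_mul,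
      h.stayFac_div, h.downFac_self, h.downFac_mul, h.downFac_div, zsub, zadd]
    clear q0
    obtain ⟨q0, q1, q2, q3, j0, n0, n1, n2, a0, a1, a2, a3, b0, b1, b2, b3, c1, c2, c3, c4,
      c5⟩ := h
    -- A second ladder step after one from `n` to `n - 1` divides by `csig σ (N / q)`, whose
    -- numerator is `N ^ 2 + q ^ 2 * σ`. In the exceptional state this is zero. There the first step
    -- already has the factor `csig (-1) 1 = 0`, so the path contributes nothing whatever value the
    -- quotient is given.
    rcases hx with n3 | ⟨hs, rfl, hN, rfl⟩
    · have n3' : N ^ 2 + σ * q ^ 2 ≠ 0 := by rwa [mul_comm σ]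
      match_scalars <;> try simp only [csig, dsig]
      all_goals field_simp
      all_goals ring
    -- At `J = 1` only the step `up` has to be treated, because the angular coefficients of the
    -- other steps vanish for `j = 0`. For those steps the exceptional alternative is contradictory.
    · first
      | exact absurd hs (by decide)
      | cases hs; done
      | skip
        subst N
        have z1 : csig (-1) (q / (q * 1)) = 0 := by simp [csig, q0]
        have z2 : q ^ 2 + q ^ 2 * -1 = 0 := by ring
        simp only [z1, z2, zero_div, div_zero, mul_zero, zero_mul, zero_smul, smul_zero, add_zero,
          zero_add, sub_zero, one_pow, mul_one, one_mul] at *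
        -- For `N = q` and `σ = -1` the denominator of the state `n + 1` is `q ^ 4 - 1`.
        have n4 : q ^ 4 - 1 ≠ 0 := fun e => n2 (by linear_combination e)
        have n5 : q ^ 2 * q ^ 2 + -1 = q ^ 4 - 1 := by ring
        try simp only [n5]
        match_scalars <;> try simp only [csig, dsig]
        all_goals field_simp
        all_goals ring

set_option maxHeartbeats 4000000 in
/-- The spin-two part of the relations that are quadratic in `R`, `S`, `U`. -/
theorem lorentz_quint_identities {M : ℤ} (h : Regular q σ (q ^ j) (nuPow q κ n)) (i : Fin 5)
    (hx : nuPow q κ n ^ 2 + q ^ 2 * σ ≠ 0 ∨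
      i = 0 ∧ q ^ j = 1 ∧ nuPow q κ n = q ∧ σ = -1) :
    (quintRed (rRed q σ κ) (sRed q σ κ) i j) (radVec n M) = (q ^ 2 • quintRed (sRed q σ κ) (rRed q
      σ κ) i j) (radVec n M) := by
  have e3 : ∀ k : ℤ, k - 1 + 1 = k := fun k => by ring
  have e4 : ∀ k : ℤ, k + 1 - 1 = k := fun k => by ring
  have q0 := h.q0
  have hl : q - q⁻¹ = (q ^ 2 - 1) / q := by field_simp
  all_goals fin_cases i
  all_goals
    simp only [crossRed, dotRed, quintRed, scalVec, vecScal, rRed, sRed, rsRed, xRed, uRed, x0Red,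
      rotRed, ladder_radVec, diagN_radVec, map_add, map_sub, map_smul, LinearMap.add_apply,
      LinearMap.sub_apply, LinearMap.smul_apply, LinearMap.neg_apply, LinearMap.zero_apply,
      Module.End.mul_apply, Pi.mul_apply, Module.End.one_apply, nuPow_add_one q q0,
      nuPow_sub_one q q0, e3, e4, (zpow_j q q0 _).1, (zpow_j q q0 _).2.1, hl]
    generalize q ^ j = J at *
    generalize nuPow q κ n = N at *
    try simp only [h.csig_self, h.csig_mul, h.csig_div, h.stayFac_self, h.stayFac_mul,
      h.stayFac_div, h.downFac_self, h.downFac_mul, h.downFac_div, zsub, zadd]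
    clear q0
    obtain ⟨q0, q1, q2, q3, j0, n0, n1, n2, a0, a1, a2, a3, b0, b1, b2, b3, c1, c2, c3, c4,
      c5⟩ := h
    rcases hx with n3 | ⟨hs, rfl, hN, rfl⟩
    · have n3' : N ^ 2 + σ * q ^ 2 ≠ 0 := by rwa [mul_comm σ]
      match_scalars <;> try simp only [csig, dsig]
      all_goals field_simp
      all_goals ring
    · first
      | exact absurd hs (by decide)
      | cases hs; done
      | skip
        subst N
        have z1 : csig (-1) (q / (q * 1)) = 0 := by simp [csig, q0]
        have z2 : q ^ 2 + q ^ 2 * -1 = 0 := by ring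
        simp only [z1, z2, zero_div, div_zero, mul_zero, zero_mul, zero_smul, smul_zero, add_zero,
          zero_add, sub_zero, one_pow, mul_one, one_mul] at *
        have n4 : q ^ 4 - 1 ≠ 0 := fun e => n2 (by linear_combination e)
        have n5 : q ^ 2 * q ^ 2 + -1 = q ^ 4 - 1 := by ring
        try simp only [n5]
        match_scalars <;> try simp only [csig, dsig]
        all_goals field_simp
        all_goals ring

set_option maxHeartbeats 4000000 in
/-- The scalar parts of the relations that are quadratic in `R`, `S`, `U`. -/
theorem lorentz_scalar_identities {M : ℤ} (h : Regular q σ (q ^ j) (nuPow q κ n))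
    (hx : nuPow q κ n ^ 2 + q ^ 2 * σ ≠ 0 ∨
      q ^ j = 1 ∧ nuPow q κ n = q ∧ σ = -1) :
    (((uRed q σ κ) * (uRed q σ κ) * (x0Red q σ κ)) j + ((x0Red q σ κ) * (uRed q σ κ) * (uRed q σ
      κ)) j) (radVec n M) = ((q + q⁻¹) • ((uRed q σ κ) * (x0Red q σ κ) * (uRed q σ κ)) j - (q -
      q⁻¹) ^ 2 • x0Red q σ κ j) (radVec n M) ∧
    (dotRed q (rRed q σ κ) (sRed q σ κ) j) (radVec n M) = ((q ^ 4)⁻¹ • dotRed q (sRed q σ κ) (rRed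
      q σ κ) j) (radVec n M) ∧
    (((uRed q σ κ) * (uRed q σ κ)) j) (radVec n M) = ((q + q⁻¹) ^ 2 • (1 : Module.End ℂ Radial) +
      (1 / 2 * (q ^ 4 - 1) ^ 2) • (dotRed q (rRed q σ κ) (rRed q σ κ) j + dotRed q (sRed q σ κ)
      (sRed q σ κ) j)) (radVec n M) ∧
    (((uRed q σ κ) * (uRed q σ κ)) j - (q ^ 2 * (q ^ 4 - 1) ^ 2) • dotRed q (rRed q σ κ) (sRed q σ
      κ) j) (radVec n M) = ((zadd (q * (q ^ j) ^ 2) * (q + q⁻¹)) • (1 : Module.End ℂ Radial))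
      (radVec n M) := by
  have e3 : ∀ k : ℤ, k - 1 + 1 = k := fun k => by ring
  have e4 : ∀ k : ℤ, k + 1 - 1 = k := fun k => by ring
  have q0 := h.q0
  have hl : q - q⁻¹ = (q ^ 2 - 1) / q := by field_simp
  refine ⟨?_, ?_, ?_, ?_⟩
  all_goals
    simp only [crossRed, dotRed, quintRed, scalVec, vecScal, rRed, sRed, rsRed, xRed, uRed, x0Red,
      rotRed, ladder_radVec, diagN_radVec, map_add, map_sub, map_smul, LinearMap.add_apply,
      LinearMap.sub_apply, LinearMap.smul_apply, LinearMap.neg_apply, LinearMap.zero_apply,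
      Module.End.mul_apply, Pi.mul_apply, Module.End.one_apply, nuPow_add_one q q0,
      nuPow_sub_one q q0, e3, e4, (zpow_j q q0 _).1, (zpow_j q q0 _).2.1, hl]
    generalize q ^ j = J at *
    generalize nuPow q κ n = N at *
    try simp only [h.csig_self, h.csig_mul, h.csig_div, h.stayFac_self, h.stayFac_mul,
      h.stayFac_div, h.downFac_self, h.downFac_mul, h.downFac_div, zsub, zadd]
    clear q0
    obtain ⟨q0, q1, q2, q3, j0, n0, n1, n2, a0, a1, a2, a3, b0, b1, b2, b3, c1, c2, c3, c4,
      c5⟩ := h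
    rcases hx with n3 | ⟨rfl, hN, rfl⟩
    · have n3' : N ^ 2 + σ * q ^ 2 ≠ 0 := by rwa [mul_comm σ]
      match_scalars <;> try simp only [csig, dsig]
      all_goals field_simp
      all_goals ring
    -- For the scalar parts nothing has to be excluded: at `J = 1` the factors `zsub (J ^ 2)` in
    -- `dotRed` are zero, and only the path that goes up and down again survives.
    · subst N
      have z1 : csig (-1) (q / (q * 1)) = 0 := by simp [csig, q0]
      have z2 : q ^ 2 + q ^ 2 * -1 = 0 := by ring
      simp only [z1, z2, zero_div, div_zero, mul_zero, zero_mul, zero_smul, smul_zero, add_zero,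
        zero_add, sub_zero, one_pow, mul_one, one_mul] at *
      have n4 : q ^ 4 - 1 ≠ 0 := fun e => n2 (by linear_combination e)
      have n5 : q ^ 2 * q ^ 2 + -1 = q ^ 4 - 1 := by ring
      try simp only [n5]
      match_scalars <;> try simp only [csig, dsig]
      all_goals field_simp
      all_goals ring

end Reduced

end

end QMink

namespace QMink

noncomputable section

/-! ## Restriction to the quantum numbers that occur -/

variable {q : ℝ}

/-- The sign of the invariant length. -/
def Family.sig : Family q → ℂ
  | .space _ _ => 1
  | .time _ _ => -1

/-- The shift of the quantum number `n`. -/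
def Family.kap : Family q → ℤ
  | .space _ _ => 0
  | .time _ _ => 1

/-- The label of the family. -/
def Family.len : Family q → ℝ
  | .space l _ => l
  | .time t _ => t

/-- The radial quantum numbers that occur for given `j`. -/
def Family.RadOccurs : Family q → ℤ → ℤ → Prop
  | .space _ _, _, _ => True
  | .time _ _, j, n => j ≤ n

lemma Family.occurs_iff (f : Family q) (s : QNum) :
    f.Occurs s ↔ |s.m| ≤ s.j ∧ f.RadOccurs s.j s.n := by
  cases f <;> simp [Family.Occurs, Family.RadOccurs]

/-- The span in `Full` of the quantum numbers that occur. -/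
abbrev Occ (f : Family q) : Submodule ℂ Full := Finsupp.supported ℂ ℂ {s | f.Occurs s}

/-- Finite linear combinations of the radial quantum numbers that occur for given `j`. -/
abbrev RadOcc (f : Family q) (j : ℤ) : Submodule ℂ Radial :=
  Finsupp.supported ℂ ℂ {p | f.RadOccurs j p.1}

lemma radVec_mem {f : Family q} {j n : ℤ} (h : f.RadOccurs j n) (M : ℤ) :
    radVec n M ∈ RadOcc f j := Finsupp.single_mem_supported ℂ 1 h

/-- The alternative `c = 0` is for steps across the boundary `j = n` of the time-like region, whose
coefficients vanish. -/
lemma smul_radVec_mem {f : Family q} {j n : ℤ} {c : ℂ} (h : c = 0 ∨ f.RadOccurs j n) (M : ℤ) :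
    c • radVec n M ∈ RadOcc f j := by
  rcases h with rfl | h
  · simp
  · exact Submodule.smul_mem _ _ (radVec_mem h M)

lemma emb_mem {f : Family q} {j m : ℤ} (hm : |m| ≤ j) {w : Radial} (hw : w ∈ RadOcc f j) :
    emb j m w ∈ Occ f := by
  have : Submodule.map (emb j m) (RadOcc f j) ≤ Occ f := by
    rw [RadOcc, Finsupp.supported_eq_span_single, Submodule.map_span, Submodule.span_le]
    rintro _ ⟨_, ⟨p, hp, rfl⟩, rfl⟩
    rw [emb_single]
    exact Finsupp.single_mem_supported ℂ 1 ((f.occurs_iff _).2 ⟨hm, hp⟩)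
  exact this ⟨w, hw, rfl⟩

/-- The change of `j` under a step. -/
def Step.shift : Step → ℤ
  | .up => 1
  | .stay => 0
  | .down => -1

/-- A step can leave the range `|m| ≤ j` only from `m` at or next to one of the ends `j`, `-j`. At
these values a factor `zsub` of the coefficient has the argument `1` and is zero. -/
lemma angCoef_eq_zero {q : ℂ} (hq : q ≠ 0) {j m : ℤ} (hm : |m| ≤ j) (A : E3) (Δ : Step)
    (h : ¬ |m + weight A| ≤ j + Δ.shift) : angCoef q A Δ (q ^ j) (q ^ m) = 0 := by
  have z1 : zsub 1 = 0 := by simp [zsub]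
  have hj : q ^ j ≠ 0 := zpow_ne_zero _ hq
  rw [abs_le] at hm h
  have key : ∀ a : ℤ, (a = j ∨ a = -j ∨ a = j - 1 ∨ a = 1 - j) → m = a →
      angCoef q A Δ (q ^ j) (q ^ m) = angCoef q A Δ (q ^ j) (q ^ a) := by rintro a - rfl; rfl
  have e1 : q ^ j / (q ^ j / q) / q = 1 := by field_simp
  have e2 : q ^ j * (q / q ^ j) / q = 1 := by field_simp
  cases A <;> cases Δ <;> simp only [weight, Step.shift] at h
  · omega
  · rw [key j (by omega) (by omega)]; simp [angCoef, hj, z1]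
  · obtain h | h : m = j ∨ m = j - 1 := by omega
    · rw [key j (by omega) h]; simp [angCoef, hj, z1]
    · rw [key (j - 1) (by omega) h]; simp only [angCoef, zpow_sub_one₀ hq, ← div_eq_mul_inv, e1,
      z1, mul_zero]
  · omega
  · rw [key (-j) (by omega) (by omega)]; simp [angCoef, hj, z1]
  · obtain h | h : m = -j ∨ m = 1 - j := by omega
    · rw [key (-j) (by omega) h]; simp [angCoef, hj, z1]
    · rw [key (1 - j) (by omega) h]
      simp only [angCoef, zpow_sub₀ hq, zpow_one, e2, z1, mul_zero, zero_div]
  · omega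
  · omega
  · obtain h | h : m = j ∨ m = -j := by omega
    · rw [key j (by omega) h]; simp [angCoef, hj, z1]
    · rw [key (-j) (by omega) h]; simp [angCoef, hj, z1]

/-- The reduced matrix elements to radial quantum numbers that do not occur vanish. -/
def Admissible (f : Family q) (y : RedVec) : Prop :=
  ∀ (Δ : Step) (j n M : ℤ), 0 ≤ j → f.RadOccurs j n → y Δ j (radVec n M) ∈ RadOcc f (j + Δ.shift)

/-- The same for a scalar operator. -/
def AdmissibleScal (f : Family q) (t : ℤ → Module.End ℂ Radial) : Prop :=
  ∀ j n M : ℤ, 0 ≤ j → f.RadOccurs j n → t j (radVec n M) ∈ RadOcc f j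

lemma mapsTo_of_basis {f : Family q} {T : Module.End ℂ Full}
    (h : ∀ s : QNum, f.Occurs s → T (Finsupp.single s 1) ∈ Occ f) : ∀ v ∈ Occ f, T v ∈ Occ f := by
  have : Occ f ≤ (Occ f).comap T := by
    conv_lhs => rw [Occ, Finsupp.supported_eq_span_single]
    rw [Submodule.span_le]
    rintro _ ⟨s, hs, rfl⟩
    exact h s hs
  exact this

lemma single_eq_emb (s : QNum) :
    (Finsupp.single s 1 : Full) = emb s.j s.m (radVec s.n s.M) := by rw [emb_single]

lemma vecOp_mem {f : Family q} (hq : (q : ℂ) ≠ 0) {y : RedVec} (hy : Admissible f y) (A : E3) :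
    ∀ v ∈ Occ f, vecOp q y A v ∈ Occ f := by
  refine mapsTo_of_basis fun s hs => ?_
  obtain ⟨hm, hn⟩ := (f.occurs_iff s).1 hs
  have hj : 0 ≤ s.j := (abs_nonneg _).trans hm
  have aux : ∀ Δ : Step, angCoef q A Δ ((q : ℂ) ^ s.j) ((q : ℂ) ^ s.m) •
      emb (s.j + Δ.shift) (s.m + weight A) (y Δ s.j (radVec s.n s.M)) ∈ Occ f := fun Δ => by
    by_cases h : |s.m + weight A| ≤ s.j + Δ.shift
    · exact Submodule.smul_mem _ _ (emb_mem h (hy Δ _ _ _ hj hn))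
    · rw [angCoef_eq_zero hq hm A Δ h, zero_smul]; exact Submodule.zero_mem _
  rw [single_eq_emb, vecOp_emb]
  have h0 := aux .stay
  simp only [Step.shift, add_zero] at h0
  exact Submodule.add_mem _ (Submodule.add_mem _ (aux .up) h0) (aux .down)

lemma scalOp_mem {f : Family q} {t : ℤ → Module.End ℂ Radial} (ht : AdmissibleScal f t) :
    ∀ v ∈ Occ f, scalOp t v ∈ Occ f := by
  refine mapsTo_of_basis fun s hs => ?_
  obtain ⟨hm, hn⟩ := (f.occurs_iff s).1 hs
  rw [single_eq_emb, scalOp_emb]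
  exact emb_mem hm (ht _ _ _ ((abs_nonneg _).trans hm) hn)

/-- Finite linear combinations of the quantum numbers that occur. -/
abbrev Space (f : Family q) := State f →₀ ℂ

/-- The inclusion into all finite linear combinations. -/
def incl (f : Family q) : Space f →ₗ[ℂ] Full := Finsupp.lmapDomain ℂ ℂ Subtype.val

lemma incl_single (f : Family q) (s : State f) (c : ℂ) :
    incl f (Finsupp.single s c) = Finsupp.single s.1 c := by
  simp [incl, Finsupp.lmapDomain_apply, Finsupp.mapDomain_single]

lemma incl_injective (f : Family q) : Function.Injective (incl f) :=
  Finsupp.mapDomain_injective Subtype.val_injective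

lemma incl_mem (f : Family q) (v : Space f) : incl f v ∈ Occ f := by
  induction v using Finsupp.induction_linear with
  | zero => simp
  | add v w hv hw => rw [map_add]; exact Submodule.add_mem _ hv hw
  | single s c => rw [incl_single]; exact Finsupp.single_mem_supported ℂ c s.2

/-- The operator `T` represents the endomorphism `S`. -/
def Lifts {f : Family q} (S : Module.End ℂ (Space f)) (T : Module.End ℂ Full) : Prop :=
  ∀ v, incl f (S v) = T (incl f v)

/-- The restriction of an operator to the quantum numbers that occur. -/
def compress (f : Family q) (T : Module.End ℂ Full) : Module.End ℂ (Space f) :=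
  Finsupp.lcomapDomain Subtype.val Subtype.val_injective ∘ₗ T ∘ₗ incl f

lemma lifts_compress {f : Family q} {T : Module.End ℂ Full} (h : ∀ v ∈ Occ f, T v ∈ Occ f) :
    Lifts (compress f T) T := fun v => by
  refine Finsupp.mapDomain_comapDomain _ Subtype.val_injective _ ?_
  rw [show Set.range (Subtype.val : State f → QNum) = {s | f.Occurs s} from Subtype.range_val]
  exact h _ (incl_mem f v)

/-- The family `Y` of endomorphisms is the vector operator with reduced matrix elements `y`. -/
def LiftsVec {f : Family q} (Y : E3 → Module.End ℂ (Space f)) (y : RedVec) : Prop :=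
  ∀ A, Lifts (Y A) (vecOp q y A)

/-- The endomorphism `S` is the scalar operator with reduced matrix elements `t`. -/
def LiftsScal {f : Family q} (S : Module.End ℂ (Space f)) (t : ℤ → Module.End ℂ Radial) : Prop :=
  Lifts S (scalOp t)

/-- Agreement on the states that occur is enough. Outside of them denominators may vanish, and the
operators on `Full` need not agree there. -/
lemma Lifts.ext {f : Family q} {S S' : Module.End ℂ (Space f)} {T T' : Module.End ℂ Full}
    (h : Lifts S T) (h' : Lifts S' T')
    (e : ∀ s, f.Occurs s → T (Finsupp.single s 1) = T' (Finsupp.single s 1)) : S = S' := by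
  refine Finsupp.lhom_ext' fun s => LinearMap.ext_ring <| incl_injective f ?_
  have := (h (Finsupp.single s 1)).trans (((incl_single f s 1).symm ▸ e s.1 s.2).trans (h' _).symm)
  exact this

section Algebra

variable {f : Family q} {Y Z : E3 → Module.End ℂ (Space f)} {y z : RedVec}
  {S T : Module.End ℂ (Space f)} {s t : ℤ → Module.End ℂ Radial}

lemma vecOp_add (q : ℂ) (y z : RedVec)
    (A : E3) : vecOp q (y + z) A = vecOp q y A + vecOp q z A := by
  refine full_hom_ext fun j m w => ?_
  simp only [vecOp_emb, LinearMap.add_apply, Pi.add_apply, map_add]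
  module

lemma vecOp_smul (q c : ℂ) (y : RedVec) (A : E3) : vecOp q (c • y) A = c • vecOp q y A := by
  refine full_hom_ext fun j m w => ?_
  simp only [vecOp_emb, LinearMap.smul_apply, Pi.smul_apply, map_smul]
  module

lemma scalOp_add (s t : ℤ → Module.End ℂ Radial) : scalOp (s + t) = scalOp s + scalOp t := by
  refine full_hom_ext fun j m w => ?_
  simp only [scalOp_emb, LinearMap.add_apply, Pi.add_apply, map_add]

lemma scalOp_smul (c : ℂ) (t : ℤ → Module.End ℂ Radial) : scalOp (c • t) = c • scalOp t := by
  refine full_hom_ext fun j m w => ?_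
  simp only [scalOp_emb, LinearMap.smul_apply, Pi.smul_apply, map_smul]

lemma scalOp_one : scalOp 1 = 1 := by
  refine full_hom_ext fun j m w => ?_
  simp only [scalOp_emb, Pi.one_apply, Module.End.one_apply]

lemma LiftsVec.add (hy : LiftsVec Y y) (hz : LiftsVec Z z) : LiftsVec (Y + Z) (y + z) :=
  fun A v => by
    rw [vecOp_add]; exact (map_add _ _ _).trans (congrArg₂ _ (hy A v) (hz A v))

lemma LiftsVec.smul (c : ℂ) (hy : LiftsVec Y y) : LiftsVec (c • Y) (c • y) :=
  fun A v => by
    rw [vecOp_smul]; exact (map_smul _ _ _).trans (congrArg _ (hy A v))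

lemma LiftsVec.sub (hy : LiftsVec Y y) (hz : LiftsVec Z z) : LiftsVec (Y - Z) (y - z) := by
  have e : Y - Z = Y + (-1 : ℂ) • Z := by
    funext A; simp only [Pi.sub_apply, Pi.add_apply, Pi.smul_apply]; module
  have e' : y - z = y + (-1 : ℂ) • z := by
    funext A j; simp only [Pi.sub_apply, Pi.add_apply, Pi.smul_apply]; module
  rw [e, e']
  exact hy.add (hz.smul (-1))

lemma LiftsScal.add (hs : LiftsScal S s) (ht : LiftsScal T t) : LiftsScal (S + T) (s + t) :=
  fun v => by rw [scalOp_add]; exact (map_add _ _ _).trans (congrArg₂ _ (hs v) (ht v))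

lemma LiftsScal.smul (c : ℂ) (hs : LiftsScal S s) : LiftsScal (c • S) (c • s) :=
  fun v => by rw [scalOp_smul]; exact (map_smul _ _ _).trans (congrArg _ (hs v))

lemma LiftsScal.sub (hs : LiftsScal S s) (ht : LiftsScal T t) : LiftsScal (S - T) (s - t) := by
  have e : S - T = S + (-1 : ℂ) • T := by module
  have e' : s - t = s + (-1 : ℂ) • t := by
    funext j; simp only [Pi.sub_apply, Pi.add_apply, Pi.smul_apply]; module
  rw [e, e']
  exact hs.add (ht.smul (-1))

lemma LiftsScal.one : LiftsScal (1 : Module.End ℂ (Space f)) 1 :=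
  fun v => by rw [scalOp_one]; rfl

lemma LiftsScal.mul (hs : LiftsScal S s) (ht : LiftsScal T t) : LiftsScal (S * T) (s * t) :=
  fun v => by rw [← scalOp_mul]; exact (hs _).trans (congrArg _ (ht v))

lemma LiftsScal.mul_vec (hs : LiftsScal S s) (hy : LiftsVec Y y) :
    LiftsVec (fun A => S * Y A) (scalVec s y) :=
  fun A v => by rw [← scalOp_mul_vecOp]; exact (hs _).trans (congrArg _ (hy A v))

lemma LiftsVec.mul_scal (hy : LiftsVec Y y) (hs : LiftsScal S s) :
    LiftsVec (fun A => Y A * S) (vecScal y s) :=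
  fun A v => by rw [← vecOp_mul_scalOp]; exact (hy A _).trans (congrArg _ (hs v))

lemma LiftsVec.mul (hy : LiftsVec Y y) (hz : LiftsVec Z z) (A B : E3) :
    Lifts (Y A * Z B) (vecOp q y A * vecOp q z B) :=
  fun v => (hy A _).trans (congrArg _ (hz B v))

lemma LiftsVec.dot (h0 : (q : ℂ) ≠ 0) (h1 : (q : ℂ) ^ 2 - 1 ≠ 0) (h2 : (q : ℂ) ^ 2 + 1 ≠ 0)
    (hy : LiftsVec Y y) (hz : LiftsVec Z z) : LiftsScal (dot q Y Z) (dotRed q y z) := fun v => by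
  rw [← dot_vecOp _ h0 h1 h2]
  simp only [QMink.dot, sum_E3, LinearMap.add_apply, LinearMap.smul_apply, map_add, map_smul,
    hy.mul hz _ _ v]

lemma LiftsVec.cross (h0 : (q : ℂ) ≠ 0) (h1 : (q : ℂ) ^ 2 - 1 ≠ 0) (h2 : (q : ℂ) ^ 2 + 1 ≠ 0)
    (hy : LiftsVec Y y) (hz : LiftsVec Z z) : LiftsVec (cross q Y Z) (crossRed q y z) :=
  fun A v => by
    rw [← cross_vecOp _ h0 h1 h2]
    simp only [QMink.cross, sum_E3, LinearMap.add_apply, LinearMap.smul_apply, map_add, map_smul,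
      hy.mul hz _ _ v]

/-- The operator `S k` has the spin-two matrix elements given by `Q`. -/
def LiftsQuint (S : E5 → Module.End ℂ (Space f)) (Q : Fin 5 → ℤ → Module.End ℂ Radial) : Prop :=
  ∀ (k : E5) (a : State f), incl f (S k (Finsupp.single a 1)) =
    quintCoef q k .up .up (q ^ a.1.j) (q ^ a.1.m) •
        emb (a.1.j + 2) (a.1.m + k.weight) (Q 0 a.1.j (radVec a.1.n a.1.M))
      + quintCoef q k .up .stay (q ^ a.1.j) (q ^ a.1.m) •
        emb (a.1.j + 1) (a.1.m + k.weight) (Q 1 a.1.j (radVec a.1.n a.1.M))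
      + quintCoef q k .stay .stay (q ^ a.1.j) (q ^ a.1.m) •
        emb a.1.j (a.1.m + k.weight) (Q 2 a.1.j (radVec a.1.n a.1.M))
      + quintCoef q k .down .stay (q ^ a.1.j) (q ^ a.1.m) •
        emb (a.1.j - 1) (a.1.m + k.weight) (Q 3 a.1.j (radVec a.1.n a.1.M))
      + quintCoef q k .down .down (q ^ a.1.j) (q ^ a.1.m) •
        emb (a.1.j - 2) (a.1.m + k.weight) (Q 4 a.1.j (radVec a.1.n a.1.M))

lemma LiftsVec.quint (h0 : (q : ℂ) ≠ 0) (h1 : (q : ℂ) ^ 2 - 1 ≠ 0) (h2 : (q : ℂ) ^ 2 + 1 ≠ 0)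
    (hy : LiftsVec Y y) (hz : LiftsVec Z z) : LiftsQuint (quint q Y Z) (quintRed y z) := by
  intro k s
  rw [← quint_vecOp _ h0 h1 h2, ← single_eq_emb]
  have := fun A B => hy.mul hz A B (Finsupp.single s 1)
  simp only [incl_single] at this
  cases k <;>
    simp only [QMink.quint, LinearMap.add_apply, LinearMap.smul_apply, map_add, map_smul, this]

lemma LiftsQuint.add {S S' : E5 → Module.End ℂ (Space f)} {Q Q' : Fin 5 → ℤ → Module.End ℂ Radial}
    (h : LiftsQuint S Q) (h' : LiftsQuint S' Q') : LiftsQuint (S + S') (Q + Q') := by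
  intro k s
  have := congrArg₂ (· + ·) (h k s) (h' k s)
  simp only [Pi.add_apply, LinearMap.add_apply, map_add] at this ⊢
  rw [this]
  module

lemma LiftsQuint.smul {S : E5 → Module.End ℂ (Space f)} {Q : Fin 5 → ℤ → Module.End ℂ Radial}
    (c : ℂ) (h : LiftsQuint S Q) : LiftsQuint (c • S) (c • Q) := by
  intro k s
  have := congrArg (c • ·) (h k s)
  simp only [Pi.smul_apply, LinearMap.smul_apply, map_smul] at this ⊢
  rw [this]
  module

lemma LiftsScal.ext (hs : LiftsScal S s) (ht : LiftsScal T t)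
    (e : ∀ j n M, 0 ≤ j → f.RadOccurs j n → s j (radVec n M) = t j (radVec n M)) : S = T :=
  Lifts.ext hs ht fun a ha => by
    obtain ⟨hm, hn⟩ := (f.occurs_iff a).1 ha
    rw [single_eq_emb, scalOp_emb, scalOp_emb, e _ _ _ ((abs_nonneg _).trans hm) hn]

/-- The selection rule that a vector operator has no element from `j = 0` to `j = 0`. For the third
component it is the cancellation of `μ ^ 2 = 1` against `zadd q / (q + q⁻¹) = 1`. -/
lemma angCoef_stay_zero (h2 : (q : ℂ) ^ 2 + 1 ≠ 0) (h0 : (q : ℂ) ≠ 0) (A : E3) :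
    angCoef q A .stay 1 1 = 0 ∧ angCoef q A .down 1 1 = 0 := by
  have : zadd (q * 1 ^ 2) / (q + (q : ℂ)⁻¹) = 1 := by
    rw [zadd, one_pow, mul_one]
    refine div_self fun e => h2 ?_
    field_simp at e; linear_combination e
  cases A
  all_goals simp [angCoef, zsub]
  all_goals simp at this
  all_goals simp [this]

/-- At `j = 0`, hence `m = 0`, the coefficients of `stay` and `down` vanish, so the reduced elements
for these steps need not be compared. This makes the exceptional state with `j = n = 0` tractable.
-/
lemma LiftsVec.ext (h0 : (q : ℂ) ≠ 0) (h2 : (q : ℂ) ^ 2 + 1 ≠ 0) (hy : LiftsVec Y y)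
    (hz : LiftsVec Z z)
    (e : ∀ Δ j n M, 0 ≤ j → f.RadOccurs j n → Δ = .up ∨ j ≠ 0 →
      y Δ j (radVec n M) = z Δ j (radVec n M)) (A : E3) : Y A = Z A :=
  Lifts.ext (hy A) (hz A) fun a ha => by
    obtain ⟨hm, hn⟩ := (f.occurs_iff a).1 ha
    have hj := (abs_nonneg _).trans hm
    rw [single_eq_emb, vecOp_emb, vecOp_emb, e .up _ _ _ hj hn (.inl rfl)]
    by_cases h : a.j = 0
    · have : a.m = 0 := by rw [h] at hm; exact abs_nonpos_iff.1 hm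
      simp only [h, this, zpow_zero, angCoef_stay_zero h2 h0, zero_smul]
    · rw [e .stay _ _ _ hj hn (.inr h), e .down _ _ _ hj hn (.inr h)]

/-- The representative paths for all indices other than `0` begin with `stay` or `down`. Their
coefficients vanish at `j = 0`, which leaves only the path that goes up twice. -/
lemma LiftsQuint.ext {S S' : E5 → Module.End ℂ (Space f)} {Q Q' : Fin 5 → ℤ → Module.End ℂ Radial}
    (h0 : (q : ℂ) ≠ 0) (h2 : (q : ℂ) ^ 2 + 1 ≠ 0) (h : LiftsQuint S Q) (h' : LiftsQuint S' Q')
    (e : ∀ i j n M, 0 ≤ j → f.RadOccurs j n → i = 0 ∨ j ≠ 0 →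
      Q i j (radVec n M) = Q' i j (radVec n M)) (k : E5) : S k = S' k := by
  refine Finsupp.lhom_ext' fun a => LinearMap.ext_ring <| incl_injective f ?_
  refine (h k a).trans (Eq.trans ?_ (h' k a).symm)
  obtain ⟨a, ha⟩ := a
  obtain ⟨hm, hn⟩ := (f.occurs_iff a).1 ha
  have hj := (abs_nonneg _).trans hm
  rw [e 0 _ _ _ hj hn (.inl rfl)]
  by_cases hh : a.j = 0
  · have : a.m = 0 := by rw [hh] at hm; exact abs_nonpos_iff.1 hm
    have z := angCoef_stay_zero h2 h0
    cases k <;>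
      simp only [hh, this, zpow_zero, quintCoef, (z _).1, (z _).2, mul_zero, add_zero, zero_smul]
  · rw [e 1 _ _ _ hj hn (.inr hh), e 2 _ _ _ hj hn (.inr hh), e 3 _ _ _ hj hn (.inr hh),
      e 4 _ _ _ hj hn (.inr hh)]

end Algebra

end

end QMink

namespace QMink

noncomputable section

/-! ## The model on the quantum numbers that occur -/

section Facts

variable {q : ℝ}

lemma family_cases (f : Family q) :
    (f.sig = 1 ∧ f.kap = 0 ∧ ∀ j n, f.RadOccurs j n ↔ True) ∨
      (f.sig = -1 ∧ f.kap = 1 ∧ ∀ j n, f.RadOccurs j n ↔ j ≤ n) := by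
  cases f
  · exact .inl ⟨rfl, rfl, fun _ _ => Iff.rfl⟩
  · exact .inr ⟨rfl, rfl, fun _ _ => Iff.rfl⟩

lemma zpow_cases (hq : 1 < q) {j : ℤ} (hj : 0 ≤ j) :
    q ^ j = 1 ∨ q ^ j = q ∨ q ^ 2 ≤ q ^ j := by
  obtain h | h | h : j = 0 ∨ j = 1 ∨ 2 ≤ j := by omega
  · simp [h]
  · simp [h]
  · exact .inr (.inr (by exact_mod_cast zpow_le_zpow_right₀ hq.le h))

lemma regular_of_occurs (hq : 1 < q) (f : Family q) {j n : ℤ} (hj : 0 ≤ j)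
    (hn : f.RadOccurs j n) : Regular q f.sig ((q : ℂ) ^ j) (nuPow q f.kap n) := by
  have q0 : 0 < q := by linarith
  have hJ : 1 ≤ q ^ j := one_le_zpow₀ hq.le hj
  have hq2 : 1 < q ^ 2 := by nlinarith
  -- Equality `J ^ 4 = q ^ 2` or `J ^ 4 = q ^ 6` would mean `j = 1 / 2` or `j = 3 / 2`. For integers
  -- `j ≥ 0` the power `q ^ j` is `1`, `q` or at least `q ^ 2`, and all three cases are excluded.
  have key : ∀ J : ℝ, (J = 1 ∨ J = q ∨ q ^ 2 ≤ J) → J ^ 4 ≠ q ^ 2 ∧ J ^ 4 ≠ q ^ 6 := by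
    rintro J (rfl | rfl | h)
    · constructor <;> intro h
      · nlinarith
      · have : 1 < q ^ 6 := one_lt_pow₀ hq (by norm_num)
        linarith
    · constructor <;> intro h
      · have := pow_lt_pow_right₀ hq (show 2 < 4 by norm_num); linarith
      · have := pow_lt_pow_right₀ hq (show 4 < 6 by norm_num); linarith
    · have h8 : (q ^ 2) ^ 4 ≤ J ^ 4 := pow_le_pow_left₀ (by positivity) h 4
      rw [← pow_mul] at h8
      have h1 := pow_lt_pow_right₀ hq (show 2 < 2 * 4 by norm_num)
      have h2 := pow_lt_pow_right₀ hq (show 6 < 2 * 4 by norm_num)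
      constructor <;> intro h <;> linarith
  have hk := key _ (zpow_cases hq hj)
  have hJ4 : 1 ≤ (q ^ j) ^ 4 := one_le_pow₀ hJ
  have hb1 : q ^ 2 * (q ^ j) ^ 4 - 1 ≠ 0 := by
    have : q ^ 2 * 1 ≤ q ^ 2 * (q ^ j) ^ 4 := mul_le_mul_of_nonneg_left hJ4 (by positivity)
    intro h; linarith
  have hb2 : q ^ 6 * (q ^ j) ^ 4 - 1 ≠ 0 := by
    have : q ^ 6 * 1 ≤ q ^ 6 * (q ^ j) ^ 4 := mul_le_mul_of_nonneg_left hJ4 (by positivity)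
    have : 1 < q ^ 6 := one_lt_pow₀ hq (by norm_num)
    intro h; linarith
  -- In the time-like case `0 ≤ j ≤ n` and `κ = 1` give `n + κ ≥ 1`, hence `N > 1` and `N ^ 2 - 1 ≠
  -- 0`. In the space-like case sums of positive numbers occur.
  have hN : (nuPow (q : ℂ) f.kap n) ^ 2 + f.sig ≠ 0 ∧
      (q : ℂ) ^ 2 * (nuPow (q : ℂ) f.kap n) ^ 2 + f.sig ≠ 0 := by
    have hp : 0 < q ^ (n + f.kap) := zpow_pos q0 _
    rcases family_cases f with ⟨e1, e2, -⟩ | ⟨e1, e2, e3⟩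
    · rw [e1, nuPow]
      norm_cast
      constructor <;> positivity
    · rw [e1, nuPow]
      have h1 : 1 < q ^ (n + f.kap) := one_lt_zpow₀ hq (by rw [e2]; have := (e3 _ _).1 hn; omega)
      have h2 : 1 < (q ^ (n + f.kap)) ^ 2 := by nlinarith
      constructor
      · have : (q ^ (n + f.kap)) ^ 2 + -1 ≠ 0 := by intro h; linarith
        exact_mod_cast this
      · have : q ^ 2 * (q ^ (n + f.kap)) ^ 2 + -1 ≠ 0 := by intro h; nlinarith
        exact_mod_cast this
  have c0 : ((q ^ j : ℝ) : ℂ) = (q : ℂ) ^ j := by push_cast; rfl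
  have hq1 : q ^ 2 - 1 ≠ 0 := by intro h; linarith
  have aux : ∀ {x : ℝ}, x ≠ 0 → (x : ℂ) ≠ 0 := fun h => by exact_mod_cast h
  refine ⟨aux q0.ne', ?_, ?_, ?_, ?_, ?_, hN.1, hN.2, ?_, ?_, ?_, ?_, ?_, ?_, ?_, ?_, ?_, ?_, ?_,
    ?_, by rw [mul_comm]; exact hN.2⟩
  · exact_mod_cast aux hq1
  · exact_mod_cast aux (show q ^ 2 + 1 ≠ 0 by positivity)
  · exact_mod_cast aux (show 1 + q ^ 2 ≠ 0 by positivity)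
  · exact zpow_ne_zero _ (aux q0.ne')
  · exact zpow_ne_zero _ (aux q0.ne')
  all_goals rw [← c0]; norm_cast
  any_goals positivity
  · exact sub_ne_zero.2 hk.1
  · exact sub_ne_zero.2 hk.2
  · rw [mul_comm]; exact hb1
  · rw [mul_comm]; exact hb2

/-- The quantity is, up to a nonzero factor, `csig σ (N / q)`. It vanishes only for `σ = -1` and `N
= q`, that is `n = 0`, and then `0 ≤ j ≤ n` forces `j = 0`. -/
lemma exceptional_of_occurs (hq : 1 < q) (f : Family q) {j n : ℤ} (hj : 0 ≤ j)
    (hn : f.RadOccurs j n) :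
    nuPow (q : ℂ) f.kap n ^ 2 + (q : ℂ) ^ 2 * f.sig ≠ 0 ∨
      j = 0 ∧ (q : ℂ) ^ j = 1 ∧ nuPow q f.kap n = q ∧ f.sig = -1 := by
  rcases family_cases f with ⟨e1, e2, -⟩ | ⟨e1, e2, e3⟩
  · left
    rw [e1, nuPow]
    have : (q ^ (n + f.kap)) ^ 2 + q ^ 2 * 1 ≠ 0 := by positivity
    exact_mod_cast this
  · have h := (e3 _ _).1 hn
    by_cases h0 : n = 0
    · right
      have : j = 0 := by omega
      simp [nuPow, e1, e2, h0, this]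
    · left
      rw [e1, nuPow, e2]
      have h2 : q ^ 2 ≤ q ^ (n + 1) := by
        exact_mod_cast zpow_le_zpow_right₀ hq.le (show (2 : ℤ) ≤ n + 1 by omega)
      have : (q ^ (n + 1)) ^ 2 + q ^ 2 * (-1) ≠ 0 := by
        intro h
        have h3 : (q ^ 2) ^ 2 ≤ (q ^ (n + 1)) ^ 2 := pow_le_pow_left₀ (by positivity) h2 2
        nlinarith [one_lt_pow₀ hq (two_ne_zero)]
      exact_mod_cast this

end Facts

/-- The operator on `Radial` with matrix elements `c M` from `M` to `M + k`. -/
def mRad (c : ℤ → ℂ) (k : ℤ) : Module.End ℂ Radial :=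
  Finsupp.linearCombination ℂ fun p : ℤ × ℤ => c p.2 • radVec p.1 (p.2 + k)

lemma mRad_radVec (c : ℤ → ℂ) (k n M : ℤ) : mRad c k (radVec n M) = c M • radVec n (M + k) := by
  simp only [mRad, Finsupp.linearCombination_single, one_smul]

lemma radial_hom_ext {S T : Module.End ℂ Radial}
    (h : ∀ n M, S (radVec n M) = T (radVec n M)) : S = T :=
  Finsupp.lhom_ext' fun p => LinearMap.ext_ring (h p.1 p.2)

lemma mRad_ladder (a b c : ℤ → ℂ) (k : ℤ) : Commute (mRad c k) (ladder a b) := by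
  refine radial_hom_ext fun n M => ?_
  simp only [Module.End.mul_apply, ladder_radVec, mRad_radVec, map_add, map_smul]
  module

lemma mRad_diagN (a c : ℤ → ℂ) (k : ℤ) : Commute (mRad c k) (diagN a) := by
  refine radial_hom_ext fun n M => ?_
  simp only [Module.End.mul_apply, diagN_radVec, mRad_radVec, map_smul]
  module

variable {q : ℝ} (f : Family q)

/-- The rescaled operators `R`. -/
def rOp (A : E3) : Module.End ℂ (Space f) := compress f (vecOp q (rRed q f.sig f.kap) A)

/-- The rescaled operators `S`. -/
def sOp (A : E3) : Module.End ℂ (Space f) := compress f (vecOp q (sRed q f.sig f.kap) A)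

/-- The rescaled space coordinates on the unit hyperboloid. -/
def xOp (A : E3) : Module.End ℂ (Space f) := compress f (vecOp q (xRed q f.sig f.kap) A)

/-- The rescaled operator `U`. -/
def uOp : Module.End ℂ (Space f) := compress f (scalOp (uRed q f.sig f.kap))

/-- The rescaled time coordinate on the unit hyperboloid. -/
def x0Op : Module.End ℂ (Space f) := compress f (scalOp (x0Red q f.sig f.kap))

/-- The operator with matrix elements `c M` from `M` to `M + k`. -/
def mOp (c : ℤ → ℂ) (k : ℤ) : Module.End ℂ (Space f) := compress f (scalOp fun _ => mRad c k)

section Admissible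

variable {f} (hq : (q : ℂ) ≠ 0)
include hq

-- In the time-like case `κ = 1`, so for `n = a` the exponent is zero and `csig (-1) 1 = 1 - 1 = 0`.
-- This factor switches off the steps that would cross the boundary `j ≤ n`.
omit hq in
lemma csig_zero_or (a j n : ℤ) (hn : f.RadOccurs j n) :
    csig f.sig ((q : ℂ) ^ (n + f.kap - 1 - a)) = 0 ∨ f.RadOccurs j n ∧ (f.sig = -1 → n ≠ a) := by
  rcases family_cases f with ⟨e1, e2, e3⟩ | ⟨e1, e2, e3⟩
  · right; refine ⟨hn, fun h => ?_⟩
    rw [e1] at h; norm_num at h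
  · by_cases h : n = a
    · left; rw [e1, e2, h]; simp [csig]
    · exact .inr ⟨hn, fun _ => h⟩

lemma csig_div_eq (j n : ℤ) : nuPow (q : ℂ) f.kap n / (q * (q : ℂ) ^ j) =
    (q : ℂ) ^ (n + f.kap - 1 - j) ∧
    nuPow (q : ℂ) f.kap n / ((q : ℂ) ^ 2 * (q : ℂ) ^ j) =
    (q : ℂ) ^ (n + f.kap - 1 - (j + 1)) := by
  rw [nuPow]
  constructor
  · rw [zpow_sub₀ hq, zpow_sub₀ hq, zpow_one]; field_simp
  · rw [zpow_sub₀ hq, zpow_sub₀ hq, zpow_add₀ hq j, zpow_one]; field_simp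

omit hq in
lemma radOccurs_mono {j n j' n' : ℤ} (h : f.RadOccurs j n)
    (h' : f.sig = -1 → j ≤ n → j' ≤ n') : f.RadOccurs j' n' := by
  rcases family_cases f with ⟨e1, e2, e3⟩ | ⟨e1, e2, e3⟩
  · exact (e3 _ _).2 trivial
  · exact (e3 _ _).2 (h' e1 ((e3 _ _).1 h))

lemma uRed_admissible : AdmissibleScal f (uRed q f.sig f.kap) := fun j n M hj hn => by
  rw [uRed, ladder_radVec, (csig_div_eq hq j n).1]
  refine Submodule.add_mem _ (smul_radVec_mem (.inr (radOccurs_mono hn (by omega))) _)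
    (smul_radVec_mem ?_ _)
  rcases csig_zero_or j j n hn with h | ⟨-, h⟩
  · left; simp [h]
  · right; exact radOccurs_mono hn fun e _ => by have := h e; omega

omit hq in
lemma x0Red_admissible : AdmissibleScal f (x0Red q f.sig f.kap) := fun j n M hj hn => by
  rw [x0Red, diagN_radVec]
  exact smul_radVec_mem (.inr hn) _

omit hq in
lemma mRad_admissible (c : ℤ → ℂ) (k : ℤ) : AdmissibleScal f (fun _ => mRad c k) :=
  fun j n M hj hn => by
    rw [mRad_radVec]
    exact smul_radVec_mem (.inr hn) _

lemma rsRed_admissible (a b : ℂ → ℂ) (c : ℂ) : Admissible f (rsRed q f.sig f.kap a b c) := by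
  intro Δ j n M hj hn
  cases Δ
  · rw [rsRed, ladder_radVec, (csig_div_eq hq j n).1, (csig_div_eq hq j n).2]
    refine Submodule.add_mem _
      (smul_radVec_mem (.inr (radOccurs_mono hn (by simp only [Step.shift]; omega))) _)
      (smul_radVec_mem ?_ _)
    -- The step to `j + 1`, `n - 1` leaves the time-like region from `n = j` and from `n = j + 1`;
    -- its two factors `csig` vanish precisely at these two values.
    rcases csig_zero_or j j n hn with h | ⟨-, h⟩
    · left; simp [h]
    · rcases csig_zero_or (j + 1) j n hn with h' | ⟨-, h'⟩
      · left; simp [h']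
      · right; exact radOccurs_mono hn fun e _ => by
          have := h e; have := h' e; simp only [Step.shift]; omega
  · rw [rsRed]
    have := uRed_admissible hq j n M hj hn
    simpa [Step.shift] using Submodule.smul_mem _ (c * stayFac q ((q : ℂ) ^ j)) this
  · rw [rsRed, LinearMap.smul_apply, ladder_radVec]
    refine Submodule.smul_mem _ _ (Submodule.add_mem _ (smul_radVec_mem (.inr ?_) _)
      (smul_radVec_mem (.inr ?_) _)) <;>
    exact radOccurs_mono hn (by simp only [Step.shift]; omega)

lemma xRed_admissible : Admissible f (xRed q f.sig f.kap) := by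
  intro Δ j n M hj hn
  cases Δ
  · rw [xRed, diagN_radVec, (csig_div_eq hq j n).1]
    refine smul_radVec_mem ?_ _
    rcases csig_zero_or j j n hn with h | ⟨-, h⟩
    · left; simp [h]
    · right; exact radOccurs_mono hn fun e _ => by have := h e; simp only [Step.shift]; omega
  all_goals
    rw [xRed, diagN_radVec]
    refine smul_radVec_mem (.inr ?_) _
    exact radOccurs_mono hn (by simp only [Step.shift]; omega)

variable (f)

lemma lifts_r : LiftsVec (rOp f) (rRed q f.sig f.kap) :=
  fun A => lifts_compress (vecOp_mem hq (rsRed_admissible hq _ _ _) A)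

lemma lifts_s : LiftsVec (sOp f) (sRed q f.sig f.kap) :=
  fun A => lifts_compress (vecOp_mem hq (rsRed_admissible hq _ _ _) A)

lemma lifts_x : LiftsVec (xOp f) (xRed q f.sig f.kap) :=
  fun A => lifts_compress (vecOp_mem hq (xRed_admissible hq) A)

lemma lifts_u : LiftsScal (uOp f) (uRed q f.sig f.kap) :=
  lifts_compress (scalOp_mem (uRed_admissible hq))

omit hq in
lemma lifts_x0 : LiftsScal (x0Op f) (x0Red q f.sig f.kap) :=
  lifts_compress (scalOp_mem x0Red_admissible)

omit hq in
lemma lifts_m (c : ℤ → ℂ) (k : ℤ) : LiftsScal (mOp f c k) (fun _ => mRad c k) :=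
  lifts_compress (scalOp_mem (mRad_admissible c k))

end Admissible

/-- The identities satisfied by the rescaled generators on the unit hyperboloid. -/
structure HatModel (q σ : ℂ) {𝒜 : Type*} [Ring 𝒜] [Algebra ℂ 𝒜] (r s x : E3 → 𝒜) (u x0 : 𝒜) :
    Prop where
  r_x0 (A : E3) : r A * x0 = (q⁻¹ * ((q ^ 4 + 1) / (q ^ 2 + 1))) • (x0 * r A)
    + (q⁻¹ * ((q ^ 2 - 1) / (q ^ 2 + 1))) • cross q x r A - (q / (1 + q ^ 2) ^ 2) • (x A * u)
  s_x0 (A : E3) : s A * x0 = (q⁻¹ * ((q ^ 4 + 1) / (q ^ 2 + 1))) • (x0 * s A)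
    + (q⁻¹ * ((q ^ 2 - 1) / (q ^ 2 + 1))) • cross q x s A
    - (1 / (q * (1 + q ^ 2) ^ 2)) • (x A * u)
  cross_r_x (A : E3) : cross q r x A = (q - 2 / q * (1 + q ^ 4) / (1 + q ^ 2)) • cross q x r A
    - (q⁻¹ * (q ^ 2 - 1) * (1 + q ^ 4) / (1 + q ^ 2)) • (x0 * r A)
    + (q⁻¹ * (1 + q ^ 4) / (1 + q ^ 2) ^ 2) • (x A * u)
  cross_s_x (A : E3) : cross q s x A = (q⁻¹ - 2 / q * (1 + q ^ 4) / (1 + q ^ 2)) • cross q x s A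
    - (q⁻¹ * (q ^ 2 - 1) * (1 + q ^ 4) / (1 + q ^ 2)) • (x0 * s A)
    - (q⁻¹ * (1 + q ^ 4) / (1 + q ^ 2) ^ 2) • (x A * u)
  u_x (A : E3) : u * x A = (q⁻¹ * ((q ^ 4 + 1) / (q ^ 2 + 1))) • (x A * u)
    - (q * (q ^ 2 - 1) ^ 2) • (x0 * r A) - (q⁻¹ * (q ^ 2 - 1) ^ 2) • cross q x r A
  cross_x_x (A : E3) : cross q x x A = (1 - q ^ 2) • (x0 * x A)
  x0_x (A : E3) : x0 * x A = x A * x0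
  x0_u_x (A : E3) : x0 * (u * x A) = (1 / (q + q⁻¹)) • (u * (x0 * x A) + x0 * x A * u)
    + (σ * (q - q⁻¹) ^ 2 * q) • (q ^ 2 • r A + s A)
  x_u_x0 (A : E3) : x A * (u * x0) = (1 / (q + q⁻¹)) • (u * (x0 * x A) + x0 * x A * u)
    - (σ * (q - q⁻¹) ^ 2 * q) • (r A + q ^ 2 • s A)
  cross_x_u_x (A : E3) : cross q x (fun B => u * x B) A =
    ((1 - q ^ 2) / (q + q⁻¹)) • (u * (x0 * x A) + x0 * x A * u)
    - (σ * (q - q⁻¹) ^ 2 * q * (1 + q ^ 4)) • (r A - s A)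
  quint_r_x (k : E5) : quint q r x k = q • quint q x r k
  quint_s_x (k : E5) : quint q s x k = q⁻¹ • quint q x s k
  quint_x_u_x (k : E5) : quint q x (fun B => u * x B) k = (1 / (q + q⁻¹)) •
    (quint q (fun B => u * x B) x k + quint q x (fun B => x B * u) k)
  dot_r_x : dot q r x =
    (q - q⁻¹ * (q ^ 2 - 1) * (q ^ 2 + 1 + (q ^ 2)⁻¹) / (1 + q ^ 2)) • dot q x r
    - (q⁻¹ * (q ^ 2 + 1 + (q ^ 2)⁻¹) / (1 + q ^ 2) ^ 2) • (x0 * u)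
  dot_s_x : dot q s x =
    (q⁻¹ + q * (q ^ 2 - 1) * (q ^ 2 + 1 + (q ^ 2)⁻¹) / (1 + q ^ 2)) • dot q x s
    - (q * (q ^ 2 + 1 + (q ^ 2)⁻¹) / (1 + q ^ 2) ^ 2) • (x0 * u)
  u_x0 : u * x0 = (q⁻¹ * ((q ^ 4 + 1) / (q ^ 2 + 1))) • (x0 * u)
    - (q⁻¹ * (q ^ 2 - 1) ^ 2) • dot q x r
  dot_x_x : dot q x x = x0 * x0 + (σ * (q + q⁻¹) ^ 2) • (1 : 𝒜)
  x0_u_x0 : x0 * u * x0 = (1 / (q + q⁻¹)) • (u * x0 * x0 + x0 * x0 * u)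
    - (σ * (q - q⁻¹) ^ 2 / (q + q⁻¹)) • u
  dot_x_u_x : dot q x (fun B => u * x B) = (1 / (q + q⁻¹)) • (u * x0 * x0 + x0 * x0 * u)
    + (σ * (2 * (q + q⁻¹) + (q - q⁻¹) ^ 2 * (q ^ 2 + 1 + (q ^ 2)⁻¹) / (q + q⁻¹))) • u
  serre (A : E3) : u * (u * x A) + x A * u * u = (q + q⁻¹) • (u * x A * u) - (q - q⁻¹) ^ 2 • x A
  u_r (A : E3) : u * r A = r A * u
  u_s (A : E3) : u * s A = s A * u
  cross_r_r (A : E3) : cross q r r A = (1 / (1 + q ^ 2)) • (u * r A)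
  cross_s_s (A : E3) : cross q s s A = -((1 / (1 + q ^ 2)) • (u * s A))
  cross_r_s (A : E3) : cross q r s A = -((q ^ 2)⁻¹ • cross q s r A)
  quint_r_s (k : E5) : quint q r s k = q ^ 2 • quint q s r k
  serre_zero : u * u * x0 + x0 * u * u = (q + q⁻¹) • (u * x0 * u) - (q - q⁻¹) ^ 2 • x0
  dot_r_s : dot q r s = (q ^ 4)⁻¹ • dot q s r
  u_u : u * u = (q + q⁻¹) ^ 2 • (1 : 𝒜)
    + (1 / 2 * (q ^ 4 - 1) ^ 2) • (dot q r r + dot q s s)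

lemma LiftsVec.neg {Y : E3 → Module.End ℂ (Space f)} {y : RedVec} (h : LiftsVec Y y) :
    LiftsVec (-Y) (-y) := by
  have e : -Y = (-1 : ℂ) • Y := by
    funext A; simp only [Pi.neg_apply, Pi.smul_apply]; module
  have e' : -y = (-1 : ℂ) • y := by
    funext A j; simp only [Pi.neg_apply, Pi.smul_apply]; module
  rw [e, e']
  exact h.smul (-1)

-- Both sides of each identity are scalar, vector or spin-two operators. The calculus of `Lifts`
-- finds their reduced forms, and these agree on the radial labels that occur by the identities for
-- reduced elements.
set_option maxHeartbeats 1000000 in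
theorem hatModel (hq : 1 < q) (f : Family q) :
    HatModel q f.sig (rOp f) (sOp f) (xOp f) (uOp f) (x0Op f) := by
  have h0 : (q : ℂ) ≠ 0 := by exact_mod_cast (show q ≠ 0 by linarith)
  have h1 : (q : ℂ) ^ 2 - 1 ≠ 0 := by
    have : q ^ 2 - 1 ≠ 0 := by nlinarith
    exact_mod_cast this
  have h2 : (q : ℂ) ^ 2 + 1 ≠ 0 := by
    have : q ^ 2 + 1 ≠ 0 := by positivity
    exact_mod_cast this
  have R := lifts_r f h0
  have S := lifts_s f h0
  have X := lifts_x f h0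
  have U := lifts_u f h0
  have X0 := lifts_x0 f
  have V := fun (Δ : Step) (j n M : ℤ) (hj : 0 ≤ j) (hn : f.RadOccurs j n) =>
    coordinate_vector_identities (M := M) (regular_of_occurs hq f hj hn) Δ
  have Q := fun (i : Fin 5) (j n M : ℤ) (hj : 0 ≤ j) (hn : f.RadOccurs j n) =>
    coordinate_quint_identities (M := M) (regular_of_occurs hq f hj hn) i
  have T := fun (j n M : ℤ) (hj : 0 ≤ j) (hn : f.RadOccurs j n) =>
    coordinate_scalar_identities (M := M) (regular_of_occurs hq f hj hn)
  -- The exceptional state has `j = 0`, so the condition `Δ = .up ∨ j ≠ 0` leaves there only the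
  -- step `up`.
  have V' := fun (Δ : Step) (j n M : ℤ) (hj : 0 ≤ j) (hn : f.RadOccurs j n)
      (e : Δ = .up ∨ j ≠ 0) =>
    lorentz_vector_identities (M := M) (regular_of_occurs hq f hj hn) Δ
      ((exceptional_of_occurs hq f hj hn).imp_right fun h => ⟨e.resolve_right (· h.1), h.2⟩)
  have Q' := fun (i : Fin 5) (j n M : ℤ) (hj : 0 ≤ j) (hn : f.RadOccurs j n)
      (e : i = 0 ∨ j ≠ 0) =>
    lorentz_quint_identities (M := M) (regular_of_occurs hq f hj hn) i
      ((exceptional_of_occurs hq f hj hn).imp_right fun h => ⟨e.resolve_right (· h.1), h.2⟩)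
  have T' := fun (j n M : ℤ) (hj : 0 ≤ j) (hn : f.RadOccurs j n) =>
    lorentz_scalar_identities (M := M) (regular_of_occurs hq f hj hn)
      ((exceptional_of_occurs hq f hj hn).imp_right fun h => h.2)
  constructor
  · exact LiftsVec.ext h0 h2 (R.mul_scal X0) ((((X0.mul_vec R).smul _).add
      ((X.cross h0 h1 h2 R).smul _)).sub ((X.mul_scal U).smul _))
      fun Δ j n M hj hn _ => (V Δ j n M hj hn).1
  · exact LiftsVec.ext h0 h2 (S.mul_scal X0) ((((X0.mul_vec S).smul _).add
      ((X.cross h0 h1 h2 S).smul _)).sub ((X.mul_scal U).smul _))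
      fun Δ j n M hj hn _ => (V Δ j n M hj hn).2.1
  · exact LiftsVec.ext h0 h2 (R.cross h0 h1 h2 X) ((((X.cross h0 h1 h2 R).smul _).sub
      ((X0.mul_vec R).smul _)).add ((X.mul_scal U).smul _))
      fun Δ j n M hj hn _ => (V Δ j n M hj hn).2.2.1
  · exact LiftsVec.ext h0 h2 (S.cross h0 h1 h2 X) ((((X.cross h0 h1 h2 S).smul _).sub
      ((X0.mul_vec S).smul _)).sub ((X.mul_scal U).smul _))
      fun Δ j n M hj hn _ => (V Δ j n M hj hn).2.2.2.1
  · exact LiftsVec.ext h0 h2 (U.mul_vec X) ((((X.mul_scal U).smul _).sub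
      ((X0.mul_vec R).smul _)).sub ((X.cross h0 h1 h2 R).smul _))
      fun Δ j n M hj hn _ => (V Δ j n M hj hn).2.2.2.2.1
  · exact LiftsVec.ext h0 h2 (X.cross h0 h1 h2 X) ((X0.mul_vec X).smul _)
      fun Δ j n M hj hn _ => (V Δ j n M hj hn).2.2.2.2.2.1
  · exact LiftsVec.ext h0 h2 (X0.mul_vec X) (X.mul_scal X0)
      fun Δ j n M hj hn _ => (V Δ j n M hj hn).2.2.2.2.2.2.1
  · exact LiftsVec.ext h0 h2 (X0.mul_vec (U.mul_vec X)) ((((U.mul_vec (X0.mul_vec X)).add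
      ((X0.mul_vec X).mul_scal U)).smul _).add (((R.smul _).add S).smul _))
      fun Δ j n M hj hn _ => (V Δ j n M hj hn).2.2.2.2.2.2.2.1
  · exact LiftsVec.ext h0 h2 (X.mul_scal (U.mul X0)) ((((U.mul_vec (X0.mul_vec X)).add
      ((X0.mul_vec X).mul_scal U)).smul _).sub ((R.add (S.smul _)).smul _))
      fun Δ j n M hj hn _ => (V Δ j n M hj hn).2.2.2.2.2.2.2.2.1
  · exact LiftsVec.ext h0 h2 (X.cross h0 h1 h2 (U.mul_vec X)) ((((U.mul_vec (X0.mul_vec X)).add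
      ((X0.mul_vec X).mul_scal U)).smul _).sub ((R.sub S).smul _))
      fun Δ j n M hj hn _ => (V Δ j n M hj hn).2.2.2.2.2.2.2.2.2
  · exact LiftsQuint.ext h0 h2 (R.quint h0 h1 h2 X) ((X.quint h0 h1 h2 R).smul _)
      fun i j n M hj hn _ => (Q i j n M hj hn).1
  · exact LiftsQuint.ext h0 h2 (S.quint h0 h1 h2 X) ((X.quint h0 h1 h2 S).smul _)
      fun i j n M hj hn _ => (Q i j n M hj hn).2.1
  · exact LiftsQuint.ext h0 h2 (X.quint h0 h1 h2 (U.mul_vec X))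
      ((((U.mul_vec X).quint h0 h1 h2 X).add (X.quint h0 h1 h2 (X.mul_scal U))).smul _)
      fun i j n M hj hn _ => (Q i j n M hj hn).2.2
  · exact LiftsScal.ext (R.dot h0 h1 h2 X) (((X.dot h0 h1 h2 R).smul _).sub ((X0.mul U).smul _))
      fun j n M hj hn => (T j n M hj hn).1
  · exact LiftsScal.ext (S.dot h0 h1 h2 X) (((X.dot h0 h1 h2 S).smul _).sub ((X0.mul U).smul _))
      fun j n M hj hn => (T j n M hj hn).2.1
  · exact LiftsScal.ext (U.mul X0) (((X0.mul U).smul _).sub ((X.dot h0 h1 h2 R).smul _))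
      fun j n M hj hn => (T j n M hj hn).2.2.1
  · exact LiftsScal.ext (X.dot h0 h1 h2 X) ((X0.mul X0).add (LiftsScal.one.smul _))
      fun j n M hj hn => (T j n M hj hn).2.2.2.1
  · exact LiftsScal.ext ((X0.mul U).mul X0) (((((U.mul X0).mul X0).add
      ((X0.mul X0).mul U)).smul _).sub (U.smul _))
      fun j n M hj hn => (T j n M hj hn).2.2.2.2.1
  · exact LiftsScal.ext (X.dot h0 h1 h2 (U.mul_vec X)) (((((U.mul X0).mul X0).add
      ((X0.mul X0).mul U)).smul _).add (U.smul _))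
      fun j n M hj hn => (T j n M hj hn).2.2.2.2.2
  · exact LiftsVec.ext h0 h2 ((U.mul_vec (U.mul_vec X)).add ((X.mul_scal U).mul_scal U))
      ((((U.mul_vec X).mul_scal U).smul _).sub (X.smul _))
      fun Δ j n M hj hn e => (V' Δ j n M hj hn e).1
  · exact LiftsVec.ext h0 h2 (U.mul_vec R) (R.mul_scal U)
      fun Δ j n M hj hn e => (V' Δ j n M hj hn e).2.1
  · exact LiftsVec.ext h0 h2 (U.mul_vec S) (S.mul_scal U)
      fun Δ j n M hj hn e => (V' Δ j n M hj hn e).2.2.1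
  · exact LiftsVec.ext h0 h2 (R.cross h0 h1 h2 R) ((U.mul_vec R).smul _)
      fun Δ j n M hj hn e => (V' Δ j n M hj hn e).2.2.2.1
  · exact LiftsVec.ext h0 h2 (S.cross h0 h1 h2 S) (((U.mul_vec S).smul _).neg)
      fun Δ j n M hj hn e => (V' Δ j n M hj hn e).2.2.2.2.1
  · exact LiftsVec.ext h0 h2 (R.cross h0 h1 h2 S) (((S.cross h0 h1 h2 R).smul _).neg)
      fun Δ j n M hj hn e => (V' Δ j n M hj hn e).2.2.2.2.2.1
  · exact LiftsQuint.ext h0 h2 (R.quint h0 h1 h2 S) ((S.quint h0 h1 h2 R).smul _)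
      fun i j n M hj hn e => Q' i j n M hj hn e
  · exact LiftsScal.ext (((U.mul U).mul X0).add ((X0.mul U).mul U))
      ((((U.mul X0).mul U).smul _).sub (X0.smul _))
      fun j n M hj hn => (T' j n M hj hn).1
  · exact LiftsScal.ext (R.dot h0 h1 h2 S) ((S.dot h0 h1 h2 R).smul _)
      fun j n M hj hn => (T' j n M hj hn).2.1
  · exact LiftsScal.ext (U.mul U) ((LiftsScal.one.smul _).add
      (((R.dot h0 h1 h2 R).add (S.dot h0 h1 h2 S)).smul _))
      fun j n M hj hn => (T' j n M hj hn).2.2.1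

end

end QMink

namespace QMink

noncomputable section

/-! ## The relations from their scalar, vector and spin-two parts -/

section Tensor

variable {𝒜 : Type*} [Ring 𝒜] [Algebra ℂ 𝒜]

/-- The trace of a tensor. -/
def dotT (q : ℂ) (Z : E3 → E3 → 𝒜) : 𝒜 := ∑ A, ∑ B, g q A B • Z A B

/-- The vector part of a tensor. -/
def crossT (q : ℂ) (Z : E3 → E3 → 𝒜) (A : E3) : 𝒜 := ∑ C, ∑ B, eps q C B A • Z B C

/-- The spin-two part of a tensor. -/
def quintT (q : ℂ) (Z : E3 → E3 → 𝒜) : E5 → 𝒜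
  | .mm => Z .minus .minus
  | .m3 => q ^ 2 • Z .minus .three + Z .three .minus
  | .zero => Z .plus .minus + q ^ 4 • Z .minus .plus + (q + q ^ 3) • Z .three .three
  | .p3 => Z .plus .three + q ^ 2 • Z .three .plus
  | .pp => Z .plus .plus

lemma quint_eq (q : ℂ) (x y : E3 → 𝒜) : quint q x y = quintT q fun A B => x A * y B := by
  funext k; cases k <;> rfl

/-- The numbers that have to be non-zero. -/
structure Generic (q : ℂ) : Prop where
  q0 : q ≠ 0
  q1 : q ^ 2 - 1 ≠ 0
  q2 : q ^ 2 + 1 ≠ 0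
  q3 : 1 + q ^ 2 ≠ 0
  q4 : q ^ 4 + 1 ≠ 0
  q5 : 1 + q ^ 2 + q ^ 4 ≠ 0

/-- The `1 + 3 + 5` components of the three parts determine the nine components of a tensor, since
the `q`-Clebsch–Gordan transformation is invertible. For the weights `1` and `-1` this needs `q ^ 4
+ 1 ≠ 0`, for the weight `0` also `1 + q ^ 2 + q ^ 4 ≠ 0`. -/
theorem tensor_ext {q : ℂ} (hq : Generic q) {Z W : E3 → E3 → 𝒜} (hd : dotT q Z = dotT q W)
    (hc : ∀ A, crossT q Z A = crossT q W A) (hQ : ∀ k, quintT q Z k = quintT q W k) (A B : E3) :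
    Z A B = W A B := by
  obtain ⟨q0, q1, q2, q3, q4, q5⟩ := hq
  have hp := hc .plus
  have hm := hc .minus
  have h3 := hc .three
  have kmm := hQ .mm
  have km3 := hQ .m3
  have k0 := hQ .zero
  have kp3 := hQ .p3
  have kpp := hQ .pp
  simp only [dotT, crossT, quintT, sum_E3, g, eps, zero_smul, add_zero, zero_add] at *
  have q4' : 1 + q ^ 4 ≠ 0 := by rwa [add_comm]
  -- Eliminating the component `33` between the trace and the spin-two part leaves `1 + q ^ 2 + q ^
  -- 4` times the sum of the components `+-` and `-+`. The third component of the vector part then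
  -- separates these two.
  have ha : Z .plus .minus = W .plus .minus := by
    linear_combination (norm := skip) (1 / (1 + q ^ 4)) • ((1 / (1 + q ^ 2 + q ^ 4)) •
      (k0 - (q + q ^ 3) • hd) - q • h3 + (q * (1 - q ^ 2)) • hd)
    match_scalars <;> field_simp <;> ring
  have hb : Z .minus .plus = W .minus .plus := by
    linear_combination (norm := skip) (1 / (1 + q ^ 2 + q ^ 4)) • (k0 - (q + q ^ 3) • hd) - ha
    match_scalars <;> field_simp <;> ring
  cases A <;> cases B
  · exact kpp
  · exact ha
  · linear_combination (norm := skip) (1 / (q ^ 4 + 1)) • (kp3 - q ^ 2 • hp)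
    match_scalars <;> field_simp <;> ring
  · exact hb
  · exact kmm
  · linear_combination (norm := skip) (1 / (q ^ 4 + 1)) • (q ^ 2 • km3 + hm)
    match_scalars <;> field_simp <;> ring
  · linear_combination (norm := skip) (1 / (q ^ 4 + 1)) • (q ^ 2 • kp3 + hp)
    match_scalars <;> field_simp <;> ring
  · linear_combination (norm := skip) (1 / (q ^ 4 + 1)) • (km3 - q ^ 2 • hm)
    match_scalars <;> field_simp <;> ring
  · linear_combination (norm := skip) hd + q • ha + q⁻¹ • hb
    match_scalars <;> field_simp <;> ring

/-- The relations of a four-vector with the generators `R`, `S`, `U`. -/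
structure IsFourVec (q : ℂ) (R S : E3 → 𝒜) (U y0 : 𝒜) (y : E3 → 𝒜) : Prop where
  r_zero (A : E3) : R A * y0 = (q⁻¹ * ((q ^ 4 + 1) / (q ^ 2 + 1))) • (y0 * R A)
    + (q⁻¹ * ((q ^ 2 - 1) / (q ^ 2 + 1))) • cross q y R A - (q / (1 + q ^ 2) ^ 2) • (y A * U)
  r_vec (A B : E3) : R A * y B = (1 / (1 + q ^ 2)) • ((q * (1 + q ^ 2)) • (y A * R B)
    - (q⁻¹ * (q ^ 2 - 1)) • (∑ C, epsMix q C A B • (y0 * R C))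
    - (q⁻¹ * (q ^ 2 - 1) * g q A B) • dot q y R
    - (2 / q) • (∑ G, ∑ S, ∑ T, (epsUp q A B G * epsLow q S T G) • (y T * R S))
    - (q⁻¹ * (1 / (1 + q ^ 2)) * g q A B) • (y0 * U)
    + (q⁻¹ * (1 / (1 + q ^ 2))) • (∑ M, epsMix q M A B • (y M * U)))
  s_zero (A : E3) : S A * y0 = (q⁻¹ * ((q ^ 4 + 1) / (q ^ 2 + 1))) • (y0 * S A)
    + (q⁻¹ * ((q ^ 2 - 1) / (q ^ 2 + 1))) • cross q y S A
    - (1 / (q * (1 + q ^ 2) ^ 2)) • (y A * U)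
  s_vec (A B : E3) : S A * y B = (1 / (1 + q ^ 2)) • ((q⁻¹ * (1 + q ^ 2)) • (y A * S B)
    - (q⁻¹ * (q ^ 2 - 1)) • (∑ C, epsMix q C A B • (y0 * S C))
    + (q * (q ^ 2 - 1) * g q A B) • dot q y S
    - (2 / q) • (∑ G, ∑ K, ∑ T, (epsUp q A B G * epsLow q K T G) • (y T * S K))
    - (q / (1 + q ^ 2) * g q A B) • (y0 * U)
    - (q⁻¹ * (1 / (1 + q ^ 2))) • (∑ M, epsMix q M A B • (y M * U)))
  u_zero : U * y0 = (q⁻¹ * ((q ^ 4 + 1) / (q ^ 2 + 1))) • (y0 * U)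
    - (q⁻¹ * (q ^ 2 - 1) ^ 2) • dot q y R
  u_vec (A : E3) : U * y A = (q⁻¹ * ((q ^ 4 + 1) / (q ^ 2 + 1))) • (y A * U)
    - (q * (q ^ 2 - 1) ^ 2) • (y0 * R A) - (q⁻¹ * (q ^ 2 - 1) ^ 2) • cross q y R A

-- Only the relations for `r A * x B` and `s A * x B` are not literally contained in `HatModel`.
-- They are tensor equations, and their scalar, vector and spin-two parts are.
set_option maxHeartbeats 4000000 in
lemma HatModel.isFourVec {q σ : ℂ} (hq : Generic q) {r s x : E3 → 𝒜} {u x0 : 𝒜}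
    (h : HatModel q σ r s x u x0) : IsFourVec q r s u x0 x where
  r_zero := h.r_x0
  s_zero := h.s_x0
  u_zero := h.u_x0
  u_vec := h.u_x
  r_vec := by
    obtain ⟨q0, q1, q2, q3, q4, q5⟩ := id hq
    refine tensor_ext hq (Z := fun A B => r A * x B) ?_ (fun A => ?_) (fun k => ?_)
    · refine h.dot_r_x.trans ?_
      simp only [dotT, dot, sum_E3, g, eps, epsMix, epsUp, epsLow, zero_smul, add_zero,
        zero_add, mul_zero, zero_mul, smul_zero, sub_zero]
      match_scalars <;> field_simp <;> ring
    · refine (h.cross_r_x A).trans ?_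
      cases A <;>
      simp only [crossT, dot, cross, sum_E3, g, eps, epsMix, epsUp, epsLow, zero_smul, add_zero,
        zero_add, mul_zero, zero_mul, smul_zero, sub_zero] <;>
      match_scalars <;> field_simp <;> ring
    · rw [← quint_eq, h.quint_r_x]
      cases k <;>
      simp only [quintT, quint, dot, sum_E3, g, eps, epsMix, epsUp, epsLow, zero_smul,
        add_zero, zero_add, mul_zero, zero_mul, smul_zero, sub_zero] <;>
      match_scalars <;> field_simp <;> ring
  s_vec := by
    obtain ⟨q0, q1, q2, q3, q4, q5⟩ := id hq
    refine tensor_ext hq (Z := fun A B => s A * x B) ?_ (fun A => ?_) (fun k => ?_)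
    · refine h.dot_s_x.trans ?_
      simp only [dotT, dot, sum_E3, g, eps, epsMix, epsUp, epsLow, zero_smul, add_zero,
        zero_add, mul_zero, zero_mul, smul_zero, sub_zero]
      match_scalars <;> field_simp <;> ring
    · refine (h.cross_s_x A).trans ?_
      cases A <;>
      simp only [crossT, dot, cross, sum_E3, g, eps, epsMix, epsUp, epsLow, zero_smul, add_zero,
        zero_add, mul_zero, zero_mul, smul_zero, sub_zero] <;>
      match_scalars <;> field_simp <;> ring
    · rw [← quint_eq, h.quint_s_x]
      cases k <;>
      simp only [quintT, quint, dot, sum_E3, g, eps, epsMix, epsUp, epsLow, zero_smul,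
        add_zero, zero_add, mul_zero, zero_mul, smul_zero, sub_zero] <;>
      match_scalars <;> field_simp <;> ring

-- On each of the three parts of a tensor the matrix `q ^ 2 • RHat` acts as a number: `(q ^ 4)⁻¹` on
-- the scalar, `-(q ^ 2)⁻¹` on the vector and `q ^ 2` on the spin-two part. These are the factors in
-- `dot_r_s`, `cross_r_s` and `quint_r_s`.
set_option maxHeartbeats 4000000 in
lemma HatModel.r_s {q σ : ℂ} (hq : Generic q) {r s x : E3 → 𝒜} {u x0 : 𝒜}
    (h : HatModel q σ r s x u x0) (A B : E3) :
    r A * s B = q ^ 2 • ∑ C, ∑ D, RHat q A B C D • (s C * r D) := by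
  obtain ⟨q0, q1, q2, q3, q4, q5⟩ := id hq
  revert A B
  refine tensor_ext hq (Z := fun A B => r A * s B) ?_ (fun A => ?_) (fun k => ?_)
  · refine h.dot_r_s.trans ?_
    simp only [dotT, dot, sum_E3, g, eps, epsMix, epsUp, epsLow, RHat, delta, zero_smul,
      add_zero, zero_add, mul_zero, zero_mul, sub_zero, reduceCtorEq, reduceIte]
    match_scalars <;> field_simp <;> ring
  · refine (h.cross_r_s A).trans ?_
    cases A <;>
    simp only [crossT, cross, sum_E3, g, eps, epsMix, epsUp, epsLow, RHat, delta, zero_smul,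
      add_zero, zero_add, mul_zero, zero_mul, sub_zero, reduceCtorEq, reduceIte] <;>
    match_scalars <;> field_simp <;> ring
  · rw [← quint_eq, h.quint_r_s]
    cases k <;>
    simp only [quintT, quint, sum_E3, g, eps, epsMix, epsUp, epsLow, RHat, delta,
      zero_smul, add_zero, zero_add, mul_zero, zero_mul, sub_zero, reduceCtorEq,
      reduceIte] <;>
    match_scalars <;> field_simp <;> ring

end Tensor

end

end QMink

namespace QMink

noncomputable section

/-! ## The momenta -/

section Momenta

variable {𝒜 : Type*} [Ring 𝒜] [Algebra ℂ 𝒜] {q σ : ℂ}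

/-- The four-vector with given time and space components. -/
def four (y0 : 𝒜) (y : E3 → 𝒜) : M4 → 𝒜
  | none => y0
  | some A => y A

/-- Every term of the relations contains exactly one of `R`, `S`, `U`. -/
lemma IsFourVec.scale {R S : E3 → 𝒜} {U y0 : 𝒜} {y : E3 → 𝒜} (h : IsFourVec q R S U y0 y)
    (c : ℂ) : IsFourVec q (fun A => c • R A) (fun A => c • S A) (c • U) y0 y := by
  constructor
  on_goal 1 => intro A; have e := congrArg (c • ·) (h.r_zero A)
  on_goal 2 => intro A B; have e := congrArg (c • ·) (h.r_vec A B)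
  on_goal 3 => intro A; have e := congrArg (c • ·) (h.s_zero A)
  on_goal 4 => intro A B; have e := congrArg (c • ·) (h.s_vec A B)
  on_goal 5 => have e := congrArg (c • ·) h.u_zero
  on_goal 6 => intro A; have e := congrArg (c • ·) (h.u_vec A)
  all_goals
    simp only [dot, cross, smul_add, smul_sub, Finset.smul_sum, smul_mul_assoc, mul_smul_comm,
      smul_comm c] at e ⊢
    exact e

lemma IsFourVec.add {R S : E3 → 𝒜} {U y0 z0 : 𝒜} {y z : E3 → 𝒜} (h : IsFourVec q R S U y0 y)
    (h' : IsFourVec q R S U z0 z) : IsFourVec q R S U (y0 + z0) (fun A => y A + z A) := by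
  constructor
  on_goal 1 => intro A; have e := congrArg₂ (· + ·) (h.r_zero A) (h'.r_zero A)
  on_goal 2 => intro A B; have e := congrArg₂ (· + ·) (h.r_vec A B) (h'.r_vec A B)
  on_goal 3 => intro A; have e := congrArg₂ (· + ·) (h.s_zero A) (h'.s_zero A)
  on_goal 4 => intro A B; have e := congrArg₂ (· + ·) (h.s_vec A B) (h'.s_vec A B)
  on_goal 5 => have e := congrArg₂ (· + ·) h.u_zero h'.u_zero
  on_goal 6 => intro A; have e := congrArg₂ (· + ·) (h.u_vec A) (h'.u_vec A)
  all_goals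
    simp only [dot, cross, mul_add, add_mul, smul_add, smul_sub, Finset.sum_add_distrib] at e ⊢
    rw [e]
    abel

/-- Factors that commute with `R`, `S`, `U` can be pulled out on either side. Together with
additivity this makes sums of terms `a * y * b` four-vectors, which is how the momenta inherit these
relations from the coordinates. -/
lemma IsFourVec.mul {R S : E3 → 𝒜} {U y0 : 𝒜} {y : E3 → 𝒜} (h : IsFourVec q R S U y0 y)
    {a b : 𝒜} (aR : ∀ A, a * R A = R A * a) (aS : ∀ A, a * S A = S A * a) (aU : a * U = U * a)
    (bR : ∀ A, b * R A = R A * b) (bS : ∀ A, b * S A = S A * b) (bU : b * U = U * b) :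
    IsFourVec q R S U (a * y0 * b) (fun A => a * y A * b) := by
  have aR' : ∀ A z, R A * (a * z) = a * (R A * z) := fun A z => by
    rw [← mul_assoc, ← aR, mul_assoc]
  have aS' : ∀ A z, S A * (a * z) = a * (S A * z) := fun A z => by
    rw [← mul_assoc, ← aS, mul_assoc]
  have aU' : ∀ z, U * (a * z) = a * (U * z) := fun z => by rw [← mul_assoc, ← aU, mul_assoc]
  constructor
  on_goal 1 => intro A; have e := congrArg (a * · * b) (h.r_zero A)
  on_goal 2 => intro A B; have e := congrArg (a * · * b) (h.r_vec A B)
  on_goal 3 => intro A; have e := congrArg (a * · * b) (h.s_zero A)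
  on_goal 4 => intro A B; have e := congrArg (a * · * b) (h.s_vec A B)
  on_goal 5 => have e := congrArg (a * · * b) h.u_zero
  on_goal 6 => intro A; have e := congrArg (a * · * b) (h.u_vec A)
  all_goals
    simp only [dot, cross, mul_add, add_mul, mul_sub, sub_mul, Finset.mul_sum, Finset.sum_mul,
      smul_mul_assoc, mul_smul_comm, mul_assoc, aR', aS', aU', bR, bS, bU] at e ⊢
    exact e

/-- A bilinear expression in the momenta. -/
theorem bilinear_momenta (c : M4 → M4 → ℂ) (X : M4 → 𝒜) (u K : 𝒜) (s t α β : ℂ)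
    (hc : ∑ a, ∑ b, c a b • (X a * X b) = 0) (hK : ∑ a, ∑ b, c a b • (X a * (u * X b)) = K)
    (hu : u * K = K * u)
    (serre : ∀ a, u * (u * X a) + X a * u * u = t • (u * X a * u) - s • X a) :
    ∑ a, ∑ b, c a b • ((X a * u - α • (u * X a)) * (X b * u - β • (u * X b))) =
      (1 + α * β - β * t) • (K * u) := by
  have e : ∀ a b, (X a * u - α • (u * X a)) * (X b * u - β • (u * X b)) =
      (1 - β * t) • ((X a * (u * X b)) * u) + (α * β) • (u * (X a * (u * X b)))
        + β • ((X a * X b) * (u * u)) + (β * s) • (X a * X b) - α • (u * (X a * X b) * u) := by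
    intro a b
    -- The expansion contains one product with two factors `u` between `X a` and `X b`. The Serre
    -- relation reduces it to products in which at most one `u` stands between them.
    have hs : u * (u * X b) = t • (u * X b * u) - s • X b - X b * u * u :=
      eq_sub_of_add_eq (serre b)
    simp only [sub_mul, mul_sub, smul_mul_assoc, mul_smul_comm, mul_assoc] at hs ⊢
    rw [hs]
    simp only [mul_sub, mul_smul_comm]
    module
  have s1 : ∀ z, ∑ a, ∑ b, c a b • ((X a * X b) * z) = 0 := fun z => by
    rw [← zero_mul z, ← hc]; simp only [Finset.sum_mul, smul_mul_assoc]
  have s2 : ∑ a, ∑ b, c a b • (u * (X a * X b) * u) = 0 := by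
    have : u * 0 * u = 0 := by simp
    rw [← this, ← hc]; simp only [Finset.sum_mul, Finset.mul_sum, smul_mul_assoc, mul_smul_comm]
  have s3 : ∑ a, ∑ b, c a b • ((X a * (u * X b)) * u) = K * u := by
    rw [← hK]; simp only [Finset.sum_mul, smul_mul_assoc]
  have s4 : ∑ a, ∑ b, c a b • (u * (X a * (u * X b))) = u * K := by
    rw [← hK]; simp only [Finset.mul_sum, mul_smul_comm]
  have s5 := hc
  have comm : ∀ (z : M4 → M4 → 𝒜) (k : ℂ), ∑ a, ∑ b, c a b • (k • z a b) =
      k • ∑ a, ∑ b, c a b • z a b := fun z k => by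
    simp only [Finset.smul_sum, smul_comm k]
  simp only [e, smul_add, smul_sub, Finset.sum_add_distrib, Finset.sum_sub_distrib]
  rw [comm, comm, comm, comm, comm, s1, s2, s3, s4, s5, hu]
  module

/-- The momenta, in terms of the rescaled generators and operators that change the length. -/
def momentum (q : ℂ) (gp gm u : 𝒜) (X : M4 → 𝒜) (a : M4) : 𝒜 :=
  gp * (X a * u - q • (u * X a)) + gm * (X a * u - q⁻¹ • (u * X a))

/-- The factor `1 + α β - β (q + q⁻¹)` of `bilinear_momenta` vanishes for `α = β = q` and for `α = β
= q⁻¹`, the roots of `z² - (q + q⁻¹) z + 1`. The two mixed terms have the factors `1 - q⁻²` and `1 -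
q ^ 2`, and they cancel because `gp * gm = q ^ 2 • (gm * gp)`. -/
lemma momentum_bilinear_zero (hq : Generic q) (c : M4 → M4 → ℂ) (X : M4 → 𝒜) (u K gp gm : 𝒜)
    (s : ℂ) (hc : ∑ a, ∑ b, c a b • (X a * X b) = 0)
    (hK : ∑ a, ∑ b, c a b • (X a * (u * X b)) = K) (hu : u * K = K * u)
    (serre : ∀ a, u * (u * X a) + X a * u * u = (q + q⁻¹) • (u * X a * u) - s • X a)
    (pu : gp * u = u * gp) (mu : gm * u = u * gm) (pX : ∀ a, gp * X a = X a * gp)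
    (mX : ∀ a, gm * X a = X a * gm) (pm : gp * gm = q ^ 2 • (gm * gp)) :
    ∑ a, ∑ b, c a b • (momentum q gp gm u X a * momentum q gp gm u X b) = 0 := by
  have q0 := hq.q0
  obtain ⟨Y, hY⟩ : ∃ Y : ℂ → M4 → 𝒜, Y = fun α a => X a * u - α • (u * X a) := ⟨_, rfl⟩
  have key : ∀ α β, ∑ a, ∑ b, c a b • (Y α a * Y β b) =
      (1 + α * β - β * (q + q⁻¹)) • (K * u) := fun α β => by
    rw [hY]; exact bilinear_momenta c X u K s _ α β hc hK hu serre
  have comm : ∀ {z : 𝒜}, z * u = u * z → (∀ a, z * X a = X a * z) →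
      ∀ α a, Y α a * z = z * Y α a := fun {z} hu hX α a => by
    have h1 : Commute z u := hu
    have h2 : Commute z (X a) := hX a
    rw [hY]
    exact ((h2.mul_right h1).sub_right ((h1.mul_right h2).smul_right α)).eq.symm
  have hp := comm pu pX
  have hm := comm mu mX
  have e : ∀ a b, momentum q gp gm u X a * momentum q gp gm u X b =
      gp * gp * (Y q a * Y q b) + gm * gm * (Y q⁻¹ a * Y q⁻¹ b)
        + q ^ 2 • (gm * gp * (Y q a * Y q⁻¹ b)) + gm * gp * (Y q⁻¹ a * Y q b) := by
    intro a b
    have h1 : ∀ α β, gp * Y α a * (gp * Y β b) = gp * gp * (Y α a * Y β b) := fun α β => by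
      rw [mul_assoc, ← mul_assoc (Y α a), hp]; simp only [mul_assoc]
    have h2 : ∀ α β, gm * Y α a * (gm * Y β b) = gm * gm * (Y α a * Y β b) := fun α β => by
      rw [mul_assoc, ← mul_assoc (Y α a), hm]; simp only [mul_assoc]
    have h3 : ∀ α β, gp * Y α a * (gm * Y β b) = q ^ 2 • (gm * gp * (Y α a * Y β b)) :=
      fun α β => by
        rw [mul_assoc, ← mul_assoc (Y α a), hm, mul_assoc gm, ← mul_assoc gp, pm, smul_mul_assoc]
    have h4 : ∀ α β, gm * Y α a * (gp * Y β b) = gm * gp * (Y α a * Y β b) := fun α β => by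
      rw [mul_assoc, ← mul_assoc (Y α a), hp]; simp only [mul_assoc]
    have hP : ∀ a, momentum q gp gm u X a = gp * Y q a + gm * Y q⁻¹ a := fun a => by
      rw [hY, momentum]
    rw [hP, hP, add_mul, mul_add, mul_add, h1, h2, h3, h4]
    abel
  have lin : ∀ (z : 𝒜) (w : M4 → M4 → 𝒜), ∑ a, ∑ b, c a b • (z * w a b) =
      z * ∑ a, ∑ b, c a b • w a b := fun z w => by
    simp only [Finset.mul_sum, mul_smul_comm]
  have lin' : ∀ (k : ℂ) (w : M4 → M4 → 𝒜), ∑ a, ∑ b, c a b • (k • w a b) =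
      k • ∑ a, ∑ b, c a b • w a b := fun z w => by
    simp only [Finset.smul_sum, smul_comm z]
  simp only [e, smul_add, Finset.sum_add_distrib]
  rw [lin', lin, lin, lin, lin, key, key, key, key]
  simp only [mul_smul_comm]
  match_scalars <;> field_simp <;> ring

/-- Both relations are contractions of the tensor of two momenta that vanish on the coordinates.
Contracting the tensor with `u` in the middle, the terms with `u` outside cancel and a combination
of `r A` and `s A` remains, which commutes with `u`. So `momentum_bilinear_zero` applies. -/
lemma HatModel.time_space {r s x : E3 → 𝒜} {u x0 : 𝒜} (h : HatModel q σ r s x u x0) (A : E3)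
    {gp gm : 𝒜} (hq : Generic q) (pu : gp * u = u * gp) (mu : gm * u = u * gm)
    (pX : ∀ a, gp * four x0 x a = four x0 x a * gp)
    (mX : ∀ a, gm * four x0 x a = four x0 x a * gm) (pm : gp * gm = q ^ 2 • (gm * gp)) :
    momentum q gp gm u (four x0 x) none * momentum q gp gm u (four x0 x) (some A) =
      momentum q gp gm u (four x0 x) (some A) * momentum q gp gm u (four x0 x) none ∧
    cross q (fun B => momentum q gp gm u (four x0 x) (some B))
        (fun B => momentum q gp gm u (four x0 x) (some B)) A =
      (1 - q ^ 2) •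
        (momentum q gp gm u (four x0 x) none * momentum q gp gm u (four x0 x) (some A)) := by
  have serre : ∀ a, u * (u * four x0 x a) + four x0 x a * u * u =
      (q + q⁻¹) • (u * four x0 x a * u) - (q - q⁻¹) ^ 2 • four x0 x a := by
    rintro (_ | B)
    · simpa only [four, mul_assoc] using h.serre_zero
    · exact h.serre B
  have dl : ∀ (z : E3 → 𝒜), ∑ B, delta A B • z B = z A := fun z => by
    simp [delta, ite_smul, Finset.sum_ite_eq]
  have dr : ∀ (z : E3 → 𝒜), ∑ B, delta B A • z B = z A := fun z => by
    simp [delta, ite_smul]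
  constructor
  · let c : M4 → M4 → ℂ
      | none, some B => delta A B
      | some B, none => -delta A B
      | _, _ => 0
    have hc : ∀ T : M4 → M4 → 𝒜, ∑ a, ∑ b, c a b • T a b =
        T none (some A) - T (some A) none := fun T => by
      simp [Fintype.sum_option, c, Finset.sum_neg_distrib, dl, sub_eq_add_neg]
    have := momentum_bilinear_zero hq c (four x0 x) u _ gp gm _ ?_ rfl ?_ serre pu mu pX mX pm
    · rw [hc] at this; exact sub_eq_zero.1 this
    · rw [hc]; exact sub_eq_zero.2 (h.x0_x A)
    · rw [hc]
      simp only [four]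
      rw [h.x0_u_x, h.x_u_x0]
      simp only [mul_add, add_mul, mul_sub, sub_mul, mul_smul_comm, smul_mul_assoc, h.u_r, h.u_s,
        mul_assoc]
      abel
  · let c : M4 → M4 → ℂ
      | none, some B => -(1 - q ^ 2) * delta A B
      | some B, some C => eps q C B A
      | _, _ => 0
    have hc : ∀ T : M4 → M4 → 𝒜, ∑ a, ∑ b, c a b • T a b =
        ∑ C, ∑ B, eps q C B A • T (some B) (some C) - (1 - q ^ 2) • T none (some A) := fun T => by
      simp only [Fintype.sum_option, c, zero_smul, zero_add, mul_smul, ← Finset.smul_sum, dl]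
      rw [Finset.sum_comm]
      module
    have := momentum_bilinear_zero hq c (four x0 x) u _ gp gm _ ?_ rfl ?_ serre pu mu pX mX pm
    · rw [hc] at this; exact sub_eq_zero.1 this
    · rw [hc]; exact sub_eq_zero.2 (h.cross_x_x A)
    · rw [hc]
      have e : ∑ C, ∑ B, eps q C B A • (four x0 x (some B) * (u * four x0 x (some C))) =
          cross q x (fun B => u * x B) A := rfl
      rw [e, h.cross_x_u_x]
      simp only [four]
      rw [h.x0_u_x]
      simp only [mul_add, add_mul, mul_sub, sub_mul, mul_smul_comm, smul_mul_assoc, h.u_r, h.u_s,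
        mul_assoc, smul_add, smul_sub]
      module

end Momenta

end

end QMink

namespace QMink

noncomputable section

/-! ## The Heisenberg relations -/

section Heisenberg

variable {𝒜 : Type*} [Ring 𝒜] [Algebra ℂ 𝒜] {q σ : ℂ}

/-- The embedding of a vector as a selfdual tensor. -/
def selfdualL (q : ℂ) : M4 → M4 → E3 → ℂ
  | some A, none, E => 1 / (1 + q ^ 2) ^ 2 * delta A E
  | none, some B, E => -q ^ 2 / (1 + q ^ 2) ^ 2 * delta B E
  | some A, some B, E => 1 / (1 + q ^ 2) ^ 2 * epsRaise q A B E
  | none, none, _ => 0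

/-- The embedding of a vector as an antiselfdual tensor. -/
def antiselfdualL (q : ℂ) : M4 → M4 → E3 → ℂ
  | some A, none, E => -q ^ 2 / (1 + q ^ 2) ^ 2 * delta A E
  | none, some B, E => 1 / (1 + q ^ 2) ^ 2 * delta B E
  | some A, some B, E => 1 / (1 + q ^ 2) ^ 2 * epsRaise q A B E
  | none, none, _ => 0

/-- The vector that determines the selfdual part of a tensor. -/
def selfdualR (q : ℂ) (T : M4 → M4 → 𝒜) (E : E3) : 𝒜 :=
  q ^ 2 • T (some E) none - T none (some E) + crossT q (fun A B => T (some A) (some B)) E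

/-- The vector that determines the antiselfdual part of a tensor. -/
def antiselfdualR (q : ℂ) (T : M4 → M4 → 𝒜) (E : E3) : 𝒜 :=
  q ^ 2 • T none (some E) - T (some E) none + crossT q (fun A B => T (some A) (some B)) E

/-- The trace of a tensor with the Minkowski metric. -/
def traceT (q : ℂ) (T : M4 → M4 → 𝒜) : 𝒜 := dotT q (fun A B => T (some A) (some B)) - T none none

lemma delta_sum (A : E3) (z : E3 → 𝒜) : ∑ B, delta A B • z B = z A := by
  simp [delta, ite_smul, Finset.sum_ite_eq]


/-- The projector factors through a three-dimensional space: it sees a tensor only through one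
vector, and it embeds this vector again as a selfdual tensor. The same holds for `PMinus`, and
`PTrace` factors through the trace. -/
lemma PPlus_apply (T : M4 → M4 → 𝒜) (a b : M4) :
    ∑ c, ∑ d, PPlus q a b c d • T c d = ∑ E, selfdualL q a b E • selfdualR q T E := by
  have e : ∀ E, selfdualR q T E = q ^ 2 • T (some E) none - T none (some E)
      + ∑ C, ∑ D, eps q D C E • T (some C) (some D) := fun E => by
    rw [selfdualR, crossT, Finset.sum_comm]
  rcases a with _ | A <;> rcases b with _ | B <;>
  simp only [Fintype.sum_option, PPlus, selfdualL, zero_smul, Finset.sum_const_zero,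
    zero_add, mul_smul, ← Finset.smul_sum, delta_sum, e]
  any_goals
    rw [Finset.sum_add_distrib]
    simp only [← Finset.smul_sum, delta_sum]
    module
  simp only [sum_E3]
  module

lemma PMinus_apply (T : M4 → M4 → 𝒜) (a b : M4) :
    ∑ c, ∑ d, PMinus q a b c d • T c d = ∑ E, antiselfdualL q a b E • antiselfdualR q T E := by
  have e : ∀ E, antiselfdualR q T E = q ^ 2 • T none (some E) - T (some E) none
      + ∑ C, ∑ D, eps q D C E • T (some C) (some D) := fun E => by
    rw [antiselfdualR, crossT, Finset.sum_comm]
  rcases a with _ | A <;> rcases b with _ | B <;>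
  simp only [Fintype.sum_option, PMinus, antiselfdualL, zero_smul, Finset.sum_const_zero,
    zero_add, mul_smul, ← Finset.smul_sum, delta_sum, e]
  any_goals
    rw [Finset.sum_add_distrib]
    simp only [← Finset.smul_sum, delta_sum]
    module
  simp only [sum_E3]
  module

lemma PTrace_apply (T : M4 → M4 → 𝒜) (a b : M4) :
    ∑ c, ∑ d, PTrace q a b c d • T c d = (q ^ 2 / (1 + q ^ 2) ^ 2 * eta q a b) • traceT q T := by
  have e : ∀ c d, PTrace q a b c d = q ^ 2 / (1 + q ^ 2) ^ 2 * eta q a b * eta q c d := by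
    rintro (_ | C) (_ | D) <;> rcases a with _ | A <;> rcases b with _ | B <;>
      simp only [PTrace, eta] <;> ring
  simp only [e, mul_smul, ← Finset.smul_sum, traceT, dotT, Fintype.sum_option, eta, zero_smul,
    Finset.sum_const_zero, add_zero, zero_add]
  module

/-- Substituting `1 - P_T - P_+ - P_-` for `P_S` gives `q² + (q⁻² - q²) P_T - (q² + 1) (P_+ + P_-)`.
Hence, besides the tensor itself, only its trace and its selfdual and antiselfdual vectors are
needed. -/
lemma RIIInv_apply (T : M4 → M4 → 𝒜) (a b : M4) :
    ∑ c, ∑ d, RIIInv q a b c d • T c d = q ^ 2 • T a b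
      + (((q ^ 2)⁻¹ - q ^ 2) * (q ^ 2 / (1 + q ^ 2) ^ 2 * eta q a b)) • traceT q T
      - (q ^ 2 + 1) • ((∑ E, selfdualL q a b E • selfdualR q T E)
        + ∑ E, antiselfdualL q a b E • antiselfdualR q T E) := by
  have e : ∑ c, ∑ d, (delta a c * delta b d) • T c d = T a b := by
    simp [delta, ite_smul, Finset.sum_ite_eq]
  rw [← PPlus_apply, ← PMinus_apply, mul_smul, ← PTrace_apply, ← e]
  simp only [RIIInv, PSym, Finset.smul_sum, ← Finset.sum_add_distrib, ← Finset.sum_sub_distrib]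
  refine Finset.sum_congr rfl fun c _ => Finset.sum_congr rfl fun d _ => ?_
  module

/-- The combination of `R` and `S` on the right-hand side of the Heisenberg relations. -/
def lorentzT (q : ℂ) (r s : E3 → 𝒜) : M4 → M4 → 𝒜
  | some A, none => r A + q ^ 2 • s A
  | none, some A => -(q ^ 2 • r A) - s A
  | some A, some B => ∑ C, epsMix q C A B • (r C - s C)
  | none, none => 0

lemma epsRaise_eq (hq : q ≠ 0) (A B C : E3) : epsRaise q A B C = epsMix q C A B := by
  cases A <;> cases B <;> cases C <;>
    simp only [epsRaise, epsMix, epsLow, sum_E3, g, eps, mul_zero, zero_mul, add_zero, zero_add] <;>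
    field_simp

/-- The tensor with `u` between the coordinates is the average of those with `u` outside, up to a
trace term proportional to `u` and a term with the Lorentz generators. For two space indices the
formula is assembled from its scalar, vector and spin-two parts. -/
lemma HatModel.middle_u (hq : Generic q) {r s x : E3 → 𝒜} {u x0 : 𝒜} (h : HatModel q σ r s x u x0)
    (a b : M4) : (q + q⁻¹) • (four x0 x a * (u * four x0 x b)) =
      u * (four x0 x a * four x0 x b) + four x0 x a * four x0 x b * u
      + (σ * (q - q⁻¹) ^ 2 * eta q a b) • u
      - (σ * (q - q⁻¹) ^ 2 * q * (q + q⁻¹)) • lorentzT q r s a b := by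
  have hq' := hq
  obtain ⟨q0, q1, q2, q3, q4, q5⟩ := hq
  have qq : q + q⁻¹ = (q ^ 2 + 1) / q := by field_simp
  rcases a with _ | A <;> rcases b with _ | B <;> simp only [four, lorentzT, eta]
  · have := h.x0_u_x0
    rw [mul_assoc] at this
    rw [this, qq]
    simp only [mul_assoc]
    match_scalars <;> field_simp
  · rw [h.x0_u_x, qq]
    match_scalars <;> field_simp
    ring
  · rw [h.x_u_x0, qq, ← h.x0_x]
    match_scalars <;> field_simp
    ring
  · have key := tensor_ext hq' (Z := fun A B => (q + q⁻¹) • (x A * (u * x B)))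
      (W := fun A B => u * (x A * x B) + x A * x B * u + (σ * (q - q⁻¹) ^ 2 * g q A B) • u
        - (σ * (q - q⁻¹) ^ 2 * q * (q + q⁻¹)) • ∑ C, epsMix q C A B • (r C - s C)) ?_ ?_ ?_
    · exact key A B
    · have d1 := congrArg (u * ·) h.dot_x_x
      have d2 := congrArg (· * u) h.dot_x_x
      have d3 := h.dot_x_u_x
      simp only [dotT, dot, sum_E3, g, epsMix, eps, mul_add, add_mul, mul_smul_comm, smul_mul_assoc,
        mul_one, one_mul, mul_zero, zero_mul, zero_smul, add_zero, zero_add, smul_zero,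
        mul_assoc] at d1 d2 d3 ⊢
      linear_combination (norm := skip) (q + q⁻¹) • d3 - d1 - d2
      rw [qq]
      match_scalars <;> field_simp <;> ring
    · intro A
      have d1 := congrArg (u * ·) (h.cross_x_x A)
      have d2 := congrArg (· * u) (h.cross_x_x A)
      have d3 := h.cross_x_u_x A
      cases A <;>
      · simp only [crossT, cross, sum_E3, g, epsMix, eps, mul_add, add_mul, mul_smul_comm,
          smul_mul_assoc, mul_one, one_mul, mul_zero, zero_mul, zero_smul, add_zero, zero_add,
          smul_zero, mul_assoc] at d1 d2 d3 ⊢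
        linear_combination (norm := skip) (q + q⁻¹) • d3 - d1 - d2
        rw [qq]
        match_scalars <;> field_simp <;> ring
    · intro k
      have d3 := h.quint_x_u_x k
      cases k <;>
      · simp only [quintT, quint, sum_E3, g, epsMix, eps, mul_add,
          mul_one, one_mul, mul_zero, zero_mul, zero_smul, add_zero, zero_add,
          smul_zero, mul_assoc] at d3 ⊢
        linear_combination (norm := skip) (q + q⁻¹) • d3
        rw [qq]
        match_scalars <;> field_simp <;> ring

/-- The condition on `α` means `α = q` or `α = q⁻¹`, the two coefficients in the momenta. The factor
`1 - α / q` on the right vanishes for `α = q`, so only the part of the momenta that lowers `M`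
contributes to the Heisenberg relations. -/
theorem HatModel.heisenberg_aux (hq : Generic q) {r s x : E3 → 𝒜} {u x0 : 𝒜}
    (h : HatModel q σ r s x u x0) {α : ℂ} (hα : 1 + α ^ 2 = α * (q + q⁻¹)) (a b : M4) :
    four x0 x a * (u * four x0 x b) - α • (u * (four x0 x a * four x0 x b))
      - (α / q ^ 2) • ∑ c, ∑ d, RIIInv q a b c d •
        (four x0 x c * four x0 x d * u - α • (four x0 x c * (u * four x0 x d))) =
    (σ * (q - q⁻¹) ^ 2 * (1 - α / q)) •
      (((1 + q ^ 4) / (q ^ 3 * (q ^ 2 - 1)) * eta q a b) • u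
        - (α * (q ^ 2 + 1)) • lorentzT q r s a b) := by
  have q0 := hq.q0
  have q1 := hq.q1
  have q2 := hq.q2
  have q3 := hq.q3
  have qq : q + q⁻¹ = (q ^ 2 + 1) / q := by field_simp
  -- For the tensor to which the braid matrix is applied, the trace is a multiple of `u`, the
  -- selfdual vector a multiple of `r` and the antiselfdual vector a multiple of `s`. The terms with
  -- `u` outside drop out of all three.
  have tr : traceT q (fun c d => four x0 x c * four x0 x d * u
      - α • (four x0 x c * (u * four x0 x d))) =
      (σ * (q + q⁻¹) ^ 2 - α * σ * (q + q⁻¹) * (q ^ 2 + (q ^ 2)⁻¹)) • u := by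
    have e : ∀ y z : E3 → 𝒜, dotT q (fun A B => y A * z B) = dot q y z := fun y z => rfl
    have e' : traceT q (fun c d => four x0 x c * four x0 x d * u
      - α • (four x0 x c * (u * four x0 x d))) = dot q x x * u - x0 * x0 * u
        - α • (dot q x (fun B => u * x B) - x0 * (u * x0)) := by
      simp only [traceT, dotT, dot, four, sum_E3, smul_sub, add_mul, smul_mul_assoc]
      module
    have h0 := h.x0_u_x0
    rw [mul_assoc] at h0
    rw [e', h.dot_x_x, h.dot_x_u_x, h0, add_mul, smul_mul_assoc, one_mul, qq]
    match_scalars <;> field_simp <;> ring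
  have sd : ∀ E, selfdualR q (fun c d => four x0 x c * four x0 x d * u
      - α • (four x0 x c * (u * four x0 x d))) E =
      (α * (σ * (q - q⁻¹) ^ 2 * q * (1 + q ^ 2) ^ 2)) • r E := fun E => by
    have e' : selfdualR q (fun c d => four x0 x c * four x0 x d * u
      - α • (four x0 x c * (u * four x0 x d))) E = q ^ 2 • (x E * x0 * u) - x0 * x E * u
        + cross q x x E * u - α • (q ^ 2 • (x E * (u * x0)) - x0 * (u * x E)
          + cross q x (fun B => u * x B) E) := by
      simp only [selfdualR, crossT, cross, four, sum_E3, smul_sub, add_mul, smul_mul_assoc]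
      module
    rw [e', h.cross_x_x, h.cross_x_u_x, ← h.x0_x, h.x_u_x0, h.x0_u_x, smul_mul_assoc, qq]
    match_scalars <;> field_simp <;> ring
  have asd : ∀ E, antiselfdualR q (fun c d => four x0 x c * four x0 x d * u
      - α • (four x0 x c * (u * four x0 x d))) E =
      -(α * (σ * (q - q⁻¹) ^ 2 * q * (1 + q ^ 2) ^ 2)) • s E := fun E => by
    have e' : antiselfdualR q (fun c d => four x0 x c * four x0 x d * u
      - α • (four x0 x c * (u * four x0 x d))) E = q ^ 2 • (x0 * x E * u) - x E * x0 * u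
        + cross q x x E * u - α • (q ^ 2 • (x0 * (u * x E)) - x E * (u * x0)
          + cross q x (fun B => u * x B) E) := by
      simp only [antiselfdualR, crossT, cross, four, sum_E3, smul_sub, add_mul, smul_mul_assoc]
      module
    rw [e', h.cross_x_x, h.cross_x_u_x, ← h.x0_x, h.x_u_x0, h.x0_u_x, smul_mul_assoc, qq]
    match_scalars <;> field_simp <;> ring
  have tl : (∑ E, selfdualL q a b E • (α * (σ * (q - q⁻¹) ^ 2 * q * (1 + q ^ 2) ^ 2)) • r E)
      + ∑ E, antiselfdualL q a b E • -(α * (σ * (q - q⁻¹) ^ 2 * q * (1 + q ^ 2) ^ 2)) • s E =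
      (α * (σ * (q - q⁻¹) ^ 2 * q)) • lorentzT q r s a b := by
    rcases a with _ | A <;> rcases b with _ | B <;>
      simp only [selfdualL, antiselfdualL, lorentzT, zero_smul, Finset.sum_const_zero, add_zero,
        smul_zero, mul_smul, ← Finset.smul_sum, delta_sum, epsRaise_eq q0]
    · match_scalars <;> field_simp
    · match_scalars <;> field_simp
    · simp only [sum_E3]
      match_scalars <;> field_simp
  rw [RIIInv_apply, tr]
  simp only [sd, asd]
  rw [tl]
  have hm := h.middle_u hq a b
  -- In the terms without projectors the tensor with `u` in the middle has the factor `1 + α ^ 2 = α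
  -- * (q + q⁻¹)`, so that `middle_u` can be applied to it.
  have e : four x0 x a * (u * four x0 x b) - α • (u * (four x0 x a * four x0 x b))
      - (α / q ^ 2) • (q ^ 2 • (four x0 x a * four x0 x b * u
        - α • (four x0 x a * (u * four x0 x b)))) =
      α • ((σ * (q - q⁻¹) ^ 2 * eta q a b) • u
        - (σ * (q - q⁻¹) ^ 2 * q * (q + q⁻¹)) • lorentzT q r s a b) := by
    have : (1 + α ^ 2) • (four x0 x a * (u * four x0 x b)) =
        α • (q + q⁻¹) • (four x0 x a * (u * four x0 x b)) := by rw [hα, mul_smul]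
    rw [hm] at this
    linear_combination (norm := skip) this
    match_scalars <;> field_simp <;> ring
  linear_combination (norm := skip) e
  obtain rfl | rfl : α = q ∨ α = q⁻¹ := by
    have : (α - q) * (α - q⁻¹) = 0 := by
      have : q * q⁻¹ = 1 := mul_inv_cancel₀ q0
      linear_combination hα + this
    rcases mul_eq_zero.1 this with e | e
    · exact .inl (sub_eq_zero.1 e)
    · exact .inr (sub_eq_zero.1 e)
  · match_scalars <;> field_simp <;> ring
  · match_scalars <;> field_simp <;> ring

end Heisenberg

end

end QMink

namespace QMink

noncomputable section

/-! ## The defining relations -/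

section Relations

variable {𝒜 : Type*} [Ring 𝒜] [Algebra ℂ 𝒜] {q σ : ℂ}

/-- The element `z` commutes with all generators on the unit hyperboloid. -/
structure CommutesWith (r s : E3 → 𝒜) (u : 𝒜) (X : M4 → 𝒜) (z : 𝒜) : Prop where
  r (A : E3) : z * r A = r A * z
  s (A : E3) : z * s A = s A * z
  u : z * u = u * z
  x (a : M4) : z * X a = X a * z

/-- The properties of the operators that change or multiply with the length: `μ` is the length,
`gp` and `gm` occur in the momenta, `L` and `Li` are the scaling operator and its inverse. -/
structure LengthOps (q σ : ℂ) (r s : E3 → 𝒜) (u : 𝒜) (X : M4 → 𝒜) (μ gp gm L Li : 𝒜) : Prop where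
  μ_comm : CommutesWith r s u X μ
  gp_comm : CommutesWith r s u X gp
  gm_comm : CommutesWith r s u X gm
  L_comm : CommutesWith r s u X L
  Li_comm : CommutesWith r s u X Li
  gp_gm : gp * gm = q ^ 2 • (gm * gp)
  μ_gp : μ * gp = q • (gp * μ)
  μ_gm : μ * gm = q⁻¹ • (gm * μ)
  L_Li : L * Li = 1
  Li_L : Li * L = 1
  L_μ : L * μ = q⁻¹ • (μ * L)
  L_gp : L * gp = q • (gp * L)
  L_gm : L * gm = q • (gm * L)
  gm_μ : (σ * (q - q⁻¹) ^ 2 / q ^ 5) • (gm * μ) = (-(Complex.I / 2) / (q + q⁻¹)) • Li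

/-- The images of the generators. -/
def genOp (q : ℂ) (r s : E3 → 𝒜) (u : 𝒜) (X : M4 → 𝒜) (μ gp gm L Li : 𝒜) : Gen → 𝒜
  | .vec .pos a => X a * μ
  | .vec .mom a => momentum q gp gm u X a
  | .R A => (1 / (q + q⁻¹)) • r A
  | .S A => (1 / (q + q⁻¹)) • s A
  | .U => (1 / (q + q⁻¹)) • u
  | .lamHalf => L
  | .lamInv => Li

lemma AlgHom.map_dot {ℬ : Type*} [Ring ℬ] [Algebra ℂ ℬ] (φ : ℬ →ₐ[ℂ] 𝒜) (q : ℂ) (x y : E3 → ℬ) :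
    φ (dot q x y) = dot q (fun A => φ (x A)) (fun A => φ (y A)) := by
  simp only [dot, map_sum, map_smul, map_mul]

lemma AlgHom.map_cross {ℬ : Type*} [Ring ℬ] [Algebra ℂ ℬ] (φ : ℬ →ₐ[ℂ] 𝒜) (q : ℂ)
    (x y : E3 → ℬ) (A : E3) :
    φ (cross q x y A) = cross q (fun A => φ (x A)) (fun A => φ (y A)) A := by
  simp only [cross, map_sum, map_smul, map_mul]

lemma dot_smul_smul (q c d : ℂ) (x y : E3 → 𝒜) :
    dot q (fun A => c • x A) (fun A => d • y A) = (c * d) • dot q x y := by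
  simp only [dot, Finset.smul_sum, smul_mul_smul_comm, smul_smul]
  refine Finset.sum_congr rfl fun A _ => Finset.sum_congr rfl fun B _ => ?_
  congr 1; ring

lemma cross_smul_smul (q c d : ℂ) (x y : E3 → 𝒜) (A : E3) :
    cross q (fun A => c • x A) (fun A => d • y A) A = (c * d) • cross q x y A := by
  simp only [cross, Finset.smul_sum, smul_mul_smul_comm, smul_smul]
  refine Finset.sum_congr rfl fun A _ => Finset.sum_congr rfl fun B _ => ?_
  congr 1; ring

variable {r s x : E3 → 𝒜} {u x0 μ gp gm L Li : 𝒜}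

lemma CommutesWith.scaled {z : 𝒜} {X : M4 → 𝒜} (h : CommutesWith r s u X z) (c : ℂ) :
    (∀ A, z * (c • r A) = c • r A * z) ∧ (∀ A, z * (c • s A) = c • s A * z) ∧
      z * (c • u) = c • u * z := by
  refine ⟨fun A => ?_, fun A => ?_, ?_⟩ <;>
    simp only [mul_smul_comm, smul_mul_assoc, h.r, h.s, h.u]

/-- Both the coordinates and the momenta are four-vectors. -/
lemma isFourVec_genOp (hq : Generic q) (h : HatModel q σ r s x u x0)
    (l : LengthOps q σ r s u (four x0 x) μ gp gm L Li) (k : Kind) :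
    IsFourVec q (fun A => (1 / (q + q⁻¹)) • r A) (fun A => (1 / (q + q⁻¹)) • s A)
      ((1 / (q + q⁻¹)) • u) (genOp q r s u (four x0 x) μ gp gm L Li (.vec k none))
      (fun A => genOp q r s u (four x0 x) μ gp gm L Li (.vec k (some A))) := by
  have X := (h.isFourVec hq).scale (1 / (q + q⁻¹))
  have one : CommutesWith r s u (four x0 x) (1 : 𝒜) := by constructor <;> intros <;> simp
  cases k
  · obtain ⟨c1, c2, c3⟩ := l.μ_comm.scaled (1 / (q + q⁻¹))
    obtain ⟨d1, d2, d3⟩ := one.scaled (1 / (q + q⁻¹))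
    have := X.mul d1 d2 d3 c1 c2 c3
    simp only [one_mul] at this
    exact this
  · have key : ∀ (g : 𝒜) (α : ℂ), CommutesWith r s u (four x0 x) g →
        IsFourVec q (fun A => (1 / (q + q⁻¹)) • r A) (fun A => (1 / (q + q⁻¹)) • s A)
          ((1 / (q + q⁻¹)) • u) (g * (x0 * u - α • (u * x0)))
          (fun A => g * (x A * u - α • (u * x A))) := by
      intro g α hg
      obtain ⟨c1, c2, c3⟩ := hg.scaled (1 / (q + q⁻¹))
      obtain ⟨d1, d2, d3⟩ := one.scaled (1 / (q + q⁻¹))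
      have e1 : ∀ A, u * ((1 / (q + q⁻¹)) • r A) = (1 / (q + q⁻¹)) • r A * u := fun A => by
        rw [mul_smul_comm, smul_mul_assoc, h.u_r]
      have e2 : ∀ A, u * ((1 / (q + q⁻¹)) • s A) = (1 / (q + q⁻¹)) • s A * u := fun A => by
        rw [mul_smul_comm, smul_mul_assoc, h.u_s]
      have e3 : u * ((1 / (q + q⁻¹)) • u) = (1 / (q + q⁻¹)) • u * u := by
        rw [mul_smul_comm, smul_mul_assoc]
      have f : ∀ v : 𝒜, g * v = v * g → u * v = v * u → (-α) • (g * u) * v = v * ((-α) • (g * u)) :=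
        fun v h1 h2 => by
          rw [smul_mul_assoc, mul_smul_comm, mul_assoc, h2, ← mul_assoc, h1, mul_assoc]
      -- The term `g * (x * u - α • (u * x))` is the sum of `g * x * u` and `(-α • (g * u)) * x *
      -- 1`, two products of the form treated in `IsFourVec.mul`.
      have := (X.mul c1 c2 c3 e1 e2 e3).add (X.mul (fun A => f _ (c1 A) (e1 A))
        (fun A => f _ (c2 A) (e2 A)) (f _ c3 e3) d1 d2 d3)
      convert this using 1
      · simp only [mul_sub, smul_mul_assoc, mul_smul_comm, mul_one, mul_assoc]; module
      · funext A
        simp only [mul_sub, smul_mul_assoc, mul_smul_comm, mul_one, mul_assoc]; module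
    exact (key gp q l.gp_comm).add (key gm q⁻¹ l.gm_comm)

/-- The operators `gp`, `gm` are moved to the left and `μ` to the right. This costs `μ * g = α • (g
* μ)` with the same `α` as in the corresponding `q`-commutator, which is the factor `α / q ^ 2` in
`heisenberg_aux`. What remains is a multiple of `gm * μ`, that is of `Li`. -/
lemma heisenberg_genOp (hq : Generic q) (h : HatModel q σ r s x u x0)
    (l : LengthOps q σ r s u (four x0 x) μ gp gm L Li) (a b : M4) :
    momentum q gp gm u (four x0 x) a * (four x0 x b * μ)
      - (q ^ 2)⁻¹ • ∑ c, ∑ d, RIIInv q a b c d •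
        (four x0 x c * μ * momentum q gp gm u (four x0 x) d) =
    -(Complex.I / 2) • (Li * (((1 + q ^ 4) * eta q a b) • (1 / (q + q⁻¹)) • u
      + (q ^ 2 * (1 - q ^ 4)) • (1 / (q + q⁻¹)) • lorentzT q r s a b)) := by
  have q0 := hq.q0
  have q1 := hq.q1
  have aux := fun (α : ℂ) (e : 1 + α ^ 2 = α * (q + q⁻¹)) => h.heisenberg_aux hq e a b
  set X := four x0 x
  have t1 : ∀ (g : 𝒜) (α : ℂ), g * (X a * u - α • (u * X a)) * (X b * μ) =
      g * (X a * (u * X b) - α • (u * (X a * X b))) * μ := fun g α => by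
    simp only [mul_sub, sub_mul, mul_smul_comm, smul_mul_assoc, mul_assoc]
  have t2 : ∀ (g : 𝒜) (α β : ℂ), CommutesWith r s u X g → μ * g = β • (g * μ) → ∀ c d,
      X c * μ * (g * (X d * u - α • (u * X d))) =
      β • (g * (X c * X d * u - α • (X c * (u * X d))) * μ) := fun g α β hg e c d => by
    have hμ := l.μ_comm
    have h1 : ∀ z, μ * (g * z) = β • (g * (μ * z)) := fun z => by
      rw [← mul_assoc, e, smul_mul_assoc, mul_assoc]
    have h2 : ∀ c z, X c * (g * z) = g * (X c * z) := fun c z => by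
      rw [← mul_assoc, ← hg.x, mul_assoc]
    have h3 : ∀ c z, μ * (X c * z) = X c * (μ * z) := fun c z => by
      rw [← mul_assoc, hμ.x, mul_assoc]
    have h4 : ∀ z, μ * (u * z) = u * (μ * z) := fun z => by rw [← mul_assoc, hμ.u, mul_assoc]
    simp only [mul_sub, sub_mul, mul_smul_comm, smul_mul_assoc, mul_assoc, h1, h2, h3, h4, hμ.x,
      hμ.u, smul_sub, smul_comm α β]
  have t3 : ∀ (g : 𝒜) (α : ℂ), CommutesWith r s u X g → μ * g = α • (g * μ) →
      g * (X a * u - α • (u * X a)) * (X b * μ) - (q ^ 2)⁻¹ • ∑ c, ∑ d, RIIInv q a b c d •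
        (X c * μ * (g * (X d * u - α • (u * X d)))) =
      g * (X a * (u * X b) - α • (u * (X a * X b)) - (α / q ^ 2) • ∑ c, ∑ d, RIIInv q a b c d •
        (X c * X d * u - α • (X c * (u * X d)))) * μ := fun g α hg e => by
    rw [t1]
    simp only [t2 g α α hg e]
    rw [mul_sub _ _ ((α / q ^ 2) • _), sub_mul]
    congr 1
    simp only [Finset.smul_sum, Finset.mul_sum, Finset.sum_mul, mul_smul_comm, smul_mul_assoc]
    refine Finset.sum_congr rfl fun c _ => Finset.sum_congr rfl fun d _ => ?_
    module
  have e1 : 1 + q ^ 2 = q * (q + q⁻¹) := by field_simp; ring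
  have e2 : 1 + q⁻¹ ^ 2 = q⁻¹ * (q + q⁻¹) := by field_simp
  have split : ∀ c d, X c * μ * momentum q gp gm u X d =
      X c * μ * (gp * (X d * u - q • (u * X d))) + X c * μ * (gm * (X d * u - q⁻¹ • (u * X d))) :=
    fun c d => by rw [momentum, mul_add]
  simp only [split, smul_add, Finset.sum_add_distrib]
  -- For the part with `gp` the factor `1 - α / q` is `1 - q / q = 0`.
  rw [momentum, add_mul, add_sub_add_comm, t3 gp q l.gp_comm l.μ_gp, t3 gm q⁻¹ l.gm_comm l.μ_gm,
    aux q e1, aux _ e2, div_self q0, sub_self, mul_zero, zero_smul, mul_zero, zero_mul, zero_add]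
  have hV : lorentzT q r s a b * μ = μ * lorentzT q r s a b := by
    have c : ∀ z : 𝒜, Commute μ z → z * μ = μ * z := fun z hz => hz.eq.symm
    have cr : ∀ A, Commute μ (r A) := l.μ_comm.r
    have cs : ∀ A, Commute μ (s A) := l.μ_comm.s
    refine c _ ?_
    rcases a with _ | A <;> rcases b with _ | B
    · exact Commute.zero_right _
    · exact (((cr B).smul_right _).neg_right).sub_right (cs B)
    · exact (cr A).add_right ((cs A).smul_right _)
    · exact Commute.sum_right _ _ _ fun C _ => ((cr C).sub_right (cs C)).smul_right _
  have k : ∀ z : 𝒜, z * μ = μ * z → (σ * (q - q⁻¹) ^ 2 / q ^ 5) • (gm * z * μ) =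
      (-(Complex.I / 2) / (q + q⁻¹)) • (Li * z) := fun z hz => by
    rw [mul_assoc, hz, ← mul_assoc, ← smul_mul_assoc, l.gm_μ, smul_mul_assoc]
  have ku := k u l.μ_comm.u.symm
  have kV := k _ hV
  simp only [mul_smul_comm, mul_sub, mul_add, sub_mul, smul_mul_assoc]
  linear_combination (norm := skip) ((1 + q ^ 4) * eta q a b) • ku + (q ^ 2 * (1 - q ^ 4)) • kV
  have qq : q + q⁻¹ = (q ^ 2 + 1) / q := by field_simp
  have q2 := hq.q2
  rw [qq]
  match_scalars <;> field_simp <;> ring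

end Relations

end

end QMink

namespace QMink

noncomputable section

section Relations

variable {𝒜 : Type*} [Ring 𝒜] [Algebra ℂ 𝒜] {q σ : ℂ} {r s x : E3 → 𝒜} {u x0 μ gp gm L Li : 𝒜}

/-- The images of the generators satisfy the defining relations. -/
theorem rel_genOp (hq : Generic q) (h : HatModel q σ r s x u x0)
    (l : LengthOps q σ r s u (four x0 x) μ gp gm L Li) {a b : Free} (hab : Rel q a b) :
    FreeAlgebra.lift ℂ (genOp q r s u (four x0 x) μ gp gm L Li) a =
      FreeAlgebra.lift ℂ (genOp q r s u (four x0 x) μ gp gm L Li) b := by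
  have F := isFourVec_genOp hq h l
  have T := fun A => h.time_space A hq l.gp_comm.u l.gm_comm.u l.gp_comm.x l.gm_comm.x l.gp_gm
  have q0 := hq.q0
  have q3 := hq.q3
  have q2 := hq.q2
  have qq : q + q⁻¹ = (1 + q ^ 2) / q := by field_simp; ring
  have e3 : ∀ a b : M4, four x0 x a * μ * (four x0 x b * μ) =
      four x0 x a * four x0 x b * (μ * μ) := fun a b => by
    rw [mul_assoc, ← mul_assoc μ, l.μ_comm.x, mul_assoc, mul_assoc]
  have L0 : ∀ a, L * four x0 x a = four x0 x a * L := l.L_comm.x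
  induction hab <;>
    simp only [map_add, map_sub, map_neg, map_mul, map_smul, map_sum, map_one, AlgHom.map_dot,
      AlgHom.map_cross, FreeAlgebra.lift_ι_apply]
  case vecVec k A =>
    cases k
    · have e := h.cross_x_x A
      simp only [genOp, cross, e3]
      rw [← smul_mul_assoc, four, four, ← e, cross, Finset.sum_mul]
      simp only [Finset.sum_mul, smul_mul_assoc]
      rfl
    · exact (T A).2
  case vecZero k A =>
    cases k
    · simp only [genOp, e3]
      exact congrArg (· * (μ * μ)) (h.x0_x A)
    · exact (T A).1
  case uSq =>
    simp only [genOp, dot_smul_smul, smul_mul_smul_comm, h.u_u]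
    rw [qq]
    match_scalars <;> field_simp
  case rr A =>
    simp only [genOp, cross_smul_smul, h.cross_r_r, smul_mul_smul_comm]
    module
  case ss A =>
    simp only [genOp, cross_smul_smul, h.cross_s_s, smul_mul_smul_comm]
    module
  case rs A B =>
    simp only [genOp, smul_mul_smul_comm, h.r_s hq A B, Finset.smul_sum]
    refine Finset.sum_congr rfl fun C _ => Finset.sum_congr rfl fun D _ => ?_
    module
  case ur A => simp only [genOp, smul_mul_smul_comm, h.u_r]
  case us A => simp only [genOp, smul_mul_smul_comm, h.u_s]
  case rVecZero k A => exact (F k).r_zero A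
  case rVec k A B => exact (F k).r_vec A B
  case sVecZero k A => exact (F k).s_zero A
  case sVec k A B => exact (F k).s_vec A B
  case uVecZero k => exact (F k).u_zero
  case uVec k A => exact (F k).u_vec A
  case lamMulInv => exact l.L_Li
  case lamInvMul => exact l.Li_L
  case lamPos a =>
    simp only [genOp]
    rw [← mul_assoc, L0, mul_assoc, l.L_μ, mul_smul_comm, mul_assoc]
  case lamMom a =>
    have e : ∀ (g : 𝒜) (α : ℂ), L * g = q • (g * L) →
        L * (g * (four x0 x a * u - α • (u * four x0 x a))) =
          q • (g * (four x0 x a * u - α • (u * four x0 x a)) * L) := fun g α hg => by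
      have c : L * (four x0 x a * u - α • (u * four x0 x a)) =
          (four x0 x a * u - α • (u * four x0 x a)) * L := by
        have c1 : Commute L (four x0 x a) := L0 a
        have c2 : Commute L u := l.L_comm.u
        exact (c1.mul_right c2).sub_right ((c2.mul_right c1).smul_right _)
      rw [← mul_assoc, hg, smul_mul_assoc, mul_assoc, c, mul_assoc]
    simp only [genOp, momentum, mul_add, add_mul, smul_add]
    rw [e gp q l.L_gp, e gm q⁻¹ l.L_gm]
  case lamR A => exact (l.L_comm.scaled _).1 A
  case lamS A => exact (l.L_comm.scaled _).2.1 A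
  case lamU => exact (l.L_comm.scaled _).2.2
  case heisenberg a b =>
    have e : FreeAlgebra.lift ℂ (genOp q r s u (four x0 x) μ gp gm L Li) (lorentzV q a b) =
        (1 / (q + q⁻¹)) • lorentzT q r s a b := by
      rcases a with _ | A <;> rcases b with _ | B <;>
      simp only [lorentzV, lorentzT, map_zero, map_add, map_sub, map_neg, map_smul, map_sum,
        FreeAlgebra.lift_ι_apply, genOp, smul_zero, Finset.smul_sum]
      · module
      · module
      · refine Finset.sum_congr rfl fun C _ => ?_
        module
    rw [e]
    exact heisenberg_genOp hq h l a b

end Relations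

end

end QMink

/-! ### Operators that multiply with the length or change it. -/

namespace QMink

noncomputable section

variable {q : ℝ}

lemma generic_of_one_lt (hq : 1 < q) : Generic (q : ℂ) := by
  have h : 1 < q ^ 2 := one_lt_pow₀ hq two_ne_zero
  have h1 : q ^ 2 - 1 ≠ 0 := by intro e; linarith
  have aux : ∀ {x : ℝ}, x ≠ 0 → (x : ℂ) ≠ 0 := fun h => by exact_mod_cast h
  refine ⟨aux (by linarith), ?_, ?_, ?_, ?_, ?_⟩
  · exact_mod_cast aux h1
  · exact_mod_cast aux (show q ^ 2 + 1 ≠ 0 by positivity)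
  · exact_mod_cast aux (show 1 + q ^ 2 ≠ 0 by positivity)
  · exact_mod_cast aux (show q ^ 4 + 1 ≠ 0 by positivity)
  · exact_mod_cast aux (show 1 + q ^ 2 + q ^ 4 ≠ 0 by positivity)

lemma Family.len_ne_zero (f : Family q) : f.len ≠ 0 := by
  cases f with
  | space l hl => exact (zero_lt_one.trans_le hl.1).ne'
  | time t ht => exact abs_pos.1 (zero_lt_one.trans_le ht.1)

lemma Family.sig_mul_sig (f : Family q) : f.sig * f.sig = 1 := by
  cases f <;> simp [Family.sig]

/-- The operator of multiplication with the length, divided by `[2]`. -/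
def lenOp (f : Family q) : Module.End ℂ (Space f) :=
  mOp f (fun M => f.len * (q : ℂ) ^ M / (q + (q : ℂ)⁻¹)) 0

/-- The operators changing the length that occur in the momenta. -/
def momOp (f : Family q) (k : ℤ) : Module.End ℂ (Space f) :=
  mOp f (fun M => -(Complex.I * f.sig * (q : ℂ) ^ (2 - k)
    / (2 * (q - (q : ℂ)⁻¹) ^ 2 * f.len * (q : ℂ) ^ M))) k

lemma mOp_mul (f : Family q) (c d : ℤ → ℂ) (k l : ℤ) :
    mOp f c k * mOp f d l = mOp f (fun M => c (M + l) * d M) (k + l) := by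
  refine ((lifts_m f c k).mul (lifts_m f d l)).ext (lifts_m f _ _) fun j n M _ _ => ?_
  simp only [Pi.mul_apply, Module.End.mul_apply, mRad_radVec, map_smul, smul_smul, add_assoc]
  rw [add_comm l k, mul_comm]

lemma mOp_smul (f : Family q) (c : ℂ) (d : ℤ → ℂ) (k : ℤ) :
    c • mOp f d k = mOp f (fun M => c * d M) k := by
  refine ((lifts_m f d k).smul c).ext (lifts_m f _ _) fun j n M _ _ => ?_
  simp only [Pi.smul_apply, LinearMap.smul_apply, mRad_radVec, smul_smul]

lemma mOp_one (f : Family q) : mOp f (fun _ => 1) 0 = 1 := by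
  refine (lifts_m f _ _).ext LiftsScal.one fun j n M _ _ => ?_
  simp only [mRad_radVec, one_smul, add_zero, Pi.one_apply, Module.End.one_apply]

lemma mOp_comm_vec (hq : 1 < q) (f : Family q) (c : ℤ → ℂ) (k : ℤ)
    {Y : E3 → Module.End ℂ (Space f)} {y : RedVec} (hy : LiftsVec Y y)
    (h : ∀ Δ j, Commute (mRad c k) (y Δ j)) (A : E3) : mOp f c k * Y A = Y A * mOp f c k := by
  have g := generic_of_one_lt hq
  refine ((lifts_m f c k).mul_vec hy).ext g.q0 g.q2 (hy.mul_scal (lifts_m f c k))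
    (fun Δ j n M _ _ _ => ?_) A
  have := LinearMap.congr_fun (h Δ j).eq (radVec n M)
  cases Δ <;> exact this

lemma mOp_comm_scal (f : Family q) (c : ℤ → ℂ) (k : ℤ)
    {T : Module.End ℂ (Space f)} {t : ℤ → Module.End ℂ Radial} (ht : LiftsScal T t)
    (h : ∀ j, Commute (mRad c k) (t j)) : mOp f c k * T = T * mOp f c k := by
  have l := lifts_m f c k
  exact (l.mul ht).ext (ht.mul l) fun j n M _ _ => LinearMap.congr_fun (h j).eq (radVec n M)

lemma mRad_rsRed (q σ : ℂ) (κ : ℤ) (a b : ℂ → ℂ) (c : ℂ) (d : ℤ → ℂ) (k : ℤ) (Δ : Step) (j : ℤ) :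
    Commute (mRad d k) (rsRed q σ κ a b c Δ j) := by
  have sm : ∀ {T : Module.End ℂ Radial} (z : ℂ), Commute (mRad d k) T →
      Commute (mRad d k) (z • T) := fun z h => by
    rw [commute_iff_eq, mul_smul_comm, smul_mul_assoc, h.eq]
  cases Δ
  · rw [rsRed]; exact mRad_ladder _ _ _ _
  · rw [rsRed, uRed]; exact sm _ (mRad_ladder _ _ _ _)
  · rw [rsRed]; exact sm _ (mRad_ladder _ _ _ _)

/-- On the unit hyperboloid no reduced element depends on `M` or changes it. -/
lemma commutesWith_mOp (hq : 1 < q) (f : Family q) (c : ℤ → ℂ) (k : ℤ) :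
    CommutesWith (rOp f) (sOp f) (uOp f) (four (x0Op f) (xOp f)) (mOp f c k) := by
  have q0 := (generic_of_one_lt hq).q0
  refine ⟨?_, ?_, ?_, fun a => ?_⟩
  · exact mOp_comm_vec hq f c k (lifts_r f q0) (mRad_rsRed _ _ _ _ _ _ c k)
  · exact mOp_comm_vec hq f c k (lifts_s f q0) (mRad_rsRed _ _ _ _ _ _ c k)
  · refine mOp_comm_scal f c k (lifts_u f q0) fun j => ?_
    rw [uRed]; exact mRad_ladder _ _ _ _
  · cases a
    · refine mOp_comm_scal f c k (lifts_x0 f) fun j => ?_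
      rw [x0Red]; exact mRad_diagN _ _ _
    · refine mOp_comm_vec hq f c k (lifts_x f q0) (fun Δ j => ?_) _
      cases Δ <;> rw [xRed] <;> exact mRad_diagN _ _ _

/-- All operators shift `M` by a fixed amount with coefficients geometric in `M`, so they commute up
to powers of `q`. The coefficients of `gp` and `gm` both contain `q ^ (-M)`, and evaluating them at
`M - 1` and `M + 1` gives the factor `q ^ 2` in `gp_gm`. The constant in `gm` is the one required by
`gm_μ`. -/
theorem lengthOps (hq : 1 < q) (f : Family q) :
    LengthOps q f.sig (rOp f) (sOp f) (uOp f) (four (x0Op f) (xOp f)) (lenOp f) (momOp f 1)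
      (momOp f (-1)) (mOp f (fun _ => (q : ℂ) ^ 2) 1) (mOp f (fun _ => ((q : ℂ) ^ 2)⁻¹) (-1)) := by
  have g := generic_of_one_lt hq
  have q0 := g.q0
  have q1 := g.q1
  have q3 := g.q3
  have l0 : (f.len : ℂ) ≠ 0 := by exact_mod_cast f.len_ne_zero
  have s0 := f.sig_mul_sig
  have qq : (q : ℂ) + (q : ℂ)⁻¹ = (1 + (q : ℂ) ^ 2) / q := by field_simp; ring
  have qm : (q : ℂ) - (q : ℂ)⁻¹ = ((q : ℂ) ^ 2 - 1) / q := by field_simp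
  have e1 : (q : ℂ) ^ (2 - 1 : ℤ) = q := by norm_num
  have e3 : (q : ℂ) ^ (2 - -1 : ℤ) = q ^ 3 := by norm_cast
  refine ⟨commutesWith_mOp hq f _ _, commutesWith_mOp hq f _ _, commutesWith_mOp hq f _ _,
    commutesWith_mOp hq f _ _, commutesWith_mOp hq f _ _, ?_, ?_, ?_, ?_, ?_, ?_, ?_, ?_, ?_⟩
  case refine_4 | refine_5 =>
    rw [mOp_mul, ← mOp_one]
    congr 1; funext M; field_simp
  all_goals
    simp only [lenOp, momOp, mOp_mul, mOp_smul]
    congr 1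
    funext M
    have hM : (q : ℂ) ^ M ≠ 0 := zpow_ne_zero _ q0
    simp only [zpow_add₀ q0, zpow_one, zpow_zero, mul_one, e1, e3, qq, qm, zpow_neg]
    field_simp
  -- The relation `gm_μ` contains the sign once explicitly and once in `gm`; its square is one.
  rw [pow_two, s0]

end

end QMink

namespace QMink

noncomputable section

/-! ## The change to the orthonormal basis -/

/-- The solution of `K (a + 1) = w a * K a`, `K 0 = 1`. -/
def stepProd (w : ℤ → ℝ) (a : ℤ) : ℝ := (∏ i ∈ Finset.Ico 0 a, w i) / ∏ i ∈ Finset.Ico a 0, w i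

lemma stepProd_pos {w : ℤ → ℝ} (hw : ∀ i, 0 < w i) (a : ℤ) : 0 < stepProd w a :=
  div_pos (Finset.prod_pos fun i _ => hw i) (Finset.prod_pos fun i _ => hw i)

lemma stepProd_add_one {w : ℤ → ℝ} (hw : ∀ i, 0 < w i) (a : ℤ) :
    stepProd w (a + 1) = w a * stepProd w a := by
  rcases le_or_gt 0 a with h | h
  · have e : Finset.Ico 0 (a + 1) = insert a (Finset.Ico 0 a) := by
      ext i; simp only [Finset.mem_insert, Finset.mem_Ico]; omega
    rw [stepProd, stepProd, e, Finset.prod_insert (by simp), Finset.Ico_eq_empty_of_le h,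
      Finset.Ico_eq_empty_of_le (h.trans (by omega)), mul_div_assoc]
  · have e : Finset.Ico a 0 = insert a (Finset.Ico (a + 1) 0) := by
      ext i; simp only [Finset.mem_insert, Finset.mem_Ico]; omega
    have := hw a
    rw [stepProd, stepProd, e, Finset.prod_insert (by simp), Finset.Ico_eq_empty_of_le h.le,
      Finset.Ico_eq_empty_of_le (show a + 1 ≤ 0 by omega)]
    field_simp

/-- The square root on the positive numbers, continued by `1`. -/
def posSqrt (x : ℝ) : ℝ := if 0 < x then √x else 1

lemma posSqrt_pos (x : ℝ) : 0 < posSqrt x := by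
  unfold posSqrt
  split_ifs with h
  · exact Real.sqrt_pos.2 h
  · exact one_pos

lemma posSqrt_eq {x : ℝ} (h : 0 < x) : posSqrt x = √x := if_pos h

lemma posSqrt_sq {x : ℝ} (h : 0 < x) : posSqrt x ^ 2 = x := by
  rw [posSqrt_eq h, Real.sq_sqrt h.le]

section Angular

variable {q : ℝ}

lemma lam_pos (hq : 1 < q) : 0 < lam q := by
  have : q⁻¹ < 1 := inv_lt_one_of_one_lt₀ hq
  unfold lam; linarith

lemma lam_mul_brk (hq : 1 < q) (a : ℤ) : lam q * brk q a = q ^ a - q ^ (-a) :=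
  mul_div_cancel₀ _ (lam_pos hq).ne'

lemma brk_pos (hq : 1 < q) {a : ℤ} (ha : 0 < a) : 0 < brk q a := by
  refine div_pos ?_ (lam_pos hq)
  have := zpow_lt_zpow_right₀ hq (show -a < a by omega)
  linarith

lemma crl_pos (hq : 1 < q) (a : ℤ) : 0 < crl q a := by
  have : 0 < q := by linarith
  unfold crl; positivity

lemma brk_two (hq : 1 < q) : brk q 2 = q + q⁻¹ := by
  have h := lam_mul_brk hq 2
  have h0 : q ≠ 0 := by linarith
  refine mul_left_cancel₀ (lam_pos hq).ne' (h.trans ?_)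
  simp only [lam, zpow_neg, zpow_ofNat]
  field_simp
  ring

/-- The unit `λ q [2] ^ {1/2}` of the vector operators. -/
def vecUnit (q : ℝ) : ℝ := lam q * q * √(brk q 2)

lemma vecUnit_pos (hq : 1 < q) : 0 < vecUnit q :=
  mul_pos (mul_pos (lam_pos hq) (by linarith)) (Real.sqrt_pos.2 (brk_pos hq two_pos))

/-- The normalization of the basis vectors that depends on `m`. -/
def angGauge (q : ℝ) (j m : ℤ) : ℝ :=
  vecUnit q ^ m /
    (stepProd (fun a => posSqrt (brk q (a + 1))) (j + m)
      * stepProd (fun a => posSqrt (brk q (a + 1))) (j - m))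

/-- The coefficient `angCoef` as a real number. -/
def angCoefReal (q : ℝ) : E3 → Step → ℤ → ℤ → ℝ
  | .plus, .up, j, m => q ^ (m - 2 * j)
  | .plus, .stay, j, m => -q ^ (m + 2) * (lam q * brk q (j - m))
  | .plus, .down, j, m =>
      q ^ (m + 2 * j + 2) * (lam q * brk q (j - m)) * (lam q * brk q (j - m - 1))
  | .minus, .up, _, m => q ^ m / vecUnit q ^ 2
  | .minus, .stay, j, m => q ^ m * (lam q * brk q (j + m)) / vecUnit q ^ 2
  | .minus, .down, j, m => q ^ m * (lam q * brk q (j + m)) * (lam q * brk q (j + m - 1))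
      / vecUnit q ^ 2
  | .three, .up, j, m => q ^ (m - j - 1) / lam q
  | .three, .stay, j, m =>
      (q ^ (2 * m) - (q ^ (2 * j + 1) + q ^ (-2 * j - 1)) / (q + q⁻¹)) / lam q
  | .three, .down, j, m => -q ^ (m + j) * (lam q * brk q (j - m)) * (lam q * brk q (j + m)) / lam q

lemma zsub_zpow (hq : 1 < q) (a : ℤ) : zsub ((q : ℂ) ^ a) = ((lam q * brk q a : ℝ) : ℂ) := by
  rw [lam_mul_brk hq, zsub, zpow_neg]; push_cast; rfl

lemma angCoef_eq_real (hq : 1 < q) (A : E3) (Δ : Step) (j m : ℤ) :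
    angCoef q A Δ ((q : ℂ) ^ j) ((q : ℂ) ^ m) = (angCoefReal q A Δ j m : ℂ) := by
  have h0 : (q : ℂ) ≠ 0 := by exact_mod_cast (show q ≠ 0 by linarith)
  have e1 : (q : ℂ) ^ j / (q : ℂ) ^ m = (q : ℂ) ^ (j - m) := by rw [zpow_sub₀ h0]
  have e2 : (q : ℂ) ^ (j - m) / q = (q : ℂ) ^ (j - m - 1) := by rw [zpow_sub_one₀ h0]; rfl
  have e3 : (q : ℂ) ^ j * (q : ℂ) ^ m = (q : ℂ) ^ (j + m) := by rw [zpow_add₀ h0]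
  have e4 : (q : ℂ) ^ (j + m) / q = (q : ℂ) ^ (j + m - 1) := by rw [zpow_sub_one₀ h0]; rfl
  have hc : ((vecUnit q ^ 2 : ℝ) : ℂ) = q * (1 + (q : ℂ) ^ 2) * (q - (q : ℂ)⁻¹) ^ 2 := by
    rw [vecUnit, mul_pow, Real.sq_sqrt (brk_pos hq two_pos).le, brk_two hq, lam]
    push_cast
    field_simp
    ring
  have hJ : (q : ℂ) ^ j ≠ 0 := zpow_ne_zero _ h0
  have hl : (lam q : ℂ) = q - (q : ℂ)⁻¹ := by rw [lam]; push_cast; rfl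
  cases A <;> cases Δ <;>
    simp only [angCoef, e1, e2, e3, e4, zsub_zpow hq, angCoefReal, Complex.ofReal_div, hc,
      Complex.ofReal_mul, Complex.ofReal_neg, Complex.ofReal_sub, Complex.ofReal_add,
      Complex.ofReal_zpow, Complex.ofReal_inv]
  all_goals
    simp only [hl, zadd, zpow_sub₀ h0, zpow_add₀ h0, zpow_mul, zpow_neg, zpow_ofNat,
      neg_mul, mul_comm (2 : ℤ)]
    try field_simp

/-- The power of `λ` by which the reduced matrix elements differ. -/
def Step.order : Step → ℕ
  | .up => 0
  | .stay => 1
  | .down => 2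

lemma brk_root (hq : 1 < q) {a : ℤ} (ha : 0 ≤ a) :
    ∃ w : ℝ, 0 < w ∧ brk q (a + 1) = w ^ 2 ∧ √(brk q (a + 1)) = w ∧
      stepProd (fun a => posSqrt (brk q (a + 1))) (a + 1) =
        w * stepProd (fun a => posSqrt (brk q (a + 1))) a := by
  have h := brk_pos hq (show 0 < a + 1 by omega)
  refine ⟨√(brk q (a + 1)), Real.sqrt_pos.2 h, (Real.sq_sqrt h.le).symm, rfl, ?_⟩
  rw [stepProd_add_one fun i => posSqrt_pos _, posSqrt_eq h]

/-- The square roots in the matrix elements are ratios of the two products in `angGauge`, which are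
indexed by `j + m` and `j - m`; a step shifts each index by at most two. The powers of `vecUnit`
come from the change of `m` and from the unit of the reduced element. The bounds on source and
target make the brackets under the roots positive. -/
lemma vecElt_step (hq : 1 < q) (A : E3) (Δ : Step) (r : ℝ) {j m : ℤ} (hm : |m| ≤ j)
    (hm' : |m + weight A| ≤ j + Δ.shift) :
    vecElt q A r (j + Δ.shift) (m + weight A) j m =
      angGauge q j m / angGauge q (j + Δ.shift) (m + weight A) *
        (angCoefReal q A Δ j m * (vecUnit q / lam q ^ Δ.order * r)) := by
  have q0 : 0 < q := by linarith
  have hl := lam_pos hq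
  have hs := Real.sqrt_pos.2 q0
  have c0 := (vecUnit_pos hq).ne'
  -- This root, `q ^ (3 / 2)` and the half-integral exponents of the third component all contain
  -- `√q`. Expressed in this way, the half-integral powers of `q` combine to integral ones.
  have eq1 : √(1 + q ^ 2) = √q * (vecUnit q / (lam q * q)) := by
    rw [vecUnit, mul_div_cancel_left₀ _ (mul_pos hl q0).ne', ← Real.sqrt_mul q0.le, brk_two hq]
    congr 1; field_simp; ring
  have eq2 : √q ^ 2 = q := Real.sq_sqrt q0.le
  have eq3 : q ^ (3 / 2 : ℝ) = √q ^ 3 := by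
    rw [Real.sqrt_eq_rpow, ← Real.rpow_natCast, ← Real.rpow_mul q0.le]; norm_num
  have G0 : ∀ a, 0 < stepProd (fun a => posSqrt (brk q (a + 1))) a :=
    stepProd_pos fun i => posSqrt_pos _
  rw [abs_le] at hm hm'
  have eq4 : q ^ ((m : ℝ) - j - 1 / 2) = q ^ (m - j) / √q := by
    rw [Real.rpow_sub q0, ← Real.sqrt_eq_rpow, ← Int.cast_sub, Real.rpow_intCast]
  have eq5 : q ^ ((m : ℝ) + j + 1 / 2) = q ^ (m + j) * √q := by
    rw [Real.rpow_add q0, ← Real.sqrt_eq_rpow, ← Int.cast_add, Real.rpow_intCast]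
  have el : lam q = (q ^ 2 - 1) / q := by rw [lam]; field_simp
  have sq2 : ∀ {a b : ℝ}, 0 < a → 0 < b → √(a ^ 2 * b ^ 2) = a * b := fun ha hb => by
    rw [← mul_pow, Real.sqrt_sq (mul_pos ha hb).le]
  generalize hG : stepProd (fun a => posSqrt (brk q (a + 1))) = G at G0
  have root : ∀ {a : ℤ}, 0 ≤ a → ∃ w : ℝ, 0 < w ∧ brk q (a + 1) = w ^ 2 ∧ G (a + 1) = w * G a :=
    fun ha => by
      obtain ⟨w, p, b, -, g⟩ := brk_root hq ha
      exact ⟨w, p, b, hG ▸ g⟩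
  have g1 := G0 (j + m)
  have g2 := G0 (j - m)
  have i1 : (j + 1 = j) = False := by simp
  have i2 : (j + 1 = j - 1) = False := by simp only [eq_iff_iff, iff_false]; omega
  have i3 : (j + -1 = j) = False := by simp
  have i4 : (j + -1 = j + 1) = False := by simp only [eq_iff_iff, iff_false]; omega
  have i5 : (j + -1 = j - 1) = True := by simp only [eq_iff_iff, iff_true]; omega
  have i6 : (m + -1 = m - 1) = True := by simp only [eq_iff_iff, iff_true]; omega
  simp only [angGauge]
  have m1 : q ^ 2 - 1 ≠ 0 := by
    have := one_lt_pow₀ hq two_ne_zero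
    intro e; linarith
  cases A <;> cases Δ <;> simp only [weight, Step.shift, add_zero] at hm' <;>
    simp only [vecElt, weight, Step.shift, angCoefReal, Step.order, hG, i1, i2, i3, i4,
      i5, i6, reduceIte, add_zero, eq1, eq3, eq4, eq5, pow_zero, pow_one, div_one]
  -- In each case the two roots by which the normalization changes are named `w0` and `w1`. The
  -- third component with unchanged `j` is absent here, because its gauge factors are equal and no
  -- root occurs.
  case' plus.up =>
    obtain ⟨w0, p0, b0, k0⟩ := root (show 0 ≤ j + m by omega)
    obtain ⟨w1, p1, b1, k1⟩ := root (show 0 ≤ j + m + 1 by omega)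
    simp only [show j + m + 2 = j + m + 1 + 1 by ring,
      show j + 1 + (m + 1) = j + m + 1 + 1 by ring, show j + 1 - (m + 1) = j - m by ring]
    simp only [b0, b1, k1, k0, sq2 p0 p1]
  case' plus.stay =>
    obtain ⟨w0, p0, b0, k0⟩ := root (show 0 ≤ j + m by omega)
    obtain ⟨w1, p1, b1, k1⟩ := root (show 0 ≤ j - m - 1 by omega)
    rw [sub_add_cancel] at b1 k1
    simp only [show j + (m + 1) = j + m + 1 by ring, show j - (m + 1) = j - m - 1 by ring]
    simp only [b0, b1, k1, k0, sq2 p0 p1]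
    have t1 := G0 (j - m - 1)
  case' plus.down =>
    obtain ⟨w0, p0, b0, k0⟩ := root (show 0 ≤ j - m - 1 by omega)
    obtain ⟨w1, p1, b1, k1⟩ := root (show 0 ≤ j - m - 1 - 1 by omega)
    rw [sub_add_cancel] at b0 k0
    rw [sub_add_cancel] at b1 k1
    simp only [show j + -1 + (m + 1) = j + m by ring, show j + -1 - (m + 1) = j - m - 1 - 1 by ring]
    simp only [b0, b1, k0, k1, sq2 p0 p1]
    have t0 := G0 (j - m - 1)
    have t1 := G0 (j - m - 1 - 1)
  case' minus.up =>
    obtain ⟨w0, p0, b0, k0⟩ := root (show 0 ≤ j - m by omega)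
    obtain ⟨w1, p1, b1, k1⟩ := root (show 0 ≤ j - m + 1 by omega)
    simp only [show j - m + 2 = j - m + 1 + 1 by ring, show j + 1 + (m + -1) = j + m by ring,
      show j + 1 - (m + -1) = j - m + 1 + 1 by ring]
    simp only [b0, b1, k1, k0, sq2 p0 p1]
  case' minus.stay =>
    obtain ⟨w0, p0, b0, k0⟩ := root (show 0 ≤ j - m by omega)
    obtain ⟨w1, p1, b1, k1⟩ := root (show 0 ≤ j + m - 1 by omega)
    rw [sub_add_cancel] at b1 k1
    simp only [show j + (m + -1) = j + m - 1 by ring, show j - (m + -1) = j - m + 1 by ring]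
    simp only [b0, b1, k1, k0, sq2 p1 p0]
    have t1 := G0 (j + m - 1)
  case' minus.down =>
    obtain ⟨w0, p0, b0, k0⟩ := root (show 0 ≤ j + m - 1 by omega)
    obtain ⟨w1, p1, b1, k1⟩ := root (show 0 ≤ j + m - 1 - 1 by omega)
    rw [sub_add_cancel] at b0 k0
    rw [sub_add_cancel] at b1 k1
    simp only [show j + -1 + (m + -1) = j + m - 1 - 1 by ring,
      show j + -1 - (m + -1) = j - m by ring]
    simp only [b0, b1, k0, k1, sq2 p0 p1]
    have t0 := G0 (j + m - 1)
    have t1 := G0 (j + m - 1 - 1)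
  case' three.up =>
    obtain ⟨w0, p0, b0, k0⟩ := root (show 0 ≤ j - m by omega)
    obtain ⟨w1, p1, b1, k1⟩ := root (show 0 ≤ j + m by omega)
    simp only [show j + 1 + m = j + m + 1 by ring, show j + 1 - m = j - m + 1 by ring]
    simp only [b0, b1, k1, k0, sq2 p0 p1]
  case' three.down =>
    obtain ⟨w0, p0, b0, k0⟩ := root (show 0 ≤ j - m - 1 by omega)
    obtain ⟨w1, p1, b1, k1⟩ := root (show 0 ≤ j + m - 1 by omega)
    rw [sub_add_cancel] at b0 k0
    rw [sub_add_cancel] at b1 k1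
    simp only [show j + -1 + m = j + m - 1 by ring, show j + -1 - m = j - m - 1 by ring]
    simp only [b0, b1, k0, k1, sq2 p0 p1]
    have t0 := G0 (j - m - 1)
    have t1 := G0 (j + m - 1)
  all_goals
    simp only [zpow_add₀ q0.ne', zpow_sub₀ q0.ne', zpow_add₀ c0, zpow_mul, zpow_neg,
      zpow_ofNat, el, neg_mul, mul_comm (2 : ℤ)]
    field_simp
  all_goals try rw [show √q ^ 4 = q ^ 2 by rw [show √q ^ 4 = (√q ^ 2) ^ 2 by ring, eq2]]
  all_goals try rw [eq2]

end Angular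

end

end QMink

/-! ### The normalization of the basis in `j` and `n`, and matrix elements of lifted operators. -/

namespace QMink

noncomputable section

variable {q : ℝ}

/-- The sign of the invariant length as a real number. -/
def Family.sgn : Family q → ℝ
  | .space _ _ => 1
  | .time _ _ => -1

lemma Family.sig_eq (f : Family q) : f.sig = (f.sgn : ℂ) := by
  cases f <;> simp [Family.sig, Family.sgn]

/-- `q ^ a + σ q ^ (- a)`. -/
def Family.cf (f : Family q) (a : ℤ) : ℝ := q ^ a + f.sgn * q ^ (-a)

/-- `q ^ a - σ q ^ (- a)`. -/
def Family.df (f : Family q) (a : ℤ) : ℝ := q ^ a - f.sgn * q ^ (-a)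

/-- The square root of `cf`. -/
def Family.rt (f : Family q) (a : ℤ) : ℝ := posSqrt (f.cf a)

lemma Family.cf_pos (hq : 1 < q) (f : Family q) {a : ℤ} (h : f.sgn = -1 → 0 < a) : 0 < f.cf a := by
  cases f with
  | space l hl =>
    have : 0 < q := by linarith
    simp only [Family.cf, Family.sgn, one_mul]; positivity
  | time t ht =>
    have := mul_pos (lam_pos hq) (brk_pos hq (h rfl))
    rw [lam_mul_brk hq] at this
    simp only [Family.cf, Family.sgn]; linarith

lemma Family.rt_pos (f : Family q) (a : ℤ) : 0 < f.rt a := posSqrt_pos _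

lemma Family.rt_sq (hq : 1 < q) (f : Family q) {a : ℤ} (h : f.sgn = -1 → 0 < a) :
    f.cf a = f.rt a ^ 2 := (posSqrt_sq (f.cf_pos hq h)).symm

/-- The product of the `rt i` for `i` up to `a`. -/
def Family.rtProd (f : Family q) (a : ℤ) : ℝ := stepProd (fun i => f.rt (i + 1)) a

lemma Family.rtProd_pos (f : Family q) (a : ℤ) : 0 < f.rtProd a :=
  stepProd_pos (fun _ => f.rt_pos _) a

lemma Family.rtProd_add_one (f : Family q) (a : ℤ) :
    f.rtProd (a + 1) = f.rt (a + 1) * f.rtProd a := stepProd_add_one (fun _ => f.rt_pos _) a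

/-- `N_j`. -/
def angNorm (q : ℝ) (j : ℤ) : ℝ := posSqrt (brk q (2 * j + 1) * brk q (2 * j + 3))

lemma angNorm_pos (j : ℤ) : 0 < angNorm q j := posSqrt_pos _

lemma brk_mul_brk_pos (hq : 1 < q) {j : ℤ} (hj : 0 ≤ j) :
    0 < brk q (2 * j + 1) * brk q (2 * j + 3) :=
  mul_pos (brk_pos hq (by omega)) (brk_pos hq (by omega))

lemma angNorm_eq (hq : 1 < q) {j : ℤ} (hj : 0 ≤ j) :
    √(brk q (2 * j + 1) * brk q (2 * j + 3)) = angNorm q j :=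
  (posSqrt_eq (brk_mul_brk_pos hq hj)).symm

/-- The normalization of the basis vectors that depends on `j` only. -/
def baseGauge (q : ℝ) (j : ℤ) : ℝ := stepProd (fun i => crl q (i + 1) * angNorm q i) j

lemma baseGauge_pos (hq : 1 < q) (j : ℤ) : 0 < baseGauge q j :=
  stepProd_pos (fun _ => mul_pos (crl_pos hq _) (angNorm_pos _)) j

lemma baseGauge_add_one (hq : 1 < q) (j : ℤ) :
    baseGauge q (j + 1) = crl q (j + 1) * angNorm q j * baseGauge q j :=
  stepProd_add_one (fun _ => mul_pos (crl_pos hq _) (angNorm_pos _)) j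

/-- The normalization of the basis vectors that depends on `j` and `n`. -/
def Family.radGauge (f : Family q) (j n : ℤ) : ℝ :=
  baseGauge q j * f.rt (n + f.kap) / (f.rtProd (n + f.kap + j) * f.rtProd (n + f.kap - j - 1))

lemma Family.radGauge_pos (hq : 1 < q) (f : Family q) (j n : ℤ) : 0 < f.radGauge j n :=
  div_pos (mul_pos (baseGauge_pos hq _) (f.rt_pos _)) (mul_pos (f.rtProd_pos _) (f.rtProd_pos _))

lemma angGauge_pos (hq : 1 < q) (j m : ℤ) : 0 < angGauge q j m :=
  div_pos (zpow_pos (vecUnit_pos hq) _) (mul_pos (stepProd_pos (fun _ => posSqrt_pos _) _)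
    (stepProd_pos (fun _ => posSqrt_pos _) _))

/-- The normalization of the basis vectors. -/
def Family.gauge (f : Family q) (s : QNum) : ℝ := angGauge q s.j s.m * f.radGauge s.j s.n

lemma Family.gauge_pos (hq : 1 < q) (f : Family q) (s : QNum) : 0 < f.gauge s :=
  mul_pos (angGauge_pos hq _ _) (f.radGauge_pos hq _ _)

lemma emb_apply (j m : ℤ) (w : Radial) (t : QNum) :
    emb j m w t = if t.j = j ∧ t.m = m then w (t.n, t.M) else 0 := by
  induction w using Finsupp.induction_linear with
  | zero => simp
  | add v w hv hw => rw [map_add, Finsupp.add_apply, hv, hw]; split_ifs <;> simp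
  | single p c =>
    rw [emb_single, Finsupp.single_apply, Finsupp.single_apply, ← ite_and]
    refine if_congr ?_ rfl rfl
    rw [QNum.ext_iff, Prod.ext_iff]
    simp only
    tauto

variable {f : Family q}

lemma incl_apply (v : Space f) (s : State f) : incl f v s.1 = v s :=
  Finsupp.mapDomain_apply Subtype.val_injective v s

lemma LiftsScal.apply_single {T : Module.End ℂ (Space f)} {t : ℤ → Module.End ℂ Radial}
    (h : LiftsScal T t) (s' s : State f) : T (Finsupp.single s 1) s' =
      if s'.1.j = s.1.j ∧ s'.1.m = s.1.m then t s.1.j (radVec s.1.n s.1.M) (s'.1.n, s'.1.M)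
      else 0 := by
  rw [← incl_apply, h, incl_single, single_eq_emb, scalOp_emb, emb_apply]

/-- The matrix elements of a vector operator. -/
lemma vecElt_match (hq : 1 < q) {Y : E3 → Module.End ℂ (Space f)} {y : RedVec} (h : LiftsVec Y y)
    (A : E3) (s' s : State f) (c : ℂ) (r : ℝ)
    (hr : ∀ Δ : Step, s'.1.j = s.1.j + Δ.shift → (Δ = .stay → s.1.j ≠ 0) →
      c * ((r * (vecUnit q / lam q ^ Δ.order) : ℝ) : ℂ) =
        ((f.radGauge s.1.j s.1.n / f.radGauge s'.1.j s'.1.n : ℝ) : ℂ) *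
          y Δ s.1.j (radVec s.1.n s.1.M) (s'.1.n, s'.1.M)) :
    c * (vecElt q A r s'.1.j s'.1.m s.1.j s.1.m : ℂ) =
      ((f.gauge s.1 / f.gauge s'.1 : ℝ) : ℂ) * Y A (Finsupp.single s 1) s' := by
  rw [← incl_apply, h, incl_single, single_eq_emb, vecOp_emb]
  simp only [Finsupp.add_apply, Finsupp.smul_apply, emb_apply, smul_eq_mul]
  obtain ⟨⟨j, m, n, M⟩, hs⟩ := s
  obtain ⟨⟨j', m', n', M'⟩, hs'⟩ := s'
  have hm := ((f.occurs_iff _).1 hs).1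
  have hm' := ((f.occurs_iff _).1 hs').1
  simp only at hm hm' hr ⊢
  by_cases e : m' = m + weight A
  · subst e
    have key : ∀ Δ : Step, j' = j + Δ.shift → (Δ = .stay → j ≠ 0) →
        c * (vecElt q A r j' (m + weight A) j m : ℂ) =
        ((f.gauge ⟨j, m, n, M⟩ / f.gauge ⟨j', m + weight A, n', M'⟩ : ℝ) : ℂ) *
          (angCoef q A Δ (q ^ j) (q ^ m) * y Δ j (radVec n M) (n', M')) := fun Δ hΔ h0 => by
      have := hr Δ hΔ h0
      subst hΔ
      rw [vecElt_step hq A Δ r hm hm', angCoef_eq_real hq, Family.gauge, Family.gauge]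
      rw [mul_div_mul_comm]
      push_cast at this ⊢
      linear_combination ((angGauge q j m : ℂ) / (angGauge q (j + Δ.shift) (m + weight A)) *
        angCoefReal q A Δ j m) * this
    obtain h1 | h1 | h1 | h1 : j' = j + 1 ∨ j' = j ∨ j' = j - 1 ∨
      (j' ≠ j + 1 ∧ j' ≠ j ∧ j' ≠ j - 1) := by omega
    · rw [key .up h1 (by simp), if_pos (by simp [h1]), if_neg (by simp; omega),
        if_neg (by simp; omega)]
      simp only [mul_zero, add_zero]
    · by_cases h0 : j = 0
      · have m0 : m = 0 := by rw [h0] at hm; exact abs_nonpos_iff.1 hm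
        have m0' : m + weight A = 0 := by rw [h1, h0] at hm'; exact abs_nonpos_iff.1 hm'
        have q0 : 0 < q := by linarith
        have g := generic_of_one_lt hq
        have A3 : A = .three := by cases A <;> simp [weight, m0] at m0' ⊢
        have z : q + q⁻¹ ≠ 0 := by positivity
        have z1 : vecElt q A r j' (m + weight A) j m = 0 := by
          subst A3 h0 m0
          simp [vecElt, h1, weight, div_self z]
        subst h0 m0 h1
        rw [zero_add] at z1
        simp [z1, (angCoef_stay_zero g.q2 g.q0 A).1]
      · rw [key .stay (by simp [h1, Step.shift]) fun _ => h0, if_neg (by simp; omega),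
          if_pos (by simp [h1]), if_neg (by simp; omega)]
        simp only [mul_zero, add_zero, zero_add]
    · rw [key .down (by simp [h1, Step.shift]; ring) (by simp), if_neg (by simp; omega),
        if_neg (by simp; omega), if_pos (by simp [h1])]
      simp only [mul_zero, add_zero, zero_add]
    · have z1 : vecElt q A r j' (m + weight A) j m = 0 := by
        cases A <;> simp [vecElt, h1]
      rw [z1, if_neg (by simp; omega), if_neg (by simp; omega), if_neg (by simp; omega)]
      simp
  · have z1 : vecElt q A r j' m' j m = 0 := by
      cases A <;> simp only [weight] at e <;> simp only [vecElt] <;> rw [if_neg (by omega)]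
    rw [z1, if_neg (by tauto), if_neg (by tauto), if_neg (by tauto)]
    simp

lemma ladder_apply (a b : ℤ → ℂ) (n M n' M' : ℤ) : ladder a b (radVec n M) (n', M') =
    if M' = M then (if n' = n + 1 then a n else 0) + (if n' = n - 1 then b n else 0) else 0 := by
  rw [ladder_radVec]
  simp only [Finsupp.add_apply, Finsupp.smul_apply, Finsupp.single_apply, Prod.mk.injEq,
    smul_eq_mul]
  by_cases h : M' = M
  · subst h
    simp only [and_true, reduceIte, eq_comm (a := n'), mul_ite, mul_one, mul_zero]
  · simp [h, Ne.symm h]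

lemma diagN_apply (a : ℤ → ℂ) (n M n' M' : ℤ) : diagN a (radVec n M) (n', M') =
    if n' = n ∧ M' = M then a n else 0 := by
  rw [diagN_radVec]
  simp only [Finsupp.smul_apply, Finsupp.single_apply, Prod.mk.injEq, smul_eq_mul]
  split_ifs <;> simp_all

lemma mRad_apply (c : ℤ → ℂ) (k n M n' M' : ℤ) : mRad c k (radVec n M) (n', M') =
    if n' = n ∧ M' = M + k then c M else 0 := by
  rw [mRad_radVec]
  simp only [Finsupp.smul_apply, Finsupp.single_apply, Prod.mk.injEq, smul_eq_mul]
  split_ifs <;> simp_all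

end

end QMink

/-! ### Matrix elements of `R` and `S` in the orthonormal basis. -/

namespace QMink

noncomputable section

variable {q : ℝ}

/-- `{a}` in the space-like case, `[a]` in the time-like case. -/
def Family.ph : Family q → ℤ → ℝ
  | .space _ _, a => crl q a
  | .time _ _, a => brk q a

/-- The ratio of `cf` and `ph`. -/
def Family.phUnit : Family q → ℝ
  | .space _ _ => 1
  | .time _ _ => lam q

lemma Family.phUnit_pos (hq : 1 < q) (f : Family q) : 0 < f.phUnit := by
  cases f
  · exact one_pos
  · exact lam_pos hq

lemma Family.ph_eq (hq : 1 < q) (f : Family q) (a : ℤ) : f.ph a = f.cf a / f.phUnit := by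
  cases f
  · simp [Family.ph, Family.cf, Family.phUnit, Family.sgn, crl]
  · rw [Family.ph, Family.phUnit, eq_div_iff (lam_pos hq).ne', mul_comm, lam_mul_brk hq]
    simp [Family.cf, Family.sgn, sub_eq_add_neg]

/-- The functions `ph` and `cf` differ by a constant, which cancels in the ratio. Positivity of the
arguments matters only in the time-like case, where `cf` is positive exactly at positive integers.
-/
lemma Family.sqrt_ph_ratio (hq : 1 < q) (f : Family q) {a b c d : ℤ}
    (h : f.sgn = -1 → 0 < a ∧ 0 < b ∧ 0 < c ∧ 0 < d) :
    √(f.ph a * f.ph b / (f.ph c * f.ph d)) = f.rt a * f.rt b / (f.rt c * f.rt d) := by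
  have u := f.phUnit_pos hq
  have p := f.rt_pos
  have pa := p a
  have pb := p b
  have pc := p c
  have pd := p d
  rw [f.ph_eq hq, f.ph_eq hq, f.ph_eq hq, f.ph_eq hq, f.rt_sq hq fun e => (h e).1,
    f.rt_sq hq fun e => (h e).2.1, f.rt_sq hq fun e => (h e).2.2.1,
    f.rt_sq hq fun e => (h e).2.2.2]
  rw [← Real.sqrt_sq (show 0 ≤ f.rt a * f.rt b / (f.rt c * f.rt d) by positivity)]
  congr 1
  field_simp

lemma Family.unit_mul_sqrt_ph (hq : 1 < q) (f : Family q) {a b : ℤ}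
    (h : f.sgn = -1 → 0 < a ∧ 0 < b) :
    f.phUnit * √(f.ph a * f.ph b) = f.rt a * f.rt b := by
  have u := f.phUnit_pos hq
  have pa := f.rt_pos a
  have pb := f.rt_pos b
  have e : √(f.ph a * f.ph b) = f.rt a * f.rt b / f.phUnit := by
    rw [f.ph_eq hq, f.ph_eq hq, f.rt_sq hq fun e => (h e).1, f.rt_sq hq fun e => (h e).2,
      ← Real.sqrt_sq (show 0 ≤ f.rt a * f.rt b / f.phUnit by positivity)]
    congr 1
    field_simp
  rw [e, mul_div_cancel₀ _ u.ne']

lemma csig_zpow (f : Family q) (a : ℤ) : csig f.sig ((q : ℂ) ^ a) = (f.cf a : ℂ) := by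
  rw [csig, f.sig_eq, Family.cf, zpow_neg]; push_cast; rfl

lemma dsig_zpow (f : Family q) (a : ℤ) : dsig f.sig ((q : ℂ) ^ a) = (f.df a : ℂ) := by
  rw [dsig, f.sig_eq, Family.df, zpow_neg]; push_cast; rfl

/-- The common form of the reduced matrix elements of `R` and `S`. -/
def redRS (f : Family q) (α β γ : ℝ) (s' s : QNum) : ℝ :=
  if (s'.n = s.n + 1 ∨ s'.n = s.n - 1) ∧ s'.M = s.M then
    if s'.j = s.j + 1 then
      ((s'.n - s.n : ℤ) * α) / (crl q (s.j + 1) * brk q 2 ^ (3 / 2 : ℝ) * lam q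
            * √(brk q (2 * s.j + 1) * brk q (2 * s.j + 3)))
        * √(f.ph ((s'.n - s.n) * (s.j + 1) + s'.n + f.kap)
            * f.ph ((s'.n - s.n) * s.j + s'.n + f.kap)
            / (f.ph (s.n + f.kap) * f.ph (s'.n + f.kap)))
    else if s'.j = s.j ∧ 1 ≤ s.j then
      γ / (crl q (s.j + 1) * crl q s.j * brk q 2 ^ (3 / 2 : ℝ))
        * √(f.ph ((s'.n - s.n) * s.j + s'.n + f.kap) * f.ph (s.n - (s'.n - s.n) * s.j + f.kap)
            / (f.ph (s.n + f.kap) * f.ph (s'.n + f.kap)))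
    else if s.j = s'.j + 1 then
      -(((s'.n - s.n : ℤ) * β) / (crl q (s'.j + 1) * brk q 2 ^ (3 / 2 : ℝ) * lam q
            * √(brk q (2 * s'.j + 1) * brk q (2 * s'.j + 3))))
        * √(f.ph (s'.n - (s'.n - s.n) * (s'.j + 1) + f.kap)
            * f.ph (s.n - (s'.n - s.n) * (s'.j + 1) + f.kap)
            / (f.ph (s.n + f.kap) * f.ph (s'.n + f.kap)))
    else 0
  else 0

lemma redR_eq (f : Family q) (s' s : QNum) :
    redR f s' s = redRS f (q ^ (2 * s.j - 1)) (q ^ (-2 * s'.j - 5)) (q ^ (-3 : ℤ)) s' s := by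
  cases f <;> simp only [redR, redRSpace, redRTime, redRS, Family.ph, Family.kap, add_zero]

lemma redS_eq (f : Family q) (s' s : QNum) :
    redS f s' s = redRS f (q ^ (-3 : ℤ)) (q ^ (-3 : ℤ)) (-q ^ (-3 : ℤ)) s' s := by
  cases f <;>
    simp only [redS, redSSpace, redSTime, redRS, Family.ph, Family.kap, add_zero, neg_div]


lemma Family.occurs_time {f : Family q} {s : QNum} (h : f.Occurs s) (e : f.sgn = -1) :
    s.j ≤ s.n ∧ f.kap = 1 := by
  cases f with
  | space l hl => simp [Family.sgn] at e; norm_num at e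
  | time t ht => exact ⟨h.2, rfl⟩

lemma stayFac_zpow (hq : 1 < q) (j : ℤ) :
    stayFac q ((q : ℂ) ^ j) = ((1 / (crl q j * crl q (j + 1)) : ℝ) : ℂ) := by
  have h0 : (q : ℂ) ≠ 0 := by exact_mod_cast (show q ≠ 0 by linarith)
  have e : (q : ℂ) * (q : ℂ) ^ j = (q : ℂ) ^ (j + 1) := by rw [zpow_add_one₀ h0, mul_comm]
  rw [stayFac, e, crl, crl, zadd, zadd, zpow_neg, zpow_neg]
  push_cast
  rfl

/-- In the rational basis the step up carries no angular normalization, and the step down from `j +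
1` carries that of both steps, hence the square. -/
lemma downFac_zpow (hq : 1 < q) {j : ℤ} (hj : 0 ≤ j) : downFac q ((q : ℂ) ^ (j + 1)) =
    ((1 / (crl q (j + 1) * angNorm q j * lam q) ^ 2 : ℝ) : ℂ) := by
  have h0 : (q : ℂ) ≠ 0 := by exact_mod_cast (show q ≠ 0 by linarith)
  have e1 : ((q : ℂ) ^ (j + 1)) ^ 2 / q = (q : ℂ) ^ (2 * j + 1) := by
    rw [← zpow_natCast, ← zpow_mul, div_eq_mul_inv, ← zpow_sub_one₀ h0]; congr 1; push_cast; ring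
  have e2 : (q : ℂ) * ((q : ℂ) ^ (j + 1)) ^ 2 = (q : ℂ) ^ (2 * j + 3) := by
    rw [← zpow_natCast, ← zpow_mul, mul_comm, ← zpow_add_one₀ h0]; congr 1; push_cast; ring
  have e3 : zadd ((q : ℂ) ^ (j + 1)) = (crl q (j + 1) : ℂ) := by
    rw [crl, zadd, zpow_neg]; push_cast; rfl
  have e4 : angNorm q j ^ 2 = brk q (2 * j + 1) * brk q (2 * j + 3) :=
    posSqrt_sq (brk_mul_brk_pos hq hj)
  rw [downFac, e1, e2, e3, zsub_zpow hq, zsub_zpow hq, mul_pow, mul_pow, e4]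
  push_cast
  ring

lemma Family.rtProd_eq_mul (f : Family q) {a b : ℤ} (h : a = b + 1) :
    f.rtProd a = f.rt a * f.rtProd b := by rw [h, f.rtProd_add_one]

lemma Family.radGauge_eq (f : Family q) {j n N a b : ℤ} (hN : N = n + f.kap) (ha : a = N + j)
    (hb : b = N - j - 1) :
    f.radGauge j n = baseGauge q j * f.rt N / (f.rtProd a * f.rtProd b) := by
  subst ha hb hN; rfl

lemma brk_two_rpow (hq : 1 < q) : brk q 2 ^ (3 / 2 : ℝ) = √(brk q 2) ^ 3 := by
  rw [Real.sqrt_eq_rpow, ← Real.rpow_natCast, ← Real.rpow_mul (brk_pos hq two_pos).le]; norm_num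

/-- The reduced matrix elements of `R` and `S` in the rational and the orthonormal basis. -/
lemma redRS_match (hq : 1 < q) (f : Family q) (a b : ℂ → ℂ) (c : ℂ) (α β : ℤ → ℝ) (γ : ℝ)
    (ha : ∀ j : ℤ, a ((q : ℂ) ^ j) = ((q * α j : ℝ) : ℂ))
    (hb : ∀ j : ℤ, b ((q : ℂ) ^ (j + 1)) = ((q * β j : ℝ) : ℂ)) (hc : c = ((q * γ : ℝ) : ℂ))
    (s' s : State f) (Δ : Step) (hj : s'.1.j = s.1.j + Δ.shift) (h0 : Δ = .stay → s.1.j ≠ 0) :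
    (1 : ℂ) * ((redRS f (α s.1.j) (β s'.1.j) γ s'.1 s.1 * (vecUnit q / lam q ^ Δ.order) : ℝ) : ℂ) =
      ((f.radGauge s.1.j s.1.n / f.radGauge s'.1.j s'.1.n : ℝ) : ℂ) *
        ((1 / ((q : ℂ) + (q : ℂ)⁻¹)) • rsRed q f.sig f.kap a b c) Δ s.1.j (radVec s.1.n s.1.M)
          (s'.1.n, s'.1.M) := by
  have q0 : 0 < q := by linarith
  have hl := lam_pos hq
  have h2 := Real.sqrt_pos.2 (brk_pos hq two_pos)
  have h22 : (q : ℂ) + (q : ℂ)⁻¹ = ((√(brk q 2) ^ 2 : ℝ) : ℂ) := by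
    rw [Real.sq_sqrt (brk_pos hq two_pos).le, brk_two hq]; push_cast; rfl
  obtain ⟨⟨j, m, n, M⟩, hs⟩ := s
  obtain ⟨⟨j', m', n', M'⟩, hs'⟩ := s'
  have hm := (abs_nonneg _).trans ((f.occurs_iff _).1 hs).1
  have hm' := (abs_nonneg _).trans ((f.occurs_iff _).1 hs').1
  have t := Family.occurs_time hs
  have t' := Family.occurs_time hs'
  have cp := crl_pos hq
  have rp := f.rt_pos
  have Kp := f.rtProd_pos
  have Bp := baseGauge_pos hq
  simp only at hm hm' t t' hj h0 ⊢
  have e1 : ∀ n : ℤ, nuPow (q : ℂ) f.kap n = (q : ℂ) ^ (n + f.kap) := fun n => rfl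
  have q0' : (q : ℂ) ≠ 0 := by exact_mod_cast q0.ne'
  have e2 : ∀ a b : ℤ, (q : ℂ) ^ a / (q * (q : ℂ) ^ b) = (q : ℂ) ^ (a - b - 1) := fun a b => by
    rw [zpow_sub₀ q0', zpow_sub₀ q0', zpow_one]; field_simp
  have e3 : ∀ a b : ℤ, (q : ℂ) ^ a / (q ^ 2 * (q : ℂ) ^ b) = (q : ℂ) ^ (a - b - 2) := fun a b => by
    rw [zpow_sub₀ q0', zpow_sub₀ q0', zpow_ofNat]; field_simp
  have e4 : ∀ a b : ℤ, (q : ℂ) ^ a * (q : ℂ) ^ b = (q : ℂ) ^ (a + b) := fun a b =>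
    (zpow_add₀ q0' a b).symm
  have e5 : ∀ a : ℤ, (q : ℂ) ^ a / q = (q : ℂ) ^ (a - 1) := fun a => by
    rw [zpow_sub_one₀ q0', div_eq_mul_inv]
  by_cases hM : M' = M
  swap
  · cases Δ <;> simp [rsRed, uRed, ladder_apply, redRS, hM]
  subst hM
  obtain ⟨N, hN⟩ : ∃ N, N = n + f.kap := ⟨_, rfl⟩
  have d1 : n + 1 - n = 1 := by ring
  have d2 : n - 1 - n = -1 := by ring
  -- In every case both radial gauges are expressed through a common product `rtProd`. Their ratio
  -- then leaves just the few roots `rt` that appear in the matrix element.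
  obtain h | h | h : n' = n + 1 ∨ n' = n - 1 ∨ ¬ (n' = n + 1 ∨ n' = n - 1) := by tauto
  · subst h
    cases Δ
    · simp only [Step.shift] at hj
      subst hj
      simp only [rsRed, Pi.smul_apply, LinearMap.smul_apply, Finsupp.smul_apply, ladder_apply,
        redRS, d1, ha, e1, e2, e3, csig_zpow, h22, smul_eq_mul]
      simp only [if_true, and_self, true_or, if_neg (show ¬ n + 1 = n - 1 by omega), add_zero]
      rw [show 1 * (j + 1) + (n + 1) + f.kap = N + j + 2 by omega,
        show 1 * j + (n + 1) + f.kap = N + j + 1 by omega,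
        show n + f.kap = N by omega,
        show n + 1 + f.kap = N + 1 by omega,
        f.sqrt_ph_ratio hq (fun e => by have := t e; have := t' e; omega),
        f.radGauge_eq (N := N) (a := N + j) (b := N - j - 1) (by omega) (by omega) (by omega),
        f.radGauge_eq (N := N + 1) (a := N + j + 2) (b := N - j - 1) (by omega) (by omega)
          (by omega),
        f.rtProd_eq_mul (a := N + j + 2) (b := N + j + 1) (by omega),
        f.rtProd_eq_mul (a := N + j + 1) (b := N + j) (by omega),
        f.rt_sq hq (a := N) (fun e => by have := t e; have := t' e; omega),
        angNorm_eq hq hm,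
        brk_two_rpow hq,
        baseGauge_add_one hq]
      simp only [Step.order, vecUnit, Int.cast_one]
      norm_cast
      have p0 := cp (j + 1)
      have p1 := rp (N)
      have p2 := rp (N + 1)
      have p3 := rp (N + j + 1)
      have p4 := rp (N + j + 2)
      have p5 := Kp (N + j)
      have p6 := Kp (N + j + 1)
      have p7 := Kp (N + j + 2)
      have p8 := Kp (N - j - 1)
      have p9 := Bp j
      have p10 := angNorm_pos (q := q) j
      field_simp
    · obtain rfl : j = j' := by simpa [Step.shift] using hj.symm
      simp only [rsRed, uRed, Pi.smul_apply, LinearMap.smul_apply, Finsupp.smul_apply,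
        ladder_apply, redRS, d1, hc, stayFac_zpow hq, e1, e2, e4, csig_zpow, h22, smul_eq_mul]
      simp only [if_true, and_self, true_or, if_neg (show ¬ n + 1 = n - 1 by omega), add_zero,
        if_neg (show ¬ j = j + 1 by omega), show 1 ≤ j by have := h0 rfl; omega]
      rw [show 1 * j + (n + 1) + f.kap = N + j + 1 by omega,
        show n - 1 * j + f.kap = N - j by omega,
        show n + f.kap = N by omega,
        show n + 1 + f.kap = N + 1 by omega,
        f.sqrt_ph_ratio hq (fun e => by have := t e; have := t' e; omega),
        f.radGauge_eq (N := N) (a := N + j) (b := N - j - 1) (by omega) (by omega) (by omega),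
        f.radGauge_eq (N := N + 1) (a := N + j + 1) (b := N - j) (by omega) (by omega) (by omega),
        f.rtProd_eq_mul (a := N + j + 1) (b := N + j) (by omega),
        f.rtProd_eq_mul (a := N - j) (b := N - j - 1) (by omega),
        f.rt_sq hq (a := N) (fun e => by have := t e; have := t' e; omega),
        brk_two_rpow hq]
      simp only [Step.order, vecUnit]
      norm_cast
      have p0 := cp (j)
      have p1 := cp (j + 1)
      have p2 := rp (N)
      have p3 := rp (N + 1)
      have p4 := rp (N + j + 1)
      have p5 := rp (N - j)
      have p6 := Kp (N + j)
      have p7 := Kp (N + j + 1)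
      have p8 := Kp (N - j)
      have p9 := Kp (N - j - 1)
      have p10 := Bp j
      field_simp
    · obtain rfl : j = j' + 1 := by simp [Step.shift] at hj; omega
      simp only [rsRed, Pi.smul_apply, LinearMap.smul_apply, Finsupp.smul_apply, ladder_apply,
        redRS, d1, hb, downFac_zpow hq hm', e1, e4, e5, csig_zpow, h22, smul_eq_mul]
      simp only [if_true, and_self, true_or, if_neg (show ¬ n + 1 = n - 1 by omega), add_zero,
        if_neg (show ¬ j' = j' + 1 + 1 by omega), if_neg (show ¬ (j' = j' + 1 ∧
        1 ≤ j' + 1) by omega)]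
      rw [show n + 1 - 1 * (j' + 1) + f.kap = N - j' by omega,
        show n - 1 * (j' + 1) + f.kap = N - j' - 1 by omega,
        show n + f.kap = N by omega,
        show n + 1 + f.kap = N + 1 by omega,
        f.sqrt_ph_ratio hq (fun e => by have := t e; have := t' e; omega),
        f.radGauge_eq (N := N) (a := N + j' + 1) (b := N - j' - 2) (by omega) (by omega) (by omega),
        f.radGauge_eq (N := N + 1) (a := N + j' + 1) (b := N - j') (by omega) (by omega) (by omega),
        f.rtProd_eq_mul (a := N - j') (b := N - j' - 1) (by omega),
        f.rtProd_eq_mul (a := N - j' - 1) (b := N - j' - 2) (by omega),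
        f.rt_sq hq (a := N) (fun e => by have := t e; have := t' e; omega),
        angNorm_eq hq hm',
        brk_two_rpow hq,
        baseGauge_add_one hq]
      simp only [Step.order, vecUnit, Int.cast_one]
      norm_cast
      have p0 := cp (j' + 1)
      have p1 := rp (N)
      have p2 := rp (N + 1)
      have p3 := rp (N - j')
      have p4 := rp (N - j' - 1)
      have p5 := Kp (N + j' + 1)
      have p6 := Kp (N - j')
      have p7 := Kp (N - j' - 1)
      have p8 := Kp (N - j' - 2)
      have p9 := Bp j'
      have p10 := angNorm_pos (q := q) j'
      field_simp
  -- In the rational basis all numerators sit on the step to `n - 1`. Therefore, unlike for `n + 1`,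
  -- factors `cf` in the numerator have to be written as squares of roots.
  · subst h
    cases Δ
    · simp only [Step.shift] at hj
      subst hj
      simp only [rsRed, Pi.smul_apply, LinearMap.smul_apply, Finsupp.smul_apply, ladder_apply,
        redRS, d2, ha, e1, e2, e3, csig_zpow, h22, smul_eq_mul]
      simp only [if_true, and_self, or_true, if_neg (show ¬ n - 1 = n + 1 by omega), zero_add]
      rw [show -1 * (j + 1) + (n - 1) + f.kap = N - j - 2 by omega,
        show -1 * j + (n - 1) + f.kap = N - j - 1 by omega,
        show n + f.kap - j - 2 = N - j - 2 by omega,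
        show n + f.kap - j - 1 = N - j - 1 by omega,
        show n + f.kap = N by omega,
        show n - 1 + f.kap = N - 1 by omega,
        f.sqrt_ph_ratio hq (fun e => by have := t e; have := t' e; omega),
        f.radGauge_eq (N := N) (a := N + j) (b := N - j - 1) (by omega) (by omega) (by omega),
        f.radGauge_eq (N := N - 1) (a := N + j) (b := N - j - 3) (by omega) (by omega) (by omega),
        f.rtProd_eq_mul (a := N - j - 1) (b := N - j - 2) (by omega),
        f.rtProd_eq_mul (a := N - j - 2) (b := N - j - 3) (by omega),
        f.rt_sq hq (a := N) (fun e => by have := t e; have := t' e; omega),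
        f.rt_sq hq (a := N - j - 1) (fun e => by have := t e; have := t' e; omega),
        f.rt_sq hq (a := N - j - 2) (fun e => by have := t e; have := t' e; omega),
        angNorm_eq hq hm,
        brk_two_rpow hq,
        baseGauge_add_one hq]
      simp only [Step.order, vecUnit, Int.cast_neg, Int.cast_one]
      norm_cast
      have p0 := cp (j + 1)
      have p1 := rp (N)
      have p2 := rp (N - 1)
      have p3 := rp (N - j - 1)
      have p4 := rp (N - j - 2)
      have p5 := Kp (N + j)
      have p6 := Kp (N - j - 1)
      have p7 := Kp (N - j - 2)
      have p8 := Kp (N - j - 3)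
      have p9 := Bp j
      have p10 := angNorm_pos (q := q) j
      field_simp
      simp
    · obtain rfl : j = j' := by simpa [Step.shift] using hj.symm
      simp only [rsRed, uRed, Pi.smul_apply, LinearMap.smul_apply, Finsupp.smul_apply,
        ladder_apply, redRS, d2, hc, stayFac_zpow hq, e1, e2, e4, csig_zpow, h22, smul_eq_mul]
      simp only [if_true, and_self, or_true, if_neg (show ¬ n - 1 = n + 1 by omega), zero_add,
        if_neg (show ¬ j = j + 1 by omega), show 1 ≤ j by have := h0 rfl; omega]
      rw [show -1 * j + (n - 1) + f.kap = N - j - 1 by omega,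
        show n - -1 * j + f.kap = N + j by omega,
        show n + f.kap + j = N + j by omega,
        show n + f.kap - j - 1 = N - j - 1 by omega,
        show n + f.kap = N by omega,
        show n - 1 + f.kap = N - 1 by omega,
        f.sqrt_ph_ratio hq (fun e => by have := t e; have := t' e; omega),
        f.radGauge_eq (N := N) (a := N + j) (b := N - j - 1) (by omega) (by omega) (by omega),
        f.radGauge_eq (N := N - 1) (a := N + j - 1) (b := N - j - 2) (by omega) (by omega)
          (by omega),
        f.rtProd_eq_mul (a := N + j) (b := N + j - 1) (by omega),
        f.rtProd_eq_mul (a := N - j - 1) (b := N - j - 2) (by omega),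
        f.rt_sq hq (a := N) (fun e => by have := t e; have := t' e; omega),
        f.rt_sq hq (a := N - j - 1) (fun e => by have := t e; have := t' e; omega),
        f.rt_sq hq (a := N + j) (fun e => by have := t e; have := t' e; omega),
        brk_two_rpow hq]
      simp only [Step.order, vecUnit]
      norm_cast
      have p0 := cp (j)
      have p1 := cp (j + 1)
      have p2 := rp (N)
      have p3 := rp (N + j)
      have p4 := rp (N - 1)
      have p5 := rp (N - j - 1)
      have p6 := Kp (N + j)
      have p7 := Kp (N + j - 1)
      have p8 := Kp (N - j - 1)
      have p9 := Kp (N - j - 2)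
      have p10 := Bp j
      field_simp
    · obtain rfl : j = j' + 1 := by simp [Step.shift] at hj; omega
      simp only [rsRed, Pi.smul_apply, LinearMap.smul_apply, Finsupp.smul_apply, ladder_apply,
        redRS, d2, hb, downFac_zpow hq hm', e1, e4, e5, csig_zpow, h22, smul_eq_mul]
      simp only [if_true, and_self, or_true, if_neg (show ¬ n - 1 = n + 1 by omega), zero_add,
        if_neg (show ¬ j' = j' + 1 + 1 by omega), if_neg (show ¬ (j' = j' + 1 ∧
        1 ≤ j' + 1) by omega)]
      rw [show n - 1 - -1 * (j' + 1) + f.kap = N + j' by omega,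
        show n - -1 * (j' + 1) + f.kap = N + j' + 1 by omega,
        show n + f.kap + (j' + 1) - 1 = N + j' by omega,
        show n + f.kap + (j' + 1) = N + j' + 1 by omega,
        show n + f.kap = N by omega,
        show n - 1 + f.kap = N - 1 by omega,
        f.sqrt_ph_ratio hq (fun e => by have := t e; have := t' e; omega),
        f.radGauge_eq (N := N) (a := N + j' + 1) (b := N - j' - 2) (by omega) (by omega) (by omega),
        f.radGauge_eq (N := N - 1) (a := N + j' - 1) (b := N - j' - 2) (by omega) (by omega)
          (by omega),
        f.rtProd_eq_mul (a := N + j' + 1) (b := N + j') (by omega),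
        f.rtProd_eq_mul (a := N + j') (b := N + j' - 1) (by omega),
        f.rt_sq hq (a := N) (fun e => by have := t e; have := t' e; omega),
        f.rt_sq hq (a := N + j' + 1) (fun e => by have := t e; have := t' e; omega),
        f.rt_sq hq (a := N + j') (fun e => by have := t e; have := t' e; omega),
        angNorm_eq hq hm',
        brk_two_rpow hq,
        baseGauge_add_one hq]
      simp only [Step.order, vecUnit, Int.cast_neg, Int.cast_one]
      norm_cast
      have p0 := cp (j' + 1)
      have p1 := rp (N)
      have p2 := rp (N + j')
      have p3 := rp (N + j' + 1)
      have p4 := rp (N - 1)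
      have p5 := Kp (N + j')
      have p6 := Kp (N + j' + 1)
      have p7 := Kp (N + j' - 1)
      have p8 := Kp (N - j' - 2)
      have p9 := Bp j'
      have p10 := angNorm_pos (q := q) j'
      field_simp
      simp
  · cases Δ <;>
      simp [rsRed, uRed, ladder_apply, redRS, not_or.1 h]

end

end QMink

/-! ### Matrix elements of `X` in the orthonormal basis. -/

namespace QMink

noncomputable section

variable {q : ℝ}


/-- The common form of the eigenvalues of `X^0`. -/
lemma timeVal_eq (hq : 1 < q) (f : Family q) (s : QNum) :
    timeVal f s = f.len * q ^ s.M / brk q 2 * f.df (s.n + f.kap) := by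
  cases f
  · have := lam_mul_brk hq s.n
    simp only [timeVal, Family.len, Family.df, Family.sgn, Family.kap, add_zero, one_mul]
    rw [← this]; ring
  · simp [timeVal, Family.len, Family.df, Family.sgn, Family.kap, crl]

/-- The common form of the reduced matrix elements of `X`. -/
def redXForm (f : Family q) (s' s : QNum) : ℝ :=
  if s'.n = s.n ∧ s'.M = s.M then
    if s'.j = s.j + 1 then
      f.len * q ^ (s.M + s.j) *
        (f.phUnit * √(f.ph (s.n + f.kap + s.j + 1) * f.ph (s.n + f.kap - s.j - 1))
        / (crl q (s.j + 1) * √(brk q 2 * brk q (2 * s.j + 1) * brk q (2 * s.j + 3))))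
    else if s'.j = s.j ∧ 1 ≤ s.j then
      -q⁻¹ * ((f.len * q ^ s.M * lam q * f.df (s.n + f.kap))
        / (√(brk q 2) * crl q s.j * crl q (s.j + 1)))
    else if s.j = s'.j + 1 then
      -f.len * q ^ (s.M - s'.j - 2) *
        (f.phUnit * √(f.ph (s.n + f.kap + s'.j + 1) * f.ph (s.n + f.kap - s'.j - 1))
        / (crl q (s'.j + 1) * √(brk q 2 * brk q (2 * s'.j + 1) * brk q (2 * s'.j + 3))))
    else 0
  else 0

lemma redX_eq (hq : 1 < q) (f : Family q) (s' s : QNum) : redX f s' s = redXForm f s' s := by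
  cases f
  · have := lam_mul_brk hq s.n
    simp only [redX, redXSpace, redXForm, Family.ph, Family.kap, add_zero, Family.len,
      Family.phUnit, one_mul, Family.df, Family.sgn]
    rw [← this, pow_two]
    congr 5
    ring
  · simp only [redX, redXTime, redXForm, Family.ph, Family.kap, Family.len,
      Family.phUnit, Family.df, Family.sgn]
    have e1 : ∀ a : ℤ, s.n + 1 + a + 1 = s.n + a + 2 := fun a => by ring
    have e2 : ∀ a : ℤ, s.n + 1 - a - 1 = s.n - a := fun a => by ring
    have e3 : crl q (s.n + 1) = q ^ (s.n + 1) - -1 * q ^ (-(s.n + 1)) := by rw [crl]; ring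
    simp only [e1, e2, e3, mul_comm (brk q (s.n + _ + 2))]
    split_ifs <;> ring

lemma vec_smul_apply (c : ℂ) (y : RedVec) (Δ : Step) (j n M n' M' : ℤ) :
    y Δ j (c • radVec n M) (n', M') = c * y Δ j (radVec n M) (n', M') := by
  rw [map_smul]; rfl

/-- The reduced matrix elements of `X` in the rational and the orthonormal basis. -/
lemma redX_match (hq : 1 < q) (f : Family q)
    (s' s : State f) (Δ : Step) (hj : s'.1.j = s.1.j + Δ.shift) (h0 : Δ = .stay → s.1.j ≠ 0) :
    (1 : ℂ) * ((redX f s'.1 s.1 * (vecUnit q / lam q ^ Δ.order) : ℝ) : ℂ) =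
      ((f.radGauge s.1.j s.1.n / f.radGauge s'.1.j s'.1.n : ℝ) : ℂ) *
        vecScal (xRed q f.sig f.kap)
          (fun _ => mRad (fun M => f.len * (q : ℂ) ^ M / (q + (q : ℂ)⁻¹)) 0) Δ s.1.j
          (radVec s.1.n s.1.M) (s'.1.n, s'.1.M) := by
  have q0 : 0 < q := by linarith
  have hl := lam_pos hq
  have h2 := Real.sqrt_pos.2 (brk_pos hq two_pos)
  have h22 : (q : ℂ) + (q : ℂ)⁻¹ = ((√(brk q 2) ^ 2 : ℝ) : ℂ) := by
    rw [Real.sq_sqrt (brk_pos hq two_pos).le, brk_two hq]; push_cast; rfl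
  have h23 : q ^ 2 - (q ^ 2)⁻¹ = lam q * √(brk q 2) ^ 2 := by
    rw [Real.sq_sqrt (brk_pos hq two_pos).le, brk_two hq, lam]; field_simp; ring
  have h24 : ∀ j : ℤ, 0 ≤ j →
      √(brk q 2 * brk q (2 * j + 1) * brk q (2 * j + 3))
        = √(brk q 2) * angNorm q j := fun j hj => by
    rw [mul_assoc, Real.sqrt_mul (brk_pos hq two_pos).le, angNorm_eq hq hj]
  rw [redX_eq hq]
  obtain ⟨⟨j, m, n, M⟩, hs⟩ := s
  obtain ⟨⟨j', m', n', M'⟩, hs'⟩ := s'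
  have hm := (abs_nonneg _).trans ((f.occurs_iff _).1 hs).1
  have hm' := (abs_nonneg _).trans ((f.occurs_iff _).1 hs').1
  have t := Family.occurs_time hs
  have t' := Family.occurs_time hs'
  have cp := crl_pos hq
  have rp := f.rt_pos
  have Kp := f.rtProd_pos
  have Bp := baseGauge_pos hq
  simp only at hm hm' t t' hj h0 ⊢
  have e1 : ∀ n : ℤ, nuPow (q : ℂ) f.kap n = (q : ℂ) ^ (n + f.kap) := fun n => rfl
  have q0' : (q : ℂ) ≠ 0 := by exact_mod_cast q0.ne'
  have e2 : ∀ a b : ℤ, (q : ℂ) ^ a / (q * (q : ℂ) ^ b) = (q : ℂ) ^ (a - b - 1) := fun a b => by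
    rw [zpow_sub₀ q0', zpow_sub₀ q0', zpow_one]; field_simp
  have e4 : ∀ a b : ℤ, (q : ℂ) ^ a * (q : ℂ) ^ b = (q : ℂ) ^ (a + b) := fun a b =>
    (zpow_add₀ q0' a b).symm
  simp only [vecScal, Module.End.mul_apply, mRad_radVec, add_zero, vec_smul_apply]
  by_cases hM : ¬ (n' = n ∧ M' = M)
  · cases Δ <;> simp [xRed, diagN_apply, redXForm, hM]
  obtain ⟨rfl, rfl⟩ := not_not.1 hM
  obtain ⟨N, hN⟩ : ∃ N, N = n' + f.kap := ⟨_, rfl⟩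
  cases Δ
  · simp only [Step.shift] at hj
    subst hj
    simp only [xRed, diagN_apply, redXForm, e1, e2, csig_zpow, h22, and_self, if_true]
    norm_cast
    rw [← hN, f.unit_mul_sqrt_ph hq (fun e => by have := t e; have := t' e; omega), h23,
      f.radGauge_eq (N := N) (a := N + j) (b := N - j - 1) (by omega) (by omega) (by omega),
      f.radGauge_eq (N := N) (a := N + j + 1) (b := N - j - 2) (by omega) (by omega) (by omega),
      f.rtProd_eq_mul (a := N + j + 1) (b := N + j) (by omega),
      f.rtProd_eq_mul (a := N - j - 1) (b := N - j - 2) (by omega),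
      f.rt_sq hq (a := N - j - 1) (fun e => by have := t e; have := t' e; omega), h24 _ hm,
      baseGauge_add_one hq, zpow_add₀ q0.ne']
    simp only [Step.order, vecUnit, pow_zero]
    have p0 := cp (j + 1)
    have p1 := rp N
    have p2 := rp (N + j + 1)
    have p3 := rp (N - j - 1)
    have p4 := Kp (N + j)
    have p5 := Kp (N - j - 2)
    have p6 := Bp j
    have p7 := angNorm_pos (q := q) j
    field_simp
  · obtain rfl : j = j' := by simpa [Step.shift] using hj.symm
    simp only [xRed, diagN_apply, redXForm, e1, dsig_zpow, h22, and_self, if_true,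
      stayFac_zpow hq, if_neg (show ¬ j = j + 1 by omega),
      show 1 ≤ j by have := h0 rfl; omega]
    norm_cast
    rw [← hN, div_self (f.radGauge_pos hq _ _).ne', h23]
    simp only [Step.order, vecUnit, pow_one]
    have p0 := cp (j + 1)
    have p1 := cp j
    field_simp
  · obtain rfl : j = j' + 1 := by simp [Step.shift] at hj; omega
    simp only [xRed, diagN_apply, redXForm, e1, e4, csig_zpow, h22, and_self, if_true,
      downFac_zpow hq hm', if_neg (show ¬ j' = j' + 1 + 1 by omega),
      if_neg (show ¬ (j' = j' + 1 ∧ 1 ≤ j' + 1) by omega)]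
    norm_cast
    rw [← hN, f.unit_mul_sqrt_ph hq (fun e => by have := t e; have := t' e; omega), h23,
      show N + (j' + 1) = N + j' + 1 by ring,
      f.radGauge_eq (N := N) (a := N + j' + 1) (b := N - j' - 2) (by omega) (by omega) (by omega),
      f.radGauge_eq (N := N) (a := N + j') (b := N - j' - 1) (by omega) (by omega) (by omega),
      f.rtProd_eq_mul (a := N + j' + 1) (b := N + j') (by omega),
      f.rtProd_eq_mul (a := N - j' - 1) (b := N - j' - 2) (by omega),
      f.rt_sq hq (a := N + j' + 1) (fun e => by have := t e; have := t' e; omega), h24 _ hm',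
      baseGauge_add_one hq, zpow_sub₀ q0.ne', zpow_sub₀ q0.ne', zpow_ofNat, zpow_add_one₀ q0.ne']
    simp only [Step.order, vecUnit]
    have p0 := cp (j' + 1)
    have p1 := rp N
    have p2 := rp (N + j' + 1)
    have p3 := rp (N - j' - 1)
    have p4 := Kp (N + j')
    have p5 := Kp (N - j' - 2)
    have p6 := Bp j'
    have p7 := angNorm_pos (q := q) j'
    field_simp

end

end QMink

/-! ### The momenta in the rational basis. -/

namespace QMink

noncomputable section

variable {q : ℝ}

/-- The factors of the momenta that depend on the length, divided by the imaginary unit. -/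
def Family.momFac (f : Family q) (k M : ℤ) : ℝ :=
  -(f.sgn * q ^ (2 - k) / (2 * lam q ^ 2 * f.len * q ^ M))

lemma momFac_eq (f : Family q) (k M : ℤ) :
    -(Complex.I * f.sig * (q : ℂ) ^ (2 - k) / (2 * (q - (q : ℂ)⁻¹) ^ 2 * f.len * (q : ℂ) ^ M)) =
      Complex.I * (f.momFac k M : ℂ) := by
  rw [Family.momFac, lam, f.sig_eq]; push_cast; ring

/-- The reduced form of the part of the momenta that changes `M` by `k`. -/
def momPart (f : Family q) (k : ℤ) : RedVec :=
  scalVec (fun _ => mRad (fun M => Complex.I * (f.momFac k M : ℂ)) k)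
    (vecScal (xRed q f.sig f.kap) (uRed q f.sig f.kap)
      - ((q : ℂ) ^ k) • scalVec (uRed q f.sig f.kap) (xRed q f.sig f.kap))

/-- The time component of the same. -/
def momPartZero (f : Family q) (k : ℤ) : ℤ → Module.End ℂ Radial :=
  (fun _ => mRad (fun M => Complex.I * (f.momFac k M : ℂ)) k) *
    (x0Red q f.sig f.kap * uRed q f.sig f.kap
      - ((q : ℂ) ^ k) • (uRed q f.sig f.kap * x0Red q f.sig f.kap))

/-- The matrix elements of `[2] U` from `n` to `n - 1` in the rational basis. -/
def Family.uDown (f : Family q) (j N : ℤ) : ℝ := f.cf (N - j - 1) * f.cf (N + j) / f.cf N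

lemma uRed_radVec (hq : 1 < q) (f : Family q) (j n M : ℤ) :
    uRed q f.sig f.kap j (radVec n M) = ((1 / f.cf (n + f.kap) : ℝ) : ℂ) • radVec (n + 1) M
      + (f.uDown j (n + f.kap) : ℂ) • radVec (n - 1) M := by
  have q0 : (q : ℂ) ≠ 0 := by exact_mod_cast (show q ≠ 0 by linarith)
  have e1 : nuPow (q : ℂ) f.kap n / (q * (q : ℂ) ^ j) = (q : ℂ) ^ (n + f.kap - j - 1) := by
    rw [nuPow, zpow_sub₀ q0 _ 1, zpow_sub₀ q0, zpow_one]; field_simp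
  have e2 : nuPow (q : ℂ) f.kap n * (q : ℂ) ^ j = (q : ℂ) ^ (n + f.kap + j) := by
    rw [nuPow, ← zpow_add₀ q0]
  rw [uRed, ladder_radVec, e1, e2, nuPow, csig_zpow, csig_zpow, csig_zpow, Family.uDown]
  push_cast
  rfl

/-- The eigenvalues of the reduced matrix elements of the rescaled coordinates. -/
def Family.xVal (f : Family q) : Step → ℤ → ℤ → ℝ
  | .up, j, N => lam q * √(brk q 2) ^ 2 * q ^ (j + 1) * f.cf (N - j - 1)
  | .stay, j, N => -(lam q * √(brk q 2) ^ 2) / (crl q j * crl q (j + 1)) * f.df N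
  | .down, j, N => -(lam q * √(brk q 2) ^ 2) / q ^ j
      / (crl q j * angNorm q (j - 1) * lam q) ^ 2 * f.cf (N + j)

lemma xRed_radVec (hq : 1 < q) (f : Family q) (Δ : Step) (j n M : ℤ) (hj : Δ = .down → 0 < j) :
    xRed q f.sig f.kap Δ j (radVec n M) = (f.xVal Δ j (n + f.kap) : ℂ) • radVec n M := by
  have q0' : q ≠ 0 := by linarith
  have q0 : (q : ℂ) ≠ 0 := by exact_mod_cast q0'
  have e1 : nuPow (q : ℂ) f.kap n / (q * (q : ℂ) ^ j) = (q : ℂ) ^ (n + f.kap - j - 1) := by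
    rw [nuPow, zpow_sub₀ q0 _ 1, zpow_sub₀ q0, zpow_one]; field_simp
  have e2 : nuPow (q : ℂ) f.kap n * (q : ℂ) ^ j = (q : ℂ) ^ (n + f.kap + j) := by
    rw [nuPow, ← zpow_add₀ q0]
  have h23 : (q : ℂ) ^ 2 - ((q : ℂ) ^ 2)⁻¹ = ((lam q * √(brk q 2) ^ 2 : ℝ) : ℂ) := by
    rw [Real.sq_sqrt (brk_pos hq two_pos).le, brk_two hq, lam]; push_cast; field_simp; ring
  cases Δ
  · rw [xRed, diagN_radVec, e1, csig_zpow, h23, Family.xVal, zpow_add_one₀ q0']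
    push_cast
    congr 1; ring
  · rw [xRed, diagN_radVec, nuPow, dsig_zpow, h23, stayFac_zpow hq, Family.xVal]
    push_cast
    congr 1; ring
  · have := downFac_zpow hq (show 0 ≤ j - 1 by have := hj rfl; omega)
    rw [sub_add_cancel] at this
    rw [xRed, diagN_radVec, e2, csig_zpow, h23, this, Family.xVal]
    push_cast
    congr 1; ring

lemma x0Red_radVec (f : Family q) (j n M : ℤ) :
    x0Red q f.sig f.kap j (radVec n M) = (f.df (n + f.kap) : ℂ) • radVec n M := by
  rw [x0Red, diagN_radVec, nuPow, dsig_zpow]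

/-- The values of the reduced matrix elements of `x u - α u x` to `n + 1` and `n - 1`. -/
def Family.comVal (f : Family q) (α : ℝ) (Δ : Step) (j N : ℤ) (up : Bool) : ℝ :=
  if up then (f.xVal Δ j (N + 1) - α * f.xVal Δ j N) / f.cf N
  else f.xVal Δ j (N - 1) * f.uDown j N - α * (f.xVal Δ j N * f.uDown (j + Δ.shift) N)

/-- The same for the time component. -/
def Family.comValZero (f : Family q) (α : ℝ) (j N : ℤ) (up : Bool) : ℝ :=
  if up then (f.df (N + 1) - α * f.df N) / f.cf N
  else (f.df (N - 1) - α * f.df N) * f.uDown j N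

lemma momPart_radVec (hq : 1 < q) (f : Family q) (k : ℤ) (Δ : Step) (j n M : ℤ)
    (hj : Δ = .down → 0 < j) : momPart f k Δ j (radVec n M) =
      (Complex.I * (f.momFac k M * f.comVal (q ^ k) Δ j (n + f.kap) true : ℝ)) •
          radVec (n + 1) (M + k)
        + (Complex.I * (f.momFac k M * f.comVal (q ^ k) Δ j (n + f.kap) false : ℝ)) •
          radVec (n - 1) (M + k) := by
  have key : ∀ j', (j' = j + Δ.shift) → momPart f k Δ j (radVec n M) =
      mRad (fun M => Complex.I * (f.momFac k M : ℂ)) k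
        (xRed q f.sig f.kap Δ j (uRed q f.sig f.kap j (radVec n M))
          - ((q : ℂ) ^ k) • uRed q f.sig f.kap j' (xRed q f.sig f.kap Δ j (radVec n M))) := by
    rintro j' rfl
    cases Δ
    · rfl
    · simp only [Step.shift, add_zero]; rfl
    · rfl
  rw [key _ rfl, xRed_radVec hq f Δ j n M hj, uRed_radVec hq, map_add, map_smul, map_smul,
    xRed_radVec hq f Δ j _ M hj, xRed_radVec hq f Δ j _ M hj, map_smul, uRed_radVec hq]
  simp only [map_sub, map_add, map_smul, mRad_radVec, Family.comVal, if_true, Bool.false_eq_true,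
    if_false, show n + 1 + f.kap = n + f.kap + 1 by ring,
      show n - 1 + f.kap = n + f.kap - 1 by ring]
  match_scalars <;> ring

lemma momPartZero_radVec (hq : 1 < q) (f : Family q) (k : ℤ) (j n M : ℤ) :
    momPartZero f k j (radVec n M) =
      (Complex.I * (f.momFac k M * f.comValZero (q ^ k) j (n + f.kap) true : ℝ)) •
          radVec (n + 1) (M + k)
        + (Complex.I * (f.momFac k M * f.comValZero (q ^ k) j (n + f.kap) false : ℝ)) •
          radVec (n - 1) (M + k) := by
  have key : momPartZero f k j (radVec n M) = mRad (fun M => Complex.I * (f.momFac k M : ℂ)) k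
      (x0Red q f.sig f.kap j (uRed q f.sig f.kap j (radVec n M))
        - ((q : ℂ) ^ k) • uRed q f.sig f.kap j (x0Red q f.sig f.kap j (radVec n M))) := rfl
  rw [key, x0Red_radVec, uRed_radVec hq, map_add, map_smul, map_smul, x0Red_radVec, x0Red_radVec,
    map_smul, uRed_radVec hq]
  simp only [map_sub, map_add, map_smul, mRad_radVec, Family.comValZero, if_true,
    Bool.false_eq_true, if_false, show n + 1 + f.kap = n + f.kap + 1 by ring,
    show n - 1 + f.kap = n + f.kap - 1 by ring]
  match_scalars <;> ring

section Values

variable (f : Family q)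

/-- A `q`-difference with the factor `q` or `q⁻¹` annihilates one of the two exponentials in `cf`
and `df`. So the `q`-commutators in the momenta leave single powers of `q`, which are the powers in
the matrix elements of `P`. -/
lemma cf_rel (hq : 1 < q) (N : ℤ) : f.cf (N + 1) - q * f.cf N = -f.sgn * lam q * q ^ (-N) ∧
    f.cf (N + 1) - q⁻¹ * f.cf N = lam q * q ^ N ∧
    f.cf N - q * f.cf (N + 1) = -lam q * q ^ (N + 1) ∧
    f.cf N - q⁻¹ * f.cf (N + 1) = f.sgn * lam q * q ^ (-N - 1) ∧
    f.df (N + 1) - q * f.df N = f.sgn * lam q * q ^ (-N) ∧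
    f.df (N + 1) - q⁻¹ * f.df N = lam q * q ^ N ∧
    f.df N - q * f.df (N + 1) = -lam q * q ^ (N + 1) ∧
    f.df N - q⁻¹ * f.df (N + 1) = -f.sgn * lam q * q ^ (-N - 1) := by
  have q0 : q ≠ 0 := by linarith
  have hN : q ^ N ≠ 0 := zpow_ne_zero _ q0
  simp only [Family.cf, Family.df, lam, neg_add, zpow_add₀ q0, zpow_sub₀ q0, zpow_neg, zpow_one]
  refine ⟨?_, ?_, ?_, ?_, ?_, ?_, ?_, ?_⟩ <;> field_simp <;> ring


end Values

end

end QMink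

/-! ### Closed forms of the `q`-commutators of `x` and `u`. -/

namespace QMink

noncomputable section

variable {q : ℝ}

/-- For the step to `n + 1` the difference is taken in the factor `cf (N - j - 1)` of `x`. For the
step to `n - 1` two factors are common to both orders of `x` and `u`, and the difference comes from
`cf (N + j)` and `cf (N + j + 1)` in `uDown` at `j` and `j + 1`. -/
lemma comVal_up (hq : 1 < q) (f : Family q) (j N : ℤ) :
    f.comVal q .up j N true =
        lam q * √(brk q 2) ^ 2 * q ^ (j + 1) * (-f.sgn * lam q * q ^ (-(N - j - 1))) / f.cf N ∧
    f.comVal q⁻¹ .up j N true =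
        lam q * √(brk q 2) ^ 2 * q ^ (j + 1) * (lam q * q ^ (N - j - 1)) / f.cf N ∧
    f.comVal q .up j N false = lam q * √(brk q 2) ^ 2 * q ^ (j + 1) * (-lam q * q ^ (N + j + 1))
        * f.cf (N - j - 1) * f.cf (N - j - 2) / f.cf N ∧
    f.comVal q⁻¹ .up j N false = lam q * √(brk q 2) ^ 2 * q ^ (j + 1)
        * (f.sgn * lam q * q ^ (-(N + j) - 1)) * f.cf (N - j - 1) * f.cf (N - j - 2) / f.cf N := by
  obtain ⟨h1, h2, -, -, -⟩ := cf_rel f hq (N - j - 1)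
  obtain ⟨-, -, h3, h4, -⟩ := cf_rel f hq (N + j)
  simp only [Family.comVal, Family.xVal, Family.uDown, Step.shift, if_true, Bool.false_eq_true,
    if_false]
  rw [← h1, ← h2, ← h3, ← h4, show N + 1 - j - 1 = N - j - 1 + 1 by ring,
    show N - 1 - j - 1 = N - j - 2 by ring, show N - (j + 1) - 1 = N - j - 2 by ring,
    show N + (j + 1) = N + j + 1 by ring]
  refine ⟨?_, ?_, ?_, ?_⟩ <;> ring

lemma comVal_stay (hq : 1 < q) (f : Family q) (j N : ℤ) :
    f.comVal q .stay j N true = -(lam q * √(brk q 2) ^ 2) / (crl q j * crl q (j + 1))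
        * (f.sgn * lam q * q ^ (-N)) / f.cf N ∧
    f.comVal q⁻¹ .stay j N true = -(lam q * √(brk q 2) ^ 2) / (crl q j * crl q (j + 1))
        * (lam q * q ^ N) / f.cf N ∧
    f.comVal q .stay j N false = -(lam q * √(brk q 2) ^ 2) / (crl q j * crl q (j + 1))
        * (-lam q * q ^ N) * f.cf (N - j - 1) * f.cf (N + j) / f.cf N ∧
    f.comVal q⁻¹ .stay j N false = -(lam q * √(brk q 2) ^ 2) / (crl q j * crl q (j + 1))
        * (-f.sgn * lam q * q ^ (-N)) * f.cf (N - j - 1) * f.cf (N + j) / f.cf N := by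
  obtain ⟨-, -, -, -, h1, h2, -⟩ := cf_rel f hq N
  obtain ⟨-, -, -, -, -, -, h3, h4⟩ := cf_rel f hq (N - 1)
  rw [sub_add_cancel] at h3 h4
  rw [show -(N - 1) - 1 = -N by ring] at h4
  simp only [Family.comVal, Family.xVal, Family.uDown, Step.shift, if_true, Bool.false_eq_true,
    if_false, add_zero]
  rw [← h1, ← h2, ← h3, ← h4]
  refine ⟨?_, ?_, ?_, ?_⟩ <;> ring

lemma comVal_down (hq : 1 < q) (f : Family q) (j N : ℤ) :
    f.comVal q .down (j + 1) N true = -(lam q * √(brk q 2) ^ 2) / q ^ (j + 1)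
      / (crl q (j + 1) * angNorm q j * lam q) ^ 2
        * (-f.sgn * lam q * q ^ (-(N + j + 1))) / f.cf N ∧
    f.comVal q⁻¹ .down (j + 1) N true = -(lam q * √(brk q 2) ^ 2) / q ^ (j + 1)
      / (crl q (j + 1) * angNorm q j * lam q) ^ 2 * (lam q * q ^ (N + j + 1)) / f.cf N ∧
    f.comVal q .down (j + 1) N false = -(lam q * √(brk q 2) ^ 2) / q ^ (j + 1)
      / (crl q (j + 1) * angNorm q j * lam q) ^ 2
        * (-lam q * q ^ (N - j - 1)) * f.cf (N + j + 1) * f.cf (N + j) / f.cf N ∧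
    f.comVal q⁻¹ .down (j + 1) N false = -(lam q * √(brk q 2) ^ 2) / q ^ (j + 1)
      / (crl q (j + 1) * angNorm q j * lam q) ^ 2
        * (f.sgn * lam q * q ^ (-(N - j - 1))) * f.cf (N + j + 1) * f.cf (N + j) / f.cf N := by
  obtain ⟨h1, h2, -, -, -⟩ := cf_rel f hq (N + j + 1)
  obtain ⟨-, -, h3, h4, -⟩ := cf_rel f hq (N - j - 2)
  rw [show N - j - 2 + 1 = N - j - 1 by ring] at h3 h4
  rw [show -(N - j - 2) - 1 = -(N - j - 1) by ring] at h4
  simp only [Family.comVal, Family.xVal, Family.uDown, Step.shift, if_true, Bool.false_eq_true,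
    if_false]
  rw [← h1, ← h2, ← h3, ← h4, add_sub_cancel_right, show N + 1 + (j + 1) = N + j + 1 + 1 by ring,
    show N - 1 + (j + 1) = N + j by ring, show N - (j + 1) - 1 = N - j - 2 by ring,
    show N + (j + 1) = N + j + 1 by ring, show N - (j + 1 + -1) - 1 = N - j - 1 by ring,
    show N + (j + 1 + -1) = N + j by ring]
  refine ⟨?_, ?_, ?_, ?_⟩ <;> ring

lemma comValZero_eq (hq : 1 < q) (f : Family q) (j N : ℤ) :
    f.comValZero q j N true = f.sgn * lam q * q ^ (-N) / f.cf N ∧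
    f.comValZero q⁻¹ j N true = lam q * q ^ N / f.cf N ∧
    f.comValZero q j N false = -lam q * q ^ N * f.cf (N - j - 1) * f.cf (N + j) / f.cf N ∧
    f.comValZero q⁻¹ j N false =
      -f.sgn * lam q * q ^ (-N) * f.cf (N - j - 1) * f.cf (N + j) / f.cf N := by
  obtain ⟨-, -, -, -, h1, h2, -⟩ := cf_rel f hq N
  obtain ⟨-, -, -, -, -, -, h3, h4⟩ := cf_rel f hq (N - 1)
  rw [sub_add_cancel] at h3 h4
  rw [show -(N - 1) - 1 = -N by ring] at h4
  simp only [Family.comValZero, Family.uDown, if_true, Bool.false_eq_true, if_false]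
  rw [← h1, ← h2, ← h3, ← h4]
  refine ⟨?_, ?_, ?_, ?_⟩ <;> ring

lemma shiftM_mul (M' M : ℤ) (a b c : ℝ) : shiftM M' M a b * c = shiftM M' M (a * c) (b * c) := by
  simp only [shiftM]; split_ifs <;> ring

lemma mul_shiftM (M' M : ℤ) (a b c : ℝ) : c * shiftM M' M a b = shiftM M' M (c * a) (c * b) := by
  simp only [shiftM]; split_ifs <;> ring

lemma momPart_apply (hq : 1 < q) (f : Family q) (Δ : Step) (j n M n' M' : ℤ)
    (hj : Δ = .down → 0 < j) : (momPart f 1 + momPart f (-1)) Δ j (radVec n M) (n', M') =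
      Complex.I * ((if n' = n + 1 then
          shiftM M' M (f.momFac 1 M * f.comVal q Δ j (n + f.kap) true)
            (f.momFac (-1) M * f.comVal q⁻¹ Δ j (n + f.kap) true)
        else if n' = n - 1 then
          shiftM M' M (f.momFac 1 M * f.comVal q Δ j (n + f.kap) false)
            (f.momFac (-1) M * f.comVal q⁻¹ Δ j (n + f.kap) false)
        else 0 : ℝ) : ℂ) := by
  rw [Pi.add_apply, Pi.add_apply, LinearMap.add_apply, Finsupp.add_apply,
    momPart_radVec hq f _ Δ j n M hj, momPart_radVec hq f _ Δ j n M hj]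
  simp only [Finsupp.add_apply, Finsupp.smul_apply, Finsupp.single_apply, Prod.mk.injEq,
    smul_eq_mul, zpow_one, zpow_neg_one, shiftM, eq_comm (b := n'), eq_comm (b := M'),
    ← sub_eq_add_neg]
  by_cases h1 : n' = n + 1
  · have : ¬ n' = n - 1 := by omega
    simp only [h1, show ¬ n + 1 = n - 1 by omega, true_and, false_and, if_true, if_false]
    push_cast
    split_ifs <;> push_cast <;> ring
  · simp only [h1, false_and, if_false]
    by_cases h2 : n' = n - 1
    · simp only [h2, true_and, if_true]
      split_ifs <;> push_cast <;> ring
    · simp [h2]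

lemma momPartZero_apply (hq : 1 < q) (f : Family q) (j n M n' M' : ℤ) :
    (momPartZero f 1 + momPartZero f (-1)) j (radVec n M) (n', M') =
      Complex.I * ((if n' = n + 1 then
          shiftM M' M (f.momFac 1 M * f.comValZero q j (n + f.kap) true)
            (f.momFac (-1) M * f.comValZero q⁻¹ j (n + f.kap) true)
        else if n' = n - 1 then
          shiftM M' M (f.momFac 1 M * f.comValZero q j (n + f.kap) false)
            (f.momFac (-1) M * f.comValZero q⁻¹ j (n + f.kap) false)
        else 0 : ℝ) : ℂ) := by
  rw [Pi.add_apply, LinearMap.add_apply, Finsupp.add_apply,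
    momPartZero_radVec hq, momPartZero_radVec hq]
  simp only [Finsupp.add_apply, Finsupp.smul_apply, Finsupp.single_apply, Prod.mk.injEq,
    smul_eq_mul, zpow_one, zpow_neg_one, shiftM, eq_comm (b := n'), eq_comm (b := M'),
    ← sub_eq_add_neg]
  by_cases h1 : n' = n + 1
  · have : ¬ n' = n - 1 := by omega
    simp only [h1, show ¬ n + 1 = n - 1 by omega, true_and, false_and, if_true, if_false]
    push_cast
    split_ifs <;> push_cast <;> ring
  · simp only [h1, false_and, if_false]
    by_cases h2 : n' = n - 1
    · simp only [h2, true_and, if_true]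
      split_ifs <;> push_cast <;> ring
    · simp [h2]

end

end QMink

/-! ### Matrix elements of `P` in a form common to both types of family. -/

namespace QMink

noncomputable section

variable {q : ℝ}

/-- Written with `n + κ` and the sign `sgn`, the space-like and the time-like expressions become
one; the ratio of roots is the same for `crl` and `brk`. This and the following lemmas allow both
cases to be treated together. -/
lemma redP_up_succ (f : Family q) (j m m' n M M' : ℤ) :
    redP f ⟨j + 1, m', n + 1, M'⟩ ⟨j, m, n, M⟩ =
      1 / 2 * shiftM M' M (q ^ (2 + 2 * j - (n + f.kap))) (-(f.sgn * q ^ (2 + (n + f.kap))))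
      * (1 / (crl q (j + 1) * lam q * f.len * q ^ M))
      * √(brk q 2 / (brk q (2 * j + 1) * brk q (2 * j + 3)))
      * √(f.ph (n + f.kap + j + 2) * f.ph (n + f.kap + j + 1)
          / (f.ph (n + f.kap) * f.ph (n + f.kap + 1))) := by
  cases f <;>
    simp only [redP, redPSpace, redPTime, if_true, Family.ph, Family.kap, Family.sgn, Family.len,
      add_zero, one_mul,
      neg_one_mul]
  all_goals simp only [shiftM_mul, mul_shiftM]
  all_goals congr 1 <;> ring_nf

lemma redP_up_pred (f : Family q) (j m m' n M M' : ℤ) :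
    redP f ⟨j + 1, m', n - 1, M'⟩ ⟨j, m, n, M⟩ =
      1 / 2 * shiftM M' M (f.sgn * q ^ (2 + 2 * j + (n + f.kap))) (-q ^ (2 - (n + f.kap)))
      * (1 / (crl q (j + 1) * lam q * f.len * q ^ M))
      * √(brk q 2 / (brk q (2 * j + 1) * brk q (2 * j + 3)))
      * √(f.ph (n + f.kap - j - 2) * f.ph (n + f.kap - j - 1)
          / (f.ph (n + f.kap) * f.ph (n + f.kap - 1))) := by
  cases f <;>
    simp only [redP, redPSpace, redPTime, if_neg (show ¬ n - 1 = n + 1 by omega), if_true,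
      Family.ph, Family.kap, Family.sgn, Family.len, add_zero, one_mul,
      neg_one_mul]
  all_goals simp only [shiftM_mul, mul_shiftM]
  all_goals congr 1 <;> ring_nf

lemma redP_stay_succ (f : Family q) (j m m' n M M' : ℤ) (hj : 1 ≤ j) :
    redP f ⟨j, m', n + 1, M'⟩ ⟨j, m, n, M⟩ =
      √(brk q 2) / (2 * crl q j * crl q (j + 1) * f.len * q ^ M)
      * shiftM M' M (q ^ (-(n + f.kap))) (f.sgn * q ^ (2 + (n + f.kap)))
      * √(f.ph (n + f.kap + j + 1) * f.ph (n + f.kap - j)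
          / (f.ph (n + f.kap) * f.ph (n + f.kap + 1))) := by
  cases f <;>
    simp only [redP, redPSpace, redPTime, if_neg (show ¬ j = j + 1 by omega), hj, and_self,
      if_true, Family.ph, Family.kap, Family.sgn, Family.len, add_zero, one_mul,
      neg_one_mul]
  all_goals simp only [shiftM_mul, mul_shiftM]
  all_goals congr 1 <;> ring_nf

lemma redP_stay_pred (f : Family q) (j m m' n M M' : ℤ) (hj : 1 ≤ j) :
    redP f ⟨j, m', n - 1, M'⟩ ⟨j, m, n, M⟩ =
      -(√(brk q 2) / (2 * crl q j * crl q (j + 1) * f.len * q ^ M))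
      * shiftM M' M (f.sgn * q ^ (n + f.kap)) (q ^ (2 - (n + f.kap)))
      * √(f.ph (n + f.kap - j - 1) * f.ph (n + f.kap + j)
          / (f.ph (n + f.kap) * f.ph (n + f.kap - 1))) := by
  cases f <;>
    simp only [redP, redPSpace, redPTime, if_neg (show ¬ j = j + 1 by omega), hj, and_self,
      if_neg (show ¬ n - 1 = n + 1 by omega), if_true, Family.ph, Family.kap, Family.sgn,
      Family.len, add_zero, one_mul,
      neg_one_mul]
  all_goals simp only [shiftM_mul, mul_shiftM]
  all_goals congr 1 <;> ring_nf

lemma redP_down_succ (f : Family q) (j m m' n M M' : ℤ) :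
    redP f ⟨j, m', n + 1, M'⟩ ⟨j + 1, m, n, M⟩ =
      -(1 / 2) * shiftM M' M (q ^ (-2 - 2 * j - (n + f.kap))) (-(f.sgn * q ^ (2 + (n + f.kap))))
      * (1 / (crl q (j + 1) * lam q * f.len * q ^ M))
      * √(brk q 2 / (brk q (2 * j + 1) * brk q (2 * j + 3)))
      * √(f.ph (n + f.kap - j) * f.ph (n + f.kap - j - 1)
          / (f.ph (n + f.kap) * f.ph (n + f.kap + 1))) := by
  cases f <;>
    simp only [redP, redPSpace, redPTime, if_neg (show ¬ j = j + 1 + 1 by omega),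
      if_neg (show ¬ (j = j + 1 ∧ 1 ≤ j + 1) by omega), if_true, Family.ph, Family.kap, Family.sgn,
      Family.len, add_zero, one_mul,
      neg_one_mul]
  all_goals simp only [shiftM_mul, mul_shiftM]
  all_goals congr 1 <;> ring_nf

lemma redP_down_pred (f : Family q) (j m m' n M M' : ℤ) :
    redP f ⟨j, m', n - 1, M'⟩ ⟨j + 1, m, n, M⟩ =
      -(1 / 2) * shiftM M' M (f.sgn * q ^ (-2 - 2 * j + (n + f.kap))) (-q ^ (2 - (n + f.kap)))
      * (1 / (crl q (j + 1) * lam q * f.len * q ^ M))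
      * √(brk q 2 / (brk q (2 * j + 1) * brk q (2 * j + 3)))
      * √(f.ph (n + f.kap + j + 1) * f.ph (n + f.kap + j)
          / (f.ph (n + f.kap) * f.ph (n + f.kap - 1))) := by
  cases f <;>
    simp only [redP, redPSpace, redPTime, if_neg (show ¬ j = j + 1 + 1 by omega),
      if_neg (show ¬ (j = j + 1 ∧ 1 ≤ j + 1) by omega), if_neg (show ¬ n - 1 = n + 1 by omega),
      if_true, Family.ph, Family.kap, Family.sgn, Family.len, add_zero, one_mul,
      neg_one_mul]
  all_goals simp only [shiftM_mul, mul_shiftM]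
  all_goals congr 1 <;> ring_nf

lemma eltP0_succ (f : Family q) (j m n M M' : ℤ) :
    eltP0 f ⟨j, m, n + 1, M'⟩ ⟨j, m, n, M⟩ =
      -(1 / (2 * lam q * f.len * q ^ M))
      * shiftM M' M (q ^ (1 - (n + f.kap))) (f.sgn * q ^ (3 + (n + f.kap)))
      * √(f.ph (n + f.kap - j) * f.ph (n + f.kap + j + 1)
          / (f.ph (n + f.kap) * f.ph (n + f.kap + 1))) := by
  cases f <;>
    simp only [eltP0, eltP0Space, eltP0Time, if_true, Family.ph, Family.kap, Family.sgn,
      Family.len, add_zero, one_mul,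
      neg_one_mul]
  all_goals simp only [shiftM_mul, mul_shiftM]
  all_goals congr 1 <;> ring_nf

lemma eltP0_pred (f : Family q) (j m n M M' : ℤ) :
    eltP0 f ⟨j, m, n - 1, M'⟩ ⟨j, m, n, M⟩ =
      1 / (2 * lam q * f.len * q ^ M)
      * shiftM M' M (f.sgn * q ^ (1 + (n + f.kap))) (q ^ (3 - (n + f.kap)))
      * √(f.ph (n + f.kap - j - 1) * f.ph (n + f.kap + j)
          / (f.ph (n + f.kap) * f.ph (n + f.kap - 1))) := by
  cases f <;>
    simp only [eltP0, eltP0Space, eltP0Time, if_neg (show ¬ n - 1 = n + 1 by omega), if_true,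
      Family.ph, Family.kap, Family.sgn, Family.len, add_zero, one_mul,
      neg_one_mul]
  all_goals simp only [shiftM_mul, mul_shiftM]
  all_goals congr 1 <;> ring_nf

end

end QMink

/-! ### Matrix elements of `P` in the orthonormal basis. -/

namespace QMink

noncomputable section

variable {q : ℝ}

lemma neg_shiftM (M' M : ℤ) (a b : ℝ) : -shiftM M' M a b = shiftM M' M (-a) (-b) := by
  simp only [shiftM]; split_ifs <;> ring

lemma sqrt_brk_two_div (hq : 1 < q) {j : ℤ} (hj : 0 ≤ j) :
    √(brk q 2 / (brk q (2 * j + 1) * brk q (2 * j + 3))) = √(brk q 2) / angNorm q j := by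
  rw [Real.sqrt_div (brk_pos hq two_pos).le, angNorm_eq hq hj]

lemma Family.sgn_cases (f : Family q) : f.sgn = 1 ∨ f.sgn = -1 := by
  cases f
  · exact .inl rfl
  · exact .inr rfl

set_option linter.unusedSimpArgs false in
/-- The reduced matrix elements of the momenta in the rational and the orthonormal basis. -/
lemma redP_match (hq : 1 < q) (f : Family q) (s' s : State f) (Δ : Step)
    (hj : s'.1.j = s.1.j + Δ.shift) (h0 : Δ = .stay → s.1.j ≠ 0) :
    Complex.I * ((redP f s'.1 s.1 * (vecUnit q / lam q ^ Δ.order) : ℝ) : ℂ) =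
      ((f.radGauge s.1.j s.1.n / f.radGauge s'.1.j s'.1.n : ℝ) : ℂ) *
        (momPart f 1 + momPart f (-1)) Δ s.1.j (radVec s.1.n s.1.M) (s'.1.n, s'.1.M) := by
  have q0 : 0 < q := by linarith
  have hl := lam_pos hq
  have hlen := f.len_ne_zero
  have h2 := Real.sqrt_pos.2 (brk_pos hq two_pos)
  obtain ⟨⟨j, m, n, M⟩, hs⟩ := s
  obtain ⟨⟨j', m', n', M'⟩, hs'⟩ := s'
  have hm := (abs_nonneg _).trans ((f.occurs_iff _).1 hs).1
  have hm' := (abs_nonneg _).trans ((f.occurs_iff _).1 hs').1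
  have t := Family.occurs_time hs
  have t' := Family.occurs_time hs'
  have cp := crl_pos hq
  have rp := f.rt_pos
  have Kp := f.rtProd_pos
  have Bp := baseGauge_pos hq
  simp only at hm hm' t t' hj h0 ⊢
  rw [momPart_apply hq f Δ j n M n' M' fun h => by subst h; simp only [Step.shift] at hj; omega,
    mul_left_comm]
  refine congrArg _ ?_
  rw [← Complex.ofReal_mul]
  refine congrArg _ ?_
  obtain ⟨N, hN⟩ : ∃ N, N = n + f.kap := ⟨_, rfl⟩
  obtain h | h | h : n' = n + 1 ∨ n' = n - 1 ∨ ¬ (n' = n + 1 ∨ n' = n - 1) := by tauto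
  · subst h
    rw [if_pos rfl]
    cases Δ
    · simp only [Step.shift] at hj
      subst hj
      obtain ⟨c1, c2, -, -⟩ := comVal_up hq f j N
      rw [redP_up_succ,
        ← hN,
        c1,
        c2,
        f.sqrt_ph_ratio hq (fun e => by have := t e; have := t' e; omega),
        f.radGauge_eq (N := N) (a := N + j) (b := N - j - 1) hN (by omega) (by omega),
        f.radGauge_eq (N := N + 1) (a := N + j + 2) (b := N - j - 1) (by omega) (by omega)
          (by omega),
        f.rtProd_eq_mul (a := N + j + 2) (b := N + j + 1) (by omega),
        f.rtProd_eq_mul (a := N + j + 1) (b := N + j) (by omega),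
        f.rt_sq hq (a := N) (fun e => by have := t e; have := t' e; omega),
        sqrt_brk_two_div hq hm,
        baseGauge_add_one hq]
      simp only [mul_shiftM, shiftM_mul, Step.order, vecUnit, Family.momFac, two_mul, neg_add,
        neg_sub, neg_mul, neg_neg, zpow_add₀ q0.ne', zpow_sub₀ q0.ne', zpow_neg, zpow_one,
        zpow_ofNat, show (2 : ℤ) - 1 = 1 from rfl, show (2 : ℤ) - -1 = 3 from rfl, neg_shiftM]
      have p0 := cp (j + 1)
      have p1 := rp (N)
      have p2 := rp (N + 1)
      have p3 := rp (N + j + 1)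
      have p4 := rp (N + j + 2)
      have p5 := Kp (N + j)
      have p6 := Kp (N + j + 1)
      have p7 := Kp (N + j + 2)
      have p8 := Kp (N - j - 1)
      have p9 := Bp j
      have p10 := zpow_pos q0 N
      have p11 := zpow_pos q0 M
      have p12 := zpow_pos q0 j
      have p13 := angNorm_pos (q := q) j
      -- The sign enters through `momFac` and through the `q`-commutators, so its square has to be
      -- replaced by one. The coefficients of the two shifts of `M` are compared separately.
      obtain h | h := f.sgn_cases <;> simp only [h] <;>
        refine congrArg₂ (shiftM M' M) ?_ ?_ <;> field_simp <;> ring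
    · obtain rfl : j = j' := by simpa [Step.shift] using hj.symm
      obtain ⟨c1, c2, -, -⟩ := comVal_stay hq f j N
      rw [redP_stay_succ f j m m' n M M' (by have := h0 rfl; omega),
        ← hN,
        c1,
        c2,
        f.sqrt_ph_ratio hq (fun e => by have := t e; have := t' e; omega),
        f.radGauge_eq (N := N) (a := N + j) (b := N - j - 1) hN (by omega) (by omega),
        f.radGauge_eq (N := N + 1) (a := N + j + 1) (b := N - j) (by omega) (by omega) (by omega),
        f.rtProd_eq_mul (a := N + j + 1) (b := N + j) (by omega),
        f.rtProd_eq_mul (a := N - j) (b := N - j - 1) (by omega),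
        f.rt_sq hq (a := N) (fun e => by have := t e; have := t' e; omega)]
      simp only [mul_shiftM, shiftM_mul, Step.order, vecUnit, Family.momFac, two_mul, neg_add,
        neg_sub, neg_mul, neg_neg, zpow_add₀ q0.ne', zpow_sub₀ q0.ne', zpow_neg, zpow_one,
        zpow_ofNat, show (2 : ℤ) - 1 = 1 from rfl, show (2 : ℤ) - -1 = 3 from rfl, neg_shiftM]
      have p0 := cp (j)
      have p1 := cp (j + 1)
      have p2 := rp (N)
      have p3 := rp (N + 1)
      have p4 := rp (N + j + 1)
      have p5 := rp (N - j)
      have p6 := Kp (N + j)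
      have p7 := Kp (N + j + 1)
      have p8 := Kp (N - j)
      have p9 := Kp (N - j - 1)
      have p10 := Bp j
      have p11 := zpow_pos q0 N
      have p12 := zpow_pos q0 M
      have p13 := zpow_pos q0 j
      obtain h | h := f.sgn_cases <;> simp only [h] <;>
        refine congrArg₂ (shiftM M' M) ?_ ?_ <;> field_simp
    · obtain rfl : j = j' + 1 := by simp [Step.shift] at hj; omega
      obtain ⟨c1, c2, -, -⟩ := comVal_down hq f j' N
      rw [redP_down_succ,
        ← hN,
        c1,
        c2,
        f.sqrt_ph_ratio hq (fun e => by have := t e; have := t' e; omega),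
        f.radGauge_eq (N := N) (a := N + j' + 1) (b := N - j' - 2) hN (by omega) (by omega),
        f.radGauge_eq (N := N + 1) (a := N + j' + 1) (b := N - j') (by omega) (by omega) (by omega),
        f.rtProd_eq_mul (a := N - j') (b := N - j' - 1) (by omega),
        f.rtProd_eq_mul (a := N - j' - 1) (b := N - j' - 2) (by omega),
        f.rt_sq hq (a := N) (fun e => by have := t e; have := t' e; omega),
        sqrt_brk_two_div hq hm',
        baseGauge_add_one hq]
      simp only [mul_shiftM, shiftM_mul, Step.order, vecUnit, Family.momFac, two_mul, neg_add,
        neg_sub, neg_mul, neg_neg, zpow_add₀ q0.ne', zpow_sub₀ q0.ne', zpow_neg, zpow_one,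
        zpow_ofNat, show (2 : ℤ) - 1 = 1 from rfl, show (2 : ℤ) - -1 = 3 from rfl, neg_shiftM]
      have p0 := cp (j' + 1)
      have p1 := rp (N)
      have p2 := rp (N + 1)
      have p3 := rp (N - j')
      have p4 := rp (N - j' - 1)
      have p5 := Kp (N + j' + 1)
      have p6 := Kp (N - j')
      have p7 := Kp (N - j' - 1)
      have p8 := Kp (N - j' - 2)
      have p9 := Bp j'
      have p10 := zpow_pos q0 N
      have p11 := zpow_pos q0 M
      have p12 := zpow_pos q0 j'
      have p13 := angNorm_pos (q := q) j'
      obtain h | h := f.sgn_cases <;> simp only [h] <;>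
        refine congrArg₂ (shiftM M' M) ?_ ?_ <;> field_simp <;> ring
  · subst h
    rw [if_neg (show ¬ n - 1 = n + 1 by omega), if_pos rfl]
    cases Δ
    · simp only [Step.shift] at hj
      subst hj
      obtain ⟨-, -, c1, c2⟩ := comVal_up hq f j N
      rw [redP_up_pred,
        ← hN,
        c1,
        c2,
        f.sqrt_ph_ratio hq (fun e => by have := t e; have := t' e; omega),
        f.radGauge_eq (N := N) (a := N + j) (b := N - j - 1) hN (by omega) (by omega),
        f.radGauge_eq (N := N - 1) (a := N + j) (b := N - j - 3) (by omega) (by omega) (by omega),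
        f.rtProd_eq_mul (a := N - j - 1) (b := N - j - 2) (by omega),
        f.rtProd_eq_mul (a := N - j - 2) (b := N - j - 3) (by omega),
        f.rt_sq hq (a := N) (fun e => by have := t e; have := t' e; omega),
        f.rt_sq hq (a := N - j - 1) (fun e => by have := t e; have := t' e; omega),
        f.rt_sq hq (a := N - j - 2) (fun e => by have := t e; have := t' e; omega),
        sqrt_brk_two_div hq hm,
        baseGauge_add_one hq]
      simp only [mul_shiftM, shiftM_mul, Step.order, vecUnit, Family.momFac, two_mul, neg_add,
        neg_sub, neg_mul, neg_neg, zpow_add₀ q0.ne', zpow_sub₀ q0.ne', zpow_neg, zpow_one,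
        zpow_ofNat, show (2 : ℤ) - 1 = 1 from rfl, show (2 : ℤ) - -1 = 3 from rfl, neg_shiftM]
      have p0 := cp (j + 1)
      have p1 := rp (N)
      have p2 := rp (N - 1)
      have p3 := rp (N - j - 1)
      have p4 := rp (N - j - 2)
      have p5 := Kp (N + j)
      have p6 := Kp (N - j - 1)
      have p7 := Kp (N - j - 2)
      have p8 := Kp (N - j - 3)
      have p9 := Bp j
      have p10 := zpow_pos q0 N
      have p11 := zpow_pos q0 M
      have p12 := zpow_pos q0 j
      have p13 := angNorm_pos (q := q) j
      obtain h | h := f.sgn_cases <;> simp only [h] <;>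
        refine congrArg₂ (shiftM M' M) ?_ ?_ <;> field_simp <;> ring
    · obtain rfl : j = j' := by simpa [Step.shift] using hj.symm
      obtain ⟨-, -, c1, c2⟩ := comVal_stay hq f j N
      rw [redP_stay_pred f j m m' n M M' (by have := h0 rfl; omega),
        ← hN,
        c1,
        c2,
        f.sqrt_ph_ratio hq (fun e => by have := t e; have := t' e; omega),
        f.radGauge_eq (N := N) (a := N + j) (b := N - j - 1) hN (by omega) (by omega),
        f.radGauge_eq (N := N - 1) (a := N + j - 1) (b := N - j - 2) (by omega) (by omega)
          (by omega),
        f.rtProd_eq_mul (a := N + j) (b := N + j - 1) (by omega),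
        f.rtProd_eq_mul (a := N - j - 1) (b := N - j - 2) (by omega),
        f.rt_sq hq (a := N) (fun e => by have := t e; have := t' e; omega),
        f.rt_sq hq (a := N - j - 1) (fun e => by have := t e; have := t' e; omega),
        f.rt_sq hq (a := N + j) (fun e => by have := t e; have := t' e; omega)]
      simp only [mul_shiftM, shiftM_mul, Step.order, vecUnit, Family.momFac, two_mul, neg_add,
        neg_sub, neg_mul, neg_neg, zpow_add₀ q0.ne', zpow_sub₀ q0.ne', zpow_neg, zpow_one,
        zpow_ofNat, show (2 : ℤ) - 1 = 1 from rfl, show (2 : ℤ) - -1 = 3 from rfl, neg_shiftM]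
      have p0 := cp (j)
      have p1 := cp (j + 1)
      have p2 := rp (N)
      have p3 := rp (N + j)
      have p4 := rp (N - 1)
      have p5 := rp (N - j - 1)
      have p6 := Kp (N + j)
      have p7 := Kp (N + j - 1)
      have p8 := Kp (N - j - 1)
      have p9 := Kp (N - j - 2)
      have p10 := Bp j
      have p11 := zpow_pos q0 N
      have p12 := zpow_pos q0 M
      have p13 := zpow_pos q0 j
      obtain h | h := f.sgn_cases <;> simp only [h] <;>
        refine congrArg₂ (shiftM M' M) ?_ ?_ <;> field_simp
    · obtain rfl : j = j' + 1 := by simp [Step.shift] at hj; omega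
      obtain ⟨-, -, c1, c2⟩ := comVal_down hq f j' N
      rw [redP_down_pred,
        ← hN,
        c1,
        c2,
        f.sqrt_ph_ratio hq (fun e => by have := t e; have := t' e; omega),
        f.radGauge_eq (N := N) (a := N + j' + 1) (b := N - j' - 2) hN (by omega) (by omega),
        f.radGauge_eq (N := N - 1) (a := N + j' - 1) (b := N - j' - 2) (by omega) (by omega)
          (by omega),
        f.rtProd_eq_mul (a := N + j' + 1) (b := N + j') (by omega),
        f.rtProd_eq_mul (a := N + j') (b := N + j' - 1) (by omega),
        f.rt_sq hq (a := N) (fun e => by have := t e; have := t' e; omega),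
        f.rt_sq hq (a := N + j' + 1) (fun e => by have := t e; have := t' e; omega),
        f.rt_sq hq (a := N + j') (fun e => by have := t e; have := t' e; omega),
        sqrt_brk_two_div hq hm',
        baseGauge_add_one hq]
      simp only [mul_shiftM, shiftM_mul, Step.order, vecUnit, Family.momFac, two_mul, neg_add,
        neg_sub, neg_mul, neg_neg, zpow_add₀ q0.ne', zpow_sub₀ q0.ne', zpow_neg, zpow_one,
        zpow_ofNat, show (2 : ℤ) - 1 = 1 from rfl, show (2 : ℤ) - -1 = 3 from rfl, neg_shiftM]
      have p0 := cp (j' + 1)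
      have p1 := rp (N)
      have p2 := rp (N + j')
      have p3 := rp (N + j' + 1)
      have p4 := rp (N - 1)
      have p5 := Kp (N + j')
      have p6 := Kp (N + j' + 1)
      have p7 := Kp (N + j' - 1)
      have p8 := Kp (N - j' - 2)
      have p9 := Bp j'
      have p10 := zpow_pos q0 N
      have p11 := zpow_pos q0 M
      have p12 := zpow_pos q0 j'
      have p13 := angNorm_pos (q := q) j'
      obtain h | h := f.sgn_cases <;> simp only [h] <;>
        refine congrArg₂ (shiftM M' M) ?_ ?_ <;> field_simp <;> ring
  · rw [if_neg (not_or.1 h).1, if_neg (not_or.1 h).2, mul_zero]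
    cases f <;> simp [redP, redPSpace, redPTime, not_or.1 h]

end

end QMink

/-! ### Comparison of all generators with the listed matrix elements. -/

namespace QMink

noncomputable section

variable {q : ℝ}

/-- The operators that represent the generators, in the rational basis. -/
def famOp (f : Family q) : Gen → Module.End ℂ (Space f) :=
  genOp (q : ℂ) (rOp f) (sOp f) (uOp f) (four (x0Op f) (xOp f)) (lenOp f) (momOp f 1)
    (momOp f (-1)) (mOp f (fun _ => (q : ℂ) ^ 2) 1) (mOp f (fun _ => ((q : ℂ) ^ 2)⁻¹) (-1))

lemma scalElt_match {f : Family q} (hq : 1 < q) {T : Module.End ℂ (Space f)}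
    {t : ℤ → Module.End ℂ Radial} (h : LiftsScal T t) (s' s : State f) (c : ℂ)
    (hc : s'.1.j = s.1.j → s'.1.m = s.1.m →
      c = ((f.radGauge s.1.j s.1.n / f.radGauge s.1.j s'.1.n : ℝ) : ℂ) *
      t s.1.j (radVec s.1.n s.1.M) (s'.1.n, s'.1.M)) :
    (if s'.1.j = s.1.j ∧ s'.1.m = s.1.m then c else 0) =
      ((f.gauge s.1 / f.gauge s'.1 : ℝ) : ℂ) * T (Finsupp.single s 1) s' := by
  rw [h.apply_single]
  split_ifs with e
  · rw [hc e.1 e.2, Family.gauge, Family.gauge, e.1, e.2,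
      mul_div_mul_left _ _ (angGauge_pos hq _ _).ne']
  · rw [mul_zero]

lemma lifts_momentum (f : Family q) (hq : 1 < q) :
    LiftsVec (fun A => momentum (q : ℂ) (momOp f 1) (momOp f (-1)) (uOp f)
      (four (x0Op f) (xOp f)) (some A)) (momPart f 1 + momPart f (-1)) := by
  have q0 : (q : ℂ) ≠ 0 := by exact_mod_cast (show q ≠ 0 by linarith)
  have key : ∀ k, LiftsVec (fun A => momOp f k *
      (xOp f A * uOp f - ((q : ℂ) ^ k) • (uOp f * xOp f A))) (momPart f k) := fun k => by
    have h := ((lifts_m f (fun M => Complex.I * (f.momFac k M : ℂ)) k).mul_vec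
      (((lifts_x f q0).mul_scal (lifts_u f q0)).sub
        (((lifts_u f q0).mul_vec (lifts_x f q0)).smul ((q : ℂ) ^ k))))
    simp only [momOp, momFac_eq]
    exact h
  have h := (key 1).add (key (-1))
  simp only [zpow_one, zpow_neg_one] at h
  exact h

lemma lifts_momentum_zero (f : Family q) (hq : 1 < q) :
    LiftsScal (momentum (q : ℂ) (momOp f 1) (momOp f (-1)) (uOp f)
      (four (x0Op f) (xOp f)) none) (momPartZero f 1 + momPartZero f (-1)) := by
  have q0 : (q : ℂ) ≠ 0 := by exact_mod_cast (show q ≠ 0 by linarith)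
  have key : ∀ k, LiftsScal (momOp f k *
      (x0Op f * uOp f - ((q : ℂ) ^ k) • (uOp f * x0Op f))) (momPartZero f k) := fun k => by
    have h := ((lifts_m f (fun M => Complex.I * (f.momFac k M : ℂ)) k).mul
      (((lifts_x0 f).mul (lifts_u f q0)).sub
        (((lifts_u f q0).mul (lifts_x0 f)).smul ((q : ℂ) ^ k))))
    simp only [momOp, momFac_eq]
    exact h
  have h := (key 1).add (key (-1))
  simp only [zpow_one, zpow_neg_one] at h
  exact h

lemma lifts_len_x (f : Family q) (hq : 1 < q) :
    LiftsVec (fun A => four (x0Op f) (xOp f) (some A) * lenOp f)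
      (vecScal (xRed q f.sig f.kap)
        (fun _ => mRad (fun M => f.len * (q : ℂ) ^ M / (q + (q : ℂ)⁻¹)) 0)) := by
  have q0 : (q : ℂ) ≠ 0 := by exact_mod_cast (show q ≠ 0 by linarith)
  exact (lifts_x f q0).mul_scal (lifts_m f _ 0)

lemma coeffU_eq (f : Family q) (j n : ℤ) : coeffU f j n = 1 / brk q 2 *
    √(f.ph (n + f.kap - j) * f.ph (n + f.kap + j + 1) /
      (f.ph (n + f.kap) * f.ph (n + f.kap + 1))) := by
  cases f <;> simp only [coeffU, coeffUSpace, coeffUTime, Family.ph, Family.kap, add_zero]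
  ring_nf

/-- The ratios of the gauge factors for neighbouring values of `n`. -/
lemma radGauge_succ (hq : 1 < q) (f : Family q) {j n N : ℤ} (hN : N = n + f.kap) :
    f.radGauge j n / f.radGauge j (n + 1) =
      f.rt N * f.rt (N - j) * f.rt (N + j + 1) / f.rt (N + 1) := by
  have p1 := f.rt_pos
  have p2 := f.rtProd_pos
  have p3 := baseGauge_pos hq j
  rw [f.radGauge_eq (N := N) (a := N + j) (b := N - j - 1) hN rfl rfl,
    f.radGauge_eq (N := N + 1) (a := N + j + 1) (b := N - j) (by omega) (by omega) (by omega),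
    f.rtProd_eq_mul (a := N + j + 1) (b := N + j) rfl,
    f.rtProd_eq_mul (a := N - j) (b := N - j - 1) (by omega)]
  have a1 := p1 (N + j + 1)
  have a2 := p1 (N - j)
  have a3 := p1 N
  have a4 := p1 (N + 1)
  have a5 := p2 (N + j)
  have a6 := p2 (N - j - 1)
  field_simp

lemma radGauge_pred (hq : 1 < q) (f : Family q) {j n N : ℤ} (hN : N = n + f.kap) :
    f.radGauge j n / f.radGauge j (n - 1) =
      f.rt N / (f.rt (N - 1) * f.rt (N - j - 1) * f.rt (N + j)) := by
  have h := radGauge_succ hq f (j := j) (n := n - 1) (N := N - 1) (by omega)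
  rw [sub_add_cancel, sub_add_cancel, show N - 1 - j = N - j - 1 by ring,
    show N - 1 + j + 1 = N + j by ring] at h
  rw [← inv_div, h, inv_div]

/-- In the rational basis `U` is not symmetric: up to the common constant it has `1 / cf` on the
step to `n + 1`, and a product of two factors `cf` divided by a third on the step to `n - 1`. The
ratio of the gauges turns both into the same square root. -/
lemma coeffU_match (hq : 1 < q) (f : Family q) (s' s : State f) (hj : s'.1.j = s.1.j)
    (_ : s'.1.m = s.1.m) :
    (if s'.1.M = s.1.M then
      if s'.1.n = s.1.n + 1 then (coeffU f s.1.j s.1.n : ℂ)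
      else if s.1.n = s'.1.n + 1 then (coeffU f s.1.j s'.1.n : ℂ) else 0 else 0) =
    ((f.radGauge s.1.j s.1.n / f.radGauge s.1.j s'.1.n : ℝ) : ℂ) *
      ((1 / ((q : ℂ) + (q : ℂ)⁻¹)) • uRed q f.sig f.kap) s.1.j (radVec s.1.n s.1.M)
        (s'.1.n, s'.1.M) := by
  have h22 : (q : ℂ) + (q : ℂ)⁻¹ = (brk q 2 : ℂ) := by rw [brk_two hq]; push_cast; rfl
  have b2 := brk_pos hq two_pos
  have rp := f.rt_pos
  obtain ⟨⟨j, m, n, M⟩, hs⟩ := s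
  obtain ⟨⟨j', m', n', M'⟩, hs'⟩ := s'
  have hm := (abs_nonneg _).trans ((f.occurs_iff _).1 hs).1
  have t := Family.occurs_time hs
  have t' := Family.occurs_time hs'
  simp only at hm t t' hj ⊢
  subst hj
  obtain ⟨N, hN⟩ : ∃ N, N = n + f.kap := ⟨_, rfl⟩
  have hN0 : f.sgn = -1 → 0 < N := fun e => by have := t e; omega
  rw [Pi.smul_apply, LinearMap.smul_apply, uRed_radVec hq, ← hN, h22]
  simp only [Finsupp.add_apply, Finsupp.smul_apply, Finsupp.single_apply, Prod.mk.injEq,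
    smul_eq_mul]
  by_cases hM : M' = M
  swap
  · simp [hM, Ne.symm hM]
  subst hM
  simp only [and_true, if_true]
  have a1 := rp N
  obtain rfl | rfl | h : n' = n + 1 ∨ n' = n - 1 ∨ (n' ≠ n + 1 ∧ n' ≠ n - 1) := by omega
  · rw [if_pos rfl, if_pos rfl, if_neg (by omega), radGauge_succ hq f hN, coeffU_eq, ← hN,
      f.sqrt_ph_ratio hq fun e => by have := t e; have := t' e; omega, f.rt_sq hq hN0]
    have a2 := rp (N + 1)
    rw [mul_zero, add_zero, mul_one]
    norm_cast
    field_simp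
  · rw [if_neg (by omega), if_pos (by omega), if_neg (by omega), if_pos rfl,
      radGauge_pred hq f hN, coeffU_eq, show n - 1 + f.kap = N - 1 by omega, sub_add_cancel,
      show N - 1 - j' = N - j' - 1 by ring, show N - 1 + j' + 1 = N + j' by ring,
      f.sqrt_ph_ratio hq fun e => by have := t e; have := t' e; omega, Family.uDown,
      f.rt_sq hq hN0, f.rt_sq hq fun e => by have := t e; have := t' e; omega,
      f.rt_sq hq (a := N + j') fun e => by have := t e; have := t' e; omega]
    have a2 := rp (N - 1)
    have a3 := rp (N - j' - 1)
    have a4 := rp (N + j')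
    rw [mul_zero, zero_add, mul_one]
    norm_cast
    field_simp
  · rw [if_neg h.1, if_neg (by omega), if_neg (Ne.symm h.1), if_neg (Ne.symm h.2)]
    simp

set_option linter.unusedSimpArgs false in
lemma eltP0_match (hq : 1 < q) (f : Family q) (s' s : State f) (hj : s'.1.j = s.1.j)
    (hm : s'.1.m = s.1.m) : Complex.I * (eltP0 f s'.1 s.1 : ℂ) =
      ((f.radGauge s.1.j s.1.n / f.radGauge s.1.j s'.1.n : ℝ) : ℂ) *
        (momPartZero f 1 + momPartZero f (-1)) s.1.j (radVec s.1.n s.1.M) (s'.1.n, s'.1.M) := by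
  have q0 : 0 < q := by linarith
  have hl := lam_pos hq
  have hlen := f.len_ne_zero
  have rp := f.rt_pos
  obtain ⟨⟨j, m, n, M⟩, hs⟩ := s
  obtain ⟨⟨j', m', n', M'⟩, hs'⟩ := s'
  have hj0 := (abs_nonneg _).trans ((f.occurs_iff _).1 hs).1
  have t := Family.occurs_time hs
  have t' := Family.occurs_time hs'
  simp only at hj0 t t' hj hm ⊢
  subst hj hm
  obtain ⟨N, hN⟩ : ∃ N, N = n + f.kap := ⟨_, rfl⟩
  have hN0 : f.sgn = -1 → 0 < N := fun e => by have := t e; omega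
  obtain ⟨c1, c2, c3, c4⟩ := comValZero_eq hq f j' N
  rw [momPartZero_apply hq, mul_left_comm]
  refine congrArg _ ?_
  rw [← Complex.ofReal_mul]
  refine congrArg _ ?_
  have a1 := rp N
  have a5 := zpow_pos q0 N
  have a6 := zpow_pos q0 M
  obtain rfl | rfl | h : n' = n + 1 ∨ n' = n - 1 ∨ (n' ≠ n + 1 ∧ n' ≠ n - 1) := by omega
  · rw [if_pos rfl, radGauge_succ hq f hN, eltP0_succ, ← hN, c1, c2,
      f.sqrt_ph_ratio hq fun e => by have := t e; have := t' e; omega, f.rt_sq hq hN0]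
    have a2 := rp (N + 1)
    simp only [mul_shiftM, shiftM_mul, neg_mul, neg_shiftM, Family.momFac, zpow_add₀ q0.ne',
      zpow_sub₀ q0.ne', zpow_neg, zpow_one, zpow_ofNat, show (2 : ℤ) - 1 = 1 from rfl,
      show (2 : ℤ) - -1 = 3 from rfl]
    obtain h | h := f.sgn_cases <;> simp only [h] <;>
      refine congrArg₂ (shiftM M' M) ?_ ?_ <;> field_simp
  · rw [if_neg (by omega), if_pos rfl, radGauge_pred hq f hN, eltP0_pred, ← hN, c3, c4,
      f.sqrt_ph_ratio hq fun e => by have := t e; have := t' e; omega,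
      f.rt_sq hq hN0, f.rt_sq hq fun e => by have := t e; have := t' e; omega,
      f.rt_sq hq (a := N + j') fun e => by have := t e; have := t' e; omega]
    have a2 := rp (N - 1)
    have a3 := rp (N - j' - 1)
    have a4 := rp (N + j')
    simp only [mul_shiftM, shiftM_mul, neg_mul, neg_shiftM, Family.momFac, zpow_add₀ q0.ne',
      zpow_sub₀ q0.ne', zpow_neg, zpow_one, zpow_ofNat, show (2 : ℤ) - 1 = 1 from rfl,
      show (2 : ℤ) - -1 = 3 from rfl]
    obtain h | h := f.sgn_cases <;> simp only [h] <;>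
      refine congrArg₂ (shiftM M' M) ?_ ?_ <;> field_simp
  · rw [if_neg h.1, if_neg h.2, mul_zero]
    cases f <;> simp [eltP0, eltP0Space, eltP0Time, h]

/-- The operators in the rational basis have the matrix elements of the family, up to a change of
the norms of the basis vectors. -/
theorem matElt_eq_famOp (hq : 1 < q) (f : Family q) (x : Gen) (s' s : State f) :
    matElt f x s'.1 s.1 =
      ((f.gauge s.1 / f.gauge s'.1 : ℝ) : ℂ) * famOp f x (Finsupp.single s 1) s' := by
  have q0 : (q : ℂ) ≠ 0 := by exact_mod_cast (show q ≠ 0 by linarith)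
  have q0' : q ≠ 0 := by linarith
  -- The operators `Λ^{1/2}` and `Λ^{-1/2}` shift only `M`, on which the gauge does not depend.
  have key : ∀ (k : ℤ) (c : ℂ), (if s'.1 = ⟨s.1.j, s.1.m, s.1.n, s.1.M + k⟩ then c else 0) =
      ((f.gauge s.1 / f.gauge s'.1 : ℝ) : ℂ) * mOp f (fun _ => c) k (Finsupp.single s 1) s' :=
    fun k c => by
      refine Eq.trans ?_ (scalElt_match hq (lifts_m f (fun _ => c) k) s' s
        (if s'.1.n = s.1.n ∧ s'.1.M = s.1.M + k then c else 0) fun _ _ => ?_)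
      · simp only [QNum.ext_iff]
        split_ifs <;> tauto
      · rw [mRad_apply]
        split_ifs with e
        · rw [e.1, div_self (f.radGauge_pos hq _ _).ne', Complex.ofReal_one, one_mul]
        · rw [mul_zero]
  match x with
  | .vec .pos none =>
    have h := scalElt_match hq ((lifts_x0 f).mul (lifts_m f
      (fun M => f.len * (q : ℂ) ^ M / (q + (q : ℂ)⁻¹)) 0)) s' s
      (if s'.1.n = s.1.n ∧ s'.1.M = s.1.M then (timeVal f s.1 : ℂ) else 0) fun _ _ => ?_
    · refine Eq.trans ?_ h
      simp only [matElt, QNum.ext_iff]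
      split_ifs <;> tauto
    · rw [Pi.mul_apply, Module.End.mul_apply, mRad_radVec, map_smul, x0Red_radVec,
        Finsupp.smul_apply, Finsupp.smul_apply, radVec, Finsupp.single_apply, timeVal_eq hq,
        brk_two hq]
      by_cases e : s'.1.n = s.1.n ∧ s'.1.M = s.1.M
      · rw [if_pos e, if_pos (by rw [e.1, e.2, add_zero]), e.1,
          div_self (f.radGauge_pos hq _ _).ne']
        simp only [smul_eq_mul]
        push_cast
        ring
      · rw [if_neg e, if_neg (by simp only [add_zero, Prod.mk.injEq]; tauto)]
        simp
  | .vec .pos (some A) =>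
    rw [matElt, ← one_mul (Complex.ofReal _),
      vecElt_match hq (lifts_len_x f hq) A s' s 1 _ (redX_match hq f s' s)]
    rfl
  | .vec .mom none =>
    exact scalElt_match hq (lifts_momentum_zero f hq) s' s _ (eltP0_match hq f s' s)
  | .vec .mom (some A) =>
    exact vecElt_match hq (lifts_momentum f hq) A s' s _ _ (redP_match hq f s' s)
  | .R A =>
    rw [matElt, ← one_mul (Complex.ofReal _), redR_eq]
    refine vecElt_match hq ((lifts_r f q0).smul (1 / ((q : ℂ) + (q : ℂ)⁻¹))) A s' s 1 _
      (redRS_match hq f _ _ _ (fun j => q ^ (2 * j - 1)) (fun j => q ^ (-2 * j - 5)) _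
        (fun j => ?_) (fun j => ?_) ?_ s' s)
    · rw [mul_comm, ← zpow_add_one₀ q0', ← zpow_natCast, ← zpow_mul]
      push_cast
      congr 1; ring
    · rw [mul_comm q, ← zpow_add_one₀ q0', one_div, ← mul_pow, mul_comm (q : ℂ),
        ← zpow_add_one₀ q0, ← zpow_natCast, ← zpow_mul, ← zpow_neg]
      push_cast
      congr 1; ring
    · push_cast; rw [zpow_neg, zpow_ofNat]; field_simp
  | .S A =>
    rw [matElt, ← one_mul (Complex.ofReal _), redS_eq]
    refine vecElt_match hq ((lifts_s f q0).smul (1 / ((q : ℂ) + (q : ℂ)⁻¹))) A s' s 1 _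
      (redRS_match hq f _ _ _ (fun _ => q ^ (-3 : ℤ)) (fun _ => q ^ (-3 : ℤ)) _
        (fun j => ?_) (fun j => ?_) ?_ s' s)
    · push_cast; rw [zpow_neg, zpow_ofNat]; field_simp
    · push_cast; rw [zpow_neg, zpow_ofNat]; field_simp
    · push_cast; rw [zpow_neg, zpow_ofNat]; field_simp
  | .U =>
    refine Eq.trans ?_ (scalElt_match hq ((lifts_u f q0).smul (1 / ((q : ℂ) + (q : ℂ)⁻¹))) s' s _
      (coeffU_match hq f s' s))
    simp only [matElt]
    split_ifs <;> tauto
  | .lamHalf => exact key 1 _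
  | .lamInv => exact key (-1) _

end

end QMink

/-! ### Adjointness of the matrix elements. -/

namespace QMink

noncomputable section

variable {q : ℝ}

/-- The relation between the reduced matrix elements of two vector operators which are adjoint to
each other. -/
def RedAdjoint (q : ℝ) (r r' : QNum → QNum → ℝ) : Prop :=
  (∀ s' s, s'.j = s.j → r' s s' = r s' s) ∧
  (∀ s' s, s'.j = s.j + 1 → r' s s' = -q ^ (-2 * s.j - 2) * r s' s) ∧
  (∀ s' s, s'.j = s.j + 1 → r s s' = -q ^ (-2 * s.j - 2) * r' s' s)

lemma rpow_half_shift (hq : 1 < q) (m j : ℤ) :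
    q ^ ((m : ℝ) + ((j + 1 : ℤ) : ℝ) + 1 / 2) * q ^ (-2 * j - 2) =
      q ^ ((m : ℝ) - (j : ℝ) - 1 / 2) := by
  rw [← Real.rpow_intCast, ← Real.rpow_add (by linarith)]
  congr 1
  push_cast
  ring

lemma RedAdjoint.symm {r r' : QNum → QNum → ℝ} (h : RedAdjoint q r r') : RedAdjoint q r' r :=
  ⟨fun s' s e => (h.1 s s' e.symm).symm, h.2.2, h.2.1⟩

/-- The factor `-q` is the metric entry `g_{+-}`. The angular factors of the steps between `j` and
`j + 1` in opposite directions differ by a power of `q` that does not depend on `m`, and the factor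
`-q ^ (-2 * j - 2)` in `RedAdjoint` compensates it. -/
lemma vecElt_adjoint_plus (hq : 1 < q) {r r' : QNum → QNum → ℝ} (h : RedAdjoint q r r')
    (s' s : QNum) : -q * vecElt q .minus (r' s s') s.j s.m s'.j s'.m =
      vecElt q .plus (r s' s) s'.j s'.m s.j s.m := by
  have q0 : q ≠ 0 := by linarith
  have h0 := h.1 s' s
  have h1 := h.2.1 s' s
  have h2 := h.2.2 s s'
  generalize r' s s' = b at *
  generalize r s' s = a at *
  obtain ⟨j, m, n, M⟩ := s
  obtain ⟨j', m', n', M'⟩ := s'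
  simp only [vecElt] at h0 h1 h2 ⊢
  by_cases e : m' = m + 1
  swap
  · rw [if_neg e, if_neg (by omega), mul_zero]
  subst e
  rw [if_pos (by omega), if_pos rfl]
  by_cases e : j' = j
  · subst e
    rw [if_pos rfl, if_pos rfl, h0 rfl, show j' + (m + 1) = j' + m + 1 by ring,
      show j' - (m + 1) + 1 = j' - m by ring, show m + 2 = m + 1 + 1 by ring,
      zpow_add_one₀ q0 (m + 1)]
    ring
  rw [if_neg (Ne.symm e), if_neg e]
  by_cases e : j' = j + 1
  · subst e
    rw [if_neg (by omega), if_pos (by omega), if_pos rfl, h1 rfl,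
      show j + 1 + (m + 1) = j + m + 2 by ring, show j + m + 2 - 1 = j + m + 1 by ring,
      mul_comm (brk q (j + m + 2))]
    have : q ^ (m + 1) * q ^ (-2 * j - 2) * q = q ^ (m - 2 * j) := by
      rw [← zpow_add₀ q0, ← zpow_add_one₀ q0]; congr 1; ring
    linear_combination (√(brk q (j + m + 1) * brk q (j + m + 2)) * a) * this
  rw [if_neg e]
  by_cases e : j = j' + 1
  · subst e
    rw [if_pos rfl, if_pos (by omega), h2 rfl, show j' - (m + 1) + 1 = j' - m by ring,
      show j' - (m + 1) + 2 = j' + 1 - m by ring, show j' + 1 - m - 1 = j' - m by ring,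
      mul_comm (brk q (j' - m))]
    have : q ^ (m + 2 * (j' + 1) + 2) * q ^ (-2 * j' - 2) = q ^ (m + 1) * q := by
      rw [← zpow_add₀ q0, ← zpow_add_one₀ q0]; congr 1; ring
    linear_combination (√(brk q (j' + 1 - m) * brk q (j' - m)) * b) * this
  · rw [if_neg e, if_neg (by omega), if_neg (by omega), mul_zero]

lemma vecElt_adjoint_three (hq : 1 < q) {r r' : QNum → QNum → ℝ} (h : RedAdjoint q r r')
    (s' s : QNum) : vecElt q .three (r' s s') s.j s.m s'.j s'.m =
      vecElt q .three (r s' s) s'.j s'.m s.j s.m := by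
  have h0 := h.1 s' s
  have h1 := h.2.1 s' s
  have h2 := h.2.2 s s'
  generalize r' s s' = b at *
  generalize r s' s = a at *
  obtain ⟨j, m, n, M⟩ := s
  obtain ⟨j', m', n', M'⟩ := s'
  simp only [vecElt] at h0 h1 h2 ⊢
  by_cases e : m' = m
  swap
  · rw [if_neg e, if_neg (Ne.symm e)]
  subst e
  rw [if_pos rfl, if_pos rfl]
  by_cases e : j' = j
  · subst e
    rw [if_pos rfl, if_pos rfl, h0 rfl]
  rw [if_neg (Ne.symm e), if_neg e]
  by_cases e : j' = j + 1
  · subst e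
    rw [if_neg (by omega), if_pos (by omega), if_pos rfl, h1 rfl, ← rpow_half_shift hq,
      show j + 1 - m' = j - m' + 1 by ring, show j + 1 + m' = j + m' + 1 by ring]
    ring
  rw [if_neg e]
  by_cases e : j = j' + 1
  · subst e
    rw [if_pos rfl, if_pos (by omega), h2 rfl, ← rpow_half_shift hq,
      show j' + 1 - m' = j' - m' + 1 by ring, show j' + 1 + m' = j' + m' + 1 by ring]
    ring
  · rw [if_neg e, if_neg (by omega), if_neg (by omega)]

/-- The metric has one nonzero entry in each row, so the sum is a single term. The components `+`
and `-` are exchanged, and the case `-` is the case `+` with the two operators interchanged. -/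
lemma vecElt_adjoint (hq : 1 < q) {r r' : QNum → QNum → ℝ} (h : RedAdjoint q r r') (A : E3)
    (s' s : QNum) : ∑ B, g q A B * (vecElt q B (r' s s') s.j s.m s'.j s'.m : ℂ) =
      (vecElt q A (r s' s) s'.j s'.m s.j s.m : ℂ) := by
  have q0 : q ≠ 0 := by linarith
  have univ : (Finset.univ : Finset E3) = {.plus, .minus, .three} := rfl
  rw [univ, Finset.sum_insert (by decide), Finset.sum_insert (by decide), Finset.sum_singleton]
  cases A <;> simp only [g, zero_mul, add_zero, zero_add, one_mul] <;> norm_cast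
  · exact vecElt_adjoint_plus hq h s' s
  · rw [← vecElt_adjoint_plus hq h.symm s s']
    field_simp
  · exact vecElt_adjoint_three hq h s' s

lemma redX_adjoint (hq : 1 < q) (f : Family q) : RedAdjoint q (redX f) (redX f) := by
  have q0 : q ≠ 0 := by linarith
  have key : ∀ s' s : QNum, s'.j = s.j + 1 →
      redX f s s' = -q ^ (-2 * s.j - 2) * redX f s' s := fun s' s h => by
    rw [redX_eq hq, redX_eq hq]
    simp only [redXForm, h]
    by_cases e : s'.n = s.n ∧ s'.M = s.M
    · rw [if_pos e, if_pos ⟨e.1.symm, e.2.symm⟩, if_neg (by omega), if_neg (by omega), if_true,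
        if_true, e.1, e.2, show s.M - s.j - 2 = (-2 * s.j - 2) + (s.M + s.j) by ring,
        zpow_add₀ q0]
      ring
    · rw [if_neg e, if_neg (by tauto), mul_zero]
  refine ⟨fun s' s h => ?_, key, key⟩
  rw [redX_eq hq, redX_eq hq]
  simp only [redXForm, h]
  by_cases e : s'.n = s.n ∧ s'.M = s.M
  · rw [if_pos e, if_pos ⟨e.1.symm, e.2.symm⟩, e.1, e.2]
  · rw [if_neg e, if_neg (by tauto)]

/-- Interchanging the states reverses the sign of `n' - n`, which cancels the minus sign in front of
the element that lowers `j`; the arguments under the root are permuted. -/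
lemma redRS_swap (f : Family q) {α β γ α' β' γ' : ℝ} {s' s : QNum} (h : s'.j = s.j + 1)
    (hβ : β' = q ^ (-2 * s.j - 2) * α) :
    redRS f α' β' γ' s s' = q ^ (-2 * s.j - 2) * redRS f α β γ s' s := by
  simp only [redRS, h]
  by_cases e : (s'.n = s.n + 1 ∨ s'.n = s.n - 1) ∧ s'.M = s.M
  · rw [if_pos e, if_pos ⟨by omega, e.2.symm⟩, if_neg (by omega), if_neg (by omega), if_true,
      if_true, hβ, show s.n - (s.n - s'.n) * (s.j + 1) + f.kap =
        (s'.n - s.n) * s.j + s'.n + f.kap by ring,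
      show s'.n - (s.n - s'.n) * (s.j + 1) + f.kap = (s'.n - s.n) * (s.j + 1) + s'.n + f.kap by
        ring, mul_comm (f.ph (s'.n + f.kap)),
      mul_comm (f.ph ((s'.n - s.n) * s.j + s'.n + f.kap))]
    push_cast
    ring
  · rw [if_neg e, if_neg (by omega), mul_zero]

lemma redRS_stay_swap (f : Family q) {α β γ α' β' : ℝ} {s' s : QNum} (h : s'.j = s.j) :
    redRS f α' β' γ s s' = redRS f α β γ s' s := by
  simp only [redRS, h]
  by_cases e : (s'.n = s.n + 1 ∨ s'.n = s.n - 1) ∧ s'.M = s.M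
  · rw [if_pos e, if_pos ⟨by omega, e.2.symm⟩]
    simp only [left_eq_add, one_ne_zero, if_false]
    rw [show (s.n - s'.n) * s.j + s.n + f.kap = s.n - (s'.n - s.n) * s.j + f.kap by ring,
      show s'.n - (s.n - s'.n) * s.j + f.kap = (s'.n - s.n) * s.j + s'.n + f.kap by ring,
      mul_comm (f.ph (s'.n + f.kap)), mul_comm (f.ph (s.n - (s'.n - s.n) * s.j + f.kap))]
  · rw [if_neg e, if_neg (by omega)]

lemma redRS_neg (f : Family q) (α β γ : ℝ) (s' s : QNum) :
    -redRS f α β γ s' s = redRS f (-α) (-β) (-γ) s' s := by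
  simp only [redRS]
  split_ifs <;> ring

/-- The factors `q ^ (2 * j - 1)`, `q ^ (-3)` and `q ^ (-2 * j - 5)` form a geometric sequence with
ratio `q ^ (-2 * j - 2)`. So raising `j` by `R` corresponds to lowering it by `S`, and raising it by
`S` to lowering it by `R`. -/
lemma redR_adjoint (hq : 1 < q) (f : Family q) :
    RedAdjoint q (redR f) (fun s' s => -redS f s' s) := by
  have q0 : q ≠ 0 := by linarith
  have e1 : ∀ j : ℤ, q ^ (-2 * j - 2) * q ^ (2 * j - 1) = q ^ (-3 : ℤ) := fun j => by
    rw [← zpow_add₀ q0]; congr 1; ring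
  have e2 : ∀ j : ℤ, q ^ (-2 * j - 2) * q ^ (-3 : ℤ) = q ^ (-2 * j - 5) := fun j => by
    rw [← zpow_add₀ q0]; congr 1; ring
  refine ⟨fun s' s h => ?_, fun s' s h => ?_, fun s' s h => ?_⟩
  · simp only [redR_eq, redS_eq, redRS_neg, neg_neg]
    exact redRS_stay_swap f h
  · simp only [redR_eq, redS_eq]
    rw [neg_mul, neg_inj]
    exact redRS_swap f h (e1 _).symm
  · simp only [redR_eq, redS_eq]
    exact (redRS_swap f h (e2 _).symm).trans (by ring)

lemma redP_zero (f : Family q) {s' s : QNum} (h : s'.n ≠ s.n + 1 ∧ s'.n ≠ s.n - 1) :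
    redP f s' s = 0 := by
  cases f <;> simp [redP, redPSpace, redPTime, h]

lemma redP_stay_zero (f : Family q) {s' s : QNum} (h : s'.j = s.j) (h1 : s.j < 1) :
    redP f s' s = 0 := by
  have h2 : ¬ 1 ≤ s.j := by omega
  cases f <;> simp [redP, redPSpace, redPTime, h, h2]

/-- The exchange of `M` and `M'` in the matrix elements of the momenta. -/
lemma shiftM_swap (hq : 1 < q) {M' M : ℤ} {a b c d e : ℝ} (h1 : a * q = e * d)
    (h2 : b = e * c * q) : shiftM M' M a b / q ^ M = e * (shiftM M M' c d / q ^ M') := by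
  have q0 : q ≠ 0 := by linarith
  obtain rfl | rfl | h : M' = M + 1 ∨ M = M' + 1 ∨ (M' ≠ M + 1 ∧ M ≠ M' + 1) := by omega
  · have : q ^ M ≠ 0 := zpow_ne_zero _ q0
    rw [shiftM, shiftM, if_pos rfl, if_neg (by omega), if_neg (by omega), if_pos (by omega),
      zpow_add_one₀ q0]
    field_simp
    linear_combination h1
  · have : q ^ M' ≠ 0 := zpow_ne_zero _ q0
    rw [shiftM, shiftM, if_neg (by omega), if_pos (by omega), if_pos rfl, if_neg (by omega),
      zpow_add_one₀ q0, h2]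
    field_simp
    ring
  · rw [shiftM, shiftM, if_neg h.1, if_neg h.2, if_neg (by omega), if_neg (by omega)]
    simp

/-- The part that raises `M` in one direction is compared with the part that lowers it in the other.
The denominators `q ^ M` of the two states differ by one factor `q`, which `shiftM_swap` takes into
account. -/
lemma redP_swap_up (hq : 1 < q) (f : Family q) {s' s : QNum} (h : s'.j = s.j + 1) :
    redP f s s' = q ^ (-2 * s.j - 2) * redP f s' s := by
  have q0 : q ≠ 0 := by linarith
  obtain ⟨j, m, n, M⟩ := s
  obtain ⟨j', m', n', M'⟩ := s'
  simp only at h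
  subst h
  obtain rfl | rfl | h : n' = n + 1 ∨ n = n' + 1 ∨ (n' ≠ n + 1 ∧ n' ≠ n - 1) := by omega
  · have h := redP_down_pred f j m' m (n + 1) M' M
    rw [add_sub_cancel_right] at h
    rw [h, redP_up_succ]
    have hs := shiftM_swap hq (M' := M) (M := M')
      (a := f.sgn * q ^ (-2 - 2 * j + (n + 1 + f.kap))) (b := -q ^ (2 - (n + 1 + f.kap)))
      (c := q ^ (2 + 2 * j - (n + f.kap))) (d := -(f.sgn * q ^ (2 + (n + f.kap))))
      (e := -q ^ (-2 * j - 2)) ?_ ?_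
    · rw [show n + 1 + f.kap + j + 1 = n + f.kap + j + 2 by ring,
        show n + 1 + f.kap + j = n + f.kap + j + 1 by ring,
        show n + 1 + f.kap - 1 = n + f.kap by ring, show n + 1 + f.kap = n + f.kap + 1 by ring,
        mul_comm (f.ph (n + f.kap + 1))]
      rw [show n + 1 + f.kap = n + f.kap + 1 by ring] at hs
      linear_combination (-(1 / 2) * (1 / (crl q (j + 1) * lam q * f.len)) *
        √(brk q 2 / (brk q (2 * j + 1) * brk q (2 * j + 3))) *
        √(f.ph (n + f.kap + j + 2) * f.ph (n + f.kap + j + 1) /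
          (f.ph (n + f.kap) * f.ph (n + f.kap + 1)))) * hs
    · rw [mul_neg, neg_mul, neg_neg, mul_left_comm, ← zpow_add₀ q0, mul_assoc, ← zpow_add_one₀ q0]
      congr 2; ring
    · rw [neg_mul, neg_mul, ← zpow_add₀ q0, ← zpow_add_one₀ q0]
      congr 2; ring
  · have h := redP_up_pred f j m m' (n' + 1) M M'
    rw [add_sub_cancel_right] at h
    rw [h, redP_down_succ]
    have hs := shiftM_swap hq (M' := M) (M := M')
      (a := q ^ (-2 - 2 * j - (n' + f.kap))) (b := -(f.sgn * q ^ (2 + (n' + f.kap))))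
      (c := f.sgn * q ^ (2 + 2 * j + (n' + 1 + f.kap))) (d := -q ^ (2 - (n' + 1 + f.kap)))
      (e := -q ^ (-2 * j - 2)) ?_ ?_
    · rw [show n' + 1 + f.kap - j - 2 = n' + f.kap - j - 1 by ring,
        show n' + 1 + f.kap - j - 1 = n' + f.kap - j by ring,
        show n' + 1 + f.kap - 1 = n' + f.kap by ring, show n' + 1 + f.kap = n' + f.kap + 1 by ring,
        mul_comm (f.ph (n' + f.kap + 1)), mul_comm (f.ph (n' + f.kap - j - 1))]
      rw [show n' + 1 + f.kap = n' + f.kap + 1 by ring] at hs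
      linear_combination (-(1 / 2) * (1 / (crl q (j + 1) * lam q * f.len)) *
        √(brk q 2 / (brk q (2 * j + 1) * brk q (2 * j + 3))) *
        √(f.ph (n' + f.kap - j) * f.ph (n' + f.kap - j - 1) /
          (f.ph (n' + f.kap) * f.ph (n' + f.kap + 1)))) * hs
    · rw [mul_neg, neg_mul, neg_neg, ← zpow_add₀ q0, ← zpow_add_one₀ q0]
      congr 1; ring
    · rw [neg_mul, neg_mul, mul_left_comm, ← zpow_add₀ q0, mul_assoc, ← zpow_add_one₀ q0]
      congr 3; ring
  · rw [redP_zero f ⟨by simp only; omega, by simp only; omega⟩, redP_zero f h, mul_zero]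

lemma redP_swap_stay (hq : 1 < q) (f : Family q) {s' s : QNum} (h : s'.j = s.j) :
    -redP f s s' = redP f s' s := by
  have q0 : q ≠ 0 := by linarith
  have key : ∀ (j m m' n M M' : ℤ), 1 ≤ j →
      -redP f ⟨j, m, n, M⟩ ⟨j, m', n + 1, M'⟩ = redP f ⟨j, m', n + 1, M'⟩ ⟨j, m, n, M⟩ :=
    fun j m m' n M M' hj => by
      have h := redP_stay_pred f j m' m (n + 1) M' M hj
      rw [add_sub_cancel_right] at h
      rw [h, redP_stay_succ f j m m' n M M' hj]
      have hs := shiftM_swap hq (M' := M) (M := M')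
        (a := f.sgn * q ^ (n + 1 + f.kap)) (b := q ^ (2 - (n + 1 + f.kap)))
        (c := q ^ (-(n + f.kap))) (d := f.sgn * q ^ (2 + (n + f.kap))) (e := 1) ?_ ?_
      · rw [show n + 1 + f.kap - j - 1 = n + f.kap - j by ring,
          show n + 1 + f.kap + j = n + f.kap + j + 1 by ring,
          show n + 1 + f.kap - 1 = n + f.kap by ring, show n + 1 + f.kap = n + f.kap + 1 by ring,
          mul_comm (f.ph (n + f.kap + 1)), mul_comm (f.ph (n + f.kap - j))]
        rw [show n + 1 + f.kap = n + f.kap + 1 by ring] at hs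
        linear_combination (√(brk q 2) / (2 * crl q j * crl q (j + 1) * f.len) *
          √(f.ph (n + f.kap + j + 1) * f.ph (n + f.kap - j) /
            (f.ph (n + f.kap) * f.ph (n + f.kap + 1)))) * hs
      · rw [one_mul, mul_assoc, ← zpow_add_one₀ q0]
        congr 2; ring
      · rw [one_mul, ← zpow_add_one₀ q0]
        congr 1; ring
  obtain ⟨j, m, n, M⟩ := s
  obtain ⟨j', m', n', M'⟩ := s'
  simp only at h
  subst h
  by_cases hj : 1 ≤ j'
  swap
  · rw [redP_stay_zero f (s' := ⟨j', m, n, M⟩) (s := ⟨j', m', n', M'⟩) rfl (not_le.1 hj),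
      redP_stay_zero f (s' := ⟨j', m', n', M'⟩) (s := ⟨j', m, n, M⟩) rfl (not_le.1 hj), neg_zero]
  obtain rfl | rfl | h : n' = n + 1 ∨ n = n' + 1 ∨ (n' ≠ n + 1 ∧ n' ≠ n - 1) := by omega
  · exact key _ _ _ _ _ _ hj
  · rw [← key _ _ _ _ _ _ hj, neg_neg]
  · rw [redP_zero f ⟨by simp only; omega, by simp only; omega⟩, redP_zero f h, neg_zero]

/-- The stored elements are divided by the imaginary unit, whose conjugate is its negative. This is
why the partner of `redP` carries a minus sign although `P` is conjugate to itself. -/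
lemma redP_adjoint (hq : 1 < q) (f : Family q) :
    RedAdjoint q (redP f) (fun s' s => -redP f s' s) :=
  ⟨fun _ _ h => redP_swap_stay hq f h,
    fun _ _ h => by simp only [redP_swap_up hq f h]; ring,
    fun _ _ h => by simp only [redP_swap_up hq f h]; ring⟩

lemma eltP0_swap (hq : 1 < q) (f : Family q) {s' s : QNum} (h : s'.j = s.j) (hm : s'.m = s.m) :
    -eltP0 f s s' = eltP0 f s' s := by
  have q0 : q ≠ 0 := by linarith
  have key : ∀ (j m n M M' : ℤ),
      -eltP0 f ⟨j, m, n, M⟩ ⟨j, m, n + 1, M'⟩ = eltP0 f ⟨j, m, n + 1, M'⟩ ⟨j, m, n, M⟩ :=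
    fun j m n M M' => by
      have h := eltP0_pred f j m (n + 1) M' M
      rw [add_sub_cancel_right] at h
      rw [h, eltP0_succ f j m n M M']
      have hs := shiftM_swap hq (M' := M) (M := M')
        (a := f.sgn * q ^ (1 + (n + 1 + f.kap))) (b := q ^ (3 - (n + 1 + f.kap)))
        (c := q ^ (1 - (n + f.kap))) (d := f.sgn * q ^ (3 + (n + f.kap))) (e := 1) ?_ ?_
      · rw [show n + 1 + f.kap - j - 1 = n + f.kap - j by ring,
          show n + 1 + f.kap + j = n + f.kap + j + 1 by ring,
          show n + 1 + f.kap - 1 = n + f.kap by ring, show n + 1 + f.kap = n + f.kap + 1 by ring,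
          mul_comm (f.ph (n + f.kap + 1))]
        rw [show n + 1 + f.kap = n + f.kap + 1 by ring] at hs
        linear_combination (-(1 / (2 * lam q * f.len)) *
          √(f.ph (n + f.kap - j) * f.ph (n + f.kap + j + 1) /
            (f.ph (n + f.kap) * f.ph (n + f.kap + 1)))) * hs
      · rw [one_mul, mul_assoc, ← zpow_add_one₀ q0]
        congr 2; ring
      · rw [one_mul, ← zpow_add_one₀ q0]
        congr 1; ring
  obtain ⟨j, m, n, M⟩ := s
  obtain ⟨j', m', n', M'⟩ := s'
  simp only at h hm
  subst h hm
  obtain rfl | rfl | h : n' = n + 1 ∨ n = n' + 1 ∨ (n' ≠ n + 1 ∧ n' ≠ n - 1) := by omega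
  · exact key _ _ _ _ _
  · rw [← key, neg_neg]
  · have z : ∀ s' s : QNum, s'.n ≠ s.n + 1 ∧ s'.n ≠ s.n - 1 → eltP0 f s' s = 0 :=
      fun s' s h => by cases f <;> simp [eltP0, eltP0Space, eltP0Time, h]
    rw [z _ _ ⟨by simp only; omega, by simp only; omega⟩, z _ _ h, neg_zero]

/-- The matrix elements of the conjugates of the generators. -/
def starElt (f : Family q) : Gen → QNum → QNum → ℂ
  | .vec k none, s', s => matElt f (.vec k none) s' s
  | .vec k (some A), s', s => ∑ B, g q A B * matElt f (.vec k (some B)) s' s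
  | .R A, s', s => -∑ B, g q A B * matElt f (.S B) s' s
  | .S A, s', s => -∑ B, g q A B * matElt f (.R B) s' s
  | .U, s', s => matElt f .U s' s
  | .lamHalf, s', s => (q : ℂ) ^ 4 * matElt f .lamInv s' s
  | .lamInv, s', s => ((q : ℂ) ^ 4)⁻¹ * matElt f .lamHalf s' s

lemma conj_g (q : ℝ) (A B : E3) : (starRingEnd ℂ) (g q A B) = g q A B := by
  cases A <;> cases B <;> simp [g]

lemma vecElt_neg (A : E3) (r : ℝ) (j' m' j m : ℤ) :
    vecElt q A (-r) j' m' j m = -vecElt q A r j' m' j m := by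
  cases A <;> simp only [vecElt] <;> split_ifs <;> ring

/-- The matrix elements of conjugate generators are adjoint to each other. -/
theorem conj_starElt (hq : 1 < q) (f : Family q) (x : Gen) (s' s : QNum) :
    (starRingEnd ℂ) (starElt f x s s') = matElt f x s' s := by
  have q0 : (q : ℂ) ≠ 0 := by exact_mod_cast (show q ≠ 0 by linarith)
  match x with
  | .vec .pos none =>
    simp only [starElt, matElt, apply_ite (starRingEnd ℂ), Complex.conj_ofReal, map_zero]
    by_cases e : s' = s
    · rw [e]
    · rw [if_neg e, if_neg (Ne.symm e)]
  | .vec .pos (some A) =>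
    simp only [starElt, matElt, map_sum, map_mul, conj_g, Complex.conj_ofReal]
    exact vecElt_adjoint hq (redX_adjoint hq f) A s' s
  | .vec .mom none =>
    simp only [starElt, matElt, apply_ite (starRingEnd ℂ), map_mul, Complex.conj_I,
      Complex.conj_ofReal, map_zero]
    by_cases e : s'.j = s.j ∧ s'.m = s.m
    · rw [if_pos e, if_pos ⟨e.1.symm, e.2.symm⟩, ← eltP0_swap hq f e.1 e.2]
      push_cast; ring
    · rw [if_neg e, if_neg (by tauto)]
  | .vec .mom (some A) =>
    simp only [starElt, matElt, map_sum, map_mul, conj_g, Complex.conj_ofReal, Complex.conj_I]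
    rw [← vecElt_adjoint hq (redP_adjoint hq f) A s' s, Finset.mul_sum]
    refine Finset.sum_congr rfl fun B _ => ?_
    rw [vecElt_neg]
    push_cast; ring
  | .R A =>
    simp only [starElt, matElt, map_sum, map_mul, map_neg, conj_g, Complex.conj_ofReal]
    rw [← vecElt_adjoint hq (redR_adjoint hq f) A s' s, ← Finset.sum_neg_distrib]
    refine Finset.sum_congr rfl fun B _ => ?_
    rw [vecElt_neg]
    push_cast; ring
  | .S A =>
    have h := vecElt_adjoint hq (redR_adjoint hq f).symm A s' s
    simp only [vecElt_neg] at h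
    simp only [starElt, matElt, map_sum, map_mul, map_neg, conj_g, Complex.conj_ofReal]
    rw [h]
    push_cast; ring
  | .U =>
    simp only [starElt, matElt, apply_ite (starRingEnd ℂ), Complex.conj_ofReal, map_zero]
    by_cases e : s'.j = s.j ∧ s'.m = s.m ∧ s'.M = s.M
    · rw [if_pos e, if_pos ⟨e.1.symm, e.2.1.symm, e.2.2.symm⟩, e.1]
      split_ifs <;> first | rfl | omega
    · rw [if_neg e, if_neg (by tauto)]
  | .lamHalf =>
    simp only [starElt, matElt, apply_ite (starRingEnd ℂ), map_mul, map_pow, map_inv₀,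
      Complex.conj_ofReal, map_zero, QNum.ext_iff]
    split_ifs <;> first | omega | exact mul_zero _ | field_simp
  | .lamInv =>
    simp only [starElt, matElt, apply_ite (starRingEnd ℂ), map_mul, map_pow, map_inv₀,
      Complex.conj_ofReal, map_zero, QNum.ext_iff]
    split_ifs <;> first | omega | exact mul_zero _ | field_simp

end

end QMink

/-! ### The representation on the span of the kets. -/

namespace QMink

noncomputable section

variable {q : ℝ}

/-- The kets as a basis of the domain. -/
def ketBasis (f : Family q) : Module.Basis (State f) ℂ (dom f) :=
  Module.Basis.span (basisVec f).orthonormal.linearIndependent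

lemma ketBasis_apply (f : Family q) (s : State f) : ketBasis f s = ket f s :=
  Module.Basis.span_apply _ s

lemma inner_ket_ket (f : Family q) (s' s : State f) :
    inner ℂ (ket f s') (ket f s) = if s' = s then (1 : ℂ) else 0 :=
  orthonormal_iff_ite.1 (basisVec f).orthonormal s' s

/-- The scalar products with the kets are the coordinates. -/
lemma inner_ket (f : Family q) (s : State f) (v : dom f) :
    inner ℂ (ket f s) v = (ketBasis f).repr v s := by
  have : (innerSL ℂ (ket f s)).toLinearMap =
      Finsupp.lapply s ∘ₗ (ketBasis f).repr.toLinearMap :=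
    (ketBasis f).ext fun t => by
      rw [LinearMap.comp_apply, LinearEquiv.coe_coe, Module.Basis.repr_self, ketBasis_apply]
      refine (inner_ket_ket f s t).trans ?_
      rw [Finsupp.lapply_apply, Finsupp.single_apply]
      exact if_congr eq_comm rfl rfl
  exact LinearMap.congr_fun this v

lemma dom_ext {f : Family q} {v w : dom f}
    (h : ∀ s, inner ℂ (ket f s) v = inner ℂ (ket f s) w) : v = w :=
  (ketBasis f).ext_elem fun s => by rw [← inner_ket, ← inner_ket, h]

lemma dom_induction {f : Family q} {p : dom f → Prop} (h0 : p 0)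
    (hadd : ∀ v w, p v → p w → p (v + w)) (hsmul : ∀ (c : ℂ) s, p (c • ket f s)) (v : dom f) :
    p v := by
  rw [← (ketBasis f).repr.symm_apply_apply v]
  induction (ketBasis f).repr v using Finsupp.induction_linear with
  | zero => rwa [map_zero]
  | add v w hv hw => rw [map_add]; exact hadd _ _ hv hw
  | single s c =>
    rw [Module.Basis.repr_symm_single, ketBasis_apply]
    exact hsmul c s

/-- The change to the rational basis. -/
def toSpace (hq : 1 < q) (f : Family q) : dom f ≃ₗ[ℂ] Space f :=
  ((ketBasis f).isUnitSMul (w := fun s => ((f.gauge s.1 : ℝ) : ℂ)⁻¹) fun s =>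
    isUnit_iff_ne_zero.2 (inv_ne_zero (by exact_mod_cast (f.gauge_pos hq s.1).ne'))).repr

lemma toSpace_apply (hq : 1 < q) (f : Family q) (v : dom f) (s : State f) :
    toSpace hq f v s = (f.gauge s.1 : ℂ) * inner ℂ (ket f s) v := by
  rw [toSpace, Module.Basis.repr_isUnitSMul, inner_ket]
  rw [Units.smul_def]
  simp

lemma toSpace_ket (hq : 1 < q) (f : Family q) (s : State f) :
    toSpace hq f (ket f s) = (f.gauge s.1 : ℂ) • Finsupp.single s 1 := by
  ext t
  rw [toSpace_apply, inner_ket_ket, Finsupp.smul_apply, Finsupp.single_apply, smul_eq_mul]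
  split_ifs with h1 h2 h2
  · rw [h1]
  · exact absurd h1.symm h2
  · exact absurd h2.symm h1
  · simp

lemma famOp_rel (hq : 1 < q) (f : Family q) ⦃a b : Free⦄ (h : Rel (q : ℂ) a b) :
    FreeAlgebra.lift ℂ (famOp f) a = FreeAlgebra.lift ℂ (famOp f) b :=
  rel_genOp (generic_of_one_lt hq) (hatModel hq f) (lengthOps hq f) h

/-- The representation in the rational basis. -/
def spaceHom (hq : 1 < q) (f : Family q) : QAlg q →ₐ[ℂ] Module.End ℂ (Space f) :=
  RingQuot.liftAlgHom ℂ ⟨FreeAlgebra.lift ℂ (famOp f), famOp_rel hq f⟩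

lemma spaceHom_gen (hq : 1 < q) (f : Family q) (x : Gen) : spaceHom hq f (gen q x) = famOp f x := by
  rw [spaceHom, gen, RingQuot.liftAlgHom_mkAlgHom_apply, FreeAlgebra.lift_ι_apply]

/-- The representation on the span of the kets. -/
def repHom (hq : 1 < q) (f : Family q) : QAlg q →ₐ[ℂ] Module.End ℂ (dom f) :=
  ((toSpace hq f).symm.conjAlgEquiv ℂ).toAlgHom.comp (spaceHom hq f)

lemma repHom_apply (hq : 1 < q) (f : Family q) (a : QAlg q) (v : dom f) :
    repHom hq f a v = (toSpace hq f).symm (spaceHom hq f a (toSpace hq f v)) := rfl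

lemma repHom_gen (hq : 1 < q) (f : Family q) (x : Gen) (v : dom f) :
    repHom hq f (gen q x) v = (toSpace hq f).symm (famOp f x (toSpace hq f v)) := by
  rw [repHom_apply, spaceHom_gen]

lemma inner_repHom (hq : 1 < q) (f : Family q) (x : Gen) (s' s : State f) :
    inner ℂ (ket f s') (repHom hq f (gen q x) (ket f s)) = matElt f x s'.1 s.1 := by
  have h : (f.gauge s'.1 : ℂ) ≠ 0 := by exact_mod_cast (f.gauge_pos hq s'.1).ne'
  have := toSpace_apply hq f (repHom hq f (gen q x) (ket f s)) s'
  rw [repHom_gen hq f x (ket f s), LinearEquiv.apply_symm_apply, toSpace_ket, map_smul,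
    Finsupp.smul_apply, smul_eq_mul] at this
  rw [repHom_gen, toSpace_ket, map_smul, matElt_eq_famOp hq, Complex.ofReal_div, div_mul_eq_mul_div,
    this, mul_div_cancel_left₀ _ h]

/-- The matrix elements of the conjugates of the generators. -/
lemma inner_genStar {f : Family q} {ρ : QAlg q →ₐ[ℂ] Module.End ℂ (dom f)}
    (h : ∀ x (s' s : State f), inner ℂ (ket f s') (ρ (gen q x) (ket f s)) = matElt f x s'.1 s.1)
    (x : Gen) (s' s : State f) :
    inner ℂ (ket f s') (ρ (genStar q x) (ket f s)) = starElt f x s'.1 s.1 := by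
  match x with
  | .vec _ none => exact h _ _ _
  | .vec _ (some A) =>
    simp only [genStar, starElt, map_sum, map_smul, LinearMap.sum_apply, LinearMap.smul_apply,
      inner_sum, inner_smul_right, h]
  | .R A =>
    simp only [genStar, starElt, map_neg, map_sum, map_smul, LinearMap.neg_apply,
      LinearMap.sum_apply, LinearMap.smul_apply, inner_neg_right, inner_sum, inner_smul_right, h]
  | .S A =>
    simp only [genStar, starElt, map_neg, map_sum, map_smul, LinearMap.neg_apply,
      LinearMap.sum_apply, LinearMap.smul_apply, inner_neg_right, inner_sum, inner_smul_right, h]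
  | .U => exact h _ _ _
  | .lamHalf =>
    simp only [genStar, starElt, map_smul, LinearMap.smul_apply, inner_smul_right, h]
  | .lamInv =>
    simp only [genStar, starElt, map_smul, LinearMap.smul_apply, inner_smul_right, h]

/-- The representation of the family. -/
def familyRep (hq : 1 < q) (f : Family q) : StarRep q (dom f) where
  toHom := repHom hq f
  adjoint x φ ψ := by
    induction φ using dom_induction with
    | h0 => simp
    | hadd v w hv hw => rw [map_add, inner_add_left, inner_add_left, hv, hw]
    | hsmul c s' =>
      rw [map_smul, inner_smul_left, inner_smul_left]
      congr 1
      induction ψ using dom_induction with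
      | h0 => simp
      | hadd v w hv hw => rw [map_add, inner_add_right, inner_add_right, hv, hw]
      | hsmul c s =>
        rw [map_smul, inner_smul_right, inner_smul_right, inner_repHom, ← conj_starElt hq f x,
          ← inner_genStar (inner_repHom hq f)]
        exact congrArg _ (inner_conj_symm _ _).symm

lemma familyRep_hasMatrixElements (hq : 1 < q) (f : Family q) :
    (familyRep hq f).HasMatrixElements := inner_repHom hq f

/-- The matrix elements determine the representation. -/
lemma toHom_eq_repHom (hq : 1 < q) {f : Family q} {ρ : StarRep q (dom f)}
    (h : ρ.HasMatrixElements) : ρ.toHom = repHom hq f := by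
  refine RingQuot.ringQuot_ext' ℂ _ _ (FreeAlgebra.hom_ext (funext fun x => ?_))
  refine (ketBasis f).ext fun s => dom_ext fun s' => ?_
  rw [ketBasis_apply]
  exact (h x s' s).trans (inner_repHom hq f x s' s).symm

end

end QMink

namespace QMink

noncomputable section

variable {q : ℝ}

/-! ## Diagonal operators -/

/-- The operator which is diagonal in the kets. -/
def diagS (f : Family q) (c : QNum → ℂ) : Module.End ℂ (Space f) :=
  Finsupp.linearCombination ℂ fun s : State f => c s.1 • Finsupp.single s 1

lemma diagS_single (f : Family q) (c : QNum → ℂ) (s : State f) :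
    diagS f c (Finsupp.single s 1) = c s.1 • Finsupp.single s 1 := by
  rw [diagS, Finsupp.linearCombination_single, one_smul]

lemma diagS_apply (f : Family q) (c : QNum → ℂ) (v : Space f) (s : State f) :
    diagS f c v s = c s.1 * v s := by
  induction v using Finsupp.induction_linear with
  | zero => simp
  | add v w hv hw => rw [map_add, Finsupp.add_apply, hv, hw, Finsupp.add_apply, mul_add]
  | single t a =>
    rw [diagS, Finsupp.linearCombination_single, Finsupp.smul_apply, Finsupp.smul_apply,
      Finsupp.single_apply, Finsupp.single_apply]
    split_ifs with h
    · subst h; simp [mul_comm]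
    · simp

lemma diagS_mul (f : Family q) (c d : QNum → ℂ) :
    diagS f c * diagS f d = diagS f (fun s => c s * d s) :=
  LinearMap.ext fun v => Finsupp.ext fun s => by
    rw [Module.End.mul_apply, diagS_apply, diagS_apply, diagS_apply, mul_assoc]

lemma diagS_one (f : Family q) : diagS f (fun _ => 1) = 1 :=
  LinearMap.ext fun v => Finsupp.ext fun s => by rw [diagS_apply, one_mul, Module.End.one_apply]

lemma eq_diagS {f : Family q} {T : Module.End ℂ (Space f)} {c : QNum → ℂ}
    (h : ∀ s : State f, incl f (T (Finsupp.single s 1)) = c s.1 • Finsupp.single s.1 1) :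
    T = diagS f c :=
  Finsupp.lhom_ext' fun s => LinearMap.ext_ring <| incl_injective f <| by
    refine (h s).trans ?_
    rw [LinearMap.comp_apply, Finsupp.lsingle_apply, diagS_single, map_smul, incl_single]

/-- The transport of operators to the span of the kets. -/
def transport (hq : 1 < q) (f : Family q) : Module.End ℂ (Space f) ≃ₐ[ℂ] Module.End ℂ (dom f) :=
  (toSpace hq f).symm.conjAlgEquiv ℂ

lemma repHom_eq_transport (hq : 1 < q) (f : Family q) (a : QAlg q) :
    repHom hq f a = transport hq f (spaceHom hq f a) := rfl

lemma transport_diagS (hq : 1 < q) (f : Family q) (c : QNum → ℂ) (s : State f) :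
    transport hq f (diagS f c) (ket f s) = c s.1 • ket f s := by
  have : transport hq f (diagS f c) (ket f s) =
    (toSpace hq f).symm (diagS f c (toSpace hq f (ket f s))) := rfl
  rw [this, LinearEquiv.symm_apply_eq, map_smul, toSpace_ket, map_smul, diagS_single, smul_comm]

/-! ## The rotation generators -/

lemma two_bracket (hq : 1 < q) : (q : ℂ) + (q : ℂ)⁻¹ ≠ 0 := by
  have : 0 < q + q⁻¹ := by positivity
  exact_mod_cast this.ne'

lemma spaceHom_dot (hq : 1 < q) (f : Family q) (x y : E3 → QAlg q) :
    spaceHom hq f (dot q x y) = dot q (fun A => spaceHom hq f (x A)) fun A =>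
      spaceHom hq f (y A) := by
  simp only [dot, map_sum, map_smul, map_mul]

lemma spaceHom_cross (hq : 1 < q) (f : Family q) (x y : E3 → QAlg q) (A : E3) :
    spaceHom hq f (cross q x y A) =
      cross q (fun A => spaceHom hq f (x A)) (fun A => spaceHom hq f (y A)) A := by
  simp only [cross, map_sum, map_smul, map_mul]

/-- A variant of `LiftsVec.ext` in which the second family of reduced elements need not come from
operators on `Space f`; it is used with `rotRed`. -/
lemma LiftsVec.incl_single_congr {f : Family q} (h0 : (q : ℂ) ≠ 0) (h2 : (q : ℂ) ^ 2 + 1 ≠ 0)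
    {Y : E3 → Module.End ℂ (Space f)} {y z : RedVec} (hy : LiftsVec Y y)
    (e : ∀ Δ j n M, 0 ≤ j → f.RadOccurs j n → Δ = .up ∨ j ≠ 0 →
      y Δ j (radVec n M) = z Δ j (radVec n M)) (A : E3) (s : State f) :
    incl f (Y A (Finsupp.single s 1)) = vecOp q z A (Finsupp.single s.1 1) := by
  rw [hy A, incl_single]
  obtain ⟨hm, hn⟩ := (f.occurs_iff s.1).1 s.2
  have hj := (abs_nonneg _).trans hm
  rw [single_eq_emb, vecOp_emb, vecOp_emb, e .up _ _ _ hj hn (.inl rfl)]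
  by_cases h : s.1.j = 0
  · have : s.1.m = 0 := by rw [h] at hm; exact abs_nonpos_iff.1 hm
    simp only [h, this, zpow_zero, angCoef_stay_zero h2 h0, zero_smul]
  · rw [e .stay _ _ _ hj hn (.inr h), e .down _ _ _ hj hn (.inr h)]

lemma spaceHom_rotL (hq : 1 < q) (f : Family q) (A : E3) : spaceHom hq f (rotL q A) =
    (((q : ℂ) ^ 2 + 1) / (q : ℂ) ^ 2 * (1 / (q + (q : ℂ)⁻¹)) ^ 2) •
      (uOp f * sOp f A - uOp f * rOp f A + ((q : ℂ) ^ 4 - 1) • cross q (rOp f) (sOp f) A) := by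
  rw [rotL, map_smul, map_add, map_sub, map_mul, map_mul, map_smul, spaceHom_cross]
  simp only [spaceHom_gen]
  simp only [famOp, genOp, cross_smul_smul, smul_mul_smul_comm]
  module

/-- The action of the rotation generators. -/
lemma incl_rotL (hq : 1 < q) (f : Family q) (A : E3) (s : State f) :
    incl f (spaceHom hq f (rotL q A) (Finsupp.single s 1)) =
      (-((q : ℂ) ^ 3)⁻¹ * angCoef q A .stay (q ^ s.1.j) (q ^ s.1.m)) •
        Finsupp.single ⟨s.1.j, s.1.m + weight A, s.1.n, s.1.M⟩ 1 := by
  have g := generic_of_one_lt hq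
  have q0 := g.q0
  have R := lifts_r f g.q0
  have S := lifts_s f g.q0
  have U := lifts_u f g.q0
  have L := ((U.mul_vec S).sub (U.mul_vec R)).add
    ((R.cross g.q0 g.q1 g.q2 S).smul ((q : ℂ) ^ 4 - 1))
  -- In this combination of the Lorentz generators the steps that change `j` cancel, and the reduced
  -- element for constant `j` is a number independent of `n` and `M`. So the operators act on `m`
  -- alone.
  have key := L.incl_single_congr (z := rotRed q) g.q0 g.q2 (fun Δ j n M hj hn e =>
    (lorentz_vector_identities (M := M) (regular_of_occurs hq f hj hn) Δ
      ((exceptional_of_occurs hq f hj hn).imp_right fun h =>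
        ⟨e.resolve_right (· h.1), h.2⟩)).2.2.2.2.2.2) A s
  have h2 := g.q2
  have c : ((q : ℂ) ^ 2 + 1) / (q : ℂ) ^ 2 * (1 / (q + (q : ℂ)⁻¹)) ^ 2 *
      -((q + (q : ℂ)⁻¹) / (q : ℂ) ^ 2) = -((q : ℂ) ^ 3)⁻¹ := by
    have : (q : ℂ) + (q : ℂ)⁻¹ = (q ^ 2 + 1) / q := by field_simp
    rw [this]
    field_simp
  rw [spaceHom_rotL, LinearMap.smul_apply, map_smul]
  refine (congrArg _ key).trans ?_
  rw [single_eq_emb, single_eq_emb, vecOp_emb, rotRed, rotRed, rotRed]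
  simp only [LinearMap.zero_apply, map_zero, smul_zero, zero_add, add_zero, LinearMap.smul_apply,
    Module.End.one_apply, map_smul, smul_smul]
  rw [← c]
  congr 1
  ring

/-- The action of the invariant. -/
lemma spaceHom_rotW (hq : 1 < q) (f : Family q) : spaceHom hq f (rotW q) =
    diagS f fun s => zadd (q * ((q : ℂ) ^ s.j) ^ 2) / (q + (q : ℂ)⁻¹) := by
  have g := generic_of_one_lt hq
  have q0 := g.q0
  have b2 := two_bracket hq
  have R := lifts_r f g.q0
  have S := lifts_s f g.q0
  have U := lifts_u f g.q0
  have W := (U.mul U).sub ((R.dot g.q0 g.q1 g.q2 S).smul ((q : ℂ) ^ 2 * ((q : ℂ) ^ 4 - 1) ^ 2))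
  have e : spaceHom hq f (rotW q) = (1 / (q + (q : ℂ)⁻¹)) ^ 2 • (uOp f * uOp f -
      ((q : ℂ) ^ 2 * ((q : ℂ) ^ 4 - 1) ^ 2) • dot q (rOp f) (sOp f)) := by
    rw [rotW, map_sub, map_mul, map_smul, spaceHom_dot]
    simp only [spaceHom_gen]
    simp only [famOp, genOp, dot_smul_smul, smul_mul_smul_comm]
    module
  refine eq_diagS fun s => ?_
  obtain ⟨hm, hn⟩ := (f.occurs_iff s.1).1 s.2
  have hj := (abs_nonneg _).trans hm
  -- The ladder terms that change `n` by two cancel between the two summands, and what remains is a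
  -- function of `j` alone.
  have key := (lorentz_scalar_identities (M := s.1.M) (regular_of_occurs hq f hj hn)
    ((exceptional_of_occurs hq f hj hn).imp_right fun h => h.2)).2.2.2
  rw [e, LinearMap.smul_apply, map_smul, W, incl_single, single_eq_emb, scalOp_emb]
  refine (congrArg (fun w => _ • emb s.1.j s.1.m w) key).trans ?_
  rw [LinearMap.smul_apply, Module.End.one_apply, map_smul, smul_smul]
  congr 1
  field_simp

/-- The coefficient of the third component at constant `j` is proportional to `q ^ (2 m)` minus the
eigenvalue of `W`. With the given prefactor the contributions of `W` cancel and `q ^ (2 m)` is left.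
-/
lemma spaceHom_tauInvHalf (hq : 1 < q) (f : Family q) :
    spaceHom hq f (tauInvHalf q) = diagS f fun s => ((q : ℂ) ^ s.m) ^ 2 := by
  have g := generic_of_one_lt hq
  have q0 := g.q0
  have q1 := g.q1
  refine eq_diagS fun s => ?_
  rw [tauInvHalf, map_add, map_smul, LinearMap.add_apply, map_add, LinearMap.smul_apply, map_smul,
    incl_rotL, spaceHom_rotW, diagS_single, map_smul, incl_single, smul_smul, weight, add_zero,
    ← add_smul, angCoef]
  congr 1
  have : (q : ℂ) - (q : ℂ)⁻¹ = (q ^ 2 - 1) / q := by field_simp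
  rw [this]
  field_simp
  ring

end

end QMink

/-! ### The Casimir operator and the radius. -/

namespace QMink

noncomputable section

variable {q : ℝ}

lemma spaceHom_tauInvHalf_mul (hq : 1 < q) (f : Family q) :
    diagS f (fun s => ((q : ℂ) ^ s.m) ^ 2) * diagS f (fun s => (((q : ℂ) ^ s.m) ^ 2)⁻¹) = 1 ∧
    diagS f (fun s => (((q : ℂ) ^ s.m) ^ 2)⁻¹) * diagS f (fun s => ((q : ℂ) ^ s.m) ^ 2) = 1 := by
  have q0 := (generic_of_one_lt hq).q0
  have h : ∀ m : ℤ, ((q : ℂ) ^ m) ^ 2 ≠ 0 := fun m => pow_ne_zero 2 (zpow_ne_zero m q0)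
  rw [diagS_mul, diagS_mul, ← diagS_one]
  simp only [mul_inv_cancel₀ (h _), inv_mul_cancel₀ (h _), and_self]

/-- `τ^{-1/2}` as a unit. -/
def tauUnit (hq : 1 < q) (f : Family q) : (Module.End ℂ (dom f))ˣ :=
  Units.map (transport hq f).toAlgHom
    ⟨diagS f fun s => ((q : ℂ) ^ s.m) ^ 2, diagS f fun s => (((q : ℂ) ^ s.m) ^ 2)⁻¹,
      (spaceHom_tauInvHalf_mul hq f).1, (spaceHom_tauInvHalf_mul hq f).2⟩

lemma repHom_tauInvHalf (hq : 1 < q) (f : Family q) :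
    repHom hq f (tauInvHalf q) = tauUnit hq f := by
  rw [repHom_eq_transport, spaceHom_tauInvHalf]
  rfl

lemma tauHalf_eq (hq : 1 < q) {f : Family q} {ρ : StarRep q (dom f)} (h : ρ.HasMatrixElements) :
    ρ.tauHalf = transport hq f (diagS f fun s => (((q : ℂ) ^ s.m) ^ 2)⁻¹) := by
  rw [StarRep.tauHalf, toHom_eq_repHom hq h, repHom_tauInvHalf, Ring.inverse_unit]
  rfl

lemma brk_eq_zsub (hq : 1 < q) (a : ℤ) :
    (brk q a : ℂ) = zsub ((q : ℂ) ^ a) / ((q : ℂ) - (q : ℂ)⁻¹) := by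
  have h : (lam q : ℂ) ≠ 0 := by exact_mod_cast (lam_pos hq).ne'
  have e : (q : ℂ) - (q : ℂ)⁻¹ = (lam q : ℂ) := by simp [lam]
  rw [zsub_zpow hq, e, Complex.ofReal_mul, mul_div_cancel_left₀ _ h]

/-- The action of the product of the ladder operators. -/
lemma incl_ladder (hq : 1 < q) (f : Family q) (c : QNum → ℂ) (s : State f) :
    incl f ((spaceHom hq f (rotL q .minus) * diagS f c * spaceHom hq f (rotL q .plus))
      (Finsupp.single s 1)) =
    ((-((q : ℂ) ^ 3)⁻¹ * angCoef q .plus .stay (q ^ s.1.j) (q ^ s.1.m)) *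
      (c ⟨s.1.j, s.1.m + 1, s.1.n, s.1.M⟩ *
        (-((q : ℂ) ^ 3)⁻¹ * angCoef q .minus .stay (q ^ s.1.j) (q ^ (s.1.m + 1))))) •
      Finsupp.single s.1 1 := by
  have q0 := (generic_of_one_lt hq).q0
  obtain ⟨hm, hn⟩ := (f.occurs_iff s.1).1 s.2
  rw [Module.End.mul_apply, Module.End.mul_apply]
  -- At the top `m = j` of a multiplet the state with `m + 1` does not occur. There the raising
  -- coefficient is zero, so both sides vanish whatever the value of `c` at that state.
  by_cases h : s.1.m = s.1.j
  · have z : angCoef (q : ℂ) .plus .stay (q ^ s.1.j) (q ^ s.1.m) = 0 := by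
      rw [h, angCoef, div_self (zpow_ne_zero _ q0), zsub]; simp
    have : spaceHom hq f (rotL q .plus) (Finsupp.single s 1) = 0 :=
      incl_injective f (by rw [incl_rotL, z, mul_zero, zero_smul, map_zero])
    rw [this, z]
    simp
  · have occ : f.Occurs ⟨s.1.j, s.1.m + 1, s.1.n, s.1.M⟩ := by
      refine (f.occurs_iff _).2 ⟨?_, hn⟩
      simp only
      rw [abs_le] at hm ⊢
      omega
    have e : spaceHom hq f (rotL q .plus) (Finsupp.single s 1) =
        (-((q : ℂ) ^ 3)⁻¹ * angCoef q .plus .stay (q ^ s.1.j) (q ^ s.1.m)) •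
          Finsupp.single ⟨_, occ⟩ 1 :=
      incl_injective f (by rw [incl_rotL, map_smul, incl_single]; rfl)
    rw [e, map_smul, map_smul, map_smul, diagS_single, map_smul, map_smul, incl_rotL, smul_smul,
      smul_smul, weight]
    simp only [add_neg_cancel_right]
    ring_nf

/-- The Casimir operator in the rational basis. -/
lemma diagS_casimir (hq : 1 < q) (f : Family q) :
    ((q : ℂ) * ((-q ^ 3 * √(1 + q ^ 2) : ℝ) : ℂ) * ((q ^ 2 * √(1 + q ^ 2) : ℝ) : ℂ)) •
      (spaceHom hq f (rotL q .minus) * diagS f (fun s => (((q : ℂ) ^ s.m) ^ 2)⁻¹) *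
        spaceHom hq f (rotL q .plus))
    + ((q : ℂ) / ((q : ℂ) - (q : ℂ)⁻¹) ^ 2) • diagS f (fun s => ((q : ℂ) ^ s.m) ^ 2)
    + ((q : ℂ)⁻¹ / ((q : ℂ) - (q : ℂ)⁻¹) ^ 2) •
      (diagS f (fun s => (((q : ℂ) ^ s.m) ^ 2)⁻¹) - ((q : ℂ) ^ 2 + 1) • 1) =
    diagS f fun s => ((brk q s.j * brk q (s.j + 1) : ℝ) : ℂ) := by
  have g := generic_of_one_lt hq
  have q0 := g.q0
  have q1 := g.q1
  have q3 := g.q3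
  refine eq_diagS fun s => ?_
  have sq : (√(1 + q ^ 2) : ℂ) * √(1 + q ^ 2) = 1 + q ^ 2 := by
    rw [← Complex.ofReal_mul, Real.mul_self_sqrt (by positivity)]; push_cast; rfl
  have μ0 := zpow_ne_zero s.1.m q0
  have j0 := zpow_ne_zero s.1.j q0
  simp only [LinearMap.add_apply, LinearMap.smul_apply, LinearMap.sub_apply, map_add, map_smul,
    incl_ladder, diagS_single, Module.End.one_apply, incl_single, smul_smul, ← add_smul,
    ← sub_smul, angCoef]
  congr 1
  push_cast
  rw [brk_eq_zsub hq, brk_eq_zsub hq, zpow_add_one₀ q0, zpow_add_one₀ q0]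
  have l : (q : ℂ) - (q : ℂ)⁻¹ = (q ^ 2 - 1) / q := by field_simp
  have c : (q : ℂ) * (-q ^ 3 * √(1 + q ^ 2)) * (q ^ 2 * √(1 + q ^ 2)) = -q ^ 6 * (1 + q ^ 2) := by
    linear_combination (-(q : ℂ) ^ 6) * sq
  rw [c, l, zsub, zsub, zsub, zsub]
  generalize (q : ℂ) ^ s.1.m = μ at *
  generalize (q : ℂ) ^ s.1.j = J at *
  field_simp
  ring

/-- The length of the coordinates. -/
lemma spaceHom_radiusSq (hq : 1 < q) (f : Family q) : spaceHom hq f (radiusSq q) =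
    spaceHom hq f (gen q (.vec .pos none)) * spaceHom hq f (gen q (.vec .pos none)) +
      (f.sig * ((q : ℂ) + (q : ℂ)⁻¹) ^ 2) • (lenOp f * lenOp f) := by
  have c := (lengthOps hq f).μ_comm.x
  have h := (hatModel hq f).dot_x_x
  have p : ∀ A : E3, famOp f (.vec .pos (some A)) = xOp f A * lenOp f := fun A => rfl
  have p0 : famOp f (.vec .pos none) = x0Op f * lenOp f := rfl
  have e : ∀ x y l : Module.End ℂ (Space f), l * y = y * l → x * l * (y * l) = x * y * (l * l) :=
    fun x y l h => by rw [mul_assoc, ← mul_assoc l, h, mul_assoc, mul_assoc]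
  rw [radiusSq, spaceHom_dot]
  simp only [spaceHom_gen, p, p0]
  have c0 : lenOp f * x0Op f = x0Op f * lenOp f := c none
  have cX : ∀ A, lenOp f * xOp f A = xOp f A * lenOp f := fun A => c (some A)
  -- On the unit hyperboloid `x ∘ x = x0 * x0 + σ [2]²`. Since the length operator commutes with `x`
  -- and `x0`, this may be multiplied by its square.
  have hh := congrArg (· * (lenOp f * lenOp f)) h
  simp only [dot, add_mul, Finset.sum_mul, smul_mul_assoc, one_mul] at hh
  rw [e _ _ _ c0, ← hh, dot]
  simp only [e _ _ _ (cX _)]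

end

end QMink

namespace QMink

noncomputable section

variable {q : ℝ}

/-! ## The spectrum of the commuting operators -/

lemma lenOp_eq (f : Family q) :
    lenOp f = diagS f fun s => f.len * (q : ℂ) ^ s.M / (q + (q : ℂ)⁻¹) := by
  refine eq_diagS fun s => ?_
  rw [lenOp, lifts_m f, incl_single, single_eq_emb, scalOp_emb,
    mRad_radVec, map_smul, add_zero]

lemma repHom_posZero (hq : 1 < q) (f : Family q) (s : State f) :
    repHom hq f (gen q (.vec .pos none)) (ket f s) = (timeVal f s.1 : ℂ) • ket f s :=
  dom_ext fun t => by
    rw [inner_repHom, inner_ket, map_smul, ← ketBasis_apply, Module.Basis.repr_self, matElt,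
      Finsupp.smul_apply, Finsupp.single_apply, smul_eq_mul]
    simp only [Subtype.ext_iff, mul_ite, mul_one, mul_zero, eq_comm]

lemma repHom_rotW (hq : 1 < q) (f : Family q) (s : State f) : repHom hq f (rotW q) (ket f s) =
    (zadd (q * ((q : ℂ) ^ s.1.j) ^ 2) / (q + (q : ℂ)⁻¹)) • ket f s := by
  rw [repHom_eq_transport, spaceHom_rotW, transport_diagS]

lemma repHom_tauInvHalf_ket (hq : 1 < q) (f : Family q) (s : State f) :
    repHom hq f (tauInvHalf q) (ket f s) = (((q : ℂ) ^ s.1.m) ^ 2) • ket f s := by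
  rw [repHom_eq_transport, spaceHom_tauInvHalf, transport_diagS]

/-- The invariant length. -/
lemma repHom_length (hq : 1 < q) (f : Family q) (s : State f) :
    repHom hq f (radiusSq q - gen q (.vec .pos none) * gen q (.vec .pos none)) (ket f s) =
      ((f.sgn * (f.len * q ^ s.1.M) ^ 2 : ℝ) : ℂ) • ket f s := by
  have g := generic_of_one_lt hq
  have q0 := g.q0
  have q2 := g.q2
  have b : (q : ℂ) + (q : ℂ)⁻¹ = (q ^ 2 + 1) / q := by field_simp
  have e : spaceHom hq f (radiusSq q - gen q (.vec .pos none) * gen q (.vec .pos none)) =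
      (f.sig * ((q : ℂ) + (q : ℂ)⁻¹) ^ 2) • (lenOp f * lenOp f) := by
    rw [map_sub, map_mul, spaceHom_radiusSq]
    exact add_sub_cancel_left (G := Module.End ℂ (Space f)) _ _
  rw [repHom_eq_transport, e, lenOp_eq,
    diagS_mul, map_smul, LinearMap.smul_apply, transport_diagS, smul_smul, f.sig_eq]
  congr 1
  push_cast
  rw [b]
  field_simp

/-- The identities behind this are `{n+1}{n-1} = λ²[n]² + [2]²` and `λ²[n+2][n] = {n+1}² - [2]²`. -/
lemma radiusSqVal_eq (hq : 1 < q) (f : Family q) (s : QNum) :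
    radiusSqVal f s = timeVal f s ^ 2 + f.sgn * (f.len * q ^ s.M) ^ 2 := by
  have q0 : q ≠ 0 := by positivity
  have z := fun a : ℤ => zpow_ne_zero a q0
  have h1 : q ^ 2 - 1 ≠ 0 := by nlinarith
  have h2 : q ^ 2 + 1 ≠ 0 := by positivity
  have e : q + q⁻¹ = (q ^ 2 + 1) / q := by field_simp
  have e' : q - q⁻¹ = (q ^ 2 - 1) / q := by field_simp
  cases f <;> simp only [radiusSqVal, timeVal, brk_two hq]
  · simp only [Family.sgn, Family.len, crl, brk, lam,
      two_mul, zpow_add₀ q0, zpow_sub₀ q0, neg_add, neg_sub, zpow_neg, zpow_one]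
    have := z s.M
    have := z s.n
    rw [e, e']
    generalize q ^ s.M = M at *
    generalize q ^ s.n = N at *
    field_simp
    ring
  · simp only [Family.sgn, Family.len, crl, brk, lam,
      two_mul, zpow_add₀ q0, neg_add, zpow_neg, zpow_ofNat]
    have := z s.M
    have := z s.n
    rw [e, e']
    generalize q ^ s.M = M at *
    generalize q ^ s.n = N at *
    field_simp
    ring

lemma repHom_radiusSq (hq : 1 < q) (f : Family q) (s : State f) :
    repHom hq f (radiusSq q) (ket f s) = (radiusSqVal f s.1 : ℂ) • ket f s := by
  have h := repHom_length hq f s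
  rw [map_sub, map_mul, LinearMap.sub_apply, Module.End.mul_apply, repHom_posZero, map_smul,
    repHom_posZero, smul_smul, sub_eq_iff_eq_add, ← add_smul] at h
  rw [h, radiusSqVal_eq hq]
  congr 1
  push_cast
  ring

section MatrixElements

variable {f : Family q} {ρ : StarRep q (dom f)}

lemma tSq_ket (hq : 1 < q) (h : ρ.HasMatrixElements) (s : State f) :
    ρ.tSq (ket f s) = ((brk q s.1.j * brk q (s.1.j + 1) : ℝ) : ℂ) • ket f s := by
  have e := congrArg (transport hq f) (spaceHom_tauInvHalf_mul hq f).1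
  rw [map_mul, map_one] at e
  have m : ∀ (A : Module.End ℂ (Space f)) (c : ℂ),
      transport hq f (A - c • 1) = transport hq f A - c • 1 := fun A c => by
    rw [← map_one (transport hq f), ← map_smul]
    exact map_sub (transport hq f).toLinearMap _ _
  rw [← transport_diagS hq f (fun s => ((brk q s.j * brk q (s.j + 1) : ℝ) : ℂ)),
    ← diagS_casimir hq, StarRep.tSq, StarRep.tMinus, StarRep.tPlus, tauHalf_eq hq h,
    toHom_eq_repHom hq h, map_add, map_add, map_smul, map_smul, map_smul, map_mul, map_mul, m]
  simp only [repHom_eq_transport, spaceHom_tauInvHalf]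
  rw [mul_smul_comm, mul_smul_comm, smul_mul_assoc, smul_smul, smul_smul,
    ← mul_assoc (transport hq f _) (transport hq f _), e, one_mul, ← mul_assoc, mul_right_comm]

lemma tauHalf_sq_ket (hq : 1 < q) (h : ρ.HasMatrixElements) (s : State f) :
    (ρ.tauHalf ^ 2) (ket f s) = ((q ^ (-4 * s.1.m) : ℝ) : ℂ) • ket f s := by
  rw [tauHalf_eq hq h, ← map_pow, pow_two, diagS_mul, transport_diagS]
  congr 1
  push_cast
  rw [neg_mul, zpow_neg, mul_comm (4 : ℤ), zpow_mul]
  have := (zpow_ne_zero s.1.m (generic_of_one_lt hq).q0)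
  norm_cast
  rw [← mul_inv]
  ring_nf

lemma isUnit_tauInvHalf (hq : 1 < q) (h : ρ.HasMatrixElements) :
    IsUnit (ρ.toHom (tauInvHalf q)) := by
  rw [toHom_eq_repHom hq h, repHom_tauInvHalf]
  exact (tauUnit hq f).isUnit

end MatrixElements

end

end QMink

namespace QMink

noncomputable section

variable {q : ℝ}

/-! ## Separation of the kets by simultaneous eigenvalues -/

lemma brk_strictMono (hq : 1 < q) : StrictMono (brk q) := fun _ _ h =>
  div_lt_div_of_pos_right (sub_lt_sub (zpow_lt_zpow_right₀ hq h)
    (zpow_lt_zpow_right₀ hq (neg_lt_neg h))) (lam_pos hq)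

/-- The difference factors as `(q ^ b - q ^ a) * (1 - q ^ (-(a + b)))`, and both factors are
positive because `a + b > 0`. -/
lemma crl_lt_crl (hq : 1 < q) {a b : ℤ} (ha : 0 ≤ a) (h : a < b) : crl q a < crl q b := by
  have q0 : 0 < q := by linarith
  have h1 : q ^ a < q ^ b := zpow_lt_zpow_right₀ hq h
  have h2 : q ^ (-(a + b)) < 1 := by
    rw [← zpow_zero q]; exact zpow_lt_zpow_right₀ hq (by omega)
  have e : crl q b - crl q a = (q ^ b - q ^ a) * (1 - q ^ (-(a + b))) := by
    rw [mul_sub, mul_one, sub_mul, ← zpow_add₀ q0.ne', ← zpow_add₀ q0.ne', crl, crl]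
    ring_nf
  have := mul_pos (sub_pos.2 h1) (sub_pos.2 h2)
  linarith

lemma crl_injOn (hq : 1 < q) {a b : ℤ} (ha : 0 ≤ a) (hb : 0 ≤ b) (h : crl q a = crl q b) :
    a = b := by
  rcases lt_trichotomy a b with hab | hab | hab
  · exact absurd h (crl_lt_crl hq ha hab).ne
  · exact hab
  · exact absurd h (crl_lt_crl hq hb hab).ne'

lemma Family.abs_len_mem (f : Family q) : |f.len| ∈ Set.Ico 1 q := by
  cases f with
  | space l hl => rw [Family.len, abs_of_pos (by linarith [hl.1])]; exact hl
  | time t ht => exact ht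

lemma length_le_of_eq (hq : 1 < q) {a b : ℝ} (ha : a ∈ Set.Ico 1 q) (hb : b ∈ Set.Ico 1 q)
    {M N : ℤ} (h : a * q ^ M = b * q ^ N) : M ≤ N := by
  have q0 : 0 < q := by linarith
  by_contra! hlt
  have h1 : q ^ (N + 1) ≤ q ^ M := zpow_le_zpow_right₀ hq.le hlt
  have h2 : b * q ^ N < q * q ^ N := mul_lt_mul_of_pos_right hb.2 (zpow_pos q0 _)
  have h3 : q ^ M ≤ a * q ^ M := le_mul_of_one_le_left (zpow_pos q0 _).le ha.1
  rw [zpow_add_one₀ q0.ne'] at h1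
  linarith

/-- The interval `[1, q)` is a fundamental domain for multiplication of positive numbers by powers
of `q`. -/
lemma length_unique (hq : 1 < q) {a b : ℝ} (ha : a ∈ Set.Ico 1 q) (hb : b ∈ Set.Ico 1 q)
    {M N : ℤ} (h : a * q ^ M = b * q ^ N) : a = b ∧ M = N := by
  have q0 : 0 < q := by linarith
  have e := le_antisymm (length_le_of_eq hq ha hb h) (length_le_of_eq hq hb ha h.symm)
  subst e
  exact ⟨mul_right_cancel₀ (zpow_pos q0 _).ne' h, rfl⟩

/-- The sign of the invariant length tells space-like from time-like labels. Its modulus gives only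
the absolute value of the label, so forward and backward families are not yet separated. -/
lemma length_eq_length (hq : 1 < q) {f f' : Family q} {M M' : ℤ}
    (h : f.sgn * (f.len * q ^ M) ^ 2 = f'.sgn * (f'.len * q ^ M') ^ 2) :
    f.sgn = f'.sgn ∧ |f.len| = |f'.len| ∧ M = M' := by
  have q0 : 0 < q := by linarith
  have pos : ∀ (f : Family q) (M : ℤ), 0 < (f.len * q ^ M) ^ 2 := fun f M =>
    sq_pos_of_ne_zero (mul_ne_zero f.len_ne_zero (zpow_pos q0 M).ne')
  have hs : f.sgn = f'.sgn := by
    have p := pos f M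
    have p' := pos f' M'
    rcases f.sgn_cases with e | e <;> rcases f'.sgn_cases with e' | e' <;> rw [e, e'] at h ⊢ <;>
      linarith
  have hs0 : f'.sgn ≠ 0 := by rcases f'.sgn_cases with e | e <;> rw [e] <;> norm_num
  rw [hs] at h
  have := sq_eq_sq_iff_abs_eq_abs _ _ |>.1 (mul_left_cancel₀ hs0 h)
  rw [abs_mul, abs_mul, abs_of_pos (zpow_pos q0 M), abs_of_pos (zpow_pos q0 M')] at this
  exact ⟨hs, length_unique hq f.abs_len_mem f'.abs_len_mem this⟩

/-- The eigenvalue of `X^0` determines `n` and the direction of time. -/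
lemma timeVal_injective (hq : 1 < q) {f f' : Family q} {s t : QNum} (hs : f.Occurs s)
    (ht : f'.Occurs t) (h1 : f.sgn = f'.sgn) (h2 : |f.len| = |f'.len|) (hM : s.M = t.M)
    (h : timeVal f s = timeVal f' t) : f = f' ∧ s.n = t.n := by
  have q0 : 0 < q := by linarith
  have b2 := brk_pos hq (a := 2) (by norm_num)
  have l := lam_pos hq
  have z := zpow_pos q0 t.M
  cases f with
  | space a ha =>
    cases f' with
    | space b hb =>
      simp only [Family.len, abs_of_pos (show 0 < a by linarith [ha.1]),
        abs_of_pos (show 0 < b by linarith [hb.1])] at h2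
      subst h2
      simp only [timeVal, hM] at h
      have : a * q ^ t.M / brk q 2 * lam q ≠ 0 := by
        have : 0 < a := by linarith [ha.1]
        positivity
      exact ⟨rfl, (brk_strictMono hq).injective (mul_left_cancel₀ this h)⟩
    | time b hb => norm_num [Family.sgn] at h1
  | time a ha =>
    cases f' with
    | space b hb => norm_num [Family.sgn] at h1
    | time b hb =>
      have n1 : 0 ≤ s.n + 1 := by have := (abs_nonneg _).trans hs.1; have := hs.2; omega
      have n2 : 0 ≤ t.n + 1 := by have := (abs_nonneg _).trans ht.1; have := ht.2; omega
      simp only [Family.len] at h2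
      simp only [timeVal, hM, mul_div_assoc, mul_assoc] at h
      have p1 := mul_pos (div_pos z b2) (crl_pos hq (s.n + 1))
      have p2 := mul_pos (div_pos z b2) (crl_pos hq (t.n + 1))
      -- The eigenvalues of `X⁰` have the sign of the label since `crl` is positive, so labels of
      -- opposite sign cannot give the same value.
      have hab : a = b := by
        rcases abs_eq_abs.1 h2 with e | e
        · exact e
        · subst e
          have b0 : b ≠ 0 := fun e => by rw [e, abs_zero] at hb; linarith [hb.1]
          have : b * (q ^ t.M / brk q 2 * crl q (s.n + 1) + q ^ t.M / brk q 2 * crl q (t.n + 1))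
            = 0 := by linarith
          rcases mul_eq_zero.1 this with e | e
          · exact absurd e b0
          · linarith
      subst hab
      have a0 : a ≠ 0 := fun e => by rw [e, abs_zero] at ha; linarith [ha.1]
      exact ⟨rfl, by
        have := crl_injOn hq n1 n2 (mul_left_cancel₀ (div_pos z b2).ne' (mul_left_cancel₀ a0 h))
        omega⟩

/-- Kets of possibly different families are separated by the eigenvalues of an element. -/
theorem exists_separating (hq : 1 < q) {f f' : Family q} (s : State f) (t : State f')
    (h : ¬(f = f' ∧ s.1 = t.1)) : ∃ (a : QAlg q) (c : Family q → QNum → ℝ),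
      (∀ f (u : State f), repHom hq f a (ket f u) = (c f u.1 : ℂ) • ket f u) ∧
      c f s.1 ≠ c f' t.1 := by
  have q0 : 0 < q := by linarith
  -- If no element separates the kets, then four particular ones do not. The invariant length fixes
  -- the sign, the modulus of the label and `M`; `X⁰` fixes the direction of time and `n`; `W` fixes
  -- `j`; `τ^{-1/2}` fixes `m`.
  by_contra! H
  have hl := H _ (fun f u => f.sgn * (f.len * q ^ u.M) ^ 2) fun f u => repHom_length hq f u
  obtain ⟨h1, h2, hM⟩ := length_eq_length hq hl
  obtain ⟨hf, hn⟩ := timeVal_injective hq s.2 t.2 h1 h2 hM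
    (H _ timeVal fun f u => repHom_posZero hq f u)
  have hj := H (rotW q) (fun _ u => crl q (2 * u.j + 1) / (q + q⁻¹)) fun f u => by
    rw [repHom_rotW]
    congr 1
    push_cast [crl, zadd]
    rw [zpow_neg, zpow_add_one₀ (generic_of_one_lt hq).q0, mul_comm 2 u.1.j, zpow_mul]
    norm_cast
    ring_nf
  have hm := H (tauInvHalf q) (fun _ u => (q ^ u.m) ^ 2) fun f u => by
    rw [repHom_tauInvHalf_ket]; norm_cast
  have j1 := (abs_nonneg _).trans ((f.occurs_iff _).1 s.2).1
  have j2 := (abs_nonneg _).trans ((f'.occurs_iff _).1 t.2).1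
  have ej := crl_injOn hq (by omega) (by omega)
    ((div_left_inj' (show q + q⁻¹ ≠ 0 by positivity)).1 hj)
  have em := zpow_right_injective₀ q0 hq.ne'
    ((pow_left_inj₀ (zpow_pos q0 _).le (zpow_pos q0 _).le two_ne_zero).1 hm)
  exact h ⟨hf, QNum.ext (by omega) em hn hM⟩

end

end QMink

namespace QMink

noncomputable section

variable {q : ℝ}

/-! ## Weak intertwiners -/

/-- Every element of the algebra has a formal adjoint with respect to a `*`-representation and to a
weak intertwiner. -/
lemma exists_adjoint {H H' : Type*} [NormedAddCommGroup H] [InnerProductSpace ℂ H]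
    [NormedAddCommGroup H'] [InnerProductSpace ℂ H'] {D : Submodule ℂ H} {D' : Submodule ℂ H'}
    (ρ : StarRep q D) (ρ' : StarRep q D') (T : H →L[ℂ] H')
    (h : ∀ (x : Gen) (φ : D) (ψ : D'),
      inner ℂ (ρ'.toHom (genStar q x) ψ : H') (T φ) =
        inner ℂ (ψ : H') (T (ρ.toHom (gen q x) φ : H))) (a : QAlg q) :
    ∃ b : QAlg q, (∀ φ ψ : D', inner ℂ (ρ'.toHom b φ) ψ = inner ℂ φ (ρ'.toHom a ψ)) ∧
      ∀ (φ : D) (ψ : D'), inner ℂ (ρ'.toHom b ψ : H') (T φ) =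
        inner ℂ (ψ : H') (T (ρ.toHom a φ : H)) := by
  obtain ⟨a, rfl⟩ := RingQuot.mkAlgHom_surjective ℂ (Rel (q : ℂ)) a
  -- The conjugation is given on generators only, so the adjoint is constructed along words in the
  -- free algebra, with products reversed. Existence suffices; that relations are respected need not
  -- be checked.
  induction a using FreeAlgebra.induction with
  | grade0 r =>
    refine ⟨algebraMap ℂ _ (star r), fun φ ψ => ?_, fun φ ψ => ?_⟩
    · simp only [AlgHom.commutes, Module.algebraMap_end_apply, inner_smul_right]
      rw [inner_smul_left]; simp
    · simp only [AlgHom.commutes, Module.algebraMap_end_apply, Submodule.coe_smul, map_smul,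
        inner_smul_right]
      rw [inner_smul_left]; simp
  | grade1 x => exact ⟨genStar q x, ρ'.adjoint x, h x⟩
  | mul a b ha hb =>
    obtain ⟨a', ha, ha'⟩ := ha
    obtain ⟨b', hb, hb'⟩ := hb
    refine ⟨b' * a', fun φ ψ => ?_, fun φ ψ => ?_⟩
    · rw [map_mul, map_mul, map_mul, Module.End.mul_apply, Module.End.mul_apply, hb, ha]
    · rw [map_mul, map_mul, map_mul, Module.End.mul_apply, Module.End.mul_apply, hb', ha']
  | add a b ha hb =>
    obtain ⟨a', ha, ha'⟩ := ha
    obtain ⟨b', hb, hb'⟩ := hb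
    refine ⟨a' + b', fun φ ψ => ?_, fun φ ψ => ?_⟩
    · rw [map_add, map_add, map_add, LinearMap.add_apply, LinearMap.add_apply, inner_add_left,
        inner_add_right, ha, hb]
    · rw [map_add, map_add, map_add, LinearMap.add_apply, LinearMap.add_apply, Submodule.coe_add,
        Submodule.coe_add, inner_add_left, map_add, inner_add_right, ha', hb']

section Families

variable {f f' : Family q} {ρ : StarRep q (dom f)} {ρ' : StarRep q (dom f')}

/-- A weak intertwiner has no matrix elements between kets that are separated. -/
lemma inner_eq_zero_of_intertwines (hq : 1 < q) (hρ : ρ.HasMatrixElements)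
    (hρ' : ρ'.HasMatrixElements) (T : Hilb f →L[ℂ] Hilb f')
    (h : ∀ (x : Gen) (φ : dom f) (ψ : dom f'),
      inner ℂ (ρ'.toHom (genStar q x) ψ : Hilb f') (T φ) =
        inner ℂ (ψ : Hilb f') (T (ρ.toHom (gen q x) φ : Hilb f)))
    {s : State f} {t : State f'} (hst : ¬(f = f' ∧ s.1 = t.1)) :
    inner ℂ (ket f' t : Hilb f') (T (ket f s)) = 0 := by
  obtain ⟨a, c, hc, hne⟩ := exists_separating hq s t hst
  obtain ⟨b, hb, hb'⟩ := exists_adjoint ρ ρ' T h a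
  have hs : ρ.toHom a (ket f s) = (c f s.1 : ℂ) • ket f s := by
    rw [toHom_eq_repHom hq hρ, hc]
  -- The adjoint of an element that is diagonal in the kets is diagonal with the conjugate
  -- eigenvalues, and these are real. So `key` below says that the matrix element of `T` is
  -- multiplied by two different numbers with the same result.
  have ht : ρ'.toHom b (ket f' t) = (c f' t.1 : ℂ) • ket f' t := dom_ext fun u => by
    refine (inner_conj_symm (ket f' u) (ρ'.toHom b (ket f' t))).symm.trans ?_
    rw [hb, toHom_eq_repHom hq hρ', hc, inner_ket, inner_ket, map_smul,
      map_smul, ← ketBasis_apply, ← ketBasis_apply, Module.Basis.repr_self,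
      Module.Basis.repr_self, Finsupp.smul_apply, Finsupp.smul_apply, Finsupp.single_apply,
      Finsupp.single_apply]
    by_cases e : u = t
    · subst e; simp
    · simp [e, Ne.symm e]
  have key := hb' (ket f s) (ket f' t)
  rw [hs, ht, Submodule.coe_smul, Submodule.coe_smul, map_smul, inner_smul_left, inner_smul_right,
    Complex.conj_ofReal] at key
  by_contra h0
  exact hne (by exact_mod_cast (mul_right_cancel₀ h0 key).symm)

lemma ket_ne_zero (s : State f) : ket f s ≠ 0 := by
  rw [← ketBasis_apply]; exact (ketBasis f).ne_zero s

/-- A vector of the Hilbert space is determined by its coordinates. -/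
lemma hilb_ext {v w : Hilb f} (h : ∀ s,
    inner ℂ (ket f s : Hilb f) v = inner ℂ (ket f s : Hilb f) w) :
    v = w :=
  (basisVec f).repr.injective <| lp.ext <| funext fun s => by
    rw [HilbertBasis.repr_apply_apply, HilbertBasis.repr_apply_apply]; exact h s

lemma exists_state (f : Family q) : ∃ s : State f, s.1 = ⟨0, 0, 0, 0⟩ :=
  ⟨⟨⟨0, 0, 0, 0⟩, by cases f <;> simp [Family.Occurs]⟩, rfl⟩

/-- Kets of different families are always separated, so all matrix elements of the intertwiner
vanish and it would annihilate a ket. -/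
theorem not_unitarilyEquivalent (hq : 1 < q) (hρ : ρ.HasMatrixElements)
    (hρ' : ρ'.HasMatrixElements) (hf : f ≠ f') : ¬ ρ.UnitarilyEquivalent ρ' := by
  rintro ⟨V, hV⟩
  obtain ⟨s, -⟩ := exists_state f
  have : V (ket f s : Hilb f) = 0 := hilb_ext fun t => by
    rw [inner_zero_right]
    exact inner_eq_zero_of_intertwines hq hρ hρ' V.toContinuousLinearEquiv.toContinuousLinearMap hV
      fun e => hf e.1
  rw [map_eq_zero_iff V V.injective] at this
  exact ket_ne_zero s (Subtype.ext this)

/-- Elements of the algebra that are diagonal in the kets. -/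
lemma repr_diagonal {T : Module.End ℂ (dom f)} {c : QNum → ℝ}
    (h : ∀ u : State f, T (ket f u) = (c u.1 : ℂ) • ket f u) (v : dom f) (t : State f) :
    (ketBasis f).repr (T v) t = c t.1 * (ketBasis f).repr v t := by
  induction v using dom_induction with
  | h0 => simp
  | hadd v w hv hw => rw [map_add, map_add, map_add, Finsupp.add_apply, hv, hw, Finsupp.add_apply,
      mul_add]
  | hsmul r s =>
    rw [map_smul, h, ← ketBasis_apply, map_smul, map_smul, map_smul, Module.Basis.repr_self]
    simp only [Finsupp.smul_apply, Finsupp.single_apply, smul_eq_mul]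
    split_ifs with e
    · rw [e]; ring
    · simp

/-- For each ket `t` of the second family an element that separates it from `s` forces the
coordinate at `t` of the image of `ket f s` to vanish. The element may depend on `t`. -/
theorem not_algEquivalent (hq : 1 < q) (hρ : ρ.HasMatrixElements)
    (hρ' : ρ'.HasMatrixElements) (hf : f ≠ f') : ¬ ρ.AlgEquivalent ρ' := by
  rintro ⟨e, he⟩
  obtain ⟨s, -⟩ := exists_state f
  refine ket_ne_zero s ((map_eq_zero_iff e e.injective).1 ((ketBasis f').ext_elem fun t => ?_))
  obtain ⟨a, c, hc, hne⟩ := exists_separating hq s t fun h => hf h.1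
  have h1 := congrArg (fun v => (ketBasis f').repr v t) (he a (ket f s))
  simp only [toHom_eq_repHom hq hρ, toHom_eq_repHom hq hρ', hc, map_smul,
    repr_diagonal (hc f'), Finsupp.smul_apply, smul_eq_mul] at h1
  by_contra h0
  rw [map_zero, Finsupp.zero_apply] at h0
  exact hne (by exact_mod_cast mul_right_cancel₀ h0 h1)

/-- An invariant subspace contains the kets that occur in its elements. -/
lemma ket_mem_of_repr_ne_zero (hq : 1 < q) {V : Submodule ℂ (dom f)}
    (hV : ∀ (a : QAlg q), ∀ φ ∈ V, repHom hq f a φ ∈ V) {v : dom f} (hv : v ∈ V) {s : State f}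
    (hs : (ketBasis f).repr v s ≠ 0) : ket f s ∈ V := by
  induction hn : ((ketBasis f).repr v).support.card using Nat.strong_induction_on
    generalizing v with
  | _ n ih =>
  -- If a second ket `t` occurs in `v`, subtract from the action of a separating element its
  -- eigenvalue at `t`. This removes `t` from the support, adds nothing to it and keeps `s`.
  by_cases h : ∃ t ≠ s, (ketBasis f).repr v t ≠ 0
  · obtain ⟨t, hts, ht⟩ := h
    obtain ⟨a, c, hc, hne⟩ := exists_separating hq s t fun e => hts (Subtype.ext e.2.symm)
    have r : ∀ u, (ketBasis f).repr (repHom hq f a v - (c f t.1 : ℂ) • v) u =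
        (c f u.1 - c f t.1) * (ketBasis f).repr v u := fun u => by
      rw [map_sub, map_smul, Finsupp.sub_apply, Finsupp.smul_apply, repr_diagonal (hc f),
        smul_eq_mul, sub_mul]
    refine ih _ ?_ (V.sub_mem (hV a v hv) (V.smul_mem (c f t.1 : ℂ) hv)) ?_ rfl
    · rw [← hn]
      refine Finset.card_lt_card ⟨fun u hu => ?_, fun hu => ?_⟩
      · rw [Finsupp.mem_support_iff, r] at hu
        exact Finsupp.mem_support_iff.2 (right_ne_zero_of_mul hu)
      · have := hu (Finsupp.mem_support_iff.2 ht)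
        rw [Finsupp.mem_support_iff, r, sub_self, zero_mul] at this
        exact this rfl
    · rw [r]
      exact mul_ne_zero (by rw [sub_ne_zero]; exact_mod_cast hne) hs
  · push Not at h
    have e : v = (ketBasis f).repr v s • ket f s := (ketBasis f).ext_elem fun t => by
      rw [map_smul, ← ketBasis_apply, Module.Basis.repr_self, Finsupp.smul_apply,
        Finsupp.single_apply]
      split_ifs with e
      · rw [e, smul_eq_mul, mul_one]
      · rw [h t (Ne.symm e), smul_zero]
    rw [e] at hv
    exact (V.smul_mem_iff hs).1 hv

end Families

end

end QMink

namespace QMink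

noncomputable section

variable {q : ℝ}

/-! ## Connectedness -/

lemma coeffU_ne_zero (hq : 1 < q) {f : Family q} {j n : ℤ} (hj : 0 ≤ j) (h : f.RadOccurs j n) :
    coeffU f j n ≠ 0 := by
  have b2 := brk_pos hq (a := 2) (by norm_num)
  cases f with
  | space l hl =>
    have := crl_pos hq (n - j)
    have := crl_pos hq (n + j + 1)
    have := crl_pos hq n
    have := crl_pos hq (n + 1)
    rw [coeffU, coeffUSpace]
    positivity
  | time t ht =>
    have hn : j ≤ n := h
    have := brk_pos hq (a := n - j + 1) (by omega)
    have := brk_pos hq (a := n + j + 2) (by omega)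
    have := brk_pos hq (a := n + 1) (by omega)
    have := brk_pos hq (a := n + 2) (by omega)
    rw [coeffU, coeffUTime]
    positivity

/-- This element serves to change `m` at fixed `j`. The coordinates would not do, since in the
space-like case their element for constant `j` contains `[n]` and vanishes at `n = 0`. -/
lemma redR_stay_ne_zero (hq : 1 < q) {f : Family q} {j n : ℤ} (hj : 1 ≤ j) (h : f.RadOccurs j n)
    (m m' M : ℤ) : redR f ⟨j, m', n + 1, M⟩ ⟨j, m, n, M⟩ ≠ 0 := by
  have q0 : 0 < q := by linarith
  have b2 := brk_pos hq (a := 2) (by norm_num)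
  have c1 := crl_pos hq (j + 1)
  have c2 := crl_pos hq j
  have hne : j ≠ j + 1 := by omega
  cases f with
  | space l hl =>
    simp only [redR, redRSpace, add_sub_cancel_left, one_mul, true_or, and_self, if_true,
      if_neg hne, hj]
    have := crl_pos hq (j + (n + 1))
    have := crl_pos hq (n - j)
    have := crl_pos hq n
    have := crl_pos hq (n + 1)
    positivity
  | time t ht =>
    have hn : j ≤ n := h
    simp only [redR, redRTime, add_sub_cancel_left, one_mul, true_or, and_self, if_true,
      if_neg hne, hj]
    have := brk_pos hq (a := j + (n + 1) + 1) (by omega)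
    have := brk_pos hq (a := n - j + 1) (by omega)
    have := brk_pos hq (a := n + 1) (by omega)
    have := brk_pos hq (a := n + 1 + 1) (by omega)
    positivity

lemma redX_up_ne_zero (hq : 1 < q) {f : Family q} {j n : ℤ} (hj : 0 ≤ j)
    (h : f.RadOccurs (j + 1) n) (m m' M : ℤ) : redX f ⟨j + 1, m', n, M⟩ ⟨j, m, n, M⟩ ≠ 0 := by
  have q0 : 0 < q := by linarith
  have b2 := brk_pos hq (a := 2) (by norm_num)
  have b3 := brk_pos hq (a := 2 * j + 1) (by omega)
  have b4 := brk_pos hq (a := 2 * j + 3) (by omega)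
  have c1 := crl_pos hq (j + 1)
  have l0 := f.len_ne_zero
  have l1 := lam_pos hq
  cases f with
  | space l hl =>
    simp only [Family.len] at l0
    simp only [redX, redXSpace, and_self, if_true]
    have := crl_pos hq (n + j + 1)
    have := crl_pos hq (n - j - 1)
    positivity
  | time t ht =>
    have hn : j + 1 ≤ n := h
    simp only [Family.len] at l0
    simp only [redX, redXTime, and_self, if_true]
    have := brk_pos hq (a := n - j) (by omega)
    have := brk_pos hq (a := n + j + 2) (by omega)
    positivity

lemma int_const {α : Sort*} {g : ℤ → α} (h : ∀ k, g k = g (k + 1)) (k : ℤ) : g k = g 0 := by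
  induction k using Int.induction_on with
  | zero => rfl
  | succ k ih => rw [← h, ih]
  | pred k ih => rw [h, sub_add_cancel, ih]

/-- The kets are connected by the matrix elements of the generators. -/
theorem eq_of_links (hq : 1 < q) {f : Family q} {α : Type*} (g : State f → α)
    (hg : ∀ x (s s' : State f), matElt f x s'.1 s.1 ≠ 0 → g s = g s') (s s' : State f) :
    g s = g s' := by
  classical
  have q0 : 0 < q := by linarith
  -- Continuing `g` by `none` to labels that do not occur allows the steps to be stated for
  -- arbitrary integers.
  let G : QNum → Option α := fun u => if h : f.Occurs u then some (g ⟨u, h⟩) else none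
  have hG : ∀ x (u u' : QNum), f.Occurs u → f.Occurs u' → matElt f x u' u ≠ 0 → G u = G u' :=
    fun x u u' h h' e => by
      simp only [G, dif_pos h, dif_pos h', hg x ⟨u, h⟩ ⟨u', h'⟩ e]
  have stepM : ∀ j m n M, G ⟨j, m, n, M⟩ = G ⟨j, m, n, 0⟩ := fun j m n M => by
    refine int_const (g := fun M => G ⟨j, m, n, M⟩) (fun M => ?_) M
    have e : f.Occurs ⟨j, m, n, M + 1⟩ ↔ f.Occurs ⟨j, m, n, M⟩ := by
      rw [f.occurs_iff, f.occurs_iff]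
    by_cases h : f.Occurs ⟨j, m, n, M⟩
    · have h' := e.2 h
      refine hG .lamHalf _ _ h h' ?_
      rw [matElt, if_pos rfl]
      exact pow_ne_zero 2 (generic_of_one_lt hq).q0
    · have h' := fun h' => h (e.1 h')
      simp only [G, dif_neg h, dif_neg h']
  have radSucc : ∀ j n, f.RadOccurs j n → f.RadOccurs j (n + 1) := fun j n h => by
    cases f with
    | space => trivial
    | time => exact (show j ≤ n from h).trans (by omega)
  have radPred : ∀ j n, f.RadOccurs (j + 1) n → f.RadOccurs j n := fun j n h => by
    cases f with
    | space => trivial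
    | time => exact (show j ≤ j + 1 by omega).trans h
  have stepN : ∀ j m n, |m| ≤ j → f.RadOccurs j n → G ⟨j, m, n, 0⟩ = G ⟨j, m, n + 1, 0⟩ :=
    fun j m n hm hn => by
      refine hG .U _ _ ((f.occurs_iff _).2 ⟨hm, hn⟩) ((f.occurs_iff _).2 ⟨hm, radSucc j n hn⟩) ?_
      simp only [matElt, and_self, if_true]
      exact_mod_cast coeffU_ne_zero hq ((abs_nonneg m).trans hm) hn
  have stepm : ∀ j m n, -j ≤ m → m + 1 ≤ j → f.RadOccurs j n →
      G ⟨j, m, n, 0⟩ = G ⟨j, m + 1, n, 0⟩ := fun j m n h1 h2 hn => by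
    have hm : |m| ≤ j := abs_le.2 ⟨h1, by omega⟩
    have hm' : |m + 1| ≤ j := abs_le.2 ⟨by omega, h2⟩
    -- The component `R^+` raises `m` and, in the element used here, also `n`; the operator `U`
    -- undoes the change of `n`.
    rw [stepN j (m + 1) n hm' hn]
    refine hG (.R .plus) _ _ ((f.occurs_iff _).2 ⟨hm, hn⟩)
      ((f.occurs_iff _).2 ⟨hm', radSucc j n hn⟩) ?_
    simp only [matElt, vecElt, if_true]
    have b1 := brk_pos hq (a := j + m + 1) (by omega)
    have b2 := brk_pos hq (a := j - m) (by omega)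
    have r := redR_stay_ne_zero hq (f := f) (by omega) hn m (m + 1) 0
    have : -q ^ (m + 2) * √(brk q (j + m + 1) * brk q (j - m)) ≠ 0 :=
      mul_ne_zero (neg_ne_zero.2 (by positivity)) (by positivity)
    exact_mod_cast mul_ne_zero this r
  have stepj : ∀ j n, 0 ≤ j → f.RadOccurs (j + 1) n →
      G ⟨j, 0, n, 0⟩ = G ⟨j + 1, 0, n, 0⟩ := fun j n hj hn => by
    -- The coordinate `X^3` changes `j` while keeping `m` and `n`. It is used at `m = 0`, which is
    -- allowed for every `j`.
    refine hG (.vec .pos (some .three)) _ _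
      ((f.occurs_iff _).2 ⟨by simpa using hj, radPred j n hn⟩)
      ((f.occurs_iff _).2 ⟨by simp only [abs_zero]; omega, hn⟩) ?_
    have hne : j + 1 ≠ j := by omega
    simp only [matElt, vecElt, if_true, if_neg hne]
    have b1 := brk_pos hq (a := j - 0 + 1) (by omega)
    have b2 := brk_pos hq (a := j + 0 + 1) (by omega)
    have r := redX_up_ne_zero hq hj hn 0 0 0
    have : q ^ (((0 : ℤ) : ℝ) - (j : ℝ) - 1 / 2) * √(1 + q ^ 2) *
        √(brk q (j - 0 + 1) * brk q (j + 0 + 1)) ≠ 0 := by positivity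
    exact_mod_cast mul_ne_zero this r
  have atZero : ∀ n, f.RadOccurs 0 n → G ⟨0, 0, n, 0⟩ = G ⟨0, 0, 0, 0⟩ := fun n hn => by
    cases f with
    | space =>
      exact int_const (g := fun n => G ⟨0, 0, n, 0⟩) (fun k => stepN 0 0 k (by simp) trivial) n
    | time =>
      have hn : 0 ≤ n := hn
      induction n, hn using Int.leInduction with
      | base => rfl
      | succ n h ih => rw [← stepN 0 0 n (by simp) h, ih h]
  have atZeroj : ∀ j n, 0 ≤ j → f.RadOccurs j n → G ⟨j, 0, n, 0⟩ = G ⟨0, 0, 0, 0⟩ :=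
    fun j n hj => by
      induction j, hj using Int.leInduction with
      | base => exact atZero n
      | succ j h ih => intro hn; rw [← stepj j n h hn, ih (radPred j n hn)]
  have toTop : ∀ j m n, |m| ≤ j → f.RadOccurs j n → G ⟨j, m, n, 0⟩ = G ⟨j, -j, n, 0⟩ :=
    fun j m n hm hn => by
      obtain ⟨h1, h2⟩ := abs_le.1 hm
      clear hm
      induction m, h1 using Int.leInduction with
      | base => rfl
      | succ m h ih => rw [← stepm j m n h h2 hn, ih (by omega)]
  -- Every state is joined to the one with all labels zero: `M` is moved to zero, `m` to zero by way
  -- of `-j`, then `j` and finally `n`. Lowering `j` before `n` keeps `j ≤ n` in the time-like case.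
  have all : ∀ s : State f, some (g s) = G ⟨0, 0, 0, 0⟩ := fun s => by
    obtain ⟨hm, hn⟩ := (f.occurs_iff s.1).1 s.2
    have hj := (abs_nonneg _).trans hm
    rw [← atZeroj s.1.j s.1.n hj hn, toTop _ 0 _ (by simpa using hj) hn, ← toTop _ _ _ hm hn,
      ← stepM _ _ _ s.1.M]
    exact (dif_pos (t := fun h => some (g ⟨s.1, h⟩)) s.2).symm
  exact Option.some_injective _ ((all s).trans (all s').symm)

/-! ## Irreducibility -/

section Irreducible

variable {f : Family q} {ρ : StarRep q (dom f)}

/-- A nonzero invariant subspace contains a ket. Membership of kets passes along nonzero matrix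
elements in both directions, backwards by means of the conjugate generator, so all kets belong to
it. -/
lemma eq_bot_or_eq_top (hq : 1 < q) {V : Submodule ℂ (dom f)}
    (hV : ∀ (a : QAlg q), ∀ φ ∈ V, repHom hq f a φ ∈ V) : V = ⊥ ∨ V = ⊤ := by
  refine or_iff_not_imp_left.2 fun h => ?_
  obtain ⟨v, hv, v0⟩ := V.ne_bot_iff.1 h
  obtain ⟨s, hs⟩ : ∃ s, (ketBasis f).repr v s ≠ 0 := by
    by_contra! H
    exact v0 ((ketBasis f).ext_elem fun s => by rw [H s, map_zero, Finsupp.zero_apply])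
  have hs := ket_mem_of_repr_ne_zero hq hV hv hs
  have key : ∀ t, (ket f s ∈ V) = (ket f t ∈ V) :=
    eq_of_links hq (fun t => ket f t ∈ V) (fun x t t' e => propext ⟨fun h => ?_, fun h => ?_⟩) s
  · rw [eq_top_iff, ← (ketBasis f).span_eq, Submodule.span_le]
    rintro _ ⟨t, rfl⟩
    rw [ketBasis_apply]
    exact key t ▸ hs
  · refine ket_mem_of_repr_ne_zero hq hV (hV (gen q x) _ h) ?_
    rw [← inner_ket, inner_repHom]
    exact e
  · refine ket_mem_of_repr_ne_zero hq hV (hV (genStar q x) _ h) ?_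
    rw [← inner_ket, inner_genStar (inner_repHom hq f)]
    rw [← conj_starElt hq f x] at e
    exact (map_ne_zero _).1 e

/-- The separation of the kets makes `T` diagonal. Intertwining a generator with a nonzero matrix
element between two kets equates the two diagonal entries, and connectedness makes them all equal.
-/
lemma eq_smul_id (hq : 1 < q) (hρ : ρ.HasMatrixElements) (T : Hilb f →L[ℂ] Hilb f)
    (h : ∀ (x : Gen) (φ ψ : dom f),
      inner ℂ (ρ.toHom (genStar q x) φ : Hilb f) (T ψ) =
        inner ℂ (φ : Hilb f) (T (ρ.toHom (gen q x) ψ : Hilb f))) :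
    ∃ c : ℂ, T = c • ContinuousLinearMap.id ℂ (Hilb f) := by
  let τ : State f → ℂ := fun s => inner ℂ (ket f s : Hilb f) (T (ket f s))
  have diag : ∀ s, T (ket f s) = τ s • (ket f s : Hilb f) := fun s => hilb_ext fun t => by
    rw [inner_smul_right, show inner ℂ (ket f t : Hilb f) (ket f s : Hilb f) = _ from
      inner_ket_ket f t s]
    split_ifs with e
    · rw [e, mul_one]
    · rw [mul_zero]
      exact inner_eq_zero_of_intertwines hq hρ hρ T (fun x φ ψ => h x ψ φ)
        fun e' => e (Subtype.ext e'.2.symm)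
  have diag' : ∀ (s : State f) (v : dom f),
      inner ℂ (ket f s : Hilb f) (T v) = τ s * inner ℂ (ket f s : Hilb f) v := fun s v => by
    induction v using dom_induction with
    | h0 => simp
    | hadd v w hv hw => rw [Submodule.coe_add, map_add, inner_add_right, hv, hw, inner_add_right,
        mul_add]
    | hsmul c t =>
      rw [Submodule.coe_smul, map_smul, inner_smul_right, inner_smul_right, diag, inner_smul_right,
        show inner ℂ (ket f s : Hilb f) (ket f t : Hilb f) = _ from inner_ket_ket f s t]
      split_ifs with e
      · rw [e]; ring
      · ring
  obtain ⟨s₀, -⟩ := exists_state f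
  have const : ∀ s, τ s = τ s₀ := fun s => eq_of_links hq τ (fun x s s' e => by
    have key := h x (ket f s') (ket f s)
    rw [diag', diag, inner_smul_right, show inner ℂ (ket f s' : Hilb f)
      (ρ.toHom (gen q x) (ket f s) : Hilb f) = _ from hρ x s' s,
      show inner ℂ (ρ.toHom (genStar q x) (ket f s') : Hilb f) (ket f s : Hilb f) = _ from
        (ρ.adjoint x _ _).trans (hρ x s' s)] at key
    exact mul_right_cancel₀ e key) s s₀
  -- Bounded operators that agree on the kets agree everywhere, since the span of the kets is dense.
  refine ⟨τ s₀, ContinuousLinearMap.ext_on (s := Set.range (basisVec f)) ?_ ?_⟩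
  · rw [Submodule.dense_iff_topologicalClosure_eq_top]
    exact (basisVec f).dense_span
  · rintro _ ⟨s, rfl⟩
    rw [← const s]
    exact diag s

theorem irreducible (hq : 1 < q) (hρ : ρ.HasMatrixElements) : ρ.Irreducible :=
  ⟨⟨ket f (exists_state f).choose, 0, ket_ne_zero _⟩,
    fun _ hV => eq_bot_or_eq_top hq fun a => toHom_eq_repHom hq hρ ▸ hV a,
    fun T hT => eq_smul_id hq hρ T hT⟩

end Irreducible

end

end QMink

theorem mainTheorem1 (q : ℝ) (hq : 1 < q) :
    -- the explicit matrix elements define a `*`-representation for every label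
    (∀ f : Family q, ∃ ρ : StarRep q (dom f), ρ.HasMatrixElements) ∧
    -- spectrum of the complete set of commuting operators, and irreducibility
    (∀ (f : Family q) (ρ : StarRep q (dom f)), ρ.HasMatrixElements →
      (∀ s : State f,
        ρ.toHom (gen q (.vec .pos none)) (ket f s) = (timeVal f s.1 : ℂ) • ket f s ∧
        ρ.toHom (radiusSq q) (ket f s) = (radiusSqVal f s.1 : ℂ) • ket f s ∧
        ρ.tSq (ket f s) = ((brk q s.1.j * brk q (s.1.j + 1) : ℝ) : ℂ) • ket f s ∧
        (ρ.tauHalf ^ 2) (ket f s) = ((q ^ (-4 * s.1.m) : ℝ) : ℂ) • ket f s) ∧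
      IsUnit (ρ.toHom (tauInvHalf q)) ∧
      ρ.Irreducible) ∧
    -- representations with different labels are inequivalent
    (∀ (f f' : Family q) (ρ : StarRep q (dom f)) (ρ' : StarRep q (dom f')),
      ρ.HasMatrixElements → ρ'.HasMatrixElements → f ≠ f' →
        ¬ ρ.AlgEquivalent ρ' ∧ ¬ ρ.UnitarilyEquivalent ρ') := by
  refine ⟨fun f => ⟨familyRep hq f, familyRep_hasMatrixElements hq f⟩, fun f ρ h =>
    ⟨fun s => ⟨?_, ?_, tSq_ket hq h s, tauHalf_sq_ket hq h s⟩, isUnit_tauInvHalf hq h,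
      irreducible hq h⟩, fun f f' ρ ρ' h h' hf =>
    ⟨not_algEquivalent hq h h' hf, not_unitarilyEquivalent hq h h' hf⟩⟩
  · rw [toHom_eq_repHom hq h, repHom_posZero]
  · rw [toHom_eq_repHom hq h, repHom_radiusSq]
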